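/- Let $p$ be a prime, let $K/\mathbf{Q}_p$ be a finite extension with ring of integers $\mathcal{O}_K$ and residue field $k$, and let $K'/K$ be a totally ramified Galois extension of degree $n$ prime to $p$, with a uniformiser $\pi'$ of $\mathcal{O}_{K'}$ such that $\pi:=(\pi')^{n}\in K$. Let $E/\mathbf{Q}_p$ be a finite extension containing the image of every embedding of $K'$ into an algebraic closure of $E$, with ring of integers $\mathcal{O}$. Put $G=\mathrm{Gal}(K'/K)=I(K'/K)$ and $h(g)=g(\pi')/\pi'\in W(k)^\times$ for $g\in G$. Let $\tau=\eta\oplus\eta'$, where $\eta\neq\eta'$ are characters $G\to\mathcal{O}^\times$. For an embedding $\sigma:W(k)\hookrightarrow\mathcal{O}$ let $e_\sigma\in W(k)\otimes_{\mathbf{Z}_p}\mathcal{O}$ be the corresponding idempotent (so $(x\otimes 1)e_\sigma=(1\otimes\sigma(x))e_\sigma$), and let $0<a_\sigma,b_\sigma<n$ be the integers with $\eta'/\eta=\sigma\circ h^{a_\sigma}$ and $\eta/\eta'=\sigma\circ h^{b_\sigma}$. Put $\pi_1=\sum_\sigma(\pi')^{a_\sigma}e_\sigma$ and $\pi_2=\sum_\sigma(\pi')^{b_\sigma}e_\sigma$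 in $\mathcal{O}_{K'}\otimes_{\mathbf{Z}_p}\mathcal{O}$. All tensor products below are over $\mathbf{Z}_p$ and $A$ denotes a $p$-adically complete $\mathcal{O}$-algebra. Consider the following stacks over $\mathrm{Spf}\,\mathcal{O}$; morphisms in the groupoids of $A$-points are the isomorphisms, and pullback is base change. (a) $\mathcal{M}^{\tau}_{\mathrm{loc}}(A)$ is the groupoid of pairs $(\mathfrak{L},\mathfrak{L}^+)$, where $\mathfrak{L}$ is a projective $\mathcal{O}_{K'}\otimes A$-module of rank $2$ with a semilinear, $A$-linear action of $G$, and $\mathfrak{L}^+\subseteq\mathfrak{L}$ is a $G$-stable $\mathcal{O}_{K'}\otimes A$-submodule such that $\mathfrak{L}/\mathfrak{L}^+$ is a projective $A$-module, such that $\mathfrak{L}/\pi'\mathfrak{L}$ has type $\tau$: for each character $\xi:G\to\mathcal{O}^\times$, the $\xi$-eigenspace $(\mathfrak{L}/\pi'\mathfrak{L})_\xi$ is a projective $k\otimes A$-module of constant rank equal to the multiplicity of $\xi$ in $\tau$. Write $\mathfrak{L}_\xi$ and $\mathfrak{L}^+_\xi$ for the $\mathcal{O}_K\otimes A$-submodules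 of $\mathfrak{L}$ and $\mathfrak{L}^+$ on which $G$ acts through $\xi$. Then $\mathcal{M}^{\tau,\mathrm{BT}}_{\mathrm{loc}}\subseteq\mathcal{M}^{\tau}_{\mathrm{loc}}$ is the substack of pairs satisfying the strong determinant condition: Zariski locally on $\mathrm{Spec}\,A$, for every $\xi$, $$\det{}_A(a\mid\mathfrak{L}^+_\xi)=\prod_{\psi:K\hookrightarrow E}\psi(a)$$ as polynomial functions of $a\in\mathcal{O}_K$. (b) $\mathcal{M}_{\mathrm{loc},\mathrm{Iw}}(A)$ is the groupoid of tuples $(\mathfrak{L}_1,\mathfrak{L}_1^+,\mathfrak{L}_2,\mathfrak{L}_2^+,f_1,f_2)$, where $\mathfrak{L}_1,\mathfrak{L}_2$ are projective $\mathcal{O}_K\otimes A$-modules of rank $2$; $f_1:\mathfrak{L}_1\to\mathfrak{L}_2$ and $f_2:\mathfrak{L}_2\to\mathfrak{L}_1$ are $\mathcal{O}_K\otimes A$-linear with $f_1f_2=f_2f_1=\pi$; $\mathrm{coker}\,f_1$ and $\mathrm{coker}\,f_2$ are projective $k\otimes A$-modules of rank one; and $\mathfrak{L}_i^+\subseteq\mathfrak{L}_i$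 are $\mathcal{O}_K\otimes A$-submodules with $\mathfrak{L}_i/\mathfrak{L}_i^+$ projective over $A$, $f_1(\mathfrak{L}_1^+)\subseteq\mathfrak{L}_2^+$ and $f_2(\mathfrak{L}_2^+)\subseteq\mathfrak{L}_1^+$. Then $\mathcal{M}^{\mathrm{BT}}_{\mathrm{loc},\mathrm{Iw}}\subseteq\mathcal{M}_{\mathrm{loc},\mathrm{Iw}}$ is the substack of tuples such that, Zariski locally on $\mathrm{Spec}\,A$, $\det_A(a\mid\mathfrak{L}_i^+)=\prod_{\psi:K\hookrightarrow E}\psi(a)$ as polynomial functions of $a\in\mathcal{O}_K$ for $i=1,2$. Then $(\mathfrak{L},\mathfrak{L}^+)\mapsto(\mathfrak{L}_\eta,\mathfrak{L}^+_\eta,\mathfrak{L}_{\eta'},\mathfrak{L}^+_{\eta'},\pi_1,\pi_2)$, with $\pi_1,\pi_2$ acting by multiplication, defines a morphism $\mathcal{M}^{\tau}_{\mathrm{loc}}\to\mathcal{M}_{\mathrm{loc},\mathrm{Iw}}$, and this morphism induces an isomorphism (i.e. an equivalence of stacks) $\mathcal{M}^{\tau,\mathrm{BT}}_{\mathrm{loc}}\to\mathcal{M}^{\mathrm{BT}}_{\mathrm{loc},\mathrm{Iw}}$.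 -/

import Mathlib

open CategoryTheory TensorProduct

universe u

noncomputable section

namespace TameLocalModel

/-! ### Base change of modules along a ring homomorphism -/

/-- An additive map `f : M → N` from an `A`-module to a `B`-module exhibits `N` as the base change
of `M` along `φ : A → B`: there is a `B`-linear isomorphism `B ⊗_A M ≃ N`, `b ⊗ m ↦ b • f m`
(in particular `f` is `φ`-semilinear). -/
def IsBaseChangeAlong {A B M N : Type u} [CommRing A] [CommRing B] [AddCommGroup M]
    [AddCommGroup N] [Module A M] [Module B N] (φ : A →+* B) (f : M →+ N) : Prop :=
  letI := φ.toAlgebra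
  ∃ e : (B ⊗[A] M) ≃ₗ[B] N, ∀ (b : B) (m : M), e (b ⊗ₜ[A] m) = b • f m

section BaseChange

variable {A B C M N P : Type u} [CommRing A] [CommRing B] [CommRing C] [AddCommGroup M]
  [AddCommGroup N] [AddCommGroup P] [Module A M] [Module B N] [Module C P]

theorem IsBaseChangeAlong.smul {φ : A →+* B} {f : M →+ N} (h : IsBaseChangeAlong φ f)
    (a : A) (m : M) : f (a • m) = φ a • f m := by
  let _ := φ.toAlgebra
  obtain ⟨e, he⟩ := h
  have h1 := he 1 (a • m)
  have h2 := he (φ a) m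
  rw [one_smul] at h1
  rw [← h1, ← h2, TensorProduct.tmul_smul, TensorProduct.smul_tmul', Algebra.smul_def, mul_one]
  rfl

theorem isBaseChangeAlong_id : IsBaseChangeAlong (RingHom.id A) (AddMonoidHom.id M) :=
  ⟨TensorProduct.lid A M, fun b m => by simp⟩

theorem IsBaseChangeAlong.comp {φ : A →+* B} {ψ : B →+* C} {f : M →+ N} {g : N →+ P}
    (hf : IsBaseChangeAlong φ f) (hg : IsBaseChangeAlong ψ g) :
    IsBaseChangeAlong (ψ.comp φ) (g.comp f) := by
  let _ := φ.toAlgebra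
  let _ := ψ.toAlgebra
  let _ := (ψ.comp φ).toAlgebra
  have : IsScalarTower A B C := IsScalarTower.of_algebraMap_eq' rfl
  obtain ⟨e, he⟩ := hf
  obtain ⟨e', he'⟩ := hg
  refine ⟨((AlgebraTensorModule.cancelBaseChange A B C C M).symm.trans
    (AlgebraTensorModule.congr (LinearEquiv.refl C C) e)).trans e', fun c m => ?_⟩
  simp [he, he']

/-- A retract of a base change is a base change. -/
theorem IsBaseChangeAlong.retract {M' N' : Type u} [AddCommGroup M'] [AddCommGroup N']
    [Module A M'] [Module B N'] {φ : A →+* B} {f : M →+ N} (hf : IsBaseChangeAlong φ f)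
    (i : M' →ₗ[A] M) (r : M →ₗ[A] M') (hri : ∀ m, r (i m) = m)
    (j : N' →ₗ[B] N) (s : N →ₗ[B] N') (hsj : ∀ n, s (j n) = n)
    (f' : M' →+ N') (hfi : ∀ m, f (i m) = j (f' m)) (hfr : ∀ m, s (f m) = f' (r m)) :
    IsBaseChangeAlong φ f' := by
  let _ := φ.toAlgebra
  obtain ⟨e, he⟩ := hf
  let F : B ⊗[A] M' →ₗ[B] N' := s ∘ₗ e.toLinearMap ∘ₗ i.baseChange B
  have hF : ∀ (b : B) (m : M'), F (b ⊗ₜ[A] m) = b • f' m := fun b m => by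
    simp [F, he, hfi, hsj]
  have hjF : ∀ t, j (F t) = e (i.baseChange B t) := fun t => by
    induction t using TensorProduct.induction_on with
    | zero => simp
    | tmul b m => rw [hF]; simp [he, hfi]
    | add x y hx hy => simp [map_add, hx, hy]
  have hFr : ∀ t, F (r.baseChange B t) = s (e t) := fun t => by
    induction t using TensorProduct.induction_on with
    | zero => simp
    | tmul b m => rw [LinearMap.baseChange_tmul, hF]; simp [he, hfr]
    | add x y hx hy => simp only [map_add, hx, hy]
  refine ⟨LinearEquiv.ofBijective F ⟨?_, ?_⟩, hF⟩
  · rw [injective_iff_map_eq_zero]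
    intro t ht
    have h1 := hjF t
    rw [ht, map_zero, eq_comm, map_eq_zero_iff e e.injective] at h1
    have h2 : (r.baseChange B) (i.baseChange B t) = t := by
      rw [← LinearMap.comp_apply, ← LinearMap.baseChange_comp,
        show r ∘ₗ i = LinearMap.id from LinearMap.ext hri, LinearMap.baseChange_id]
      rfl
    rw [← h2, h1, map_zero]
  · intro n
    exact ⟨r.baseChange B (e.symm (j n)), by rw [hFr]; simp [hsj]⟩

end BaseChange

/-- The restriction of an additive map to submodules. -/
def restrictAdd {R S M N : Type u} [Semiring R] [Semiring S] [AddCommGroup M] [AddCommGroup N]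
    [Module R M] [Module S N] {P : Submodule R M} {Q : Submodule S N} (f : M →+ N)
    (h : ∀ m ∈ P, f m ∈ Q) : P →+ Q where
  toFun m := ⟨f m, h m m.2⟩
  map_zero' := Subtype.ext (map_zero f)
  map_add' m n := Subtype.ext (map_add f (m : M) (n : M))

/-! ### Projective modules of constant rank -/

/-- `M` is a finite projective `R`-module of constant rank `n`. -/
def IsProjOfRank (R M : Type u) [CommRing R] [AddCommGroup M] [Module R M] (n : ℕ) : Prop :=
  Module.Finite R M ∧ Module.Projective R M ∧ ∀ x, Module.rankAtStalk (R := R) M x = n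

/-- The `R`-module `M` is (through `R → R ⧸ I`) a finite projective `R ⧸ I`-module of constant
rank `n`. -/
def IsProjOfRankOverQuotient (R M : Type u) [CommRing R] [AddCommGroup M] [Module R M]
    (I : Ideal R) (n : ℕ) : Prop :=
  ∃ _ : Module (R ⧸ I) M, IsScalarTower R (R ⧸ I) M ∧ IsProjOfRank (R ⧸ I) M n

/-! ### Local fields -/

section Fields

set_option linter.unusedSectionVars false

variable (p : ℕ) [Fact p.Prime]
  (K K' E : Type u) [Field K] [Field K'] [Field E]
  [Algebra ℚ_[p] K] [Algebra ℤ_[p] K] [IsScalarTower ℤ_[p] ℚ_[p] K]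
  [Algebra ℚ_[p] K'] [Algebra ℤ_[p] K'] [IsScalarTower ℤ_[p] ℚ_[p] K']
  [Algebra ℚ_[p] E] [Algebra ℤ_[p] E] [IsScalarTower ℤ_[p] ℚ_[p] E]
  [Algebra K K'] [IsScalarTower ℚ_[p] K K'] [IsScalarTower ℤ_[p] K K']
  [FiniteDimensional K K']

/-- The ring of integers of an algebraic extension `F` of `ℚ_p`: the integral closure of `ℤ_p`. -/
def OInt (F : Type u) [Field F] [Algebra ℤ_[p] F] : Type u := integralClosure ℤ_[p] F

namespace OInt

variable (F : Type u) [Field F] [Algebra ℤ_[p] F]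

instance : CommRing (OInt p F) := inferInstanceAs (CommRing (integralClosure ℤ_[p] F))
instance : IsDomain (OInt p F) := inferInstanceAs (IsDomain (integralClosure ℤ_[p] F))
instance : Algebra ℤ_[p] (OInt p F) := inferInstanceAs (Algebra ℤ_[p] (integralClosure ℤ_[p] F))
instance : Algebra (OInt p F) F := inferInstanceAs (Algebra (integralClosure ℤ_[p] F) F)
instance : IsScalarTower ℤ_[p] (OInt p F) F :=
  inferInstanceAs (IsScalarTower ℤ_[p] (integralClosure ℤ_[p] F) F)
instance : IsIntegralClosure (OInt p F) ℤ_[p] F :=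
  inferInstanceAs (IsIntegralClosure (integralClosure ℤ_[p] F) ℤ_[p] F)
instance : Algebra.IsIntegral ℤ_[p] (OInt p F) :=
  inferInstanceAs (Algebra.IsIntegral ℤ_[p] (integralClosure ℤ_[p] F))

variable {p F}

/-- An element of `F` integral over `ℤ_p`, as an element of the ring of integers. -/
def mk (x : F) (hx : IsIntegral ℤ_[p] x) : OInt p F := ⟨x, hx⟩

theorem algebraMap_mk (x : F) (hx : IsIntegral ℤ_[p] x) :
    algebraMap (OInt p F) F (mk x hx) = x := rfl

theorem ext {x y : OInt p F} (h : algebraMap (OInt p F) F x = algebraMap (OInt p F) F y) : x = y :=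
  Subtype.ext h

/-- The map on rings of integers induced by a homomorphism of extensions of `ℚ_p`. -/
def map {F' : Type u} [Field F'] [Algebra ℤ_[p] F'] (f : F →ₐ[ℤ_[p]] F') :
    OInt p F →ₐ[ℤ_[p]] OInt p F' := f.mapIntegralClosure

theorem algebraMap_map {F' : Type u} [Field F'] [Algebra ℤ_[p] F'] (f : F →ₐ[ℤ_[p]] F')
    (x : OInt p F) : algebraMap (OInt p F') F' (map f x) = f (algebraMap (OInt p F) F x) := rfl

end OInt

/-- The inclusion `𝒪_K → 𝒪_{K'}`. -/
def intIncl : OInt p K →ₐ[ℤ_[p]] OInt p K' := OInt.map (IsScalarTower.toAlgHom ℤ_[p] K K')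

variable {K K'} in
/-- The action of an element of `Gal(K'/K)` on `𝒪_{K'}`. -/
def galAct (g : Gal(K'/K)) : OInt p K' →ₐ[ℤ_[p]] OInt p K' :=
  OInt.map ((g.restrictScalars ℤ_[p] : K' ≃ₐ[ℤ_[p]] K') : K' →ₐ[ℤ_[p]] K')

/-- `K'/K` is a totally ramified Galois extension of degree prime to `p` (hence tamely ramified),
equipped with a uniformiser `π'` of `𝒪_{K'}` such that `π = π' ^ e(K'/K)` lies in `K`; here
`e(K'/K) = [K' : K]` as the extension is totally ramified. -/
structure TameTotRam where
  /-- the uniformiser of `𝒪_{K'}` -/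
  π' : OInt p K'
  /-- the uniformiser of `𝒪_K` -/
  π : OInt p K
  isGalois : IsGalois K K'
  coprime : p.Coprime (Module.finrank K K')
  ne_zero : π' ≠ 0
  isMaximal : (Ideal.span {π'}).IsMaximal
  /-- the residue field extension is trivial -/
  totRam : Function.Surjective ((Ideal.Quotient.mk (Ideal.span {π'})).comp
    (intIncl p K K' : OInt p K →+* OInt p K'))
  pow_eq : π' ^ Module.finrank K K' = intIncl p K K' π

/-- The Witt vectors `W(k')` of the residue field `k'` of `K'`, realised inside `𝒪_{K'}` as the
subring generated over `ℤ_p` by the roots of unity of order prime to `p`. -/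
def Witt : Subalgebra ℤ_[p] (OInt p K') :=
  Algebra.adjoin ℤ_[p] {ζ | ∃ m : ℕ, p.Coprime m ∧ ζ ^ m = 1}

/-- The embeddings `σ : W(k') → 𝒪`. -/
abbrev Emb := Witt p K' →ₐ[ℤ_[p]] OInt p E

variable {p K K'}

theorem galAct_coe (g : Gal(K'/K)) (x : OInt p K') :
    algebraMap (OInt p K') K' (galAct p g x) = g (algebraMap (OInt p K') K' x) := rfl

theorem galAct_intIncl (g : Gal(K'/K)) (x : OInt p K) :
    galAct p g (intIncl p K K' x) = intIncl p K K' x :=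
  OInt.ext (g.commutes (algebraMap (OInt p K) K x))

namespace TameTotRam

variable (T : TameTotRam p K K')

theorem p_mem : (p : OInt p K') ∈ Ideal.span {T.π'} := by
  have := T.isMaximal
  have h : (Ideal.comap (algebraMap ℤ_[p] (OInt p K')) (Ideal.span {T.π'})).IsMaximal :=
    Ideal.isMaximal_comap_of_isIntegral_of_isMaximal _
  have h2 := IsLocalRing.eq_maximalIdeal h
  have h3 : (p : ℤ_[p]) ∈ Ideal.comap (algebraMap ℤ_[p] (OInt p K')) (Ideal.span {T.π'}) := by
    rw [h2, PadicInt.maximalIdeal_eq_span_p]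
    exact Ideal.mem_span_singleton_self _
  simpa using h3

/-- A root of unity of order prime to `p` congruent to `1` modulo `π'` is `1`. -/
theorem eq_one_of_sub_one_mem (T : TameTotRam p K K') {ω : OInt p K'} {m : ℕ} (hm : p.Coprime m) (h : ω ^ m = 1)
    (h1 : ω - 1 ∈ Ideal.span {T.π'}) : ω = 1 := by
  have hmul := mul_geom_sum ω m
  rw [h, sub_self, mul_eq_zero] at hmul
  rcases hmul with h0 | h0
  · exact sub_eq_zero.1 h0
  exfalso
  have hω : Ideal.Quotient.mk (Ideal.span {T.π'}) ω = 1 := by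
    rw [← map_one (Ideal.Quotient.mk (Ideal.span {T.π'}))]
    exact Ideal.Quotient.eq.2 h1
  have hm0 : (m : OInt p K') ∈ Ideal.span {T.π'} := by
    rw [← Ideal.Quotient.eq_zero_iff_mem]
    have := congrArg (Ideal.Quotient.mk (Ideal.span {T.π'})) h0
    simpa [hω] using this
  apply T.isMaximal.ne_top
  rw [Ideal.eq_top_iff_one]
  have hb := Nat.gcd_eq_gcd_ab p m
  rw [hm.gcd_eq_one] at hb
  have hb' : (1 : OInt p K') = p * (Nat.gcdA p m : OInt p K') + m * (Nat.gcdB p m : OInt p K') := by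
    exact_mod_cast congrArg (Int.cast : ℤ → OInt p K') hb
  rw [hb']
  exact Ideal.add_mem _ (Ideal.mul_mem_right _ _ T.p_mem) (Ideal.mul_mem_right _ _ hm0)

theorem galAct_pow_π' (g : Gal(K'/K)) :
    galAct p g T.π' ^ Module.finrank K K' = T.π' ^ Module.finrank K K' := by
  rw [← map_pow, T.pow_eq, galAct_intIncl]

theorem algebraMap_π'_ne_zero : algebraMap (OInt p K') K' T.π' ≠ 0 :=
  fun h => T.ne_zero (OInt.ext (h.trans (map_zero _).symm))

theorem quot_pow (g : Gal(K'/K)) :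
    (g (algebraMap (OInt p K') K' T.π') / algebraMap (OInt p K') K' T.π') ^
      Module.finrank K K' = 1 := by
  have h := congrArg (algebraMap (OInt p K') K') (T.galAct_pow_π' g)
  rw [map_pow, map_pow, galAct_coe] at h
  rw [div_pow, h, div_self (pow_ne_zero _ T.algebraMap_π'_ne_zero)]

/-- The character `h : Gal(K'/K) → W(k')ˣ`, `h(g) = g(π') / π'`, with values in the roots of unity
of order dividing `[K' : K]`. -/
def h (g : Gal(K'/K)) : Witt p K' :=
  ⟨OInt.mk (g (algebraMap (OInt p K') K' T.π') / algebraMap (OInt p K') K' T.π')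
      (IsIntegral.of_pow Module.finrank_pos (by rw [T.quot_pow g]; exact isIntegral_one)),
    Algebra.subset_adjoin ⟨Module.finrank K K', T.coprime, OInt.ext (T.quot_pow g)⟩⟩

theorem h_mul (g : Gal(K'/K)) : (T.h g : OInt p K') * T.π' = galAct p g T.π' :=
  OInt.ext (div_mul_cancel₀ _ T.algebraMap_π'_ne_zero)

/-- `Gal(K'/K)` acts trivially on the residue field. -/
theorem galAct_sub_mem (g : Gal(K'/K)) (x : OInt p K') :
    galAct p g x - x ∈ Ideal.span {T.π'} := by
  obtain ⟨y, hy⟩ := T.totRam (Ideal.Quotient.mk _ x)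
  have h1 : intIncl p K K' y - x ∈ Ideal.span {T.π'} := Ideal.Quotient.eq.1 hy
  obtain ⟨z, hz⟩ := Ideal.mem_span_singleton.1 h1
  have h2 : galAct p g (intIncl p K K' y - x) ∈ Ideal.span {T.π'} := by
    rw [hz, map_mul, ← T.h_mul]
    exact Ideal.mul_mem_right _ _ (Ideal.mul_mem_left _ _ (Ideal.mem_span_singleton_self _))
  rw [map_sub, galAct_intIncl] at h2
  have := Ideal.sub_mem _ h1 h2
  rwa [sub_sub_sub_cancel_left] at this

/-- `Gal(K'/K)` acts trivially on `W(k')`. -/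
theorem galAct_witt (T : TameTotRam p K K') (g : Gal(K'/K)) (x : Witt p K') : galAct p g (x : OInt p K') = x := by
  have hle : Witt p K' ≤ AlgHom.equalizer (galAct p g) (AlgHom.id ℤ_[p] (OInt p K')) := by
    refine Algebra.adjoin_le ?_
    rintro ζ ⟨m, hm, hζ⟩
    show galAct p g ζ = ζ
    have hm0 : m ≠ 0 := by
      rintro rfl
      exact (Fact.out : p.Prime).one_lt.ne' (by simpa using hm)
    have e1 : ζ ^ (m - 1) * ζ = 1 := by rw [pow_sub_one_mul hm0, hζ]
    have e2 : galAct p g ζ * ζ ^ (m - 1) = 1 := by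
      apply T.eq_one_of_sub_one_mem hm
      · rw [mul_pow, ← map_pow, hζ, map_one, one_mul, ← pow_mul, mul_comm, pow_mul, hζ, one_pow]
      · have := Ideal.mul_mem_right (ζ ^ (m - 1)) _ (T.galAct_sub_mem g ζ)
        rwa [sub_mul, mul_comm ζ, e1] at this
    calc galAct p g ζ = galAct p g ζ * ζ ^ (m - 1) * ζ := by rw [mul_assoc, e1, mul_one]
      _ = ζ := by rw [e2, one_mul]
  exact hle x.2

/-- The cardinality `q` of the residue field `k'` of `K'`. -/
def q : ℕ := Nat.card (OInt p K' ⧸ Ideal.span {T.π'})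

theorem pow_q_sub_one {ζ : OInt p K'} {m : ℕ} (hm : p.Coprime m) (h : ζ ^ m = 1) :
    ζ ^ (T.q - 1) = 1 := by
  apply T.eq_one_of_sub_one_mem hm
  · rw [← pow_mul, mul_comm, pow_mul, h, one_pow]
  rw [← Ideal.Quotient.eq_zero_iff_mem, map_sub, map_pow, map_one, sub_eq_zero]
  by_cases hq : T.q = 0
  · simp [hq]
  have hfin : Finite (OInt p K' ⧸ Ideal.span {T.π'}) := Nat.finite_of_card_ne_zero hq
  have := T.isMaximal
  let _ := Ideal.Quotient.field (Ideal.span {T.π'})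
  let _ := Fintype.ofFinite (OInt p K' ⧸ Ideal.span {T.π'})
  rw [q, Nat.card_eq_fintype_card]
  apply FiniteField.pow_card_sub_one_eq_one
  intro h0
  have hm0 : m ≠ 0 := by
    rintro rfl
    exact (Fact.out : p.Prime).one_lt.ne' (by simpa using hm)
  have h2 := congrArg (Ideal.Quotient.mk (Ideal.span {T.π'})) h
  rw [map_pow, h0, map_one, zero_pow hm0] at h2
  exact zero_ne_one h2

variable {E}

/-- The idempotent `e_σ` of `𝒪 ⊗_{ℤ_p} W(k') ⊆ 𝒪 ⊗_{ℤ_p} 𝒪_{K'}` attached to an embedding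
`σ : W(k') → 𝒪`, characterised by `(1 ⊗ x) e_σ = (σ(x) ⊗ 1) e_σ` for all `x ∈ W(k')`; explicitly,
`e_σ = (q - 1)⁻¹ ∑ σ(ζ)⁻¹ ⊗ ζ`, the sum running over the `(q - 1)`-st roots of unity `ζ`. -/
def idem (σ : Emb p K' E) : OInt p E ⊗[ℤ_[p]] OInt p K' :=
  (Ring.inverse ((T.q - 1 : ℕ) : OInt p E)) ⊗ₜ[ℤ_[p]] 1 *
    ∑ ζ ∈ Polynomial.nthRootsFinset (T.q - 1) (1 : Witt p K'),
      (Ring.inverse (σ ζ)) ⊗ₜ[ℤ_[p]] (ζ : OInt p K')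

theorem mul_idem (σ : Emb p K' E) (x : Witt p K') :
    (1 ⊗ₜ[ℤ_[p]] (x : OInt p K')) * T.idem σ = (σ x ⊗ₜ[ℤ_[p]] 1) * T.idem σ := by
  have hroot : ∀ w : Witt p K', (∃ m : ℕ, p.Coprime m ∧ (w : OInt p K') ^ m = 1) →
      (1 ⊗ₜ[ℤ_[p]] (w : OInt p K')) * T.idem σ = (σ w ⊗ₜ[ℤ_[p]] 1) * T.idem σ := by
    rintro w ⟨m, hm, hw⟩
    have hN := T.pow_q_sub_one hm hw
    rcases Nat.eq_zero_or_pos (T.q - 1) with h0 | h0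
    · simp [idem, h0]
    have hwN : w ^ (T.q - 1) = 1 := Subtype.ext hN
    have hw1 : w ^ (T.q - 1 - 1) * w = 1 := by rw [pow_sub_one_mul h0.ne', hwN]
    rw [idem, mul_left_comm, mul_left_comm (σ w ⊗ₜ[ℤ_[p]] (1 : OInt p K'))]
    congr 1
    simp only [Finset.mul_sum, Algebra.TensorProduct.tmul_mul_tmul, one_mul]
    refine Finset.sum_nbij' (fun ζ => w * ζ) (fun ζ => w ^ (T.q - 1 - 1) * ζ) ?_ ?_ ?_ ?_ ?_
    · intro ζ hζ
      rw [Polynomial.mem_nthRootsFinset h0] at hζ ⊢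
      rw [mul_pow, hζ, hwN, one_mul]
    · intro ζ hζ
      rw [Polynomial.mem_nthRootsFinset h0] at hζ ⊢
      rw [mul_pow, hζ, ← pow_mul, mul_comm _ (T.q - 1), pow_mul, hwN, one_pow, one_mul]
    · intro ζ _
      rw [← mul_assoc, hw1, one_mul]
    · intro ζ _
      rw [← mul_assoc, mul_comm w, hw1, one_mul]
    · intro ζ _
      have hu : IsUnit (σ w) := (IsUnit.of_mul_eq_one_right _ hw1).map σ
      rw [map_mul, Ring.mul_inverse_rev, mul_comm (Ring.inverse (σ ζ)), ← mul_assoc,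
        Ring.mul_inverse_cancel _ hu, one_mul]
      rfl
  obtain ⟨x, hx⟩ := x
  refine Algebra.adjoin_induction (p := fun x hx => (1 ⊗ₜ[ℤ_[p]] x) * T.idem σ =
    (σ ⟨x, hx⟩ ⊗ₜ[ℤ_[p]] 1) * T.idem σ) (fun ω hω => hroot ⟨ω, _⟩ hω) ?_ ?_ ?_ hx
  · intro r
    have : (⟨algebraMap ℤ_[p] (OInt p K') r, Subalgebra.algebraMap_mem _ r⟩ : Witt p K') =
      algebraMap ℤ_[p] (Witt p K') r := rfl
    rw [this, AlgHom.commutes, Algebra.algebraMap_eq_smul_one, Algebra.algebraMap_eq_smul_one,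
      TensorProduct.smul_tmul]
  · intro x y hx hy h1 h2
    have : (⟨x + y, add_mem hx hy⟩ : Witt p K') = ⟨x, hx⟩ + ⟨y, hy⟩ := rfl
    rw [this, map_add, TensorProduct.add_tmul, add_mul, ← h1, ← h2, ← add_mul,
      ← TensorProduct.tmul_add]
  · intro x y hx hy h1 h2
    have : (⟨x * y, mul_mem hx hy⟩ : Witt p K') = ⟨x, hx⟩ * ⟨y, hy⟩ := rfl
    have e1 : (1 : OInt p E) ⊗ₜ[ℤ_[p]] (x * y) = (1 ⊗ₜ x) * (1 ⊗ₜ y) := by simp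
    have e2 : (σ ⟨x, hx⟩ * σ ⟨y, hy⟩) ⊗ₜ[ℤ_[p]] (1 : OInt p K') =
      (σ ⟨y, hy⟩ ⊗ₜ 1) * (σ ⟨x, hx⟩ ⊗ₜ 1) := by simp [mul_comm]
    rw [this, map_mul, e2, mul_assoc, ← h1, mul_left_comm, ← h2, ← mul_assoc, ← e1]

/-- `a` is an integer with `0 < a < e(K'/K)` and `η' / η = σ ∘ h ^ a`. If `η ≠ η'`, there is exactly
one such `a` for each `σ`. -/
def IsExponent (η η' : Gal(K'/K) →* (OInt p E)ˣ) (σ : Emb p K' E) (a : ℕ) : Prop :=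
  0 < a ∧ a < Module.finrank K K' ∧
    ∀ g, (η' g : OInt p E) = (η g : OInt p E) * σ (T.h g) ^ a

/-- The element `∑_σ π' ^ a_σ e_σ` of `𝒪 ⊗_{ℤ_p} 𝒪_{K'}`, where `a_σ` is the unique integer with
`0 < a_σ < e(K'/K)` and `η' / η = σ ∘ h ^ a_σ`. -/
def piElt (η η' : Gal(K'/K) →* (OInt p E)ˣ) : OInt p E ⊗[ℤ_[p]] OInt p K' :=
  ∑ᶠ (σ : Emb p K' E) (a : ℕ) (_ : T.IsExponent η η' σ a), (1 ⊗ₜ (T.π' ^ a)) * T.idem σ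

theorem map_galAct_idem (g : Gal(K'/K)) (σ : Emb p K' E) :
    Algebra.TensorProduct.map (AlgHom.id ℤ_[p] (OInt p E)) (galAct p g) (T.idem σ) = T.idem σ := by
  simp only [idem, map_mul, map_sum, Algebra.TensorProduct.map_tmul, AlgHom.id_apply,
    map_one, T.galAct_witt]

/-- `∑_σ π' ^ a_σ e_σ` lies in the `η' / η`-eigenspace of `Gal(K'/K)`. -/
theorem map_galAct_piElt (η η' : Gal(K'/K) →* (OInt p E)ˣ) (g : Gal(K'/K)) :
    ((η g : OInt p E) ⊗ₜ 1) *
      Algebra.TensorProduct.map (AlgHom.id ℤ_[p] (OInt p E)) (galAct p g) (T.piElt η η') =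
    ((η' g : OInt p E) ⊗ₜ 1) * T.piElt η η' := by
  let P : OInt p E ⊗[ℤ_[p]] OInt p K' → Prop := fun t => ((η g : OInt p E) ⊗ₜ 1) *
      Algebra.TensorProduct.map (AlgHom.id ℤ_[p] (OInt p E)) (galAct p g) t =
    ((η' g : OInt p E) ⊗ₜ 1) * t
  have h0 : P 0 := by simp [P]
  have hadd : ∀ x y, P x → P y → P (x + y) := fun x y hx hy => by
    simp only [P, map_add, mul_add] at hx hy ⊢
    rw [hx, hy]
  refine finsum_induction P h0 hadd fun σ => finsum_induction P h0 hadd fun a =>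
    finsum_induction P h0 hadd fun ha => ?_
  show _ = _
  rw [map_mul, T.map_galAct_idem, ha.2.2 g, Algebra.TensorProduct.map_tmul, map_one, map_pow,
    ← T.h_mul, mul_pow]
  have e1 : (1 : OInt p E) ⊗ₜ[ℤ_[p]] ((T.h g : OInt p K') ^ a * T.π' ^ a) =
    (1 ⊗ₜ (T.π' ^ a)) * (1 ⊗ₜ ((T.h g ^ a : Witt p K') : OInt p K')) := by
      simp [mul_comm]
  have e2 : ((η g : OInt p E) * σ (T.h g) ^ a) ⊗ₜ[ℤ_[p]] (1 : OInt p K') =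
    ((η g : OInt p E) ⊗ₜ 1) * (σ (T.h g ^ a) ⊗ₜ 1) := by simp
  rw [e1, e2, mul_assoc (1 ⊗ₜ _), T.mul_idem, mul_assoc]
  congr 1
  rw [mul_left_comm]

end TameTotRam

/-! ### Test objects -/

variable (p K K')

/-- A `p`-adically complete (and separated) `𝒪`-algebra, where `𝒪` is the ring of integers of `E`;
equivalently a `ϖ`-adically complete one. It is considered as the affine formal test scheme
`Spf A → Spf 𝒪`. -/
structure TestAlg : Type (u + 1) where
  /-- the underlying ring -/
  carrier : Type u
  [commRing : CommRing carrier]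
  [algebraInt : Algebra (OInt p E) carrier]
  [algebraPadic : Algebra ℤ_[p] carrier]
  [tower : IsScalarTower ℤ_[p] (OInt p E) carrier]
  complete : IsAdicComplete (Ideal.span {(p : carrier)}) carrier

attribute [instance] TestAlg.commRing TestAlg.algebraInt TestAlg.algebraPadic TestAlg.tower

/-- Morphisms `Spf A → Spf B` of test objects are `𝒪`-algebra homomorphisms `B → A`. -/
instance : Category.{u} (TestAlg.{u} p E) where
  Hom X Y := Y.carrier →ₐ[OInt p E] X.carrier
  id X := AlgHom.id _ _
  comp f g := AlgHom.comp f g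

/-- The ring homomorphism underlying a morphism of test objects. -/
def TestAlg.toAlgHom {X Y : TestAlg.{u} p E} (f : X ⟶ Y) :
    Y.carrier →ₐ[OInt p E] X.carrier := f

variable {E}

/-- The ring `A ⊗_{ℤ_p} 𝒪_F`. -/
abbrev Coeff (A : TestAlg.{u} p E) (F : Type u) [Field F] [Algebra ℤ_[p] F] : Type u :=
  A.carrier ⊗[ℤ_[p]] OInt p F

variable {p}

/-- The map `B ⊗ 𝒪_F → A ⊗ 𝒪_F` induced by a morphism `Spf A → Spf B`. -/
def coeffMap {X Y : TestAlg.{u} p E} (f : X ⟶ Y) (F : Type u) [Field F] [Algebra ℤ_[p] F] :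
    Coeff p Y F →ₐ[ℤ_[p]] Coeff p X F :=
  Algebra.TensorProduct.map ((TestAlg.toAlgHom p E f).restrictScalars ℤ_[p]) (AlgHom.id _ _)

theorem coeffMap_id (X : TestAlg.{u} p E) (F : Type u) [Field F] [Algebra ℤ_[p] F]
    (x : Coeff p X F) : coeffMap (𝟙 X) F x = x :=
  DFunLike.congr_fun (Algebra.TensorProduct.map_id (R := ℤ_[p]) (A := X.carrier)) x

theorem coeffMap_comp {X Y Z : TestAlg.{u} p E} (f : X ⟶ Y) (g : Y ⟶ Z) (F : Type u) [Field F]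
    [Algebra ℤ_[p] F] (x : Coeff p Z F) :
    coeffMap (f ≫ g) F x = coeffMap f F (coeffMap g F x) := by
  induction x using TensorProduct.induction_on with
  | zero => simp
  | tmul a y => rfl
  | add x y hx hy => simp only [map_add, hx, hy]

/-- The map `A ⊗ 𝒪_K → A ⊗ 𝒪_{K'}`. -/
def coeffIncl (A : TestAlg.{u} p E) : Coeff p A K →ₐ[A.carrier] Coeff p A K' :=
  Algebra.TensorProduct.map (AlgHom.id _ _) (intIncl p K K')

variable {K K'} in
/-- The action of an element of `Gal(K'/K)` on `A ⊗ 𝒪_{K'}`, trivial on `A`. -/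
def coeffGal (A : TestAlg.{u} p E) (g : Gal(K'/K)) : Coeff p A K' →ₐ[A.carrier] Coeff p A K' :=
  Algebra.TensorProduct.map (AlgHom.id _ _) (galAct p g)

variable {K'} in
/-- The image in `A ⊗ 𝒪_{K'}` of an element of `𝒪 ⊗ 𝒪_{K'}`. -/
def coeffOfInt (A : TestAlg.{u} p E) :
    OInt p E ⊗[ℤ_[p]] OInt p K' →ₐ[ℤ_[p]] Coeff p A K' :=
  Algebra.TensorProduct.map (IsScalarTower.toAlgHom ℤ_[p] (OInt p E) A.carrier) (AlgHom.id _ _)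

theorem coeffMap_coeffIncl {X Y : TestAlg.{u} p E} (f : X ⟶ Y) (x : Coeff p Y K) :
    coeffMap f K' (coeffIncl K K' Y x) = coeffIncl K K' X (coeffMap f K x) := by
  induction x using TensorProduct.induction_on with
  | zero => simp
  | tmul a y => rfl
  | add x y hx hy => simp only [map_add, hx, hy]

theorem coeffGal_coeffIncl (A : TestAlg.{u} p E) (g : Gal(K'/K)) (x : Coeff p A K) :
    coeffGal A g (coeffIncl K K' A x) = coeffIncl K K' A x := by
  induction x using TensorProduct.induction_on with
  | zero => simp
  | tmul a y => simp [coeffGal, coeffIncl, galAct_intIncl]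
  | add x y hx hy => simp only [map_add, hx, hy]

theorem coeffMap_coeffOfInt {X Y : TestAlg.{u} p E} (f : X ⟶ Y)
    (x : OInt p E ⊗[ℤ_[p]] OInt p K') :
    coeffMap f K' (coeffOfInt Y x) = coeffOfInt X x := by
  induction x using TensorProduct.induction_on with
  | zero => simp
  | tmul a y => simp [coeffMap, coeffOfInt]
  | add x y hx hy => simp only [map_add, hx, hy]

theorem coeffGal_coeffOfInt (A : TestAlg.{u} p E) (g : Gal(K'/K))
    (x : OInt p E ⊗[ℤ_[p]] OInt p K') :
    coeffGal A g (coeffOfInt A x) =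
      coeffOfInt A (Algebra.TensorProduct.map (AlgHom.id ℤ_[p] (OInt p E)) (galAct p g) x) := by
  induction x using TensorProduct.induction_on with
  | zero => simp
  | tmul a y => simp [coeffGal, coeffOfInt]
  | add x y hx hy => simp only [map_add, hx, hy]

/-! ### The stack of pairs `(𝔏, 𝔏⁺)` with an action of `Gal(K'/K)` -/

variable (p E)

/-- A pair `(𝔏, 𝔏⁺)` over a test object `A`: an `𝒪_{K'} ⊗ A`-module `𝔏` with a semilinear, `A`-linear
action `ρ` of `Gal(K'/K)`, and a `Gal(K'/K)`-stable `𝒪_{K'} ⊗ A`-submodule `𝔏⁺`. The projectivity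
conditions are imposed in `isLoc` below. (The `A`-module structure on `𝔏` is the one induced from
`A → A ⊗ 𝒪_{K'}`.) -/
structure LocDatum : Type (u + 1) where
  /-- the test object -/
  A : TestAlg.{u} p E
  /-- the module `𝔏` -/
  L : Type u
  [addCommGroup : AddCommGroup L]
  [moduleCoeff : Module (Coeff p A K') L]
  [module : Module A.carrier L]
  [isScalarTower : IsScalarTower A.carrier (Coeff p A K') L]
  /-- the action of the Galois group -/
  ρ : Gal(K'/K) →* Module.End A.carrier L
  semilinear : ∀ (g : Gal(K'/K)) (x : Coeff p A K') (l : L), ρ g (x • l) = coeffGal A g x • ρ g l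
  /-- the submodule `𝔏⁺` -/
  Lp : Submodule (Coeff p A K') L
  stable : ∀ (g : Gal(K'/K)), ∀ l ∈ Lp, ρ g l ∈ Lp

attribute [instance] LocDatum.addCommGroup LocDatum.moduleCoeff LocDatum.module
  LocDatum.isScalarTower

variable {p K K' E}

namespace LocDatum

/-- A morphism `X → Y` over `f : Spf A → Spf B` is an `𝒪_{K'}`-semilinear, `Gal(K'/K)`-equivariant
map `𝔏_Y → 𝔏_X` inducing isomorphisms `A ⊗_B 𝔏_Y ≃ 𝔏_X` and `A ⊗_B 𝔏⁺_Y ≃ 𝔏⁺_X`. -/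
@[ext]
structure Hom (X Y : LocDatum.{u} p K K' E) : Type u where
  /-- the morphism of test objects -/
  base : X.A ⟶ Y.A
  /-- the map of modules -/
  toFun : Y.L →+ X.L
  map_smul : ∀ (x : Coeff p Y.A K') (l : Y.L), toFun (x • l) = coeffMap base K' x • toFun l
  map_ρ : ∀ (g : Gal(K'/K)) (l : Y.L), toFun (Y.ρ g l) = X.ρ g (toFun l)
  map_mem : ∀ l ∈ Y.Lp, toFun l ∈ X.Lp
  isBaseChange : IsBaseChangeAlong (TestAlg.toAlgHom p E base).toRingHom toFun
  isBaseChange_plus : IsBaseChangeAlong (TestAlg.toAlgHom p E base).toRingHom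
    (restrictAdd toFun map_mem)

instance : Category.{u} (LocDatum.{u} p K K' E) where
  Hom := Hom
  id X :=
    { base := 𝟙 X.A
      toFun := AddMonoidHom.id _
      map_smul := fun x l => by rw [coeffMap_id]; rfl
      map_ρ := fun _ _ => rfl
      map_mem := fun _ hl => hl
      isBaseChange := isBaseChangeAlong_id
      isBaseChange_plus := isBaseChangeAlong_id }
  comp {X Y Z} f g :=
    { base := f.base ≫ g.base
      toFun := f.toFun.comp g.toFun
      map_smul := fun x l => by
        rw [coeffMap_comp, AddMonoidHom.comp_apply, g.map_smul, f.map_smul]; rfl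
      map_ρ := fun σ l => by
        rw [AddMonoidHom.comp_apply, g.map_ρ, f.map_ρ]; rfl
      map_mem := fun l hl => f.map_mem _ (g.map_mem l hl)
      isBaseChange := g.isBaseChange.comp f.isBaseChange
      isBaseChange_plus := g.isBaseChange_plus.comp f.isBaseChange_plus }

variable (p K K' E) in
/-- The projection to the category of test objects. -/
def proj : LocDatum.{u} p K K' E ⥤ TestAlg.{u} p E where
  obj X := X.A
  map f := Hom.base f

variable (X : LocDatum.{u} p K K' E)

/-- `𝔏` as an `𝒪_K ⊗ A`-module. -/
instance : Module (Coeff p X.A K) X.L := Module.compHom X.L (coeffIncl K K' X.A).toRingHom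

theorem coeff_smul_def (x : Coeff p X.A K) (l : X.L) : x • l = coeffIncl K K' X.A x • l := rfl

instance : IsScalarTower X.A.carrier (Coeff p X.A K) X.L where
  smul_assoc a x l := by
    rw [coeff_smul_def, coeff_smul_def, map_smul, smul_assoc]

/-- The `𝒪_K ⊗ A`-submodule `𝔏_ξ` of `𝔏` on which `Gal(K'/K)` acts through `ξ`. -/
def eigen (ξ : Gal(K'/K) →* (OInt p E)ˣ) : Submodule (Coeff p X.A K) X.L where
  carrier := {l | ∀ g, X.ρ g l = algebraMap (OInt p E) X.A.carrier (ξ g) • l}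
  add_mem' {l m} hl hm g := by rw [map_add, hl g, hm g, smul_add]
  zero_mem' g := by simp
  smul_mem' x l hl g := by
    rw [coeff_smul_def, X.semilinear, coeffGal_coeffIncl, hl g]
    rw [smul_comm]

/-- The submodule `𝔏⁺_ξ = 𝔏⁺ ∩ 𝔏_ξ` of `𝔏_ξ`. -/
def eigenPlus (ξ : Gal(K'/K) →* (OInt p E)ˣ) : Submodule (Coeff p X.A K) (X.eigen ξ) where
  carrier := {l | (l : X.L) ∈ X.Lp}
  add_mem' hl hm := X.Lp.add_mem hl hm
  zero_mem' := X.Lp.zero_mem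
  smul_mem' x _ hl := X.Lp.smul_mem (coeffIncl K K' X.A x) hl

end LocDatum

/-! ### The stack of lattice chains -/

variable (p K E)

/-- A tuple `(𝔏₁, 𝔏₁⁺, 𝔏₂, 𝔏₂⁺, f₁, f₂)` over a test object `A`: two `𝒪_K ⊗ A`-modules with
submodules, and two maps between them. The conditions on such tuples are imposed in `isIw` below. -/
structure IwDatum : Type (u + 1) where
  /-- the test object -/
  A : TestAlg.{u} p E
  /-- the module `𝔏₁` -/
  L₁ : Type u
  /-- the module `𝔏₂` -/
  L₂ : Type u
  [addCommGroup₁ : AddCommGroup L₁]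
  [moduleCoeff₁ : Module (Coeff p A K) L₁]
  [module₁ : Module A.carrier L₁]
  [isScalarTower₁ : IsScalarTower A.carrier (Coeff p A K) L₁]
  [addCommGroup₂ : AddCommGroup L₂]
  [moduleCoeff₂ : Module (Coeff p A K) L₂]
  [module₂ : Module A.carrier L₂]
  [isScalarTower₂ : IsScalarTower A.carrier (Coeff p A K) L₂]
  /-- the submodule `𝔏₁⁺` -/
  Lp₁ : Submodule (Coeff p A K) L₁
  /-- the submodule `𝔏₂⁺` -/
  Lp₂ : Submodule (Coeff p A K) L₂
  /-- the map `f₁` -/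
  f₁ : L₁ →ₗ[Coeff p A K] L₂
  /-- the map `f₂` -/
  f₂ : L₂ →ₗ[Coeff p A K] L₁

attribute [instance] IwDatum.addCommGroup₁ IwDatum.moduleCoeff₁ IwDatum.module₁
  IwDatum.isScalarTower₁ IwDatum.addCommGroup₂ IwDatum.moduleCoeff₂ IwDatum.module₂
  IwDatum.isScalarTower₂

variable {p K E}

namespace IwDatum

/-- A morphism `X → Y` over `f : Spf A → Spf B` is a pair of `𝒪_K`-semilinear maps
`𝔏_{i,Y} → 𝔏_{i,X}` compatible with `f₁`, `f₂` and inducing isomorphisms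
`A ⊗_B 𝔏_{i,Y} ≃ 𝔏_{i,X}` and `A ⊗_B 𝔏⁺_{i,Y} ≃ 𝔏⁺_{i,X}`. -/
@[ext]
structure Hom (X Y : IwDatum.{u} p K E) : Type u where
  /-- the morphism of test objects -/
  base : X.A ⟶ Y.A
  /-- the map `𝔏_{1,Y} → 𝔏_{1,X}` -/
  toFun₁ : Y.L₁ →+ X.L₁
  /-- the map `𝔏_{2,Y} → 𝔏_{2,X}` -/
  toFun₂ : Y.L₂ →+ X.L₂
  map_smul₁ : ∀ (x : Coeff p Y.A K) (l : Y.L₁), toFun₁ (x • l) = coeffMap base K x • toFun₁ l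
  map_smul₂ : ∀ (x : Coeff p Y.A K) (l : Y.L₂), toFun₂ (x • l) = coeffMap base K x • toFun₂ l
  map_f₁ : ∀ l, toFun₂ (Y.f₁ l) = X.f₁ (toFun₁ l)
  map_f₂ : ∀ l, toFun₁ (Y.f₂ l) = X.f₂ (toFun₂ l)
  map_mem₁ : ∀ l ∈ Y.Lp₁, toFun₁ l ∈ X.Lp₁
  map_mem₂ : ∀ l ∈ Y.Lp₂, toFun₂ l ∈ X.Lp₂
  isBaseChange₁ : IsBaseChangeAlong (TestAlg.toAlgHom p E base).toRingHom toFun₁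
  isBaseChange₂ : IsBaseChangeAlong (TestAlg.toAlgHom p E base).toRingHom toFun₂
  isBaseChange_plus₁ : IsBaseChangeAlong (TestAlg.toAlgHom p E base).toRingHom
    (restrictAdd toFun₁ map_mem₁)
  isBaseChange_plus₂ : IsBaseChangeAlong (TestAlg.toAlgHom p E base).toRingHom
    (restrictAdd toFun₂ map_mem₂)

instance : Category.{u} (IwDatum.{u} p K E) where
  Hom := Hom
  id X :=
    { base := 𝟙 X.A
      toFun₁ := AddMonoidHom.id _
      toFun₂ := AddMonoidHom.id _
      map_smul₁ := fun x l => by rw [coeffMap_id]; rfl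
      map_smul₂ := fun x l => by rw [coeffMap_id]; rfl
      map_f₁ := fun _ => rfl
      map_f₂ := fun _ => rfl
      map_mem₁ := fun _ hl => hl
      map_mem₂ := fun _ hl => hl
      isBaseChange₁ := isBaseChangeAlong_id
      isBaseChange₂ := isBaseChangeAlong_id
      isBaseChange_plus₁ := isBaseChangeAlong_id
      isBaseChange_plus₂ := isBaseChangeAlong_id }
  comp {X Y Z} f g :=
    { base := f.base ≫ g.base
      toFun₁ := f.toFun₁.comp g.toFun₁
      toFun₂ := f.toFun₂.comp g.toFun₂
      map_smul₁ := fun x l => by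
        rw [coeffMap_comp, AddMonoidHom.comp_apply, g.map_smul₁, f.map_smul₁]; rfl
      map_smul₂ := fun x l => by
        rw [coeffMap_comp, AddMonoidHom.comp_apply, g.map_smul₂, f.map_smul₂]; rfl
      map_f₁ := fun l => by
        rw [AddMonoidHom.comp_apply, g.map_f₁, f.map_f₁]; rfl
      map_f₂ := fun l => by
        rw [AddMonoidHom.comp_apply, g.map_f₂, f.map_f₂]; rfl
      map_mem₁ := fun l hl => f.map_mem₁ _ (g.map_mem₁ l hl)
      map_mem₂ := fun l hl => f.map_mem₂ _ (g.map_mem₂ l hl)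
      isBaseChange₁ := g.isBaseChange₁.comp f.isBaseChange₁
      isBaseChange₂ := g.isBaseChange₂.comp f.isBaseChange₂
      isBaseChange_plus₁ := g.isBaseChange_plus₁.comp f.isBaseChange_plus₁
      isBaseChange_plus₂ := g.isBaseChange_plus₂.comp f.isBaseChange_plus₂ }

variable (p K E) in
/-- The projection to the category of test objects. -/
def proj : IwDatum.{u} p K E ⥤ TestAlg.{u} p E where
  obj X := X.A
  map f := Hom.base f

end IwDatum

namespace LocDatum

/-! ### Projection to the eigenspaces -/

section Projector

variable (ξ : Gal(K'/K) →* (OInt p E)ˣ)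

theorem natCard_gal_mul_inverse (T : TameTotRam p K K') :
    (Nat.card Gal(K'/K) : OInt p E) * Ring.inverse (Nat.card Gal(K'/K) : OInt p E) = 1 := by
  apply Ring.mul_inverse_cancel
  have := T.isGalois
  have h : IsUnit (Nat.card Gal(K'/K) : ℤ_[p]) := by
    rw [IsGalois.card_aut_eq_finrank, PadicInt.isUnit_iff, PadicInt.norm_natCast_eq_one_iff]
    exact T.coprime
  simpa using h.map (algebraMap ℤ_[p] (OInt p E))

/-- The projector `n⁻¹ ∑_g ξ(g)⁻¹ g` to the `ξ`-eigenspace. -/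
def projector (X : LocDatum.{u} p K K' E) : X.L →ₗ[X.A.carrier] X.L :=
  ∑ g : Gal(K'/K), algebraMap (OInt p E) X.A.carrier
    (Ring.inverse (Nat.card Gal(K'/K) : OInt p E) * (ξ g⁻¹ : (OInt p E)ˣ)) • X.ρ g

theorem projector_apply (X : LocDatum.{u} p K K' E) (l : X.L) :
    projector ξ X l = ∑ g : Gal(K'/K), algebraMap (OInt p E) X.A.carrier
      (Ring.inverse (Nat.card Gal(K'/K) : OInt p E) * (ξ g⁻¹ : (OInt p E)ˣ)) • X.ρ g l := by
  simp [projector]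

theorem projector_mem (X : LocDatum.{u} p K K' E) (l : X.L) : projector ξ X l ∈ X.eigen ξ := by
  intro h
  rw [projector_apply, map_sum, Finset.smul_sum]
  refine Fintype.sum_equiv (Equiv.mulLeft h) _ _ fun g => ?_
  rw [map_smul, ← Module.End.mul_apply, ← map_mul, ← mul_smul, ← map_mul, Equiv.coe_mulLeft]
  congr 2
  rw [mul_inv_rev, map_mul, Units.val_mul, mul_left_comm, mul_left_comm (ξ h : OInt p E),
    ← Units.val_mul (ξ h), ← map_mul, mul_inv_cancel, map_one, Units.val_one, mul_one]

theorem projector_eq_self (T : TameTotRam p K K') (X : LocDatum.{u} p K K' E) (l : X.L) (hl : l ∈ X.eigen ξ) :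
    projector ξ X l = l := by
  rw [projector_apply]
  have : ∀ g : Gal(K'/K), algebraMap (OInt p E) X.A.carrier
      (Ring.inverse (Nat.card Gal(K'/K) : OInt p E) * (ξ g⁻¹ : (OInt p E)ˣ)) • X.ρ g l =
      algebraMap (OInt p E) X.A.carrier (Ring.inverse (Nat.card Gal(K'/K) : OInt p E)) • l := by
    intro g
    rw [hl g, ← mul_smul, ← map_mul, mul_assoc, ← Units.val_mul, ← map_mul, inv_mul_cancel,
      map_one, Units.val_one, mul_one]
  rw [Finset.sum_congr rfl fun g _ => this g, Finset.sum_const, Finset.card_univ,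
    ← Nat.card_eq_fintype_card, ← Nat.cast_smul_eq_nsmul X.A.carrier, ← mul_smul,
    ← map_natCast (algebraMap (OInt p E) X.A.carrier), ← map_mul, natCard_gal_mul_inverse T,
    map_one, one_smul]

theorem projector_mem_plus (X : LocDatum.{u} p K K' E) (l : X.L) (hl : l ∈ X.Lp) :
    projector ξ X l ∈ X.Lp := by
  rw [projector_apply]
  refine Submodule.sum_mem _ fun g _ => ?_
  exact (X.Lp.restrictScalars X.A.carrier).smul_mem _ (X.stable g l hl)

variable {X Y : LocDatum.{u} p K K' E} (f : X ⟶ Y)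

theorem Hom.map_algebraMap_smul (f : Hom X Y) (a : OInt p E) (l : Y.L) :
    f.toFun (algebraMap (OInt p E) Y.A.carrier a • l) =
      algebraMap (OInt p E) X.A.carrier a • f.toFun l := by
  rw [f.isBaseChange.smul]
  congr 1
  exact (TestAlg.toAlgHom p E f.base).commutes a

theorem Hom.map_projector (f : Hom X Y) (l : Y.L) :
    f.toFun (projector ξ Y l) = projector ξ X (f.toFun l) := by
  rw [projector_apply, projector_apply, map_sum]
  exact Finset.sum_congr rfl fun g _ => by rw [f.map_algebraMap_smul, f.map_ρ]

/-- The projection `𝔏 → 𝔏_ξ`. -/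
def toEigen (X : LocDatum.{u} p K K' E) : X.L →ₗ[X.A.carrier] X.eigen ξ where
  toFun l := ⟨projector ξ X l, projector_mem ξ X l⟩
  map_add' _ _ := Subtype.ext (map_add _ _ _)
  map_smul' _ _ := Subtype.ext (map_smul _ _ _)

/-- The projection `𝔏⁺ → 𝔏⁺_ξ`. -/
def toEigenPlus (X : LocDatum.{u} p K K' E) : X.Lp →ₗ[X.A.carrier] X.eigenPlus ξ where
  toFun l := ⟨⟨projector ξ X l, projector_mem ξ X l⟩, projector_mem_plus ξ X l l.2⟩
  map_add' _ _ := Subtype.ext (Subtype.ext (map_add _ _ _))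
  map_smul' _ _ := Subtype.ext (Subtype.ext (map_smul _ _ _))

/-- The inclusion `𝔏_ξ → 𝔏`. -/
def ofEigen (X : LocDatum.{u} p K K' E) : X.eigen ξ →ₗ[X.A.carrier] X.L where
  toFun l := l
  map_add' _ _ := rfl
  map_smul' _ _ := rfl

/-- The inclusion `𝔏⁺_ξ → 𝔏⁺`. -/
def ofEigenPlus (X : LocDatum.{u} p K K' E) : X.eigenPlus ξ →ₗ[X.A.carrier] X.Lp where
  toFun l := ⟨((l : X.eigen ξ) : X.L), l.2⟩
  map_add' _ _ := rfl
  map_smul' _ _ := rfl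

theorem Hom.map_eigen (f : Hom X Y) (l : Y.L) (hl : l ∈ Y.eigen ξ) : f.toFun l ∈ X.eigen ξ := by
  intro g
  rw [← f.map_ρ, hl g, f.map_algebraMap_smul]

/-- The map `𝔏_{Y,ξ} → 𝔏_{X,ξ}` induced by a morphism. -/
def Hom.eigenMap (f : Hom X Y) : Y.eigen ξ →+ X.eigen ξ := restrictAdd f.toFun (f.map_eigen ξ)

theorem Hom.eigenMap_mem (f : Hom X Y) (l : Y.eigen ξ) (hl : l ∈ Y.eigenPlus ξ) :
    f.eigenMap ξ l ∈ X.eigenPlus ξ := f.map_mem _ hl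

theorem Hom.isBaseChange_eigen (T : TameTotRam p K K') (f : Hom X Y) :
    IsBaseChangeAlong (TestAlg.toAlgHom p E f.base).toRingHom (f.eigenMap ξ) :=
  f.isBaseChange.retract (ofEigen ξ Y) (toEigen ξ Y)
    (fun l => Subtype.ext (projector_eq_self ξ T Y l l.2)) (ofEigen ξ X) (toEigen ξ X)
    (fun l => Subtype.ext (projector_eq_self ξ T X l l.2)) _ (fun _ => rfl)
    (fun l => Subtype.ext (f.map_projector ξ l).symm)

theorem Hom.isBaseChange_eigenPlus (T : TameTotRam p K K') (f : Hom X Y) :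
    IsBaseChangeAlong (M := Y.eigenPlus ξ) (N := X.eigenPlus ξ)
      (TestAlg.toAlgHom p E f.base).toRingHom
      (restrictAdd (f.eigenMap ξ) (f.eigenMap_mem ξ)) :=
  f.isBaseChange_plus.retract (ofEigenPlus ξ Y) (toEigenPlus ξ Y)
    (fun l => Subtype.ext (Subtype.ext (projector_eq_self ξ T Y _ l.1.2))) (ofEigenPlus ξ X)
    (toEigenPlus ξ X)
    (fun l => Subtype.ext (Subtype.ext (projector_eq_self ξ T X _ l.1.2))) _ (fun _ => rfl)
    (fun l => Subtype.ext (Subtype.ext (f.map_projector ξ l).symm))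

end Projector

/-! ### The morphism to the stack of lattice chains -/

variable (T : TameTotRam p K K') (η η' : Gal(K'/K) →* (OInt p E)ˣ)

/-- Multiplication by `∑_σ π' ^ a_σ e_σ`, where `η' / η = σ ∘ h ^ a_σ`, as a map `𝔏_η → 𝔏_{η'}`. -/
def mulPi (X : LocDatum.{u} p K K' E) : X.eigen η →ₗ[Coeff p X.A K] X.eigen η' where
  toFun l := ⟨coeffOfInt X.A (T.piElt η η') • (l : X.L), fun g => by
    have key := congrArg (coeffOfInt X.A) (T.map_galAct_piElt η η' g)
    have h1 : ∀ (a : OInt p E) (m : X.L),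
        algebraMap (OInt p E) X.A.carrier a • m = coeffOfInt X.A (a ⊗ₜ[ℤ_[p]] (1 : OInt p K')) • m := by
      intro a m
      rw [← algebraMap_smul (Coeff p X.A K') (algebraMap (OInt p E) X.A.carrier a) m]
      rfl
    rw [map_mul, map_mul, ← coeffGal_coeffOfInt] at key
    rw [X.semilinear, l.2 g, h1, h1, ← mul_smul, ← mul_smul, mul_comm, key]⟩
  map_add' l m := Subtype.ext (smul_add _ _ _)
  map_smul' x l := Subtype.ext (smul_comm (coeffOfInt X.A (T.piElt η η')) (coeffIncl K K' X.A x)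
    (l : X.L))

theorem mulPi_coe (X : LocDatum.{u} p K K' E) (l : X.eigen η) :
    (mulPi T η η' X l : X.L) = coeffOfInt X.A (T.piElt η η') • (l : X.L) := rfl

/-- The morphism `(𝔏, 𝔏⁺) ↦ (𝔏_η, 𝔏⁺_η, 𝔏_{η'}, 𝔏⁺_{η'}, π₁, π₂)`, where `f₁`, `f₂` are the
multiplications by `π₁ = ∑_σ π' ^ a_σ e_σ` and `π₂ = ∑_σ π' ^ b_σ e_σ`, with
`η' / η = σ ∘ h ^ a_σ` and `η / η' = σ ∘ h ^ b_σ`. -/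
def toIw : LocDatum.{u} p K K' E ⥤ IwDatum.{u} p K E where
  obj X :=
    { A := X.A
      L₁ := X.eigen η
      L₂ := X.eigen η'
      Lp₁ := X.eigenPlus η
      Lp₂ := X.eigenPlus η'
      f₁ := mulPi T η η' X
      f₂ := mulPi T η' η X }
  map {X Y} f :=
    { base := Hom.base f
      toFun₁ := Hom.eigenMap η f
      toFun₂ := Hom.eigenMap η' f
      map_smul₁ := fun x l => Subtype.ext (by
        show Hom.toFun f (coeffIncl K K' Y.A x • (l : Y.L)) = _
        rw [Hom.map_smul, coeffMap_coeffIncl]; rfl)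
      map_smul₂ := fun x l => Subtype.ext (by
        show Hom.toFun f (coeffIncl K K' Y.A x • (l : Y.L)) = _
        rw [Hom.map_smul, coeffMap_coeffIncl]; rfl)
      map_f₁ := fun l => Subtype.ext (by
        show Hom.toFun f (coeffOfInt Y.A (T.piElt η η') • (l : Y.L)) = _
        rw [Hom.map_smul, coeffMap_coeffOfInt]; rfl)
      map_f₂ := fun l => Subtype.ext (by
        show Hom.toFun f (coeffOfInt Y.A (T.piElt η' η) • (l : Y.L)) = _
        rw [Hom.map_smul, coeffMap_coeffOfInt]; rfl)
      map_mem₁ := Hom.eigenMap_mem η f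
      map_mem₂ := Hom.eigenMap_mem η' f
      isBaseChange₁ := Hom.isBaseChange_eigen η T f
      isBaseChange₂ := Hom.isBaseChange_eigen η' T f
      isBaseChange_plus₁ := Hom.isBaseChange_eigenPlus η T f
      isBaseChange_plus₂ := Hom.isBaseChange_eigenPlus η' T f }

end LocDatum

/-! ### The conditions cutting out the stacks -/

variable (K) in
/-- The Kottwitz determinant condition `det_A(a | M) = ∏_{ψ : K → E} ψ(a)` for an
`𝒪_K ⊗ A`-module `M`, as an identity of polynomial functions in `a ∈ 𝒪_K`, Zariski locally on
`Spec A`: there are elements `s` generating the unit ideal of `A` such that over each localisation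
`A_s`, and after any further base change `B`, the module `M` becomes free and for all `a_i ∈ 𝒪_K`
and `b_i ∈ B` the determinant of `∑ b_i a_i` on `B ⊗_A M` is `∏_ψ ∑ b_i ψ(a_i)`. -/
def DetCondition [FiniteDimensional ℚ_[p] K] (A : TestAlg.{u} p E) (M : Type u) [AddCommGroup M]
    [Module (Coeff p A K) M] [Module A.carrier M] [IsScalarTower A.carrier (Coeff p A K) M] :
    Prop :=
  ∃ S : Set A.carrier, Ideal.span S = ⊤ ∧ ∀ s ∈ S,
    ∀ (B : Type u) [CommRing B] [Algebra A.carrier B], IsUnit (algebraMap A.carrier B s) →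
      Module.Free B (B ⊗[A.carrier] M) ∧
      ∀ (n : ℕ) (a : Fin n → OInt p K) (b : Fin n → B),
        LinearMap.det (∑ i, b i • ((LinearMap.lsmul (Coeff p A K) M
          (1 ⊗ₜ[ℤ_[p]] a i)).restrictScalars A.carrier).baseChange B) =
        ∏ ψ : K →ₐ[ℚ_[p]] E, ∑ i, b i * algebraMap A.carrier B
          (algebraMap (OInt p E) A.carrier (OInt.map (ψ.restrictScalars ℤ_[p]) (a i)))

namespace LocDatum

/-- The conditions defining the stack `M_loc^{K'/K}` in rank two: `𝔏` is a projective
`𝒪_{K'} ⊗ A`-module of rank two, and `𝔏 / 𝔏⁺` is a projective `A`-module. -/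
def isLoc : ObjectProperty (LocDatum.{u} p K K' E) := fun X =>
  IsProjOfRank (Coeff p X.A K') X.L 2 ∧ Module.Projective X.A.carrier (X.L ⧸ X.Lp)

/-- The submodule `π' 𝔏` of `𝔏`. -/
def piL (T : TameTotRam p K K') (X : LocDatum.{u} p K K' E) : Submodule (Coeff p X.A K) X.L where
  carrier := {l | ∃ m : X.L, l = ((1 : X.A.carrier) ⊗ₜ[ℤ_[p]] T.π' : Coeff p X.A K') • m}
  add_mem' := by
    rintro _ _ ⟨m, rfl⟩ ⟨n, rfl⟩
    exact ⟨m + n, (smul_add _ _ _).symm⟩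
  zero_mem' := ⟨0, (smul_zero _).symm⟩
  smul_mem' := by
    rintro x _ ⟨m, rfl⟩
    exact ⟨x • m, smul_comm (coeffIncl K K' X.A x) _ m⟩

/-- The `ξ`-eigenspace `(𝔏 / π' 𝔏)_ξ` of `𝔏 / π' 𝔏`, i.e. the set of classes of all `l` such that
`g l - ξ(g) l ∈ π' 𝔏` for all `g`. -/
def residualEigen (T : TameTotRam p K K') (X : LocDatum.{u} p K K' E)
    (ξ : Gal(K'/K) →* (OInt p E)ˣ) : Submodule (Coeff p X.A K) (X.L ⧸ X.piL T) :=
  Submodule.map (X.piL T).mkQ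
    { carrier := {l | ∀ g, X.ρ g l - algebraMap (OInt p E) X.A.carrier (ξ g) • l ∈ X.piL T}
      add_mem' := fun {l m} hl hm g => by
        have := (X.piL T).add_mem (hl g) (hm g)
        rwa [sub_add_sub_comm, ← map_add, ← smul_add] at this
      zero_mem' := fun g => by simp
      smul_mem' := fun x l hl g => by
        have := (X.piL T).smul_mem x (hl g)
        rwa [smul_sub, smul_comm x, coeff_smul_def, ← coeffGal_coeffIncl K K' X.A g x,
          ← X.semilinear] at this }

open Classical in
/-- The conditions defining the open and closed substack `M_loc^τ` for the tame inertial type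
`τ = η ⊕ η'`: for all characters `ξ` of `I(K'/K) = Gal(K'/K)`, the eigenspace `(𝔏 / π' 𝔏)_ξ` is a
projective `k ⊗ A`-module of constant rank equal to the multiplicity of `ξ` in `τ`; that is, locally
on `Spec A` the `I(K'/K)`-representation `𝔏 / π' 𝔏` is the sum of the characters `η` and `η'` over
`k ⊗ A = (𝒪_K ⊗ A) / π`. -/
def isLocType (T : TameTotRam p K K') (η η' : Gal(K'/K) →* (OInt p E)ˣ) :
    ObjectProperty (LocDatum.{u} p K K' E) := fun X =>
  X.isLoc ∧ ∀ ξ : Gal(K'/K) →* (OInt p E)ˣ,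
    IsProjOfRankOverQuotient (Coeff p X.A K) (X.residualEigen T ξ)
      (Ideal.span {1 ⊗ₜ[ℤ_[p]] T.π}) ((if ξ = η then 1 else 0) + (if ξ = η' then 1 else 0))

/-- The conditions defining the substack `M_loc^{τ,BT}` of `M_loc^τ`, for `τ = η ⊕ η'`: the strong
determinant condition, i.e. the determinant condition on `𝔏⁺_ξ` for all characters `ξ` (here the
maximal unramified extension of `K` inside `K'` is `K`, as `K'/K` is totally ramified). -/
def isLocTypeBT [FiniteDimensional ℚ_[p] K] (T : TameTotRam p K K')
    (η η' : Gal(K'/K) →* (OInt p E)ˣ) : ObjectProperty (LocDatum.{u} p K K' E) := fun X =>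
  X.isLocType T η η' ∧ ∀ ξ : Gal(K'/K) →* (OInt p E)ˣ, DetCondition K X.A (X.eigenPlus ξ)

end LocDatum

namespace IwDatum

/-- The conditions defining the stack `M_{loc,Iw}`, for the uniformiser `π` of `K`. -/
structure isIw (π : OInt p K) (X : IwDatum.{u} p K E) : Prop where
  rank₁ : IsProjOfRank (Coeff p X.A K) X.L₁ 2
  rank₂ : IsProjOfRank (Coeff p X.A K) X.L₂ 2
  comp₁₂ : ∀ l, X.f₁ (X.f₂ l) = ((1 : X.A.carrier) ⊗ₜ[ℤ_[p]] π : Coeff p X.A K) • l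
  comp₂₁ : ∀ l, X.f₂ (X.f₁ l) = ((1 : X.A.carrier) ⊗ₜ[ℤ_[p]] π : Coeff p X.A K) • l
  /-- the cokernel of `f₁` is a projective `k ⊗ A`-module of rank one,
  where `k ⊗ A = (𝒪_K ⊗ A) / π` -/
  coker₁ : IsProjOfRankOverQuotient (Coeff p X.A K) (X.L₂ ⧸ X.f₁.range)
    (Ideal.span {1 ⊗ₜ[ℤ_[p]] π}) 1
  coker₂ : IsProjOfRankOverQuotient (Coeff p X.A K) (X.L₁ ⧸ X.f₂.range)
    (Ideal.span {1 ⊗ₜ[ℤ_[p]] π}) 1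
  plus₁ : Module.Projective X.A.carrier (X.L₁ ⧸ X.Lp₁)
  plus₂ : Module.Projective X.A.carrier (X.L₂ ⧸ X.Lp₂)
  map_plus₁ : ∀ l ∈ X.Lp₁, X.f₁ l ∈ X.Lp₂
  map_plus₂ : ∀ l ∈ X.Lp₂, X.f₂ l ∈ X.Lp₁

/-- The conditions defining the substack `M_{loc,Iw}^{BT}` of `M_{loc,Iw}`: the determinant
condition on `𝔏₁⁺` and `𝔏₂⁺`. -/
def isIwBT [FiniteDimensional ℚ_[p] K] (π : OInt p K) : ObjectProperty (IwDatum.{u} p K E) :=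
  fun X => X.isIw π ∧ DetCondition K X.A X.Lp₁ ∧ DetCondition K X.A X.Lp₂

end IwDatum

/-! ### The stacks, as categories fibred in groupoids over the affine test objects -/

section Stacks

variable (T : TameTotRam p K K') (η η' : Gal(K'/K) →* (OInt p E)ˣ)

/-- The stack `M_loc^τ` for `τ = η ⊕ η'`. -/
def locStack : BasedCategory.{u, u + 1} (TestAlg.{u} p E) :=
  BasedCategory.ofFunctor
    ((LocDatum.isLocType.{u} T η η').ι ⋙ LocDatum.proj p K K' E)

/-- The stack `M_{loc,Iw}`. -/
def iwStack (π : OInt p K) : BasedCategory.{u, u + 1} (TestAlg.{u} p E) :=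
  BasedCategory.ofFunctor
    (ObjectProperty.ι (IwDatum.isIw.{u} (E := E) π) ⋙ IwDatum.proj p K E)

/-- The morphism `M_loc^τ → M_{loc,Iw}`, given that the underlying rule takes values in
`M_{loc,Iw}`. -/
def locToIw (h : ∀ X : LocDatum.{u} p K K' E, X.isLocType T η η' →
    ((LocDatum.toIw T η η').obj X).isIw T.π) :
    BasedFunctor (locStack.{u} T η η') (iwStack.{u} (E := E) T.π) where
  toFunctor := ObjectProperty.lift (IwDatum.isIw T.π)
    ((LocDatum.isLocType T η η').ι ⋙ LocDatum.toIw T η η') fun X => h X.obj X.property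
  w := rfl

variable [FiniteDimensional ℚ_[p] K]

/-- The stack `M_loc^{τ,BT}` for `τ = η ⊕ η'`. -/
def locStackBT : BasedCategory.{u, u + 1} (TestAlg.{u} p E) :=
  BasedCategory.ofFunctor
    ((LocDatum.isLocTypeBT.{u} T η η').ι ⋙ LocDatum.proj p K K' E)

/-- The stack `M_{loc,Iw}^{BT}`. -/
def iwStackBT (π : OInt p K) : BasedCategory.{u, u + 1} (TestAlg.{u} p E) :=
  BasedCategory.ofFunctor
    ((IwDatum.isIwBT.{u} (E := E) π).ι ⋙ IwDatum.proj p K E)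

/-- The inclusion `M_loc^{τ,BT} → M_loc^τ`. -/
def locIncl : BasedFunctor (locStackBT.{u} T η η') (locStack.{u} T η η') where
  toFunctor := ObjectProperty.ιOfLE fun _ hX => hX.1
  w := rfl

/-- The inclusion `M_{loc,Iw}^{BT} → M_{loc,Iw}`. -/
def iwIncl (π : OInt p K) : BasedFunctor (iwStackBT.{u} (E := E) π) (iwStack.{u} (E := E) π) where
  toFunctor := ObjectProperty.ιOfLE fun _ hX => hX.1
  w := rfl

end Stacks

end Fields

end TameLocalModel

end

noncomputable section

namespace TameLocalModel

/-! ### Rings of integers -/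

section RingOfIntegers

set_option linter.unusedSectionVars false

variable {p : ℕ} [Fact p.Prime] (F : Type u) [Field F] [Algebra ℚ_[p] F] [Algebra ℤ_[p] F]
  [IsScalarTower ℤ_[p] ℚ_[p] F] [FiniteDimensional ℚ_[p] F]

/-! Put n = [K' : K] and, for an embedding σ, let a be the exponent with η' = η · σ∘h^a. Total
ramification makes 𝒪_{K'} free over 𝒪_K on 1, π', …, π'^(n-1) (`combineEquiv`). As n is prime to p,
every 𝔏 splits into n parts, the i-th being the one on which G acts through η h^i (`isotypic`), and
π' carries part i to part i+1, cyclically. The type condition says that only η and η' survive in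
𝔏/π'𝔏, so where η h^i is neither of them, part i lies in π' times part i-1. Hence over e_σ part i is
π'^i 𝔏_η for i < a and π'^(i-a) 𝔏_{η'} for i ≥ a (`isLocType.exists_eq_of_mem_isotypic`). So 𝔏 is a
staircase built from 𝔏_η, 𝔏_{η'} and the maps π₁, π₂, whose product is π because the two exponents
add up to n.

Conversely, from a chain one puts L₁ at the positions below a and L₂ at the positions from a on. The
shift by one position, which uses f₁ to enter position a and f₂ to return from position n-1 to
position 0, has n-th power π (`Stair.shift_pow`). As 𝒪_{K'} ⊗ A is obtained from 𝒪_K ⊗ A by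
adjoining an n-th root of π, the shift defines an 𝒪_{K'} ⊗ A-module structure (`exists_glueHom`).

Since a depends on σ, idempotents do the bookkeeping. The size of E gives ∑ e_σ = 1 (`sum_idem`).
The idempotent w_i (`wIdem`, `wc`) cuts out the part with a = i, so that π₁ = ∑ π'^i w_i
(`piElt_eq`). From the w_i one forms u_i (`uc`), supported where a > i, and y_i (`yc`), equal to
π'^(i-a) where a ≤ i.

For local freeness, a maximal ideal of 𝒪_K ⊗ A contains π because A is p-adically complete. The
cokernel conditions and Nakayama give, up to scalars outside the ideal, generators m₀, f₂ n₀ of L₁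
and n₀, f₁ m₀ of L₂ (`exists_chain_generators`), and m₀, n₀ then form a basis of 𝔏. Freeness follows
in both directions from a rank comparison, carried out with maps whose kernel and cokernel are
killed by a scalar (`IsIsoUpTo`).

The submodule 𝔏⁺ is where the determinant condition is essential. The submodule of 𝔏 generated by
𝔏⁺_η and 𝔏⁺_{η'} lies in 𝔏⁺, has projective quotient, and its ξ-part is an idempotent mixture of
𝔏⁺_η and 𝔏⁺_{η'}, so it again satisfies the determinant condition (`Gluing.detCondition`). That
condition fixes the rank (`DetCondition.rankAtStalk`), so the two submodules agree
(`isLocTypeBT.reglue_Lp_eq`). Full faithfulness and essential surjectivity are then read off from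
the gluing. -/

instance OInt.instFinite : Module.Finite ℤ_[p] (OInt p F) :=
  IsIntegralClosure.finite ℤ_[p] ℚ_[p] F (OInt p F)

theorem OInt.algebraMap_padicInt_injective : Function.Injective (algebraMap ℤ_[p] (OInt p F)) := by
  have : Function.Injective (algebraMap ℤ_[p] F) := by
    rw [IsScalarTower.algebraMap_eq ℤ_[p] ℚ_[p] F]
    exact (algebraMap ℚ_[p] F).injective.comp (IsFractionRing.injective ℤ_[p] ℚ_[p])
  rw [IsScalarTower.algebraMap_eq ℤ_[p] (OInt p F) F, RingHom.coe_comp] at this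
  exact this.of_comp

instance OInt.instIsTorsionFree : Module.IsTorsionFree ℤ_[p] (OInt p F) := by
  have : FaithfulSMul ℤ_[p] (OInt p F) :=
    (faithfulSMul_iff_algebraMap_injective _ _).2 (OInt.algebraMap_padicInt_injective F)
  infer_instance

instance OInt.instFree : Module.Free ℤ_[p] (OInt p F) := Module.free_of_finite_type_torsion_free'

instance OInt.instIsNoetherianRing : IsNoetherianRing (OInt p F) :=
  IsNoetherianRing.of_finite ℤ_[p] (OInt p F)

variable {F}

/-- Both sides say that the minimal polynomial over ℚ_p has coefficients in ℤ_p: one by the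
definition of the spectral value, the other because ℤ_p is integrally closed. -/
theorem isIntegral_iff_spectralNorm_le_one (x : F) :
    IsIntegral ℤ_[p] x ↔ spectralNorm ℚ_[p] F x ≤ 1 := by
  have hx : IsIntegral ℚ_[p] x := Algebra.IsIntegral.isIntegral x
  rw [spectralNorm, spectralValue_le_one_iff (minpoly.monic hx)]
  constructor
  · intro h n
    rw [minpoly.isIntegrallyClosed_eq_field_fractions' ℚ_[p] h, Polynomial.coeff_map]
    exact PadicInt.norm_le_one _
  · intro h
    have hl : minpoly ℚ_[p] x ∈ Polynomial.lifts (algebraMap ℤ_[p] ℚ_[p]) := by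
      rw [Polynomial.lifts_iff_coeff_lifts]
      exact fun n => ⟨⟨_, h n⟩, rfl⟩
    obtain ⟨q, hq, -, hm⟩ := Polynomial.lifts_and_degree_eq_and_monic hl (minpoly.monic hx)
    refine ⟨q, hm, ?_⟩
    rw [IsScalarTower.algebraMap_eq ℤ_[p] ℚ_[p] F, ← Polynomial.eval₂_map, hq]
    exact minpoly.aeval ℚ_[p] x

theorem spectralNorm_mul_eq (x y : F) : spectralNorm ℚ_[p] F (x * y) =
    spectralNorm ℚ_[p] F x * spectralNorm ℚ_[p] F y :=
  spectralAlgNorm_mul x y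

theorem spectralNorm_pow_eq (x : F) (n : ℕ) : spectralNorm ℚ_[p] F (x ^ n) =
    spectralNorm ℚ_[p] F x ^ n :=
  map_pow (spectralMulAlgNorm ℚ_[p] F) x n

theorem OInt.isUnit_iff (a : OInt p F) :
    IsUnit a ↔ spectralNorm ℚ_[p] F (algebraMap (OInt p F) F a) = 1 := by
  have hle : ∀ b : OInt p F, spectralNorm ℚ_[p] F (algebraMap (OInt p F) F b) ≤ 1 := fun b =>
    (isIntegral_iff_spectralNorm_le_one _).1 b.2
  constructor
  · intro h
    obtain ⟨b, hb⟩ := h.exists_right_inv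
    have h1 := congrArg (fun z => spectralNorm ℚ_[p] F (algebraMap (OInt p F) F z)) hb
    simp only [map_mul, map_one, spectralNorm_mul_eq, spectralNorm_one] at h1
    refine le_antisymm (hle a) ?_
    rw [← h1]
    exact mul_le_of_le_one_right (spectralNorm_nonneg _) (hle b)
  · intro h
    have h0 : algebraMap (OInt p F) F a ≠ 0 := by
      intro h0
      rw [h0, spectralNorm_zero] at h
      exact zero_ne_one h
    have h1 : spectralNorm ℚ_[p] F (algebraMap (OInt p F) F a)⁻¹ = 1 := by
      have := spectralNorm_mul_eq (p := p) (algebraMap (OInt p F) F a) (algebraMap (OInt p F) F a)⁻¹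
      rwa [mul_inv_cancel₀ h0, spectralNorm_one, h, one_mul, eq_comm] at this
    refine IsUnit.of_mul_eq_one (OInt.mk _ ((isIntegral_iff_spectralNorm_le_one _).2 h1.le))
      (OInt.ext ?_)
    rw [map_mul, OInt.algebraMap_mk, map_one, mul_inv_cancel₀ h0]

theorem OInt.spectralNorm_lt_one {a : OInt p F} (ha : ¬IsUnit a) :
    spectralNorm ℚ_[p] F (algebraMap (OInt p F) F a) < 1 :=
  lt_of_le_of_ne ((isIntegral_iff_spectralNorm_le_one _).1 a.2) fun h =>
    ha ((OInt.isUnit_iff a).2 h)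

/-- The nonunits are the elements of spectral norm less than 1, and these are closed under addition
because the norm is nonarchimedean. -/
instance OInt.instIsLocalRing : IsLocalRing (OInt p F) := by
  refine IsLocalRing.of_nonunits_add fun a b ha hb hab => ?_
  have h := isNonarchimedean_spectralNorm (K := ℚ_[p]) (algebraMap (OInt p F) F a)
    (algebraMap (OInt p F) F b)
  rw [← map_add, (OInt.isUnit_iff _).1 hab] at h
  exact absurd h (not_le.2 (max_lt (OInt.spectralNorm_lt_one ha) (OInt.spectralNorm_lt_one hb)))

/-- A nonunit has norm less than 1, so some power has norm below that of p, and its quotient by p is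
integral. This is how a uniformiser is forced into every ideal that is prime and contains p. -/
theorem OInt.exists_pow_mem_span {a : OInt p F} (ha : ¬IsUnit a) :
    ∃ n : ℕ, a ^ n ∈ Ideal.span {(p : OInt p F)} := by
  have hp : (0 : ℝ) < ‖(p : ℚ_[p])‖ := norm_pos_iff.2 (Nat.cast_ne_zero.2 (Fact.out : p.Prime).ne_zero)
  obtain ⟨n, hn⟩ := exists_pow_lt_of_lt_one hp (OInt.spectralNorm_lt_one ha)
  refine ⟨n, ?_⟩
  have hpF : (p : F) ≠ 0 := by
    have : CharZero F := charZero_of_injective_algebraMap (algebraMap ℚ_[p] F).injective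
    exact Nat.cast_ne_zero.2 (Fact.out : p.Prime).ne_zero
  have hs : spectralNorm ℚ_[p] F (p : F) = ‖(p : ℚ_[p])‖ := by
    rw [← spectralNorm_extends (L := F), map_natCast]
  have h1 : spectralNorm ℚ_[p] F (algebraMap (OInt p F) F a ^ n / p) ≤ 1 := by
    have h2 := spectralNorm_mul_eq (p := p) (algebraMap (OInt p F) F a ^ n / p) (p : F)
    rw [div_mul_cancel₀ _ hpF, spectralNorm_pow_eq, hs] at h2
    by_contra hc
    push Not at hc
    have := mul_lt_mul_of_pos_right hc hp
    rw [one_mul] at this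
    linarith
  rw [Ideal.mem_span_singleton]
  refine ⟨OInt.mk _ ((isIntegral_iff_spectralNorm_le_one _).2 h1), OInt.ext ?_⟩
  rw [map_mul, OInt.algebraMap_mk, map_natCast, map_pow, mul_div_cancel₀ _ hpF]

variable (p F) in
theorem OInt.not_isUnit_p : ¬IsUnit (p : OInt p F) := by
  rw [OInt.isUnit_iff, map_natCast, ← map_natCast (algebraMap ℚ_[p] F), spectralNorm_extends]
  exact Padic.norm_p_lt_one.ne

theorem OInt.span_p_le_jacobson : Ideal.span {(p : OInt p F)} ≤ (⊥ : Ideal (OInt p F)).jacobson := by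
  rw [IsLocalRing.jacobson_eq_maximalIdeal ⊥ bot_ne_top, Ideal.span_singleton_le_iff_mem]
  exact OInt.not_isUnit_p p F

/-- A finite free module over the complete ring ℤ_p is complete, coordinate by coordinate.
Completeness is needed for lifting roots of unity by Hensel's lemma. -/
instance OInt.instIsAdicComplete : IsAdicComplete (Ideal.span {(p : OInt p F)}) (OInt p F) := by
  have h1 : IsHausdorff (Ideal.span {(p : OInt p F)}) (OInt p F) :=
    IsHausdorff.of_le_jacobson _ _ OInt.span_p_le_jacobson
  have h2 : Ideal.span {(p : OInt p F)} =
      (Ideal.span {(p : ℤ_[p])}).map (algebraMap ℤ_[p] (OInt p F)) := by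
    rw [Ideal.map_span, Set.image_singleton, map_natCast]
  have h3 : IsPrecomplete (Ideal.span {(p : OInt p F)}) (OInt p F) := by
    rw [h2, IsPrecomplete.map_algebraMap_iff, isPrecomplete_iff]
    have hc : IsAdicComplete (Ideal.span {(p : ℤ_[p])}) ℤ_[p] := by
      rw [← PadicInt.maximalIdeal_eq_span_p]; infer_instance
    intro f hf
    let b := Module.finBasis ℤ_[p] (OInt p F)
    have hf' : ∀ i : Fin _, ∃ L : ℤ_[p], ∀ n, b.repr (f n) i ≡ L
        [SMOD (Ideal.span {(p : ℤ_[p])} ^ n • ⊤ : Submodule ℤ_[p] ℤ_[p])] := fun i => by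
      refine hc.toIsPrecomplete.prec fun {m n} hmn => ?_
      have := (hf hmn).map (b.coord i)
      refine this.mono ?_
      rw [Submodule.map_smul'']
      exact smul_mono_right _ le_top
    choose L hL using hf'
    refine ⟨∑ i, L i • b i, fun n => ?_⟩
    rw [SModEq.sub_mem]
    rw [← b.sum_repr (f n), ← Finset.sum_sub_distrib]
    refine Submodule.sum_mem _ fun i _ => ?_
    rw [← sub_smul]
    have h4 := SModEq.sub_mem.1 (hL i n)
    rw [smul_eq_mul, Ideal.mul_top] at h4
    exact Submodule.smul_mem_smul h4 trivial
  exact { toIsHausdorff := h1, toIsPrecomplete := h3 }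

end RingOfIntegers

/-! ### Total ramification: the 𝒪_K-basis of powers of π', and the character h -/

section TotallyRamified

set_option linter.unusedSectionVars false

variable {p : ℕ} [Fact p.Prime]
  {K K' E : Type u} [Field K] [Field K'] [Field E]
  [Algebra ℚ_[p] K] [Algebra ℤ_[p] K] [IsScalarTower ℤ_[p] ℚ_[p] K]
  [Algebra ℚ_[p] K'] [Algebra ℤ_[p] K'] [IsScalarTower ℤ_[p] ℚ_[p] K']
  [Algebra ℚ_[p] E] [Algebra ℤ_[p] E] [IsScalarTower ℤ_[p] ℚ_[p] E]
  [Algebra K K'] [IsScalarTower ℚ_[p] K K'] [IsScalarTower ℤ_[p] K K']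
  [FiniteDimensional K K'] [FiniteDimensional ℚ_[p] K] [FiniteDimensional ℚ_[p] K']
  [FiniteDimensional ℚ_[p] E]

theorem intIncl_injective : Function.Injective (intIncl p K K') := fun x y h => by
  refine OInt.ext ((algebraMap K K').injective ?_)
  exact congrArg (algebraMap (OInt p K') K') h

namespace TameTotRam

variable (T : TameTotRam p K K')

include T in
theorem finrank_pos : 0 < Module.finrank K K' := Module.finrank_pos

theorem not_isUnit_π' : ¬IsUnit T.π' := fun h =>
  T.isMaximal.ne_top (Ideal.span_singleton_eq_top.2 h)

theorem exists_pow_π'_mem : ∃ N : ℕ, T.π' ^ N ∈ Ideal.span {(p : OInt p K')} :=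
  OInt.exists_pow_mem_span T.not_isUnit_π'

/-- The map `(c_i) ↦ ∑ c_i π' ^ i`. -/
def combine : (Fin (Module.finrank K K') → OInt p K) →ₗ[ℤ_[p]] OInt p K' where
  toFun c := ∑ i, intIncl p K K' (c i) * T.π' ^ (i : ℕ)
  map_add' c d := by simp [add_mul, Finset.sum_add_distrib]
  map_smul' a c := by simp [Finset.smul_sum]

theorem combine_apply (c) : T.combine c = ∑ i, intIncl p K K' (c i) * T.π' ^ (i : ℕ) := rfl

/-- Because π'^n = π, the quotient of j by n is absorbed into the coefficient and only the remainder
stays in the exponent. -/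
theorem mul_pow_mem_range_combine (y : OInt p K) (j : ℕ) :
    intIncl p K K' y * T.π' ^ j ∈ LinearMap.range T.combine := by
  have hn := T.finrank_pos
  refine ⟨Pi.single ⟨j % Module.finrank K K', Nat.mod_lt _ hn⟩
    (y * T.π ^ (j / Module.finrank K K')), ?_⟩
  rw [combine_apply, Finset.sum_eq_single ⟨j % Module.finrank K K', Nat.mod_lt _ hn⟩]
  · rw [Pi.single_eq_same, map_mul, map_pow, ← T.pow_eq, mul_assoc, ← pow_mul, ← pow_add]
    simp only [Nat.div_add_mod]
  · intro i _ hi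
    rw [Pi.single_eq_of_ne hi, map_zero, zero_mul]
  · simp

/-- Successive approximation: the residue extension is trivial, so the current error agrees with an
element of 𝒪_K modulo π', and subtracting it gains one power of π'. -/
theorem exists_sub_mem_range_combine (z : OInt p K') (N : ℕ) :
    ∃ z', z - T.π' ^ N * z' ∈ LinearMap.range T.combine := by
  induction N with
  | zero => exact ⟨z, by simp⟩
  | succ N ih =>
    obtain ⟨z', hz'⟩ := ih
    obtain ⟨y, hy⟩ := T.totRam (Ideal.Quotient.mk _ z')
    obtain ⟨w, hw⟩ := Ideal.mem_span_singleton.1 (Ideal.Quotient.eq.1 hy.symm)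
    refine ⟨w, ?_⟩
    have h1 := Submodule.add_mem _ hz' (T.mul_pow_mem_range_combine y N)
    convert h1 using 1
    have hw' : z' = intIncl p K K' y + T.π' * w := by rw [← hw]; simp
    rw [hw']
    ring

/-- Nakayama over ℤ_p: a high power of π' is divisible by p, so the approximation shows that the
image fills 𝒪_{K'} modulo p. -/
theorem combine_surjective : Function.Surjective T.combine := by
  rw [← LinearMap.range_eq_top, ← top_le_iff]
  obtain ⟨N, hN⟩ := T.exists_pow_π'_mem
  obtain ⟨v, hv⟩ := Ideal.mem_span_singleton.1 hN
  refine Submodule.le_of_le_smul_of_le_jacobson_bot (I := Ideal.span {(p : ℤ_[p])})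
    Module.Finite.fg_top ?_ ?_
  · rw [← PadicInt.maximalIdeal_eq_span_p, IsLocalRing.jacobson_eq_maximalIdeal ⊥ bot_ne_top]
  · intro z _
    obtain ⟨z', hz'⟩ := T.exists_sub_mem_range_combine z N
    refine Submodule.mem_sup.2 ⟨_, hz', T.π' ^ N * z', ?_, by ring⟩
    have : T.π' ^ N * z' = (p : ℤ_[p]) • (v * z') := by
      rw [hv, Algebra.smul_def, map_natCast, mul_assoc]
    rw [this]
    exact Submodule.smul_mem_smul (Ideal.mem_span_singleton_self _) trivial

theorem span_pow_π' : ⊤ ≤ Submodule.span K (Set.range fun i : Fin (Module.finrank K K') =>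
    algebraMap (OInt p K') K' T.π' ^ (i : ℕ)) := by
  have hO : ∀ z : OInt p K', algebraMap (OInt p K') K' z ∈ Submodule.span K
      (Set.range fun i : Fin (Module.finrank K K') => algebraMap (OInt p K') K' T.π' ^ (i : ℕ)) := by
    intro z
    obtain ⟨c, rfl⟩ := T.combine_surjective z
    rw [combine_apply, map_sum]
    refine Submodule.sum_mem _ fun i _ => ?_
    rw [map_mul, map_pow]
    have : algebraMap (OInt p K') K' (intIncl p K K' (c i)) =
      algebraMap K K' (algebraMap (OInt p K) K (c i)) := rfl
    rw [this, ← Algebra.smul_def]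
    exact Submodule.smul_mem _ _ (Submodule.subset_span ⟨i, rfl⟩)
  intro z _
  -- An arbitrary element of K' becomes integral after multiplication by a nonzero element of ℤ_p,
  -- which is a unit in K.
  obtain ⟨m, hm⟩ := IsIntegral.exists_multiple_integral_of_isLocalization
    (nonZeroDivisors ℤ_[p]) (Rₘ := ℚ_[p]) z (Algebra.IsIntegral.isIntegral z)
  have h1 := hO (OInt.mk _ hm)
  rw [OInt.algebraMap_mk, Submonoid.smul_def] at h1
  have hm0 : algebraMap ℤ_[p] K m ≠ 0 := by
    rw [IsScalarTower.algebraMap_apply ℤ_[p] ℚ_[p] K]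
    exact fun h => nonZeroDivisors.ne_zero m.2
      (IsFractionRing.injective ℤ_[p] ℚ_[p] (((algebraMap ℚ_[p] K).injective
        (h.trans (map_zero _).symm)).trans (map_zero _).symm))
  have h2 := Submodule.smul_mem _ (algebraMap ℤ_[p] K m)⁻¹ h1
  rwa [← algebraMap_smul K (m : ℤ_[p]) z, smul_smul, inv_mul_cancel₀ hm0, one_smul] at h2

/-- The n powers of π' span K' over K, which has dimension n, so they are linearly independent. -/
theorem combine_injective : Function.Injective T.combine := by
  rw [injective_iff_map_eq_zero]
  intro c hc
  have hli := linearIndependent_of_top_le_span_of_card_eq_finrank T.span_pow_π' (by simp)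
  have h1 := Fintype.linearIndependent_iff.1 hli (fun i => algebraMap (OInt p K) K (c i)) (by
    rw [combine_apply] at hc
    have := congrArg (algebraMap (OInt p K') K') hc
    rw [map_sum, map_zero] at this
    rw [← this]
    refine Finset.sum_congr rfl fun i _ => ?_
    rw [map_mul, map_pow, Algebra.smul_def]
    rfl)
  exact funext fun i => OInt.ext ((h1 i).trans (map_zero _).symm)

/-- The decomposition of `𝒪_{K'}` as the direct sum of the `𝒪_K π' ^ i`. -/
def combineEquiv : (Fin (Module.finrank K K') → OInt p K) ≃ₗ[ℤ_[p]] OInt p K' :=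
  LinearEquiv.ofBijective T.combine ⟨T.combine_injective, T.combine_surjective⟩

/-! ### The character `h` with values in `𝒪_K` -/

/-- The group acts trivially on the Witt vectors, so h(g) is a fixed element and Galois theory
places it in K. -/
theorem exists_intIncl_eq_h (g : Gal(K'/K)) :
    ∃ y : OInt p K, intIncl p K K' y = (T.h g : OInt p K') := by
  have := T.isGalois
  have hfix : algebraMap (OInt p K') K' (T.h g) ∈ (⊥ : IntermediateField K K') := by
    rw [IsGalois.mem_bot_iff_fixed]
    intro f
    rw [← galAct_coe, T.galAct_witt]
  obtain ⟨y, hy⟩ := IntermediateField.mem_bot.1 hfix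
  have hyi : IsIntegral ℤ_[p] y := by
    rw [← isIntegral_algebraMap_iff (A := K) (B := K') (algebraMap K K').injective, hy]
    exact (T.h g : OInt p K').2
  exact ⟨OInt.mk y hyi, OInt.ext hy⟩

theorem coe_h_mul (g g' : Gal(K'/K)) : (T.h (g * g') : OInt p K') = T.h g * T.h g' := by
  apply mul_right_cancel₀ T.ne_zero
  rw [T.h_mul, mul_right_comm, T.h_mul, mul_comm]
  have : galAct p (g * g') T.π' = galAct p g (galAct p g' T.π') := rfl
  rw [this, ← T.h_mul, map_mul, T.galAct_witt]

theorem coe_h_one : (T.h 1 : OInt p K') = 1 := by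
  apply mul_right_cancel₀ T.ne_zero
  rw [T.h_mul, one_mul]
  rfl

/-- The character `h : Gal(K'/K) → W(k)ˣ ⊆ 𝒪_Kˣ`. -/
def hU : Gal(K'/K) →* (OInt p K)ˣ :=
  MonoidHom.toHomUnits
    { toFun := fun g => (T.exists_intIncl_eq_h g).choose
      map_one' := intIncl_injective (by
        rw [(T.exists_intIncl_eq_h 1).choose_spec, coe_h_one, map_one])
      map_mul' := fun g g' => intIncl_injective (by
        rw [(T.exists_intIncl_eq_h (g * g')).choose_spec, coe_h_mul, map_mul,
          (T.exists_intIncl_eq_h g).choose_spec, (T.exists_intIncl_eq_h g').choose_spec]) }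

theorem intIncl_hU (g : Gal(K'/K)) : intIncl p K K' (T.hU g : OInt p K) = T.h g :=
  (T.exists_intIncl_eq_h g).choose_spec

theorem galAct_π' (g : Gal(K'/K)) : galAct p g T.π' = intIncl p K K' (T.hU g) * T.π' := by
  rw [intIncl_hU, h_mul]

/-- An automorphism that fixes π' fixes 𝒪_K and all powers of π', hence 𝒪_{K'} and its fraction
field. -/
theorem hU_injective : Function.Injective T.hU := by
  rw [injective_iff_map_eq_one]
  intro g hg
  have h1 : galAct p g T.π' = T.π' := by rw [galAct_π', hg, Units.val_one, map_one, one_mul]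
  have h2 : ∀ z, galAct p g z = z := by
    intro z
    obtain ⟨c, rfl⟩ := T.combine_surjective z
    simp only [combine_apply, map_sum, map_mul, map_pow, galAct_intIncl, h1]
  refine AlgEquiv.ext fun z => ?_
  have := IsIntegralClosure.isFractionRing_of_finite_extension ℤ_[p] ℚ_[p] K' (OInt p K')
  obtain ⟨a, b, hb, rfl⟩ := IsFractionRing.div_surjective (A := OInt p K') z
  rw [map_div₀, ← galAct_coe, ← galAct_coe, h2, h2]
  rfl

include T in
theorem natCard_gal : Nat.card Gal(K'/K) = Module.finrank K K' := by
  have := T.isGalois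
  exact IsGalois.card_aut_eq_finrank K K'

theorem coe_hU_injective : Function.Injective
    ((Units.coeHom (OInt p K)).comp T.hU : Gal(K'/K) →* OInt p K) :=
  Units.val_injective.comp T.hU_injective

include T in
-- A finite group that embeds into a domain multiplicatively is cyclic. Cyclicity is what makes
-- every character a twist of a given one by a power of σ ∘ h.
theorem isCyclic_gal : IsCyclic Gal(K'/K) := isCyclic_of_injective_ringHom _ T.coe_hU_injective

theorem hU_pow_finrank (g : Gal(K'/K)) : (T.hU g : OInt p K) ^ Module.finrank K K' = 1 := by
  rw [← Units.val_pow_eq_pow_val, ← map_pow, ← T.natCard_gal, pow_card_eq_one', map_one,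
    Units.val_one]

/-- This and `sum_hU_pow_eq_zero` are the two orthogonality relations for the faithful character h,
summed over exponents and over the group. They make all the projectors below orthogonal and
complete. -/
theorem sum_range_hU_pow (g : Gal(K'/K)) (hg : g ≠ 1) :
    ∑ i ∈ Finset.range (Module.finrank K K'), (T.hU g : OInt p K) ^ i = 0 := by
  have h1 := mul_geom_sum (T.hU g : OInt p K) (Module.finrank K K')
  rw [T.hU_pow_finrank, sub_self, mul_eq_zero] at h1
  refine h1.resolve_left fun h0 => hg ?_
  apply T.coe_hU_injective
  simpa using sub_eq_zero.1 h0

theorem sum_hU_pow_eq_zero {k : ℕ} (hk : ¬Module.finrank K K' ∣ k) :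
    ∑ g : Gal(K'/K), (T.hU g : OInt p K) ^ k = 0 := by
  have := T.isCyclic_gal
  have h1 := sum_hom_units_eq_zero (((Units.coeHom (OInt p K)).comp T.hU) ^ k) (by
    intro h0
    obtain ⟨g, hg⟩ := IsCyclic.exists_generator (α := Gal(K'/K))
    have h2 : T.hU (g ^ k) = T.hU 1 := by
      ext1
      have := DFunLike.congr_fun h0 g
      simpa using this
    have h3 := orderOf_dvd_of_pow_eq_one (T.hU_injective h2)
    rw [orderOf_eq_card_of_forall_mem_zpowers hg, T.natCard_gal] at h3
    exact hk h3)
  simpa using h1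

end TameTotRam
end TotallyRamified

section Idempotents

set_option linter.unusedSectionVars false

variable {p : ℕ} [Fact p.Prime]
  {K K' E : Type u} [Field K] [Field K'] [Field E]
  [Algebra ℚ_[p] K] [Algebra ℤ_[p] K] [IsScalarTower ℤ_[p] ℚ_[p] K]
  [Algebra ℚ_[p] K'] [Algebra ℤ_[p] K'] [IsScalarTower ℤ_[p] ℚ_[p] K']
  [Algebra ℚ_[p] E] [Algebra ℤ_[p] E] [IsScalarTower ℤ_[p] ℚ_[p] E]
  [Algebra K K'] [IsScalarTower ℚ_[p] K K'] [IsScalarTower ℤ_[p] K K']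
  [FiniteDimensional K K'] [FiniteDimensional ℚ_[p] K] [FiniteDimensional ℚ_[p] K']
  [FiniteDimensional ℚ_[p] E]

namespace TameTotRam

variable (T : TameTotRam p K K')

/-! ### Roots of unity -/

/-- The residue ring is finite over ℤ_p and killed by p. Without finiteness, the cardinality `q`
would be the default value 0. -/
instance finite_residue : Finite (OInt p K' ⧸ Ideal.span {T.π'}) := by
  have hk : (algebraMap ℤ_[p] (OInt p K' ⧸ Ideal.span {T.π'})) p = 0 := by
    rw [map_natCast, ← map_natCast (Ideal.Quotient.mk (Ideal.span {T.π'})),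
      Ideal.Quotient.eq_zero_iff_mem]
    exact T.p_mem
  have hfin : Module.Finite ℤ_[p] (OInt p K' ⧸ Ideal.span {T.π'}) := inferInstance
  let I := Ideal.span {(p : ℤ_[p])}
  have hI : ∀ a ∈ I, ∀ x : OInt p K' ⧸ Ideal.span {T.π'}, a • x = 0 := by
    intro a ha x
    obtain ⟨b, rfl⟩ := Ideal.mem_span_singleton.1 ha
    rw [Algebra.smul_def, map_mul, hk, zero_mul, zero_mul]
  let _ : Module (ℤ_[p] ⧸ I) (OInt p K' ⧸ Ideal.span {T.π'}) :=
    Module.IsTorsionBySet.module (I := I) fun x a => hI a a.2 x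
  have : IsScalarTower ℤ_[p] (ℤ_[p] ⧸ I) (OInt p K' ⧸ Ideal.span {T.π'}) :=
    ⟨fun a b x => by
      obtain ⟨b, rfl⟩ := Ideal.Quotient.mk_surjective b
      exact mul_smul a b x⟩
  have : Module.Finite (ℤ_[p] ⧸ I) (OInt p K' ⧸ Ideal.span {T.π'}) :=
    Module.Finite.of_restrictScalars_finite ℤ_[p] _ _
  have : Finite (ℤ_[p] ⧸ I) := by
    have e : ℤ_[p] ⧸ I ≃+* IsLocalRing.ResidueField ℤ_[p] :=
      Ideal.quotEquivOfEq PadicInt.maximalIdeal_eq_span_p.symm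
    have : Finite (IsLocalRing.ResidueField ℤ_[p]) :=
      Finite.of_equiv _ PadicInt.residueField.symm.toEquiv
    exact Finite.of_equiv _ e.symm.toEquiv
  exact Module.finite_of_finite (ℤ_[p] ⧸ I)

theorem one_lt_q : 1 < T.q := by
  have := T.isMaximal
  have : Nontrivial (OInt p K' ⧸ Ideal.span {T.π'}) := Ideal.Quotient.nontrivial_iff.2 T.isMaximal.ne_top
  exact Finite.one_lt_card

theorem natCast_q_mem : (T.q : OInt p K') ∈ Ideal.span {T.π'} := by
  rw [← Ideal.Quotient.eq_zero_iff_mem, map_natCast]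
  have h := card_nsmul_eq_zero' (x := (1 : OInt p K' ⧸ Ideal.span {T.π'}))
  rwa [nsmul_one] at h

theorem coprime_q_sub_one : p.Coprime (T.q - 1) := by
  rw [(Fact.out : p.Prime).coprime_iff_not_dvd]
  rintro ⟨c, hc⟩
  have h1 : ((T.q - 1 : ℕ) : OInt p K') ∈ Ideal.span {T.π'} := by
    rw [hc, Nat.cast_mul]
    exact Ideal.mul_mem_right _ _ T.p_mem
  rw [Nat.cast_sub T.one_lt_q.le, Nat.cast_one] at h1
  have h2 := Ideal.sub_mem _ T.natCast_q_mem h1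
  rw [sub_sub_cancel] at h2
  exact T.isMaximal.ne_top ((Ideal.eq_top_iff_one _).2 h2)

/-- Raising to a high power of p turns a congruence modulo π' into one modulo p, the ideal for which
completeness is known. -/
theorem exists_pow_sub_one_mem {a : OInt p K'} (ha : a - 1 ∈ Ideal.span {T.π'}) :
    ∃ k : ℕ, a ^ p ^ k - 1 ∈ Ideal.span {(p : OInt p K')} := by
  obtain ⟨N, hN⟩ := T.exists_pow_π'_mem
  obtain ⟨c, hc⟩ := Ideal.mem_span_singleton.1 ha
  obtain ⟨r, hr⟩ := exists_add_pow_prime_pow_eq (Fact.out : p.Prime) (a - 1) 1 N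
  have hNp : N ≤ p ^ N := (Nat.lt_pow_self (Fact.out : p.Prime).one_lt).le
  refine ⟨N, ?_⟩
  rw [sub_add_cancel, one_pow] at hr
  have h1 : (a - 1) ^ p ^ N ∈ Ideal.span {(p : OInt p K')} := by
    rw [hc, mul_pow, ← Nat.add_sub_cancel' hNp, pow_add, mul_assoc]
    exact Ideal.mul_mem_right _ _ hN
  have h2 : a ^ p ^ N - 1 = (a - 1) ^ p ^ N + p * ((a - 1) * 1 * r) := by rw [hr]; ring
  rw [h2]
  exact Ideal.add_mem _ h1 (Ideal.mul_mem_right _ _ (Ideal.mem_span_singleton_self _))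

theorem exists_isPrimitiveRoot : ∃ ζ : OInt p K', IsPrimitiveRoot ζ (T.q - 1) := by
  have := T.isMaximal
  have hq : T.q - 1 ≠ 0 := Nat.sub_ne_zero_of_lt T.one_lt_q
  let k := OInt p K' ⧸ Ideal.span {T.π'}
  let _ : Field k := Ideal.Quotient.field (Ideal.span {T.π'})
  have : Finite k := T.finite_residue
  have hcard : Nat.card kˣ = T.q - 1 := by
    rw [Nat.card_units, q]
  obtain ⟨u, hu⟩ := IsCyclic.exists_generator (α := kˣ)
  have hprim : IsPrimitiveRoot (u : k) (T.q - 1) := by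
    rw [IsPrimitiveRoot.coe_units_iff, ← hcard, ← orderOf_eq_card_of_forall_mem_zpowers hu]
    exact IsPrimitiveRoot.orderOf u
  obtain ⟨a, ha⟩ := Ideal.Quotient.mk_surjective (u : k)
  have ha1 : a ^ (T.q - 1) - 1 ∈ Ideal.span {T.π'} := by
    rw [← Ideal.Quotient.eq_zero_iff_mem, map_sub, map_pow, ha, hprim.pow_eq_one, map_one, sub_self]
  -- A lift a of a generator of the residue units solves X^(q-1) = 1 only modulo π'. Its power with
  -- exponent p^j solves it modulo p, where Hensel's lemma applies.
  obtain ⟨j, hj⟩ := T.exists_pow_sub_one_mem ha1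
  rw [← pow_mul, mul_comm, pow_mul] at hj
  -- This makes the derivative (q-1) X^(q-2) a unit at the approximate root.
  have hN : IsUnit ((T.q - 1 : ℕ) : OInt p K') := by
    by_contra hc
    have h1 := Nat.isCoprime_iff_coprime.2 T.coprime_q_sub_one
    have h2 := h1.map (Int.castRingHom (OInt p K'))
    obtain ⟨x, y, hxy⟩ := h2
    simp only [eq_intCast, Int.cast_natCast] at hxy
    have := IsLocalRing.nonunits_add (a := x * (p : OInt p K')) (b := y * ((T.q - 1 : ℕ) : OInt p K'))
      (fun h => OInt.not_isUnit_p p K' (isUnit_of_mul_isUnit_right h))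
      (fun h => hc (isUnit_of_mul_isUnit_right h))
    rw [hxy] at this
    exact this isUnit_one
  obtain ⟨ζ, hζ, hζa⟩ := HenselianRing.is_henselian (I := Ideal.span {(p : OInt p K')})
    (Polynomial.X ^ (T.q - 1) - 1) (by
      simpa using Polynomial.monic_X_pow_sub_C (1 : OInt p K') hq) (a ^ p ^ j) (by simpa using hj) (by
      simp only [Polynomial.derivative_sub, Polynomial.derivative_X_pow, Polynomial.derivative_one,
        sub_zero, Polynomial.eval_mul, Polynomial.eval_pow, Polynomial.eval_X]
      rw [map_mul]
      refine IsUnit.mul ?_ ?_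
      · simpa using hN.map (Ideal.Quotient.mk (Ideal.span {(p : OInt p K')}))
      · rw [map_pow]
        refine IsUnit.pow _ (IsUnit.of_pow_eq_one (n := T.q - 1) ?_ hq)
        rw [← map_pow, ← sub_eq_zero, ← map_one (Ideal.Quotient.mk _), ← map_sub,
          Ideal.Quotient.eq_zero_iff_mem]
        exact hj)
  have hζ1 : ζ ^ (T.q - 1) = 1 := by
    simpa [Polynomial.IsRoot, sub_eq_zero] using hζ
  have hle : Ideal.span {(p : OInt p K')} ≤ Ideal.span {T.π'} := by
    rw [Ideal.span_singleton_le_iff_mem]; exact T.p_mem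
  have hmk : Ideal.Quotient.mk (Ideal.span {T.π'}) ζ = (u : k) ^ p ^ j := by
    rw [← ha, ← map_pow]
    exact Ideal.Quotient.eq.2 (hle hζa)
  -- Since p is prime to q-1, the residue of the root is still of exact order q-1, and so is the
  -- root itself.
  have hp2 := hprim.pow_of_coprime (p ^ j) (Nat.Coprime.pow_left j T.coprime_q_sub_one)
  rw [← hmk] at hp2
  exact ⟨ζ, hζ1, fun l hl => hp2.dvd_of_pow_eq_one l (by rw [← map_pow, hl, map_one])⟩

theorem exists_isPrimitiveRoot_witt : ∃ ω : Witt p K', IsPrimitiveRoot ω (T.q - 1) := by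
  obtain ⟨ζ, hζ⟩ := T.exists_isPrimitiveRoot
  refine ⟨⟨ζ, Algebra.subset_adjoin ⟨_, T.coprime_q_sub_one, hζ.pow_eq_one⟩⟩, ?_⟩
  exact IsPrimitiveRoot.of_map_of_injective (f := (Witt p K').val) hζ Subtype.val_injective

/-- A homomorphism of domains which are flat over `ℤ_p` is injective on roots of unity. -/
theorem isPrimitiveRoot_map {R R' : Type*} [CommRing R] [IsDomain R] [CommRing R'] [IsDomain R']
    [CharZero R'] (f : R →+* R') {ω : R} {m : ℕ} (hm : 0 < m) (h : IsPrimitiveRoot ω m) :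
    IsPrimitiveRoot (f ω) m := by
  refine IsPrimitiveRoot.mk_of_lt _ hm (by rw [← map_pow, h.pow_eq_one, map_one]) fun l hl0 hl h1 => ?_
  have h2 : ω ^ l ≠ 1 := h.pow_ne_one_of_pos_of_lt hl0.ne' hl
  -- If f(ω)^l = 1 with ω^l ≠ 1, the geometric sum of ω^l vanishes in R, while its image is m ≠ 0 in
  -- R'.
  have h3 := mul_geom_sum (ω ^ l) m
  rw [← pow_mul, mul_comm l, pow_mul, h.pow_eq_one, one_pow, sub_self, mul_eq_zero] at h3
  have h4 := congrArg f (h3.resolve_left (sub_ne_zero.2 h2))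
  rw [map_sum, map_zero] at h4
  simp only [map_pow, h1, one_pow, Finset.sum_const, Finset.card_range, nsmul_eq_mul, mul_one] at h4
  exact hm.ne' (Nat.cast_eq_zero.1 h4)

end TameTotRam
end Idempotents

/-! ### The idempotents e_σ add up to 1 -/

section IdempotentDecomposition

set_option linter.unusedSectionVars false

variable {p : ℕ} [Fact p.Prime]
  {K K' E : Type u} [Field K] [Field K'] [Field E]
  [Algebra ℚ_[p] K] [Algebra ℤ_[p] K] [IsScalarTower ℤ_[p] ℚ_[p] K]
  [Algebra ℚ_[p] K'] [Algebra ℤ_[p] K'] [IsScalarTower ℤ_[p] ℚ_[p] K']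
  [Algebra ℚ_[p] E] [Algebra ℤ_[p] E] [IsScalarTower ℤ_[p] ℚ_[p] E]
  [Algebra K K'] [IsScalarTower ℚ_[p] K K'] [IsScalarTower ℤ_[p] K K']
  [FiniteDimensional K K'] [FiniteDimensional ℚ_[p] K] [FiniteDimensional ℚ_[p] K']
  [FiniteDimensional ℚ_[p] E]

theorem OInt.tmul_one_mul_eq_zero {r : OInt p E} {F : Type u} [Field F] [Algebra ℚ_[p] F]
    [Algebra ℤ_[p] F] [IsScalarTower ℤ_[p] ℚ_[p] F] [FiniteDimensional ℚ_[p] F]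
    {z : OInt p E ⊗[ℤ_[p]] OInt p F} (h : (r ⊗ₜ[ℤ_[p]] (1 : OInt p F)) * z = 0) :
    r = 0 ∨ z = 0 := by
  have h1 : r • z = 0 := by
    rw [← h, Algebra.smul_def]
    rfl
  exact smul_eq_zero.1 h1

instance OInt.instCharZero : CharZero (OInt p E) :=
  charZero_of_injective_algebraMap (OInt.algebraMap_padicInt_injective E)

namespace TameTotRam

variable (T : TameTotRam p K K')

include T in
-- An embedding into the algebraic closure exists and by hypothesis lands in E. Everything later
-- uses the hypothesis on E only through this.
theorem exists_algHom (hE : ∀ (ψ : K' →ₐ[ℚ_[p]] AlgebraicClosure E) (x : K'),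
    ψ x ∈ (algebraMap E (AlgebraicClosure E)).range) : Nonempty (K' →ₐ[ℚ_[p]] E) := by
  let ψ : K' →ₐ[ℚ_[p]] AlgebraicClosure E := IsAlgClosed.lift
  let j := IsScalarTower.toAlgHom ℚ_[p] E (AlgebraicClosure E)
  have hj : Function.Injective j := (algebraMap E (AlgebraicClosure E)).injective
  exact ⟨(AlgEquiv.ofInjective j hj).symm.toAlgHom.comp (ψ.codRestrict j.range fun x => hE ψ x)⟩

theorem isUnit_natCast_q_sub_one : IsUnit ((T.q - 1 : ℕ) : OInt p E) := by
  have h : IsUnit ((T.q - 1 : ℕ) : ℤ_[p]) := by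
    rw [PadicInt.isUnit_iff, PadicInt.norm_natCast_eq_one_iff]
    exact T.coprime_q_sub_one
  simpa using h.map (algebraMap ℤ_[p] (OInt p E))

/-- The element `(q - 1)⁻¹ ∑_k α ^ k ⊗ ω ^ k`. -/
def rootIdem (ω : Witt p K') (α : OInt p E) : OInt p E ⊗[ℤ_[p]] OInt p K' :=
  (Ring.inverse ((T.q - 1 : ℕ) : OInt p E)) ⊗ₜ[ℤ_[p]] 1 *
    ∑ k ∈ Finset.range (T.q - 1), (α ⊗ₜ[ℤ_[p]] (ω : OInt p K')) ^ k

variable {T}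

/-- The element α ⊗ ω has order dividing q-1, so it fixes its own geometric sum. Thus 1 ⊗ ω acts on
`rootIdem` as α⁻¹, and a nonzero `rootIdem` is an eigenvector of ω. -/
theorem rootIdem_mul {ω : Witt p K'} (hω : IsPrimitiveRoot ω (T.q - 1)) {α : OInt p E}
    (hα : α ^ (T.q - 1) = 1) :
    (α ⊗ₜ[ℤ_[p]] (ω : OInt p K')) * T.rootIdem ω α = T.rootIdem ω α := by
  have h1 : (α ⊗ₜ[ℤ_[p]] (ω : OInt p K')) ^ (T.q - 1) = 1 := by
    rw [Algebra.TensorProduct.tmul_pow, hα]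
    have : (ω : OInt p K') ^ (T.q - 1) = 1 := congrArg Subtype.val hω.pow_eq_one
    rw [this]
    rfl
  have h2 := mul_geom_sum (α ⊗ₜ[ℤ_[p]] (ω : OInt p K')) (T.q - 1)
  rw [h1, sub_self, sub_mul, one_mul, sub_eq_zero] at h2
  rw [rootIdem, mul_left_comm, h2]

/-- After exchanging the two sums, the sum over j of ζ^(jk) vanishes except for k = 0. -/
theorem sum_rootIdem {ω : Witt p K'} {ζ : OInt p E} (hζ : IsPrimitiveRoot ζ (T.q - 1)) :
    ∑ j ∈ Finset.range (T.q - 1), T.rootIdem ω (ζ ^ j) = 1 := by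
  have hq : 0 < T.q - 1 := Nat.sub_pos_of_lt T.one_lt_q
  simp only [rootIdem]
  rw [← Finset.mul_sum, Finset.sum_comm, Finset.sum_eq_single 0]
  · simp only [pow_zero, Finset.sum_const, Finset.card_range, nsmul_eq_mul, mul_one]
    have : ((T.q - 1 : ℕ) : OInt p E ⊗[ℤ_[p]] OInt p K') =
        ((T.q - 1 : ℕ) : OInt p E) ⊗ₜ 1 := by
      rw [← map_natCast (algebraMap (OInt p E) (OInt p E ⊗[ℤ_[p]] OInt p K'))]
      rfl
    rw [this, Algebra.TensorProduct.tmul_mul_tmul,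
      Ring.inverse_mul_cancel _ T.isUnit_natCast_q_sub_one, one_mul]
    rfl
  · intro k hk hk0
    have h1 : ζ ^ k ≠ 1 := hζ.pow_ne_one_of_pos_of_lt hk0 (Finset.mem_range.1 hk)
    have h2 := mul_geom_sum (ζ ^ k) (T.q - 1)
    rw [← pow_mul, mul_comm k, pow_mul, hζ.pow_eq_one, one_pow, sub_self, mul_eq_zero] at h2
    have h3 := h2.resolve_left (sub_ne_zero.2 h1)
    simp only [Algebra.TensorProduct.tmul_pow, ← TensorProduct.sum_tmul]
    have : ∑ j ∈ Finset.range (T.q - 1), (ζ ^ j) ^ k = 0 := by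
      rw [← h3]
      exact Finset.sum_congr rfl fun j _ => by rw [← pow_mul, ← pow_mul, mul_comm]
    rw [this, TensorProduct.zero_tmul]
  · intro h
    exact absurd (Finset.mem_range.2 hq) h

/-- All roots of unity of order prime to p are powers of ω, so the generators of the Witt vectors
act by scalars of 𝒪, and this property passes to sums and products. -/
theorem exists_tmul_one_mul_rootIdem {ω : Witt p K'} (hω : IsPrimitiveRoot ω (T.q - 1))
    {α : OInt p E} (hα : α ^ (T.q - 1) = 1) (x : Witt p K') :
    ∃ y : OInt p E, (1 ⊗ₜ[ℤ_[p]] (x : OInt p K')) * T.rootIdem ω α =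
      (y ⊗ₜ[ℤ_[p]] 1) * T.rootIdem ω α := by
  have hq : 0 < T.q - 1 := Nat.sub_pos_of_lt T.one_lt_q
  have : NeZero (T.q - 1) := ⟨hq.ne'⟩
  obtain ⟨x, hx⟩ := x
  refine Algebra.adjoin_induction (p := fun x _ => ∃ y : OInt p E,
    (1 ⊗ₜ[ℤ_[p]] x) * T.rootIdem ω α = (y ⊗ₜ[ℤ_[p]] 1) * T.rootIdem ω α) ?_ ?_ ?_ ?_ hx
  · rintro ζ ⟨m, hm, hζ⟩
    obtain ⟨k, -, hk⟩ := hω.eq_pow_of_pow_eq_one (ξ := ⟨ζ, Algebra.subset_adjoin ⟨m, hm, hζ⟩⟩)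
      (Subtype.ext (T.pow_q_sub_one hm hζ))
    have hk' : ζ = (ω : OInt p K') ^ k := (congrArg Subtype.val hk).symm
    refine ⟨(α ^ (T.q - 1 - 1)) ^ k, ?_⟩
    have h1 : ∀ k : ℕ, (α ⊗ₜ[ℤ_[p]] (ω : OInt p K')) ^ k * T.rootIdem ω α = T.rootIdem ω α := by
      intro k
      induction k with
      | zero => simp
      | succ k ih => rw [pow_succ, mul_assoc, rootIdem_mul hω hα, ih]
    conv_rhs => rw [← h1 k]
    rw [hk', ← mul_assoc, Algebra.TensorProduct.tmul_pow, Algebra.TensorProduct.tmul_mul_tmul,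
      ← mul_pow, pow_sub_one_mul hq.ne', hα, one_pow, one_mul]
  · intro r
    refine ⟨algebraMap _ _ r, ?_⟩
    rw [Algebra.algebraMap_eq_smul_one, Algebra.algebraMap_eq_smul_one, TensorProduct.smul_tmul]
  · rintro x y - - ⟨a, ha⟩ ⟨b, hb⟩
    exact ⟨a + b, by rw [TensorProduct.tmul_add, TensorProduct.add_tmul, add_mul, add_mul, ha, hb]⟩
  · rintro x y - - ⟨a, ha⟩ ⟨b, hb⟩
    refine ⟨a * b, ?_⟩
    have e1 : (1 : OInt p E) ⊗ₜ[ℤ_[p]] (x * y) = (1 ⊗ₜ x) * (1 ⊗ₜ y) := by simp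
    have e2 : (a * b) ⊗ₜ[ℤ_[p]] (1 : OInt p K') = (b ⊗ₜ 1) * (a ⊗ₜ 1) := by simp [mul_comm]
    rw [e1, mul_assoc, hb, mul_left_comm, ha, ← mul_assoc, e2]

/-- As 𝒪 ⊗ 𝒪_{K'} is torsion-free over 𝒪, the scalar through which a Witt vector acts on a nonzero
element is unique. Uniqueness makes the scalar a ring homomorphism in the Witt vector, which is the
required σ. -/
theorem exists_emb_of_rootIdem_ne_zero {ω : Witt p K'} (hω : IsPrimitiveRoot ω (T.q - 1))
    {α : OInt p E} (hα : α ^ (T.q - 1) = 1) (h0 : T.rootIdem ω α ≠ 0) :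
    ∃ σ : Emb p K' E, σ ω * α = 1 := by
  have huniq : ∀ y y' : OInt p E, (y ⊗ₜ[ℤ_[p]] 1) * T.rootIdem ω α =
      (y' ⊗ₜ[ℤ_[p]] 1) * T.rootIdem ω α → y = y' := by
    intro y y' h
    rw [← sub_eq_zero, ← sub_mul, ← TensorProduct.sub_tmul] at h
    exact sub_eq_zero.1 ((OInt.tmul_one_mul_eq_zero h).resolve_right h0)
  choose s hs using exists_tmul_one_mul_rootIdem hω hα
  have hmul : ∀ x y, s (x * y) = s x * s y := fun x y => by
    apply huniq
    have e1 : (1 : OInt p E) ⊗ₜ[ℤ_[p]] ((x * y : Witt p K') : OInt p K') =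
      (1 ⊗ₜ (x : OInt p K')) * (1 ⊗ₜ (y : OInt p K')) := by simp
    have e2 : (s x * s y) ⊗ₜ[ℤ_[p]] (1 : OInt p K') = (s y ⊗ₜ 1) * (s x ⊗ₜ 1) := by
      simp [mul_comm]
    rw [← hs, e1, mul_assoc, hs, mul_left_comm, hs, ← mul_assoc, e2]
  have hadd : ∀ x y, s (x + y) = s x + s y := fun x y => by
    apply huniq
    rw [← hs, TensorProduct.add_tmul, add_mul, ← hs, ← hs, ← add_mul, ← TensorProduct.tmul_add]
    rfl
  have halg : ∀ r : ℤ_[p], s (algebraMap _ _ r) = algebraMap _ _ r := fun r => by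
    apply huniq
    rw [← hs]
    have : ((algebraMap ℤ_[p] (Witt p K') r : Witt p K') : OInt p K') = algebraMap _ _ r := rfl
    rw [this, Algebra.algebraMap_eq_smul_one, Algebra.algebraMap_eq_smul_one,
      TensorProduct.smul_tmul]
  let σ : Emb p K' E :=
    { toFun := s
      map_one' := by simpa using halg 1
      map_mul' := hmul
      map_zero' := by simpa using halg 0
      map_add' := hadd
      commutes' := halg }
  refine ⟨σ, huniq _ _ ?_⟩
  have e2 : (σ ω * α) ⊗ₜ[ℤ_[p]] (1 : OInt p K') = (α ⊗ₜ 1) * (s ω ⊗ₜ 1) := by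
    rw [mul_comm]; simp [σ]
  rw [e2, mul_assoc, ← hs, ← mul_assoc, Algebra.TensorProduct.tmul_mul_tmul, mul_one, one_mul,
    rootIdem_mul hω hα]
  exact (one_mul _).symm

theorem idem_eq_rootIdem {ω : Witt p K'} (hω : IsPrimitiveRoot ω (T.q - 1)) {α : OInt p E}
    (σ : Emb p K' E) (hσ : σ ω * α = 1) : T.idem σ = T.rootIdem ω α := by
  have hq : 0 < T.q - 1 := Nat.sub_pos_of_lt T.one_lt_q
  have : NeZero (T.q - 1) := ⟨hq.ne'⟩
  rw [idem, rootIdem]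
  congr 1
  symm
  refine Finset.sum_bij (fun k _ => ω ^ k) ?_ ?_ ?_ ?_
  · intro k _
    rw [Polynomial.mem_nthRootsFinset hq, ← pow_mul, mul_comm, pow_mul, hω.pow_eq_one, one_pow]
  · intro a ha b hb hab
    exact hω.pow_inj (Finset.mem_range.1 ha) (Finset.mem_range.1 hb) hab
  · intro ζ hζ
    obtain ⟨k, hk, h⟩ := hω.eq_pow_of_pow_eq_one ((Polynomial.mem_nthRootsFinset hq _).1 hζ)
    exact ⟨k, Finset.mem_range.2 hk, h⟩
  · intro k _
    have h1 : σ (ω ^ k) * α ^ k = 1 := by rw [map_pow, ← mul_pow, hσ, one_pow]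
    have h2 : Ring.inverse (σ (ω ^ k)) = α ^ k := by
      rw [← mul_one (Ring.inverse _), ← h1, ← mul_assoc,
        Ring.inverse_mul_cancel _ (IsUnit.of_mul_eq_one _ h1), one_mul]
    rw [Algebra.TensorProduct.tmul_pow, h2]
    rfl

variable (T)

variable {T} in
theorem emb_ext {ω : Witt p K'} (hω : IsPrimitiveRoot ω (T.q - 1)) {σ σ' : Emb p K' E}
    (h : σ ω = σ' ω) : σ = σ' := by
  have hq : 0 < T.q - 1 := Nat.sub_pos_of_lt T.one_lt_q
  have : NeZero (T.q - 1) := ⟨hq.ne'⟩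
  refine AlgHom.ext fun x => ?_
  obtain ⟨x, hx⟩ := x
  refine Algebra.adjoin_induction (p := fun x hx => σ ⟨x, hx⟩ = σ' ⟨x, hx⟩) ?_ ?_ ?_ ?_ hx
  · rintro ζ ⟨m, hm, hζ⟩
    obtain ⟨k, -, hk⟩ := hω.eq_pow_of_pow_eq_one (ξ := ⟨ζ, Algebra.subset_adjoin ⟨m, hm, hζ⟩⟩)
      (Subtype.ext (T.pow_q_sub_one hm hζ))
    rw [← hk, map_pow, map_pow, h]
  · intro r
    exact (σ.commutes r).trans (σ'.commutes r).symm
  · intro x y hx hy h1 h2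
    have : (⟨x + y, add_mem hx hy⟩ : Witt p K') = ⟨x, hx⟩ + ⟨y, hy⟩ := rfl
    rw [this, map_add, map_add, h1, h2]
  · intro x y hx hy h1 h2
    have : (⟨x * y, mul_mem hx hy⟩ : Witt p K') = ⟨x, hx⟩ * ⟨y, hy⟩ := rfl
    rw [this, map_mul, map_mul, h1, h2]

include T in
theorem finite_emb : Finite (Emb p K' E) := by
  obtain ⟨ω, hω⟩ := T.exists_isPrimitiveRoot_witt
  have hq : 0 < T.q - 1 := Nat.sub_pos_of_lt T.one_lt_q
  refine Finite.of_injective (β := Polynomial.nthRootsFinset (T.q - 1) (1 : OInt p E))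
    (fun σ => ⟨σ ω, ?_⟩) fun σ σ' h => emb_ext hω (congrArg Subtype.val h)
  rw [Polynomial.mem_nthRootsFinset hq, ← map_pow, hω.pow_eq_one, map_one]

/-- The elements `rootIdem` for all (q-1)-st roots of unity α add up to 1. Those which come from an
embedding are the e_σ, and all others are zero. -/
theorem sum_idem [Fintype (Emb p K' E)] (hE : Nonempty (K' →ₐ[ℚ_[p]] E)) :
    ∑ σ : Emb p K' E, T.idem σ = 1 := by
  classical
  obtain ⟨ι⟩ := hE
  obtain ⟨ω, hω⟩ := T.exists_isPrimitiveRoot_witt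
  have hq : 0 < T.q - 1 := Nat.sub_pos_of_lt T.one_lt_q
  have : NeZero (T.q - 1) := ⟨hq.ne'⟩
  -- The embedding of K' into E supplies a primitive (q-1)-st root of unity in 𝒪.
  have hζ : IsPrimitiveRoot (OInt.map (ι.restrictScalars ℤ_[p]) (ω : OInt p K')) (T.q - 1) :=
    isPrimitiveRoot_map ((OInt.map (ι.restrictScalars ℤ_[p])).comp (Witt p K').val).toRingHom
      hq hω
  set ζ := OInt.map (ι.restrictScalars ℤ_[p]) (ω : OInt p K')
  have hJ : ∀ σ : Emb p K' E, ∃ j < T.q - 1, σ ω * ζ ^ j = 1 := by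
    intro σ
    obtain ⟨j, hj, h⟩ := hζ.eq_pow_of_pow_eq_one (ξ := σ ω ^ (T.q - 1 - 1)) (by
      rw [← pow_mul, mul_comm, pow_mul, ← map_pow, hω.pow_eq_one, map_one, one_pow])
    exact ⟨j, hj, by rw [h, mul_pow_sub_one hq.ne', ← map_pow, hω.pow_eq_one, map_one]⟩
  choose J hJlt hJ using hJ
  have hinj : Function.Injective J := by
    intro σ σ' h
    refine emb_ext hω ?_
    have h1 := hJ σ
    rw [h] at h1
    exact left_inv_eq_right_inv h1 (by rw [mul_comm]; exact hJ σ')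
  rw [← sum_rootIdem (ω := ω) hζ]
  have h1 : ∀ σ, T.idem σ = T.rootIdem ω (ζ ^ J σ) := fun σ => idem_eq_rootIdem hω σ (hJ σ)
  rw [Finset.sum_congr rfl fun σ _ => h1 σ,
    ← Finset.sum_image (f := fun j => T.rootIdem ω (ζ ^ j)) (g := J) (fun a _ b _ h => hinj h)]
  refine Finset.sum_subset ?_ ?_
  · intro j hj
    obtain ⟨σ, -, rfl⟩ := Finset.mem_image.1 hj
    exact Finset.mem_range.2 (hJlt σ)
  · intro j hj hj'
    -- A nonzero term would produce an embedding, hence an index in the image of `J`.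
    by_contra h0
    obtain ⟨σ, hσ⟩ := exists_emb_of_rootIdem_ne_zero hω
      (by rw [← pow_mul, mul_comm, pow_mul, hζ.pow_eq_one, one_pow]) h0
    refine hj' (Finset.mem_image.2 ⟨σ, Finset.mem_univ _, ?_⟩)
    have h2 : ζ ^ J σ = ζ ^ j := by
      have := hJ σ
      rw [mul_comm] at this hσ
      exact left_inv_eq_right_inv this (by rw [mul_comm]; exact hσ)
    exact hζ.pow_inj (hJlt σ) (Finset.mem_range.1 hj) h2

/-! ### Exponents of characters -/

theorem h_eq_one_iff (g : Gal(K'/K)) : T.h g = 1 ↔ g = 1 := by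
  rw [← T.hU_injective.eq_iff, map_one, ← Units.val_inj, ← (intIncl_injective (K' := K')).eq_iff,
    intIncl_hU, Units.val_one, map_one, ← Subtype.val_inj]
  rfl

/-- The character `h` as a homomorphism to `W(k)`. -/
def hHom : Gal(K'/K) →* Witt p K' where
  toFun := T.h
  map_one' := Subtype.ext T.coe_h_one
  map_mul' g g' := Subtype.ext (T.coe_h_mul g g')

theorem hHom_apply (g : Gal(K'/K)) : T.hHom g = T.h g := rfl

theorem h_pow_finrank (g : Gal(K'/K)) : T.h g ^ Module.finrank K K' = 1 := by
  rw [← hHom_apply, ← map_pow, ← T.natCard_gal, pow_card_eq_one', map_one]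

theorem isPrimitiveRoot_h {g : Gal(K'/K)} (hg : ∀ x, x ∈ Subgroup.zpowers g) (σ : Emb p K' E) :
    IsPrimitiveRoot (σ (T.h g)) (Module.finrank K K') := by
  refine isPrimitiveRoot_map σ.toRingHom T.finrank_pos ⟨T.h_pow_finrank g, fun l hl => ?_⟩
  rw [← hHom_apply, ← map_pow, hHom_apply, T.h_eq_one_iff] at hl
  rw [← T.natCard_gal, ← orderOf_eq_card_of_forall_mem_zpowers hg]
  exact orderOf_dvd_of_pow_eq_one hl

/-- At a generator g of the group, (ξ/ξ₀)(g) is an n-th root of unity, hence a power of the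
primitive root σ(h(g)). The exponent 0 is allowed here. -/
theorem exists_exponent (ξ₀ ξ : Gal(K'/K) →* (OInt p E)ˣ) (σ : Emb p K' E) :
    ∃ i < Module.finrank K K', ∀ g, (ξ g : OInt p E) = ξ₀ g * σ (T.h g) ^ i := by
  have := T.isCyclic_gal
  have : NeZero (Module.finrank K K') := ⟨T.finrank_pos.ne'⟩
  obtain ⟨g, hg⟩ := IsCyclic.exists_generator (α := Gal(K'/K))
  obtain ⟨i, hi, h⟩ := (T.isPrimitiveRoot_h hg σ).eq_pow_of_pow_eq_one
    (ξ := (((ξ₀ g)⁻¹ * ξ g : (OInt p E)ˣ) : OInt p E)) (by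
      rw [← Units.val_pow_eq_pow_val, mul_pow, inv_pow, ← map_pow, ← map_pow, ← T.natCard_gal,
        pow_card_eq_one', map_one, map_one, inv_one, one_mul, Units.val_one])
  refine ⟨i, hi, fun x => ?_⟩
  obtain ⟨k, rfl⟩ := (mem_powers_iff_mem_zpowers (x := g) (y := x)).2 (hg x)
  have h1 : (ξ g : OInt p E) = ξ₀ g * σ (T.h g) ^ i := by
    rw [h, ← Units.val_mul, mul_inv_cancel_left]
  simp only [map_pow, Units.val_pow_eq_pow_val, ← hHom_apply]
  rw [hHom_apply, h1, mul_pow, ← pow_mul, ← pow_mul, mul_comm i]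

theorem exponent_unique {ξ₀ ξ : Gal(K'/K) →* (OInt p E)ˣ} {σ : Emb p K' E} {i j : ℕ}
    (hi : i < Module.finrank K K') (hj : j < Module.finrank K K')
    (h : ∀ g, (ξ g : OInt p E) = ξ₀ g * σ (T.h g) ^ i)
    (h' : ∀ g, (ξ g : OInt p E) = ξ₀ g * σ (T.h g) ^ j) : i = j := by
  have := T.isCyclic_gal
  obtain ⟨g, hg⟩ := IsCyclic.exists_generator (α := Gal(K'/K))
  refine (T.isPrimitiveRoot_h hg σ).pow_inj hi hj ?_
  exact (ξ₀ g).isUnit.mul_left_cancel ((h g).symm.trans (h' g))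

end TameTotRam
end IdempotentDecomposition

/-! ### Idempotents of 𝒪 ⊗ 𝒪_K comparing two characters -/

section CharacterIdempotents

set_option linter.unusedSectionVars false

variable {p : ℕ} [Fact p.Prime]
  {K K' E : Type u} [Field K] [Field K'] [Field E]
  [Algebra ℚ_[p] K] [Algebra ℤ_[p] K] [IsScalarTower ℤ_[p] ℚ_[p] K]
  [Algebra ℚ_[p] K'] [Algebra ℤ_[p] K'] [IsScalarTower ℤ_[p] ℚ_[p] K']
  [Algebra ℚ_[p] E] [Algebra ℤ_[p] E] [IsScalarTower ℤ_[p] ℚ_[p] E]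
  [Algebra K K'] [IsScalarTower ℚ_[p] K K'] [IsScalarTower ℤ_[p] K K']
  [FiniteDimensional K K'] [FiniteDimensional ℚ_[p] K] [FiniteDimensional ℚ_[p] K']
  [FiniteDimensional ℚ_[p] E]

namespace TameTotRam

variable (T : TameTotRam p K K')

/-- The idempotent `n⁻¹ ∑_g (ξ₀ / ξ)(g) ⊗ h(g) ^ i` of `𝒪 ⊗ 𝒪_K`, which cuts out the part on which
`ξ = ξ₀ h ^ i`. -/
def wIdem (ξ₀ ξ : Gal(K'/K) →* (OInt p E)ˣ) (i : ℕ) : OInt p E ⊗[ℤ_[p]] OInt p K :=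
  ∑ g : Gal(K'/K), (Ring.inverse (Nat.card Gal(K'/K) : OInt p E) *
    ((ξ₀ g * (ξ g)⁻¹ : (OInt p E)ˣ) : OInt p E)) ⊗ₜ[ℤ_[p]] ((T.hU g : OInt p K) ^ i)

variable (ξ₀ ξ ξ' : Gal(K'/K) →* (OInt p E)ˣ)

/-- The idempotent is the average over g of (ξ₀/ξ)(g) ⊗ h(g)^i, so translating the summation
variable shows that each of these elements acts on it as 1. -/
theorem tmul_mul_wIdem (g : Gal(K'/K)) (i : ℕ) :
    ((ξ g : OInt p E) ⊗ₜ[ℤ_[p]] (1 : OInt p K)) * T.wIdem ξ₀ ξ i =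
      ((ξ₀ g : OInt p E) ⊗ₜ[ℤ_[p]] ((T.hU g : OInt p K) ^ i)) * T.wIdem ξ₀ ξ i := by
  rw [wIdem, Finset.mul_sum, Finset.mul_sum]
  refine Fintype.sum_equiv (Equiv.mulLeft g⁻¹) _ _ fun x => ?_
  rw [Equiv.coe_mulLeft, Algebra.TensorProduct.tmul_mul_tmul, Algebra.TensorProduct.tmul_mul_tmul]
  congr 1
  · rw [mul_left_comm, mul_left_comm (ξ₀ g : OInt p E), ← Units.val_mul, ← Units.val_mul]
    congr 2
    simp only [map_mul, map_inv, mul_inv, inv_inv]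
    have : ∀ a b c d : (OInt p E)ˣ, a * (b * c) = d * (d⁻¹ * b * (a * c)) := fun a b c d => by
      rw [mul_assoc, mul_inv_cancel_left, mul_left_comm]
    exact this _ _ _ _
  · rw [one_mul, ← mul_pow, ← Units.val_mul, ← map_mul, mul_inv_cancel_left]

include T in
theorem inverse_smul_sum_const {M : Type*} [AddCommGroup M] [Module (OInt p E) M] (z : M) :
    ∑ _g : Gal(K'/K), Ring.inverse (Nat.card Gal(K'/K) : OInt p E) • z = z := by
  rw [Finset.sum_const, Finset.card_univ, ← Nat.card_eq_fintype_card,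
    ← Nat.cast_smul_eq_nsmul (OInt p E), smul_smul, LocDatum.natCard_gal_mul_inverse T, one_smul]

theorem tmul_mul_wIdem' (g : Gal(K'/K)) (i : ℕ) :
    (((ξ₀ g * (ξ g)⁻¹ : (OInt p E)ˣ) : OInt p E) ⊗ₜ[ℤ_[p]] ((T.hU g : OInt p K) ^ i)) *
      T.wIdem ξ₀ ξ i = T.wIdem ξ₀ ξ i := by
  have h1 : (((ξ₀ g * (ξ g)⁻¹ : (OInt p E)ˣ) : OInt p E) ⊗ₜ[ℤ_[p]] ((T.hU g : OInt p K) ^ i)) =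
      ((((ξ g)⁻¹ : (OInt p E)ˣ) : OInt p E) ⊗ₜ[ℤ_[p]] (1 : OInt p K)) *
        ((ξ₀ g : OInt p E) ⊗ₜ[ℤ_[p]] ((T.hU g : OInt p K) ^ i)) := by
    rw [Algebra.TensorProduct.tmul_mul_tmul, one_mul, mul_comm, Units.val_mul, mul_comm]
  rw [h1, mul_assoc, ← tmul_mul_wIdem, ← mul_assoc, Algebra.TensorProduct.tmul_mul_tmul, one_mul,
    ← Units.val_mul, inv_mul_cancel]
  exact one_mul _

theorem wIdem_mul_self (i : ℕ) : T.wIdem ξ₀ ξ i * T.wIdem ξ₀ ξ i = T.wIdem ξ₀ ξ i := by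
  conv_lhs => enter [1]; rw [wIdem]
  rw [Finset.sum_mul]
  conv_rhs => rw [← T.inverse_smul_sum_const (E := E) (T.wIdem ξ₀ ξ i)]
  refine Finset.sum_congr rfl fun g _ => ?_
  rw [← smul_eq_mul (Ring.inverse _), ← TensorProduct.smul_tmul', smul_mul_assoc,
    tmul_mul_wIdem']

/-- Averaging the hypothesis over the group multiplies z by the average of h^k, which is zero. -/
theorem one_tmul_hU_mul_eq_zero {z : OInt p E ⊗[ℤ_[p]] OInt p K} {k : ℕ}
    (hk : ¬Module.finrank K K' ∣ k)
    (h : ∀ g, ((1 : OInt p E) ⊗ₜ[ℤ_[p]] ((T.hU g : OInt p K) ^ k)) * z = z) : z = 0 := by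
  have h1 := T.inverse_smul_sum_const (E := E) z
  rw [← h1, ← Finset.smul_sum]
  have h2 : ∑ g : Gal(K'/K), z = 0 := by
    rw [← Finset.sum_congr rfl fun g _ => h g, ← Finset.sum_mul, ← TensorProduct.tmul_sum,
      T.sum_hU_pow_eq_zero hk, TensorProduct.tmul_zero, zero_mul]
  rw [h2, smul_zero]

/-- On the product both h^i and h^j act as ξ/ξ₀, so h^(i-j) acts trivially and the product vanishes
by averaging. The exponent i + (n - j) stands for i - j, as h^n = 1. -/
theorem wIdem_mul_of_ne {i j : ℕ} (hi : i < Module.finrank K K') (hj : j < Module.finrank K K')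
    (hij : i ≠ j) : T.wIdem ξ₀ ξ i * T.wIdem ξ₀ ξ j = 0 := by
  have hk : ¬Module.finrank K K' ∣ i + (Module.finrank K K' - j) := by
    rintro ⟨c, hc⟩
    have : c = 1 := by
      by_contra h
      rcases Nat.lt_or_gt_of_ne h with h | h
      · have : c = 0 := by omega
        subst this; omega
      · have := Nat.mul_le_mul_left (Module.finrank K K') h
        omega
    subst this; omega
  refine T.one_tmul_hU_mul_eq_zero hk fun g => ?_
  have h1 := T.tmul_mul_wIdem' ξ₀ ξ g i
  have h2 := T.tmul_mul_wIdem' ξ₀ ξ g j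
  set c := ((ξ₀ g * (ξ g)⁻¹ : (OInt p E)ˣ) : OInt p E)
  set c' := (((ξ₀ g * (ξ g)⁻¹)⁻¹ : (OInt p E)ˣ) : OInt p E)
  have hc : c * c' = 1 := Units.mul_inv _
  have e1 : (1 : OInt p E) ⊗ₜ[ℤ_[p]] ((T.hU g : OInt p K) ^ (i + (Module.finrank K K' - j))) *
      (T.wIdem ξ₀ ξ i * T.wIdem ξ₀ ξ j) =
      (c ⊗ₜ ((T.hU g : OInt p K) ^ i)) * T.wIdem ξ₀ ξ i *
        ((c' ⊗ₜ ((T.hU g : OInt p K) ^ (Module.finrank K K' - j))) * T.wIdem ξ₀ ξ j) := by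
    rw [mul_mul_mul_comm, Algebra.TensorProduct.tmul_mul_tmul, hc, pow_add]
  rw [e1, h1]
  congr 1
  conv_lhs => rw [← h2]
  rw [← mul_assoc, Algebra.TensorProduct.tmul_mul_tmul, mul_comm c', hc, ← pow_add,
    Nat.sub_add_cancel hj.le, T.hU_pow_finrank]
  exact one_mul _

theorem sum_wIdem : ∑ i ∈ Finset.range (Module.finrank K K'), T.wIdem ξ₀ ξ i = 1 := by
  simp only [wIdem]
  rw [Finset.sum_comm, Finset.sum_eq_single 1]
  · simp only [map_one, inv_one, mul_one, Units.val_one, one_pow, Finset.sum_const,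
      Finset.card_range]
    rw [TensorProduct.smul_tmul', ← T.natCard_gal, nsmul_eq_mul,
      LocDatum.natCard_gal_mul_inverse T]
    rfl
  · intro g _ hg
    rw [← TensorProduct.tmul_sum, T.sum_range_hU_pow g hg, TensorProduct.tmul_zero]
  · simp

theorem sum_char_eq_zero (h : ξ ≠ ξ') :
    ∑ g : Gal(K'/K), ((ξ g * (ξ' g)⁻¹ : (OInt p E)ˣ) : OInt p E) = 0 := by
  refine sum_hom_units_eq_zero ((Units.coeHom (OInt p E)).comp (ξ * ξ'⁻¹)) fun h0 => h ?_
  ext g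
  have := DFunLike.congr_fun h0 g
  have h1 : ξ g * (ξ' g)⁻¹ = 1 := Units.val_injective this
  rw [mul_inv_eq_one.1 h1]

/-- On the product both characters agree with ξ₀ h^i, so ξ/ξ' acts trivially there. The average of
this nontrivial character is zero. -/
theorem wIdem_mul_wIdem_of_ne (h : ξ ≠ ξ') (i : ℕ) : T.wIdem ξ₀ ξ i * T.wIdem ξ₀ ξ' i = 0 := by
  set z := T.wIdem ξ₀ ξ i * T.wIdem ξ₀ ξ' i
  have h1 : ∀ g, (((ξ g * (ξ' g)⁻¹ : (OInt p E)ˣ) : OInt p E) ⊗ₜ[ℤ_[p]] (1 : OInt p K)) * z = z := by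
    intro g
    have e1 : ((ξ g : OInt p E) ⊗ₜ[ℤ_[p]] (1 : OInt p K)) * z =
        ((ξ' g : OInt p E) ⊗ₜ[ℤ_[p]] (1 : OInt p K)) * z := by
      rw [← mul_assoc, tmul_mul_wIdem, mul_left_comm, tmul_mul_wIdem, mul_left_comm, ← mul_assoc]
    have e2 : (((ξ g * (ξ' g)⁻¹ : (OInt p E)ˣ) : OInt p E) ⊗ₜ[ℤ_[p]] (1 : OInt p K)) =
        ((((ξ' g)⁻¹ : (OInt p E)ˣ) : OInt p E) ⊗ₜ[ℤ_[p]] (1 : OInt p K)) *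
          ((ξ g : OInt p E) ⊗ₜ[ℤ_[p]] (1 : OInt p K)) := by
      rw [Algebra.TensorProduct.tmul_mul_tmul, one_mul, Units.val_mul, mul_comm]
    rw [e2, mul_assoc, e1, ← mul_assoc, Algebra.TensorProduct.tmul_mul_tmul, ← Units.val_mul,
      inv_mul_cancel, one_mul]
    exact one_mul _
  rw [← T.inverse_smul_sum_const (E := E) z, ← Finset.smul_sum, ← Finset.sum_congr rfl fun g _ => h1 g,
    ← Finset.sum_mul, ← TensorProduct.sum_tmul, sum_char_eq_zero ξ ξ' h, TensorProduct.zero_tmul,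
    zero_mul, smul_zero]

theorem wIdem_zero_of_ne (h : ξ₀ ≠ ξ) : T.wIdem ξ₀ ξ 0 = 0 := by
  simp only [wIdem, pow_zero]
  rw [← TensorProduct.sum_tmul, ← Finset.mul_sum, sum_char_eq_zero ξ₀ ξ h, mul_zero,
    TensorProduct.zero_tmul]

theorem wIdem_self_zero : T.wIdem ξ₀ ξ₀ 0 = 1 := by
  simp only [wIdem, pow_zero, mul_inv_cancel, Units.val_one, mul_one]
  rw [← TensorProduct.sum_tmul]
  have := T.inverse_smul_sum_const (E := E) (1 : OInt p E)
  simp only [smul_eq_mul, mul_one] at this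
  rw [this]
  rfl

/-- The relation ξ = ξ₀ h^i is the same as ξ₀ = ξ h^(n-i); on the averages this is the substitution
of g⁻¹ for g. It encodes that the exponents of π₁ and π₂ add up to n. -/
theorem wIdem_swap {i : ℕ} (hi : i ≤ Module.finrank K K') :
    T.wIdem ξ ξ₀ (Module.finrank K K' - i) = T.wIdem ξ₀ ξ i := by
  rw [wIdem, wIdem]
  refine Fintype.sum_equiv (Equiv.inv _) _ _ fun g => ?_
  congr 1
  · simp only [Equiv.inv_apply, map_inv, inv_inv, mul_comm]
  · rw [Equiv.inv_apply]
    have h1 : (T.hU g⁻¹ : OInt p K) ^ i * (T.hU g : OInt p K) ^ i = 1 := by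
      rw [← mul_pow, ← Units.val_mul, ← map_mul, inv_mul_cancel, map_one, Units.val_one, one_pow]
    have h2 : (T.hU g : OInt p K) ^ (Module.finrank K K' - i) * (T.hU g : OInt p K) ^ i = 1 := by
      rw [← pow_add, Nat.sub_add_cancel hi, hU_pow_finrank]
    exact left_inv_eq_right_inv h2 (by rw [mul_comm]; exact h1)

/-- The map `𝒪 ⊗ 𝒪_K → 𝒪 ⊗ 𝒪_{K'}`. -/
def inclD : OInt p E ⊗[ℤ_[p]] OInt p K →ₐ[OInt p E] OInt p E ⊗[ℤ_[p]] OInt p K' :=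
  Algebra.TensorProduct.map (AlgHom.id _ _) (intIncl p K K')

theorem inclD_tmul (a : OInt p E) (b : OInt p K) :
    inclD (K' := K') (a ⊗ₜ[ℤ_[p]] b) = a ⊗ₜ intIncl p K K' b := rfl

variable {ξ₀ ξ} in
-- On e_σ the element h(g) acts as σ(h(g)), so each summand of the average acts as n⁻¹.
theorem inclD_wIdem_mul_idem {σ : Emb p K' E} {a : ℕ}
    (h : ∀ g, (ξ g : OInt p E) = ξ₀ g * σ (T.h g) ^ a) :
    inclD (T.wIdem ξ₀ ξ a) * T.idem σ = T.idem σ := by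
  conv_rhs => rw [← T.inverse_smul_sum_const (E := E) (T.idem σ)]
  rw [wIdem, map_sum, Finset.sum_mul]
  refine Finset.sum_congr rfl fun g _ => ?_
  rw [inclD_tmul, map_pow, intIncl_hU]
  have e1 : (Ring.inverse (Nat.card Gal(K'/K) : OInt p E) *
      ((ξ₀ g * (ξ g)⁻¹ : (OInt p E)ˣ) : OInt p E)) ⊗ₜ[ℤ_[p]] ((T.h g : OInt p K') ^ a) =
      (((Ring.inverse (Nat.card Gal(K'/K) : OInt p E) *
      ((ξ₀ g * (ξ g)⁻¹ : (OInt p E)ˣ) : OInt p E))) ⊗ₜ[ℤ_[p]] (1 : OInt p K')) *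
        (1 ⊗ₜ ((T.h g ^ a : Witt p K') : OInt p K')) := by
    rw [Algebra.TensorProduct.tmul_mul_tmul, mul_one, one_mul]
    rfl
  rw [e1, mul_assoc, T.mul_idem, ← mul_assoc, Algebra.TensorProduct.tmul_mul_tmul, mul_assoc,
    Units.val_mul, mul_right_comm (ξ₀ g : OInt p E), map_pow, ← h, Units.mul_inv, mul_one, mul_one,
    Algebra.smul_def]
  rfl

/-- Embeddings with the same exponent are grouped together: on e_σ, every w_i other than the one
with i = a_σ is zero. This removes σ from the definition of π₁, so that later computations need only
the w_i. -/
theorem piElt_eq (hE : Nonempty (K' →ₐ[ℚ_[p]] E)) (h : ξ₀ ≠ ξ) :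
    T.piElt ξ₀ ξ = ∑ i ∈ Finset.range (Module.finrank K K'),
      (1 ⊗ₜ[ℤ_[p]] (T.π' ^ i)) * inclD (T.wIdem ξ₀ ξ i) := by
  classical
  have := T.finite_emb (E := E)
  let _ := Fintype.ofFinite (Emb p K' E)
  choose a ha ha' using fun σ : Emb p K' E => T.exists_exponent ξ₀ ξ σ
  -- `IsExponent` asks for a positive exponent; exponent 0 would make the two characters equal.
  have ha0 : ∀ σ, 0 < a σ := fun σ => by
    rcases Nat.eq_zero_or_pos (a σ) with h0 | h0
    · refine absurd ?_ h
      ext g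
      rw [ha' σ g, h0, pow_zero, mul_one]
    · exact h0
  have hl : T.piElt ξ₀ ξ = ∑ σ : Emb p K' E, (1 ⊗ₜ (T.π' ^ a σ)) * T.idem σ := by
    rw [piElt, finsum_eq_sum_of_fintype]
    refine Finset.sum_congr rfl fun σ _ => ?_
    rw [finsum_eq_single _ (a σ)]
    · exact finsum_eq_if.trans (if_pos ⟨ha0 σ, ha σ, ha' σ⟩)
    · intro b hb
      refine finsum_eq_if.trans (if_neg fun hb' => hb ?_)
      exact T.exponent_unique hb'.2.1 (ha σ) hb'.2.2 (ha' σ)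
  rw [hl, ← mul_one (∑ i ∈ Finset.range (Module.finrank K K'), _), ← T.sum_idem hE,
    Finset.mul_sum]
  refine Finset.sum_congr rfl fun σ _ => ?_
  rw [Finset.sum_mul, Finset.sum_eq_single (a σ)]
  · rw [mul_assoc, T.inclD_wIdem_mul_idem (ha' σ)]
  · intro i hi hia
    rw [mul_assoc, ← T.inclD_wIdem_mul_idem (ha' σ), ← mul_assoc (inclD _), ← map_mul,
      T.wIdem_mul_of_ne ξ₀ ξ (Finset.mem_range.1 hi) (ha σ) hia, map_zero, zero_mul, mul_zero]
  · intro hn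
    exact absurd (Finset.mem_range.2 (ha σ)) hn

end TameTotRam
end CharacterIdempotents

/-! ### Locally free modules -/

section LocallyFree

/-- The linear map `φ : R ^ r → M` is an isomorphism up to the scalar `c`. -/
structure IsIsoUpTo {R M : Type*} [CommRing R] [AddCommGroup M] [Module R M] {ι : Type*}
    (c : R) (φ : (ι → R) →ₗ[R] M) : Prop where
  surj : ∀ m, ∃ v, φ v = c • m
  inj : ∀ v, φ v = 0 → c • v = 0

section

variable {R M : Type*} [CommRing R] [AddCommGroup M] [Module R M] {ι : Type*}

/-- A choice s(m) of preimages of c m need not be linear, but two choices differ by an element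
killed by c, so c · s is linear. This is why c is squared. -/
theorem IsIsoUpTo.exists_inverse {c : R} {φ : (ι → R) →ₗ[R] M} (h : IsIsoUpTo c φ) :
    ∃ θ : M →ₗ[R] (ι → R), (∀ m, φ (θ m) = (c * c) • m) ∧ ∀ v, θ (φ v) = (c * c) • v := by
  choose s hs using h.surj
  have key : ∀ v m, φ v = c • m → c • v = c • s m := fun v m hv => by
    rw [← sub_eq_zero, ← smul_sub]
    exact h.inj _ (by rw [map_sub, hv, hs, sub_self])
  refine ⟨{ toFun := fun m => c • s m, map_add' := fun m n => ?_, map_smul' := fun a m => ?_ },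
    fun m => ?_, fun v => ?_⟩
  · rw [← smul_add]
    exact (key (s m + s n) (m + n) (by rw [map_add, hs, hs, smul_add])).symm
  · rw [RingHom.id_apply, smul_comm]
    exact (key (a • s m) (a • m) (by rw [map_smul, hs, smul_comm])).symm
  · show φ (c • s m) = _
    rw [map_smul, hs, smul_smul]
  · show c • s (φ v) = _
    rw [← key (c • v) _ (by rw [map_smul]), smul_smul]

theorem IsIsoUpTo.smul {c : R} {φ : (ι → R) →ₗ[R] M} (h : IsIsoUpTo c φ) (d : R) :
    IsIsoUpTo (d * c) φ where
  surj m := by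
    obtain ⟨v, hv⟩ := h.surj m
    exact ⟨d • v, by rw [map_smul, hv, mul_smul]⟩
  inj v hv := by rw [mul_smul, h.inj v hv, smul_zero]

/-- If `M` is free on `ι` up to a scalar `g`, and `φ : R ^ ι → M` is surjective up to a scalar
`c`, then `φ` is an isomorphism up to a scalar. -/
theorem IsIsoUpTo.of_surj [Fintype ι] [DecidableEq ι] {g c : R} {φ₀ φ : (ι → R) →ₗ[R] M} (h : IsIsoUpTo g φ₀)
    (hφ : ∀ m, ∃ v, φ v = c • m) : IsIsoUpTo (c * (g * g * c) ^ Fintype.card ι) φ := by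
  obtain ⟨θ, h1, h2⟩ := h.exists_inverse
  choose s hs using hφ
  -- P factors the quasi-inverse of φ₀ through φ, and Q lifts c φ₀ through φ. Their composite is a
  -- scalar, so det P divides a power of that scalar.
  let P : Module.End R (ι → R) := θ ∘ₗ φ
  let Q : Module.End R (ι → R) :=
    (Pi.basisFun R ι).constr R fun i => s (φ₀ (Pi.single i 1))
  have hQ : φ ∘ₗ Q = c • φ₀ := by
    refine (Pi.basisFun R ι).ext fun i => ?_
    rw [LinearMap.comp_apply, Module.Basis.constr_basis, hs, Pi.basisFun_apply,
      LinearMap.smul_apply]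
  have hPQ : P * Q = (g * g * c) • 1 := by
    refine LinearMap.ext fun v => ?_
    have := LinearMap.congr_fun hQ v
    show θ (φ (Q v)) = (g * g * c) • v
    rw [LinearMap.comp_apply] at this
    rw [this, LinearMap.smul_apply, map_smul, h2, smul_smul, mul_comm]
  refine ⟨fun m => ⟨(g * g * c) ^ Fintype.card ι • s m, ?_⟩, fun v hv => ?_⟩
  · rw [map_smul, hs, smul_smul, mul_comm]
  · rcases subsingleton_or_nontrivial R with hR | hR
    · exact Subsingleton.elim _ _
    have hdet : LinearMap.det P * LinearMap.det Q = (g * g * c) ^ Fintype.card ι := by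
      rw [← map_mul, hPQ, LinearMap.det_smul, Module.finrank_fintype_fun_eq_card, map_one, mul_one]
    have hP : P v = 0 := by
      show θ (φ v) = 0
      rw [hv, map_zero]
    -- Multiplication by the adjugate matrix turns P v = 0 into det(P) v = 0.
    have hPv : LinearMap.det P • v = 0 := by
      have e1 : Matrix.mulVec (LinearMap.toMatrix' P) v = 0 := by
        rw [LinearMap.toMatrix'_mulVec, hP]
      have e2 := congrArg (Matrix.mulVec (LinearMap.toMatrix' P).adjugate) e1
      rwa [Matrix.mulVec_mulVec, Matrix.adjugate_mul, Matrix.mulVec_zero, Matrix.smul_mulVec,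
        Matrix.one_mulVec, LinearMap.det_toMatrix'] at e2
    rw [← hdet, mul_comm (LinearMap.det P), ← mul_assoc, mul_smul, hPv, smul_zero]

end

variable {R M : Type u} [CommRing R] [AddCommGroup M] [Module R M] {r : ℕ}

theorem IsIsoUpTo.exists_of_surj {ι : Type*} [Finite ι] {g c : R} {φ₀ φ : (ι → R) →ₗ[R] M}
    (h : IsIsoUpTo g φ₀) (hφ : ∀ m, ∃ v, φ v = c • m) {𝔪 : Ideal R} (h𝔪 : 𝔪.IsPrime) (hg : g ∉ 𝔪)
    (hc : c ∉ 𝔪) : ∃ d ∉ 𝔪, IsIsoUpTo d φ := by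
  classical
  have := Fintype.ofFinite ι
  refine ⟨_, fun hd => ?_, h.of_surj hφ⟩
  refine (h𝔪.mem_or_mem hd).elim hc fun hd => (h𝔪.mem_or_mem (h𝔪.mem_of_pow_mem _ hd)).elim
    (fun hd => (h𝔪.mem_or_mem hd).elim hg hg) hc

/-- A finite projective module of rank `r` is free of rank `r` up to a scalar prime to a given
prime. -/
theorem IsProjOfRank.exists_isIsoUpTo (h : IsProjOfRank R M r) (𝔪 : Ideal R) [h𝔪 : 𝔪.IsPrime] :
    ∃ c ∉ 𝔪, ∃ φ : (Fin r → R) →ₗ[R] M, IsIsoUpTo c φ := by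
  obtain ⟨hfin, hproj, hrank⟩ := h
  let Rm := Localization.AtPrime 𝔪
  let Mm := LocalizedModule 𝔪.primeCompl M
  let ι := LocalizedModule.mkLinearMap 𝔪.primeCompl M
  have hfree : Module.Free Rm Mm := Module.free_of_flat_of_isLocalRing
  have hr : Module.finrank Rm Mm = r := hrank ⟨𝔪, h𝔪⟩
  let b : Module.Basis (Fin r) Rm Mm := Module.finBasisOfFinrankEq Rm Mm hr
  -- A common denominator t moves a basis of the localisation into M.
  obtain ⟨t, ht⟩ := IsLocalizedModule.exist_integer_multiples_of_finite 𝔪.primeCompl ι b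
  choose m hm using ht
  let φ : (Fin r → R) →ₗ[R] M := Fintype.linearCombination R m
  have hφ : ∀ v, ι (φ v) = ∑ i, (algebraMap R Rm (v i) * algebraMap R Rm t) • b i := fun v => by
    rw [Fintype.linearCombination_apply, map_sum]
    refine Finset.sum_congr rfl fun i _ => ?_
    rw [map_smul, hm, mul_smul, algebraMap_smul, algebraMap_smul]
  have htu : IsUnit (algebraMap R Rm t) := IsLocalization.map_units Rm t
  have hinj : ∀ v, φ v = 0 → ∃ s ∈ 𝔪.primeCompl, s • v = 0 := fun v hv => by
    have h1 := hφ v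
    rw [hv, map_zero, eq_comm] at h1
    have h2 := Fintype.linearIndependent_iff.1 b.linearIndependent _ h1
    have h3 : ∀ i, ∃ s : 𝔪.primeCompl, (s : R) * v i = 0 := fun i => by
      have := (htu.mul_left_eq_zero).1 (h2 i)
      exact (IsLocalization.map_eq_zero_iff 𝔪.primeCompl Rm _).1 this
    choose s hs using h3
    refine ⟨∏ i, (s i : R), prod_mem fun i _ => (s i).2, funext fun i => ?_⟩
    rw [Pi.smul_apply, smul_eq_mul, ← Finset.mul_prod_erase _ _ (Finset.mem_univ i), mul_right_comm,
      hs, zero_mul, Pi.zero_apply]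
  have hsurj : ∀ n : M, ∃ s ∈ 𝔪.primeCompl, s • n ∈ LinearMap.range φ := fun n => by
    obtain ⟨d, hd⟩ := IsLocalization.exist_integer_multiples_of_finite 𝔪.primeCompl
      (fun i => b.repr (ι n) i * (htu.unit⁻¹ : Rmˣ))
    choose v hv using hd
    have h1 : ι (φ v) = ι ((d : R) • n) := by
      rw [hφ, map_smul, ← b.sum_repr (ι n), Finset.smul_sum]
      refine Finset.sum_congr rfl fun i _ => ?_
      rw [hv, smul_mul_assoc, mul_assoc, IsUnit.val_inv_mul, mul_one, smul_assoc]
    obtain ⟨s, hs⟩ := IsLocalizedModule.exists_of_eq (S := 𝔪.primeCompl) h1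
    exact ⟨s * d, mul_mem s.2 d.2, (s : R) • v, by
      rw [map_smul, mul_smul]; exact hs⟩
  -- Finite generation allows a single denominator for all elements of M.
  have hcok : ∃ s ∈ 𝔪.primeCompl, ∀ n : M, s • n ∈ LinearMap.range φ := by
    classical
    obtain ⟨B, hB⟩ := hfin.fg_top
    choose s hs hs' using hsurj
    refine ⟨∏ n ∈ B, s n, prod_mem fun n _ => hs n, fun n => ?_⟩
    have : (⊤ : Submodule R M) ≤
        (LinearMap.range φ).comap (LinearMap.lsmul R M (∏ n ∈ B, s n)) := by
      rw [← hB, Submodule.span_le]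
      intro n hn
      show (∏ n ∈ B, s n) • n ∈ LinearMap.range φ
      rw [← Finset.prod_erase_mul _ _ hn, mul_smul]
      exact Submodule.smul_mem _ _ (hs' n)
    exact this (Submodule.mem_top (x := n))
  obtain ⟨s, hs, hs'⟩ := hcok
  -- Projectivity lifts multiplication by s to a linear ψ with φ ψ = s. Then ψ φ - s has values in
  -- the kernel of φ, and on the finitely many basis vectors it is killed by a scalar outside 𝔪.
  obtain ⟨ψ, hψ⟩ := Module.projective_lifting_property φ.rangeRestrict
    ((LinearMap.lsmul R M s).codRestrict (LinearMap.range φ) hs') φ.surjective_rangeRestrict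
  have hψ' : ∀ n, φ (ψ n) = s • n := fun n => congrArg Subtype.val (LinearMap.congr_fun hψ n)
  have hker : ∀ i, ∃ d ∈ 𝔪.primeCompl, d • (ψ (φ (Pi.single i 1)) - s • Pi.single i 1) = 0 :=
    fun i => hinj _ (by rw [map_sub, hψ', map_smul, sub_self])
  choose d hd hd' using hker
  have hall : ∀ v, (∏ i, d i) • (ψ (φ v) - s • v) = 0 := by
    have : (∏ i, d i) • (ψ ∘ₗ φ - s • LinearMap.id) = 0 := by
      refine (Pi.basisFun R (Fin r)).ext fun i => ?_
      rw [Pi.basisFun_apply, ← Finset.prod_erase_mul _ _ (Finset.mem_univ i)]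
      show (_ * d i) • (ψ (φ (Pi.single i 1)) - s • Pi.single i 1) = 0
      rw [mul_smul, hd', smul_zero]
    exact fun v => LinearMap.congr_fun this v
  refine ⟨(∏ i, d i) * s, mul_mem (prod_mem fun i _ => hd i) hs, φ, fun n => ?_, fun v hv => ?_⟩
  · exact ⟨(∏ i, d i) • ψ n, by rw [map_smul, hψ', mul_smul]⟩
  · have := hall v
    rwa [hv, map_zero, zero_sub, smul_neg, neg_eq_zero, smul_smul] at this

/-- A module which is free of rank `r` up to scalars prime to any given maximal ideal is projective
of rank `r`. -/
theorem isProjOfRank_of_isIsoUpTo (h : ∀ 𝔪 : Ideal R, 𝔪.IsMaximal →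
    ∃ c ∉ 𝔪, ∃ φ : (Fin r → R) →ₗ[R] M, IsIsoUpTo c φ) : IsProjOfRank R M r := by
  have h' : ∀ 𝔪 : Ideal R, 𝔪.IsMaximal → ∃ c ∉ 𝔪, ∃ (φ : (Fin r → R) →ₗ[R] M)
      (θ : M →ₗ[R] (Fin r → R)), (∀ m, φ (θ m) = c • m) ∧ ∀ v, θ (φ v) = c • v := fun 𝔪 h𝔪 => by
    obtain ⟨c, hc, φ, hφ⟩ := h 𝔪 h𝔪
    obtain ⟨θ, h1, h2⟩ := hφ.exists_inverse
    exact ⟨c * c, fun h => hc ((h𝔪.isPrime.mem_or_mem h).elim id id), φ, θ, h1, h2⟩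
  have hretr : ∃ (n : ℕ) (i : M →ₗ[R] (Fin n → Fin r → R)) (q : (Fin n → Fin r → R) →ₗ[R] M),
      q ∘ₗ i = LinearMap.id := by
    -- The scalars whose multiplication on M factors through R^r generate the unit ideal. Writing 1
    -- as a combination of them exhibits M as a direct summand of a finite free module.
    let I : Set R := {c | ∃ (φ : (Fin r → R) →ₗ[R] M) (θ : M →ₗ[R] (Fin r → R)),
      ∀ m, φ (θ m) = c • m}
    have hI : Ideal.span I = ⊤ := by
      by_contra hne
      obtain ⟨𝔪, h𝔪, hle⟩ := Ideal.exists_le_maximal _ hne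
      obtain ⟨c, hc, φ, θ, h1, -⟩ := h' 𝔪 h𝔪
      exact hc (hle (Ideal.subset_span ⟨φ, θ, h1⟩))
    have h1 : (1 : R) ∈ Submodule.span R I := by
      rw [show Submodule.span R I = ⊤ from hI]
      trivial
    obtain ⟨n, a, g, hag⟩ := Submodule.mem_span_set'.1 h1
    choose φ θ hφθ using fun i => (g i).2
    refine ⟨n, LinearMap.pi θ, ∑ i, a i • φ i ∘ₗ LinearMap.proj i, LinearMap.ext fun m => ?_⟩
    have : ∀ i, a i • φ i (θ i m) = (a i • (g i : R)) • m := fun i => by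
      rw [hφθ, smul_assoc]
    simp [this, ← Finset.sum_smul]
    simpa using congrArg (· • m) hag
  obtain ⟨n, i, q, hqi⟩ := hretr
  have hq : Function.Surjective q := fun m => ⟨i m, LinearMap.congr_fun hqi m⟩
  have hfin : Module.Finite R M := Module.Finite.of_surjective q hq
  have hproj : Module.Projective R M := Module.Projective.of_split i q hqi
  refine ⟨hfin, hproj, fun x => ?_⟩
  obtain ⟨𝔪, h𝔪, hle⟩ := Ideal.exists_le_maximal _ x.2.ne_top
  obtain ⟨c, hc, φ, θ, h1, h2⟩ := h' 𝔪 h𝔪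
  have hcx : c ∈ x.asIdeal.primeCompl := fun h => hc (hle h)
  -- The scalar c is a unit at x, so the localised map is an isomorphism and the rank at x is r.
  let φx := LocalizedModule.map x.asIdeal.primeCompl φ
  have hbij : Function.Bijective φx := by
    constructor
    · rw [injective_iff_map_eq_zero]
      intro z hz
      induction z using LocalizedModule.induction_on with
      | h v s =>
      rw [show φx (LocalizedModule.mk v s) = LocalizedModule.mk (φ v) s from
        IsLocalizedModule.map_LocalizedModules _ _ _ _, ← LocalizedModule.zero_mk s, LocalizedModule.mk_eq] at hz
      obtain ⟨t, ht⟩ := hz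
      rw [smul_zero, smul_zero] at ht
      rw [← LocalizedModule.zero_mk s, LocalizedModule.mk_eq]
      refine ⟨⟨c, hcx⟩ * t, ?_⟩
      rw [smul_zero, smul_zero, mul_smul]
      simp only [Submonoid.smul_def] at ht ⊢
      have := h2 ((t : R) • (s : R) • v)
      rw [map_smul φ, map_smul φ, ht, map_zero] at this
      exact this.symm
    · intro z
      induction z using LocalizedModule.induction_on with
      | h v s =>
      refine ⟨LocalizedModule.mk (θ v) (⟨c, hcx⟩ * s), ?_⟩
      rw [show φx (LocalizedModule.mk (θ v) _) = LocalizedModule.mk (φ (θ v)) _ from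
        IsLocalizedModule.map_LocalizedModules _ _ _ _, h1]
      exact LocalizedModule.mk_cancel_common_left (⟨c, hcx⟩ : x.asIdeal.primeCompl) s v
  have hx : Nontrivial R := ⟨⟨0, 1, fun h => x.2.ne_top (Ideal.eq_top_of_isUnit_mem _
    (h ▸ x.asIdeal.zero_mem) isUnit_one)⟩⟩
  have e : Module.rankAtStalk (R := R) (Fin r → R) x = Module.rankAtStalk (R := R) M x :=
    (LinearEquiv.ofBijective φx hbij).finrank_eq
  rw [← e, Module.rankAtStalk_eq_finrank_of_free, Pi.natCast_apply, Module.finrank_fin_fun]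
  rfl

/-! ### Finite extensions generated by a root of a uniformiser -/

section Extension

variable {S S' M : Type u} [CommRing S] [CommRing S'] [Algebra S S'] [AddCommGroup M]
  [Module S' M] {r : ℕ}

/-- Because S' = S + x S' with x in every maximal ideal, no maximal ideal of S' above 𝔪 contains g.
The finite S-module S'/(g) therefore equals 𝔪 times itself, and Nakayama gives a scalar prime to 𝔪
that kills it. -/
theorem exists_dvd_algebraMap [Module.Finite S S'] {x : S'}
    (hx : ∀ I : Ideal S', I.IsMaximal → x ∈ I) (hS : ∀ z, ∃ s z', z = algebraMap S S' s + x * z')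
    (𝔪 : Ideal S) [h𝔪 : 𝔪.IsMaximal] (𝔪' : Ideal S') [h𝔪' : 𝔪'.IsMaximal]
    (hcomap : 𝔪'.comap (algebraMap S S') = 𝔪) {g : S'} (hg : g ∉ 𝔪') :
    ∃ c ∉ 𝔪, g ∣ algebraMap S S' c := by
  obtain ⟨s, z, rfl⟩ := hS g
  set g := algebraMap S S' s + x * z
  have hs : s ∉ 𝔪 := fun hs => hg <| by
    rw [← hcomap] at hs
    exact Ideal.add_mem _ hs (Ideal.mul_mem_right _ _ (hx _ h𝔪'))
  -- A maximal ideal containing 𝔪 and g = s + x z also contains x, hence s. But it meets S in 𝔪, and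
  -- s is not in 𝔪.
  have hJ : 𝔪.map (algebraMap S S') ⊔ Ideal.span {g} = ⊤ := by
    by_contra hne
    obtain ⟨I, hI, hle⟩ := Ideal.exists_le_maximal _ hne
    have h1 : 𝔪 ≤ I.comap (algebraMap S S') := Ideal.map_le_iff_le_comap.1 (le_sup_left.trans hle)
    have hIS : (I.comap (algebraMap S S')).IsPrime := Ideal.comap_isPrime _ _
    have h2 := h𝔪.eq_of_le hIS.ne_top h1
    apply hs
    rw [h2, Ideal.mem_comap]
    have h3 : g ∈ I := hle (Ideal.mem_sup_right (Ideal.mem_span_singleton_self g))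
    exact (Ideal.add_mem_iff_left _ (Ideal.mul_mem_right _ _ (hx _ hI))).1 h3
  let N := S' ⧸ Ideal.span {g}
  have hN : (⊤ : Submodule S N) ≤ 𝔪 • ⊤ := by
    rintro n -
    obtain ⟨a, rfl⟩ := Ideal.Quotient.mk_surjective n
    have ha : a ∈ 𝔪.map (algebraMap S S') ⊔ Ideal.span {g} := hJ ▸ Submodule.mem_top
    obtain ⟨b, hb, d, hd, rfl⟩ := Submodule.mem_sup.1 ha
    rw [map_add, Ideal.Quotient.eq_zero_iff_mem.2 hd, add_zero]
    have hle : (𝔪.map (algebraMap S S')) ≤ (𝔪.map (algebraMap S S')) := le_rfl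
    refine Submodule.span_induction (p := fun b _ => Ideal.Quotient.mk (Ideal.span {g}) b ∈
      (𝔪 • ⊤ : Submodule S N)) ?_ ?_ ?_ ?_ hb
    · rintro _ ⟨t, ht, rfl⟩
      have := Submodule.smul_mem_smul ht (Submodule.mem_top (x := (1 : N)))
      rwa [Algebra.smul_def, mul_one] at this
    · rw [map_zero]
      exact Submodule.zero_mem _
    · intro a b _ _ ha hb
      rw [map_add]
      exact Submodule.add_mem _ ha hb
    · intro a b _ hb
      rw [smul_eq_mul, map_mul]
      refine Submodule.smul_induction_on hb ?_ ?_
      · intro t ht n _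
        rw [mul_smul_comm]
        exact Submodule.smul_mem_smul ht Submodule.mem_top
      · intro u v hu hv
        rw [mul_add]
        exact Submodule.add_mem _ hu hv
  obtain ⟨c, hc, hc'⟩ := Submodule.exists_sub_one_mem_and_smul_eq_zero_of_fg_of_le_smul 𝔪 ⊤
    (Module.Finite.fg_top (R := S) (M := N)) hN
  refine ⟨c, fun h => h𝔪.ne_top ?_, ?_⟩
  · rw [Ideal.eq_top_iff_one]
    simpa using Ideal.sub_mem _ h hc
  · rw [← Ideal.mem_span_singleton, ← Ideal.Quotient.eq_zero_iff_mem]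
    have := hc' 1 Submodule.mem_top
    rwa [Algebra.smul_def, mul_one] at this

/-- Trades the scalar from S' for one from S. Eigenspaces are modules over 𝒪_K ⊗ A only, so all
comparisons take place at a maximal ideal of that ring. -/
theorem IsProjOfRank.exists_isIsoUpTo_algebraMap [Module.Finite S S']
    (hinj : Function.Injective (algebraMap S S')) {x : S'}
    (hx : ∀ I : Ideal S', I.IsMaximal → x ∈ I) (hS : ∀ z, ∃ s z', z = algebraMap S S' s + x * z')
    (h : IsProjOfRank S' M r) (𝔪 : Ideal S) [h𝔪 : 𝔪.IsMaximal] :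
    ∃ c ∉ 𝔪, ∃ φ : (Fin r → S') →ₗ[S'] M, IsIsoUpTo (algebraMap S S' c) φ := by
  obtain ⟨𝔪', h𝔪', hcomap⟩ := Ideal.exists_ideal_over_maximal_of_isIntegral (S := S') 𝔪
    (by rw [(RingHom.injective_iff_ker_eq_bot _).1 hinj]; exact bot_le)
  obtain ⟨g, hg, φ, hφ⟩ := h.exists_isIsoUpTo 𝔪'
  obtain ⟨c, hc, d, hd⟩ := exists_dvd_algebraMap hx hS 𝔪 𝔪' hcomap hg
  exact ⟨c, hc, φ, by rw [hd, mul_comm]; exact hφ.smul d⟩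

theorem isProjOfRank_of_isIsoUpTo_algebraMap [Algebra.IsIntegral S S']
    (h : ∀ 𝔪 : Ideal S, 𝔪.IsMaximal →
      ∃ c ∉ 𝔪, ∃ φ : (Fin r → S') →ₗ[S'] M, IsIsoUpTo (algebraMap S S' c) φ) :
    IsProjOfRank S' M r := by
  refine isProjOfRank_of_isIsoUpTo fun 𝔪' h𝔪' => ?_
  obtain ⟨c, hc, φ, hφ⟩ := h _ (Ideal.isMaximal_comap_of_isIntegral_of_isMaximal (R := S) 𝔪')
  exact ⟨_, hc, φ, hφ⟩

/-- If `S'` has the `S`-basis `1, x, …, x ^ (n - 1)` and `x ^ n = π`, then any element `y` with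
`y ^ n = π` of an `S`-algebra defines an algebra homomorphism with `x ↦ y`. -/
theorem exists_algHom_of_pow_eq {B : Type*} [Ring B] [Algebra S B] {n : ℕ} (hn : n ≠ 0)
    (x : S') (π : S) (hx : x ^ n = algebraMap S S' π)
    (hspan : ∀ z : S', ∃ c : Fin n → S, z = ∑ i, c i • x ^ (i : ℕ))
    (hli : LinearIndependent S fun i : Fin n => x ^ (i : ℕ)) (y : B)
    (hy : y ^ n = algebraMap S B π) : ∃ φ : S' →ₐ[S] B, φ x = y := by
  have hsurj : Function.Surjective (Polynomial.aeval x : Polynomial S →ₐ[S] S') := fun z => by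
    obtain ⟨c, rfl⟩ := hspan z
    refine ⟨∑ i, Polynomial.C (c i) * Polynomial.X ^ (i : ℕ), ?_⟩
    simp [Algebra.smul_def]
  let F : Polynomial S := Polynomial.X ^ n - Polynomial.C π
  have hF : F.Monic := Polynomial.monic_X_pow_sub_C π hn
  -- Division by X^n - π leaves a remainder of degree less than n, which must be zero by linear
  -- independence. So S' is S[X]/(X^n - π), and every n-th root y of π receives a homomorphism.
  have hker : ∀ q : Polynomial S, Polynomial.aeval x q = 0 → Polynomial.aeval y q = 0 := by
    intro q hq
    rcases subsingleton_or_nontrivial S with hS | hS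
    · rw [Subsingleton.elim q 0, map_zero]
    have hdiv := Polynomial.modByMonic_add_div q F
    have hFx : Polynomial.aeval x F = 0 := by simp [F, hx]
    have hFy : Polynomial.aeval y F = 0 := by simp [F, hy]
    have hdeg : (q %ₘ F).natDegree < n := by
      have := Polynomial.natDegree_modByMonic_lt q hF (by
        intro h1
        have := congrArg Polynomial.natDegree h1
        rw [Polynomial.natDegree_X_pow_sub_C, Polynomial.natDegree_one] at this
        exact hn this)
      rwa [Polynomial.natDegree_X_pow_sub_C] at this
    have hrem : Polynomial.aeval x (q %ₘ F) = 0 := by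
      rw [← hdiv, map_add, map_mul, hFx, zero_mul, add_zero] at hq
      exact hq
    have hzero : q %ₘ F = 0 := by
      rw [Polynomial.aeval_eq_sum_range' hdeg, Finset.sum_range] at hrem
      have := Fintype.linearIndependent_iff.1 hli _ hrem
      ext i
      rcases lt_or_ge i n with hi | hi
      · exact this ⟨i, hi⟩
      · exact Polynomial.coeff_eq_zero_of_natDegree_lt (hdeg.trans_le hi)
    rw [← hdiv, hzero, zero_add, map_mul, hFy, zero_mul]
  choose q hq using hsurj
  have hq' : ∀ f g : Polynomial S, Polynomial.aeval x f = Polynomial.aeval x g →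
      Polynomial.aeval y f = Polynomial.aeval y g := fun f g h => by
    rw [← sub_eq_zero, ← map_sub]
    exact hker _ (by rw [map_sub, h, sub_self])
  refine ⟨AlgHom.ofLinearMap
    { toFun := fun z => Polynomial.aeval y (q z)
      map_add' := fun z w => by
        rw [← map_add]
        exact hq' _ _ (by simp [hq])
      map_smul' := fun s z => by
        rw [RingHom.id_apply, ← map_smul]
        exact hq' _ _ (by simp [hq]) } ?_ ?_, ?_⟩
  · show Polynomial.aeval y (q 1) = 1
    rw [← map_one (Polynomial.aeval y : Polynomial S →ₐ[S] B)]
    exact hq' _ _ (by simp [hq])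
  · intro z w
    show Polynomial.aeval y (q (z * w)) = Polynomial.aeval y (q z) * Polynomial.aeval y (q w)
    rw [← map_mul]
    exact hq' _ _ (by simp [hq])
  · show Polynomial.aeval y (q x) = y
    rw [hq' (q x) Polynomial.X (by simp [hq]), Polynomial.aeval_X]

end Extension

end LocallyFree

/-! ### The rings `A ⊗ 𝒪_K` and `A ⊗ 𝒪_{K'}` -/

section CoeffRings

set_option linter.unusedSectionVars false

variable {p : ℕ} [Fact p.Prime]
  {K K' E : Type u} [Field K] [Field K'] [Field E]
  [Algebra ℚ_[p] K] [Algebra ℤ_[p] K] [IsScalarTower ℤ_[p] ℚ_[p] K]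
  [Algebra ℚ_[p] K'] [Algebra ℤ_[p] K'] [IsScalarTower ℤ_[p] ℚ_[p] K']
  [Algebra ℚ_[p] E] [Algebra ℤ_[p] E] [IsScalarTower ℤ_[p] ℚ_[p] E]
  [Algebra K K'] [IsScalarTower ℚ_[p] K K'] [IsScalarTower ℤ_[p] K K']
  [FiniteDimensional K K'] [FiniteDimensional ℚ_[p] K] [FiniteDimensional ℚ_[p] K']
  [FiniteDimensional ℚ_[p] E]


theorem TestAlg.span_p_le_jacobson (A : TestAlg.{u} p E) :
    Ideal.span {(p : A.carrier)} ≤ Ideal.jacobson ⊥ :=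
  have := A.complete
  IsAdicComplete.le_jacobson_bot _

/-- The ring A ⊗ 𝒪_F is integral over A, so its maximal ideals contract to maximal ideals of A,
which contain p by completeness. A power of a nonunit of 𝒪_F is divisible by p. This is what makes
Nakayama available for π and π'. -/
theorem one_tmul_mem_of_isMaximal {F : Type u} [Field F] [Algebra ℚ_[p] F] [Algebra ℤ_[p] F]
    [IsScalarTower ℤ_[p] ℚ_[p] F] [FiniteDimensional ℚ_[p] F] (A : TestAlg.{u} p E) {a : OInt p F}
    (ha : ¬IsUnit a) (I : Ideal (Coeff p A F)) (hI : I.IsMaximal) :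
    (1 : A.carrier) ⊗ₜ[ℤ_[p]] a ∈ I := by
  have hp : (p : Coeff p A F) ∈ I := by
    have h1 : (I.comap (algebraMap A.carrier (Coeff p A F))).IsMaximal :=
      Ideal.isMaximal_comap_of_isIntegral_of_isMaximal _
    have h2 := A.span_p_le_jacobson (Ideal.mem_span_singleton_self (p : A.carrier))
    have h3 : (p : A.carrier) ∈ I.comap (algebraMap A.carrier (Coeff p A F)) :=
      Ideal.mem_sInf.1 h2 ⟨bot_le, h1⟩
    simpa using h3
  obtain ⟨n, hn⟩ := OInt.exists_pow_mem_span ha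
  obtain ⟨b, hb⟩ := Ideal.mem_span_singleton.1 hn
  refine hI.isPrime.mem_of_pow_mem n ?_
  have : ((1 : A.carrier) ⊗ₜ[ℤ_[p]] a) ^ n = (p : Coeff p A F) * (1 ⊗ₜ b) := by
    rw [Algebra.TensorProduct.tmul_pow, one_pow, hb, ← nsmul_eq_mul, ← nsmul_eq_mul,
      TensorProduct.tmul_smul]
  rw [this]
  exact Ideal.mul_mem_right _ _ hp

/-- `A ⊗ 𝒪_{K'}` as an algebra over `A ⊗ 𝒪_K`. -/
@[reducible]
def coeffAlgebra (A : TestAlg.{u} p E) : Algebra (Coeff p A K) (Coeff p A K') :=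
  (coeffIncl K K' A).toRingHom.toAlgebra

attribute [local instance] coeffAlgebra

theorem algebraMap_coeff (A : TestAlg.{u} p E) (s : Coeff p A K) :
    algebraMap (Coeff p A K) (Coeff p A K') s = coeffIncl K K' A s := rfl

instance (X : LocDatum.{u} p K K' E) : IsScalarTower (Coeff p X.A K) (Coeff p X.A K') X.L where
  smul_assoc s x l := by rw [Algebra.smul_def, mul_smul]; rfl

namespace TameTotRam

variable (T : TameTotRam p K K') (A : TestAlg.{u} p E)

/-- The uniformiser `π'` as an element of `A ⊗ 𝒪_{K'}`. -/
def unif : Coeff p A K' := 1 ⊗ₜ[ℤ_[p]] T.π'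

/-- The uniformiser `π` as an element of `A ⊗ 𝒪_K`. -/
def unifBase : Coeff p A K := 1 ⊗ₜ[ℤ_[p]] T.π

theorem unif_pow : T.unif A ^ Module.finrank K K' = coeffIncl K K' A (T.unifBase A) := by
  rw [unif, Algebra.TensorProduct.tmul_pow, one_pow, T.pow_eq]; rfl

theorem unif_mem (I : Ideal (Coeff p A K')) (hI : I.IsMaximal) : T.unif A ∈ I :=
  one_tmul_mem_of_isMaximal A T.not_isUnit_π' I hI

theorem not_isUnit_π : ¬IsUnit T.π := fun h => T.not_isUnit_π' <| by
  have := h.map (intIncl p K K')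
  rw [← T.pow_eq] at this
  exact (isUnit_pow_iff T.finrank_pos.ne').1 this

theorem unifBase_mem (I : Ideal (Coeff p A K)) (hI : I.IsMaximal) : T.unifBase A ∈ I :=
  one_tmul_mem_of_isMaximal A T.not_isUnit_π I hI

/-- The isomorphism `(A ⊗ 𝒪_K) ^ n ≃ A ⊗ 𝒪_{K'}`, `c ↦ ∑ c_i π' ^ i`. -/
def coeffCombine : (Fin (Module.finrank K K') → Coeff p A K) ≃ₗ[A.carrier] Coeff p A K' :=
  (TensorProduct.piRight ℤ_[p] A.carrier A.carrier fun _ => OInt p K).symm ≪≫ₗ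
    TensorProduct.AlgebraTensorModule.congr (LinearEquiv.refl A.carrier A.carrier) T.combineEquiv

theorem coeffCombine_apply (c : Fin (Module.finrank K K') → Coeff p A K) :
    T.coeffCombine A c = ∑ i, coeffIncl K K' A (c i) * T.unif A ^ (i : ℕ) := by
  obtain ⟨t, rfl⟩ := (TensorProduct.piRight ℤ_[p] A.carrier A.carrier fun _ => OInt p K).surjective c
  rw [coeffCombine, LinearEquiv.trans_apply, LinearEquiv.symm_apply_apply]
  induction t using TensorProduct.induction_on with
  | zero => simp
  | add x y hx hy => simp only [map_add, Pi.add_apply, add_mul, Finset.sum_add_distrib, hx, hy]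
  | tmul a v =>
    rw [TensorProduct.AlgebraTensorModule.congr_tmul]
    show a ⊗ₜ[ℤ_[p]] T.combine v = _
    rw [combine_apply, TensorProduct.tmul_sum]
    refine Finset.sum_congr rfl fun i _ => ?_
    simp [coeffIncl, unif, Algebra.TensorProduct.tmul_pow]

variable {A} in
theorem exists_eq_sum (z : Coeff p A K') : ∃ c : Fin (Module.finrank K K') → Coeff p A K,
    z = ∑ i, c i • T.unif A ^ (i : ℕ) := by
  obtain ⟨c, rfl⟩ := (T.coeffCombine A).surjective z
  exact ⟨c, by rw [coeffCombine_apply]; simp only [Algebra.smul_def]; rfl⟩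

theorem linearIndependent_unif_pow :
    LinearIndependent (Coeff p A K) fun i : Fin (Module.finrank K K') => T.unif A ^ (i : ℕ) := by
  rw [Fintype.linearIndependent_iff]
  intro c hc
  have : T.coeffCombine A c = 0 := by
    rw [coeffCombine_apply, ← hc]
    simp only [Algebra.smul_def]; rfl
  exact congrFun ((T.coeffCombine A).map_eq_zero_iff.1 this)

/-- The basis `1, π', …, π' ^ (n - 1)` of `A ⊗ 𝒪_{K'}` over `A ⊗ 𝒪_K`. -/
def unifBasis : Module.Basis (Fin (Module.finrank K K')) (Coeff p A K) (Coeff p A K') :=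
  Module.Basis.mk (T.linearIndependent_unif_pow A) fun z _ => by
    obtain ⟨c, rfl⟩ := T.exists_eq_sum z
    exact Submodule.sum_mem _ fun i _ => Submodule.smul_mem _ _ (Submodule.subset_span ⟨i, rfl⟩)

include T in
theorem coeff_finite : Module.Finite (Coeff p A K) (Coeff p A K') :=
  Module.Finite.of_basis (T.unifBasis A)

include T in
theorem coeffIncl_injective : Function.Injective (algebraMap (Coeff p A K) (Coeff p A K')) := by
  have := Module.Free.of_basis (T.unifBasis A)
  rw [injective_iff_map_eq_zero]
  intro s hs
  have h1 := Fintype.linearIndependent_iff.1 (T.linearIndependent_unif_pow A) (fun _ => s)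
    (Finset.sum_eq_zero fun i _ => by rw [Algebra.smul_def, hs, zero_mul])
  exact h1 ⟨0, T.finrank_pos⟩

theorem exists_eq_algebraMap_add (z : Coeff p A K') :
    ∃ s z', z = algebraMap (Coeff p A K) (Coeff p A K') s + T.unif A * z' := by
  obtain ⟨c, rfl⟩ := T.exists_eq_sum z
  have h0 := T.finrank_pos
  refine ⟨c ⟨0, h0⟩, ∑ i : Fin (Module.finrank K K'),
    if (i : ℕ) = 0 then 0 else c i • T.unif A ^ ((i : ℕ) - 1), ?_⟩
  rw [Finset.mul_sum, ← Finset.add_sum_erase _ _ (Finset.mem_univ (⟨0, h0⟩ : Fin _)),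
    ← Finset.add_sum_erase _ _ (Finset.mem_univ (⟨0, h0⟩ : Fin _))]
  simp only [pow_zero, if_true, mul_zero, zero_add]
  congr 1
  · rw [Algebra.smul_def, mul_one]
  · refine Finset.sum_congr rfl fun i hi => ?_
    have hi0 : (i : ℕ) ≠ 0 := fun h => (Finset.mem_erase.1 hi).1 (Fin.ext h)
    rw [if_neg hi0, mul_smul_comm, mul_pow_sub_one hi0]

variable {A} in
theorem coeff_induction {P : Coeff p A K' → Prop} (h1 : ∀ s, P (coeffIncl K K' A s))
    (h2 : P (T.unif A)) (hadd : ∀ y z, P y → P z → P (y + z)) (hmul : ∀ y z, P y → P z → P (y * z))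
    (z : Coeff p A K') : P z := by
  obtain ⟨c, rfl⟩ := T.exists_eq_sum z
  have h0 : P 0 := by simpa using h1 0
  have h1' : P 1 := by simpa using h1 1
  refine Finset.sum_induction _ P hadd h0 fun i _ => ?_
  rw [Algebra.smul_def]
  refine hmul _ _ (h1 _) ?_
  induction (i : ℕ) with
  | zero => rwa [pow_zero]
  | succ k ih => rw [pow_succ]; exact hmul _ _ ih h2

/-- `h(g)` as an element of `A ⊗ 𝒪_K`. -/
def hc (g : Gal(K'/K)) : Coeff p A K := 1 ⊗ₜ[ℤ_[p]] (T.hU g : OInt p K)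

theorem coeffGal_unif (g : Gal(K'/K)) :
    coeffGal A g (T.unif A) = coeffIncl K K' A (T.hc A g) * T.unif A := by
  simp only [unif, hc, coeffGal, coeffIncl, Algebra.TensorProduct.map_tmul, galAct_π', map_one,
    Algebra.TensorProduct.tmul_mul_tmul, one_mul]

theorem hc_mul (g g' : Gal(K'/K)) : T.hc A (g * g') = T.hc A g * T.hc A g' := by
  simp [hc]

theorem hc_one : T.hc A 1 = 1 := by simp [hc]; rfl

/-- The idempotent of `A ⊗ 𝒪_K` which cuts out the part on which `ξ = ξ₀ h ^ i`. -/
def wc (ξ₀ ξ : Gal(K'/K) →* (OInt p E)ˣ) (i : ℕ) : Coeff p A K :=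
  coeffOfInt A (T.wIdem ξ₀ ξ i)

/-- The value `ξ(g)` as an element of `A ⊗ 𝒪_K`. -/
def chc (ξ : Gal(K'/K) →* (OInt p E)ˣ) (g : Gal(K'/K)) : Coeff p A K :=
  algebraMap (OInt p E) A.carrier (ξ g) ⊗ₜ[ℤ_[p]] 1

theorem chc_mul (ξ : Gal(K'/K) →* (OInt p E)ˣ) (g g' : Gal(K'/K)) :
    chc A ξ (g * g') = chc A ξ g * chc A ξ g' := by
  simp [chc]

theorem chc_one (ξ : Gal(K'/K) →* (OInt p E)ˣ) : chc A ξ 1 = 1 := by simp [chc]; rfl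

section

variable (ξ₀ ξ ξ' : Gal(K'/K) →* (OInt p E)ˣ)

theorem chc_mul_wc (g : Gal(K'/K)) (i : ℕ) :
    chc A ξ g * T.wc A ξ₀ ξ i = chc A ξ₀ g * T.hc A g ^ i * T.wc A ξ₀ ξ i := by
  have := congrArg (coeffOfInt A) (T.tmul_mul_wIdem ξ₀ ξ g i)
  rw [map_mul, map_mul] at this
  simpa [wc, chc, hc, coeffOfInt, Algebra.TensorProduct.tmul_pow] using this

theorem wc_mul_self (i : ℕ) : T.wc A ξ₀ ξ i * T.wc A ξ₀ ξ i = T.wc A ξ₀ ξ i := by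
  rw [wc, ← map_mul, wIdem_mul_self]

theorem wc_mul_of_ne {i j : ℕ} (hi : i < Module.finrank K K') (hj : j < Module.finrank K K')
    (hij : i ≠ j) : T.wc A ξ₀ ξ i * T.wc A ξ₀ ξ j = 0 := by
  rw [wc, wc, ← map_mul, T.wIdem_mul_of_ne ξ₀ ξ hi hj hij, map_zero]

theorem sum_wc : ∑ i ∈ Finset.range (Module.finrank K K'), T.wc A ξ₀ ξ i = 1 := by
  simp only [wc]
  rw [← map_sum, sum_wIdem, map_one]

theorem wc_zero_of_ne (h : ξ₀ ≠ ξ) : T.wc A ξ₀ ξ 0 = 0 := by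
  rw [wc, T.wIdem_zero_of_ne ξ₀ ξ h, map_zero]

theorem wc_self_zero : T.wc A ξ₀ ξ₀ 0 = 1 := by
  rw [wc, wIdem_self_zero, map_one]

theorem wc_self_of_pos {i : ℕ} (h0 : 0 < i) (hi : i < Module.finrank K K') :
    T.wc A ξ₀ ξ₀ i = 0 := by
  have := T.wc_mul_of_ne A ξ₀ ξ₀ T.finrank_pos hi h0.ne
  rwa [wc_self_zero, one_mul] at this

theorem wc_mul_wc_of_ne (h : ξ ≠ ξ') (i : ℕ) : T.wc A ξ₀ ξ i * T.wc A ξ₀ ξ' i = 0 := by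
  rw [wc, wc, ← map_mul, T.wIdem_mul_wIdem_of_ne ξ₀ ξ ξ' h, map_zero]

theorem wc_swap {i : ℕ} (hi : i ≤ Module.finrank K K') :
    T.wc A ξ ξ₀ (Module.finrank K K' - i) = T.wc A ξ₀ ξ i := by
  rw [wc, T.wIdem_swap ξ₀ ξ hi, wc]

theorem coeffIncl_coeffOfInt (z : OInt p E ⊗[ℤ_[p]] OInt p K) :
    coeffIncl K K' A (coeffOfInt A z) = coeffOfInt A (inclD z) := by
  induction z using TensorProduct.induction_on with
  | zero => simp
  | tmul a y => rfl
  | add x y hx hy => simp only [map_add, hx, hy]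

theorem coeffOfInt_piElt (hE : Nonempty (K' →ₐ[ℚ_[p]] E)) (h : ξ₀ ≠ ξ) :
    coeffOfInt A (T.piElt ξ₀ ξ) = ∑ i ∈ Finset.range (Module.finrank K K'),
      T.unif A ^ i * coeffIncl K K' A (T.wc A ξ₀ ξ i) := by
  rw [T.piElt_eq ξ₀ ξ hE h, map_sum]
  refine Finset.sum_congr rfl fun i _ => ?_
  rw [map_mul, wc, coeffIncl_coeffOfInt]
  simp [coeffOfInt, unif, Algebra.TensorProduct.tmul_pow]

/-- The idempotent of `A ⊗ 𝒪_K` which cuts out the part on which `ξ = ξ₀ h ^ j` for some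
`i < j < n`. -/
def uc (i : ℕ) : Coeff p A K := 1 - ∑ j ∈ Finset.range (i + 1), T.wc A ξ₀ ξ j

/-- The element of `A ⊗ 𝒪_{K'}` which is `π' ^ (i - j)` on the part on which `ξ = ξ₀ h ^ j` for
some `j ≤ i`, and zero on the part on which `ξ = ξ₀ h ^ j` for some `i < j < n`. -/
def yc (i : ℕ) : Coeff p A K' :=
  ∑ j ∈ Finset.range (i + 1), T.unif A ^ (i - j) * coeffIncl K K' A (T.wc A ξ₀ ξ j)

theorem uc_zero (h : ξ₀ ≠ ξ) : T.uc A ξ₀ ξ 0 = 1 := by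
  simp [uc, T.wc_zero_of_ne A ξ₀ ξ h]

theorem uc_last : T.uc A ξ₀ ξ (Module.finrank K K' - 1) = 0 := by
  rw [uc, Nat.sub_add_cancel T.finrank_pos, sum_wc, sub_self]

theorem uc_succ (i : ℕ) : T.uc A ξ₀ ξ (i + 1) + T.wc A ξ₀ ξ (i + 1) = T.uc A ξ₀ ξ i := by
  rw [uc, uc, Finset.sum_range_succ _ (i + 1)]
  ring

theorem uc_mul_wc_of_le {i j : ℕ} (hji : j ≤ i) (hi : i < Module.finrank K K') :
    T.uc A ξ₀ ξ i * T.wc A ξ₀ ξ j = 0 := by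
  rw [uc, sub_mul, one_mul, Finset.sum_mul, Finset.sum_eq_single j, wc_mul_self, sub_self]
  · intro k hk hkj
    exact T.wc_mul_of_ne A ξ₀ ξ (by have := Finset.mem_range.1 hk; omega) (by omega) hkj
  · intro h
    exact absurd (Finset.mem_range.2 (by omega)) h

theorem uc_mul_wc_of_lt {i j : ℕ} (hij : i < j) (hj : j < Module.finrank K K') :
    T.uc A ξ₀ ξ i * T.wc A ξ₀ ξ j = T.wc A ξ₀ ξ j := by
  rw [uc, sub_mul, one_mul, Finset.sum_mul, Finset.sum_eq_zero, sub_zero]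
  intro k hk
  have := Finset.mem_range.1 hk
  exact T.wc_mul_of_ne A ξ₀ ξ (by omega) hj (by omega)

theorem uc_mul_of_le {i j : ℕ} (hij : i ≤ j) (hj : j < Module.finrank K K') :
    T.uc A ξ₀ ξ j * T.uc A ξ₀ ξ i = T.uc A ξ₀ ξ j := by
  conv_lhs => enter [2]; rw [uc]
  rw [mul_sub, mul_one, Finset.mul_sum, Finset.sum_eq_zero, sub_zero]
  intro k hk
  have := Finset.mem_range.1 hk
  exact T.uc_mul_wc_of_le A ξ₀ ξ (by omega) hj

theorem uc_mul_self {i : ℕ} (hi : i < Module.finrank K K') :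
    T.uc A ξ₀ ξ i * T.uc A ξ₀ ξ i = T.uc A ξ₀ ξ i := T.uc_mul_of_le A ξ₀ ξ le_rfl hi

theorem yc_zero (h : ξ₀ ≠ ξ) : T.yc A ξ₀ ξ 0 = 0 := by
  simp [yc, T.wc_zero_of_ne A ξ₀ ξ h]

/-- Going up one position multiplies the old contributions by π' and adds a new one where a = i+1.
Every induction along the staircase uses this recursion. -/
theorem yc_succ (i : ℕ) : T.yc A ξ₀ ξ (i + 1) =
    T.unif A * T.yc A ξ₀ ξ i + coeffIncl K K' A (T.wc A ξ₀ ξ (i + 1)) := by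
  rw [yc, Finset.sum_range_succ, Nat.sub_self, pow_zero, one_mul, yc, Finset.mul_sum]
  congr 1
  refine Finset.sum_congr rfl fun j hj => ?_
  rw [← mul_assoc, ← pow_succ', Nat.succ_sub (Nat.lt_succ_iff.1 (Finset.mem_range.1 hj))]

theorem yc_mul_wc_of_lt {i j : ℕ} (hij : i < j) (hj : j < Module.finrank K K') :
    T.yc A ξ₀ ξ i * coeffIncl K K' A (T.wc A ξ₀ ξ j) = 0 := by
  rw [yc, Finset.sum_mul]
  refine Finset.sum_eq_zero fun k hk => ?_
  have := Finset.mem_range.1 hk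
  rw [mul_assoc, ← map_mul, T.wc_mul_of_ne A ξ₀ ξ (by omega) hj (by omega), map_zero, mul_zero]

/-- Where a = j ≤ i, the two factors are π'^(i-j) and π'^j; where a > i, the first factor is zero.
-/
theorem yc_mul_piElt (hE : Nonempty (K' →ₐ[ℚ_[p]] E)) (h : ξ₀ ≠ ξ) {i : ℕ}
    (hi : i < Module.finrank K K') :
    T.yc A ξ₀ ξ i * coeffOfInt A (T.piElt ξ₀ ξ) =
      T.unif A ^ i * coeffIncl K K' A (1 - T.uc A ξ₀ ξ i) := by
  rw [uc, sub_sub_cancel, map_sum, Finset.mul_sum, yc, Finset.sum_mul]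
  refine Finset.sum_congr rfl fun j hj => ?_
  have hji := Finset.mem_range.1 hj
  rw [T.coeffOfInt_piElt A ξ₀ ξ hE h, Finset.mul_sum, Finset.sum_eq_single j]
  · rw [mul_mul_mul_comm, ← pow_add, Nat.sub_add_cancel (by omega), ← map_mul, wc_mul_self]
  · intro k hk hkj
    rw [mul_mul_mul_comm, ← map_mul,
      T.wc_mul_of_ne A ξ₀ ξ (by omega) (Finset.mem_range.1 hk) hkj.symm, map_zero, mul_zero]
  · intro h
    exact absurd (Finset.mem_range.2 (by omega)) h

theorem coeffOfInt_piElt_swap (hE : Nonempty (K' →ₐ[ℚ_[p]] E)) (h : ξ₀ ≠ ξ) :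
    coeffOfInt A (T.piElt ξ ξ₀) = ∑ i ∈ Finset.range (Module.finrank K K'),
      T.unif A ^ (Module.finrank K K' - i) * coeffIncl K K' A (T.wc A ξ₀ ξ i) := by
  obtain ⟨m, hm⟩ := Nat.exists_eq_add_of_lt T.finrank_pos
  rw [T.coeffOfInt_piElt A ξ ξ₀ hE h.symm]
  simp only [zero_add] at hm
  have h1 : ∀ i ∈ Finset.range (Module.finrank K K'), T.wc A ξ ξ₀ i =
      T.wc A ξ₀ ξ (Module.finrank K K' - i) := fun i hi =>
    (T.wc_swap A ξ ξ₀ (Finset.mem_range.1 hi).le).symm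
  rw [Finset.sum_congr rfl fun i hi => by rw [h1 i hi], hm, Finset.sum_range_succ',
    Finset.sum_range_succ', ← Finset.sum_range_reflect]
  -- The two terms of index 0, split off before the reflection, vanish because w_0 = 0 and w_n = 0
  -- for distinct characters.
  have hw : T.wc A ξ₀ ξ (m + 1) = 0 := by
    have := T.wc_swap A ξ ξ₀ (i := 0) (Nat.zero_le _)
    rw [Nat.sub_zero, hm, T.wc_zero_of_ne A ξ ξ₀ h.symm] at this
    exact this
  rw [Nat.sub_zero, hw, T.wc_zero_of_ne A ξ₀ ξ h]
  simp only [map_zero, mul_zero, add_zero]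
  refine Finset.sum_congr rfl fun i hi => ?_
  have := Finset.mem_range.1 hi
  rw [show m - 1 - i + 1 = m + 1 - (i + 1) by omega, show m + 1 - (m + 1 - (i + 1)) = i + 1 by omega]

/-- One more step after the last position closes the cycle: π' · π'^(n-1-a) = π'^(n-a), and n - a is
the exponent of π₂. -/
theorem unif_mul_yc_last (hE : Nonempty (K' →ₐ[ℚ_[p]] E)) (h : ξ₀ ≠ ξ) :
    T.unif A * T.yc A ξ₀ ξ (Module.finrank K K' - 1) = coeffOfInt A (T.piElt ξ ξ₀) := by
  have h0 := T.finrank_pos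
  rw [T.coeffOfInt_piElt_swap A ξ₀ ξ hE h, yc, Finset.mul_sum, Nat.sub_add_cancel h0]
  refine Finset.sum_congr rfl fun j hj => ?_
  have := Finset.mem_range.1 hj
  rw [← mul_assoc, ← pow_succ', show Module.finrank K K' - 1 - j + 1 = Module.finrank K K' - j by
    omega]

theorem piElt_mul_piElt (hE : Nonempty (K' →ₐ[ℚ_[p]] E)) (h : ξ₀ ≠ ξ) :
    coeffOfInt A (T.piElt ξ ξ₀) * coeffOfInt A (T.piElt ξ₀ ξ) =
      coeffIncl K K' A (T.unifBase A) := by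
  have h0 := T.finrank_pos
  rw [← T.unif_mul_yc_last A ξ₀ ξ hE h, mul_assoc, T.yc_mul_piElt A ξ₀ ξ hE h (by omega), uc_last,
    sub_zero, map_one, mul_one, ← pow_succ', Nat.sub_add_cancel h0, unif_pow]

end

end TameTotRam

end CoeffRings

/-! ### The decomposition of a lattice with an action of the Galois group -/

section Isotypic

set_option linter.unusedSectionVars false

variable {p : ℕ} [Fact p.Prime]
  {K K' E : Type u} [Field K] [Field K'] [Field E]
  [Algebra ℚ_[p] K] [Algebra ℤ_[p] K] [IsScalarTower ℤ_[p] ℚ_[p] K]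
  [Algebra ℚ_[p] K'] [Algebra ℤ_[p] K'] [IsScalarTower ℤ_[p] ℚ_[p] K']
  [Algebra ℚ_[p] E] [Algebra ℤ_[p] E] [IsScalarTower ℤ_[p] ℚ_[p] E]
  [Algebra K K'] [IsScalarTower ℚ_[p] K K'] [IsScalarTower ℤ_[p] K K']
  [FiniteDimensional K K'] [FiniteDimensional ℚ_[p] K] [FiniteDimensional ℚ_[p] K']
  [FiniteDimensional ℚ_[p] E]


attribute [local instance] coeffAlgebra

namespace TameTotRam

variable (T : TameTotRam p K K') (A : TestAlg.{u} p E)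

theorem hc_pow_finrank (g : Gal(K'/K)) : T.hc A g ^ Module.finrank K K' = 1 := by
  rw [hc, Algebra.TensorProduct.tmul_pow, T.hU_pow_finrank, one_pow]
  rfl

theorem sum_range_hc_pow (g : Gal(K'/K)) (hg : g ≠ 1) :
    ∑ i ∈ Finset.range (Module.finrank K K'), T.hc A g ^ i = 0 := by
  simp only [hc, Algebra.TensorProduct.tmul_pow, one_pow]
  rw [← TensorProduct.tmul_sum, T.sum_range_hU_pow g hg, TensorProduct.tmul_zero]

theorem sum_hc_pow_eq_zero {k : ℕ} (hk : ¬Module.finrank K K' ∣ k) :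
    ∑ g : Gal(K'/K), T.hc A g ^ k = 0 := by
  simp only [hc, Algebra.TensorProduct.tmul_pow, one_pow]
  rw [← TensorProduct.tmul_sum, T.sum_hU_pow_eq_zero hk, TensorProduct.tmul_zero]

/-- The inverse of the order of the Galois group. -/
def invc (p : ℕ) [Fact p.Prime] (K K' : Type u) {E : Type u} [Field K] [Field K'] [Field E]
    [Algebra K K'] [Algebra ℤ_[p] K] [Algebra ℤ_[p] E] (A : TestAlg.{u} p E) : Coeff p A K :=
  algebraMap (OInt p E) A.carrier (Ring.inverse (Nat.card Gal(K'/K) : OInt p E)) ⊗ₜ[ℤ_[p]] 1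

include T in
theorem natCard_mul_invc : (Nat.card Gal(K'/K) : Coeff p A K) * invc p K K' A = 1 := by
  have := congrArg (algebraMap A.carrier (Coeff p A K))
    (congrArg (algebraMap (OInt p E) A.carrier) (LocDatum.natCard_gal_mul_inverse (E := E) T))
  rw [map_mul, map_mul, map_natCast, map_natCast, map_one, map_one] at this
  exact this

end TameTotRam

namespace LocDatum

variable (T : TameTotRam p K K') (η ξ : Gal(K'/K) →* (OInt p E)ˣ) (X : LocDatum.{u} p K K' E)

theorem chc_smul (g : Gal(K'/K)) (l : X.L) :
    TameTotRam.chc X.A ξ g • l = algebraMap (OInt p E) X.A.carrier (ξ g) • l := by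
  rw [← algebraMap_smul (Coeff p X.A K) (algebraMap (OInt p E) X.A.carrier (ξ g))]; rfl

theorem mem_eigen {l : X.L} :
    l ∈ X.eigen ξ ↔ ∀ g, X.ρ g l = TameTotRam.chc X.A ξ g • l := by
  simp only [chc_smul]; rfl

theorem ρ_smul (g : Gal(K'/K)) (s : Coeff p X.A K) (l : X.L) : X.ρ g (s • l) = s • X.ρ g l := by
  rw [coeff_smul_def, X.semilinear, coeffGal_coeffIncl]; rfl

theorem ρ_unif_smul (g : Gal(K'/K)) (l : X.L) :
    X.ρ g (T.unif X.A • l) = T.unif X.A • T.hc X.A g • X.ρ g l := by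
  rw [X.semilinear, T.coeffGal_unif, mul_comm, mul_smul]; rfl

/-- The submodule of `𝔏` on which the Galois group acts through `η h ^ i`. -/
def isotypic (i : ℕ) : Submodule (Coeff p X.A K) X.L where
  carrier := {l | ∀ g, X.ρ g l = (TameTotRam.chc X.A η g * T.hc X.A g ^ i) • l}
  add_mem' {l m} hl hm g := by rw [map_add, hl g, hm g, smul_add]
  zero_mem' g := by simp
  smul_mem' x l hl g := by rw [ρ_smul, hl g, smul_comm]

theorem isotypic_zero : X.isotypic T η 0 = X.eigen η := by
  ext l
  rw [mem_eigen]
  simp [isotypic]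

variable {X}

theorem unif_smul_mem_isotypic {i : ℕ} {l : X.L} (hl : l ∈ X.isotypic T η i) :
    T.unif X.A • l ∈ X.isotypic T η (i + 1) := fun g => by
  rw [ρ_unif_smul, hl g, smul_comm (TameTotRam.chc X.A η g * T.hc X.A g ^ (i + 1)), ← mul_smul]
  congr 2
  ring

/-- On the support of w_i the characters η h^i and ξ agree, so there part i of the lattice and the
ξ-eigenspace are exchanged freely. The next statement is the opposite direction. -/
theorem wc_smul_mem_eigen {i : ℕ} {l : X.L} (hl : l ∈ X.isotypic T η i) :
    T.wc X.A η ξ i • l ∈ X.eigen ξ := (X.mem_eigen ξ).2 fun g => by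
  rw [ρ_smul, hl g, ← mul_smul, ← mul_smul, T.chc_mul_wc, mul_comm]

theorem wc_smul_mem_isotypic {i : ℕ} {l : X.L} (hl : l ∈ X.eigen ξ) :
    T.wc X.A η ξ i • l ∈ X.isotypic T η i := fun g => by
  rw [ρ_smul, (X.mem_eigen ξ).1 hl g, ← mul_smul, ← mul_smul, ← T.chc_mul_wc, mul_comm]

variable (X)

/-- The projector to the submodule on which the Galois group acts through `η h ^ i`. -/
def isotypicProj (i : ℕ) : X.L →ₗ[Coeff p X.A K] X.L where
  toFun l := ∑ g : Gal(K'/K),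
    (TameTotRam.invc p K K' X.A * (TameTotRam.chc X.A η g⁻¹ * T.hc X.A g⁻¹ ^ i)) • X.ρ g l
  map_add' l m := by simp only [map_add, smul_add, Finset.sum_add_distrib]
  map_smul' s l := by
    simp only [ρ_smul, RingHom.id_apply, Finset.smul_sum]
    exact Finset.sum_congr rfl fun g _ => smul_comm _ _ _

theorem isotypicProj_apply (i : ℕ) (l : X.L) : X.isotypicProj T η i l = ∑ g : Gal(K'/K),
    (TameTotRam.invc p K K' X.A * (TameTotRam.chc X.A η g⁻¹ * T.hc X.A g⁻¹ ^ i)) • X.ρ g l := rfl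

theorem isotypicProj_mem (i : ℕ) (l : X.L) : X.isotypicProj T η i l ∈ X.isotypic T η i := by
  intro h
  rw [isotypicProj_apply, map_sum, Finset.smul_sum]
  refine Fintype.sum_equiv (Equiv.mulLeft h) _ _ fun g => ?_
  rw [ρ_smul, ← Module.End.mul_apply, ← map_mul, ← mul_smul, Equiv.coe_mulLeft]
  congr 1
  have e1 : TameTotRam.chc X.A η g⁻¹ = TameTotRam.chc X.A η (h * g)⁻¹ * TameTotRam.chc X.A η h := by
    rw [← TameTotRam.chc_mul]; congr 1; group
  have e2 : T.hc X.A g⁻¹ = T.hc X.A (h * g)⁻¹ * T.hc X.A h := by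
    rw [← TameTotRam.hc_mul]; congr 1; group
  rw [e1, e2]
  ring

include T in
theorem sum_invc_smul (l : X.L) : ∑ _g : Gal(K'/K), TameTotRam.invc p K K' X.A • l = l := by
  rw [Finset.sum_const, Finset.card_univ, ← Nat.card_eq_fintype_card,
    ← Nat.cast_smul_eq_nsmul (Coeff p X.A K), ← mul_smul, T.natCard_mul_invc, one_smul]

variable {X} in
theorem isotypicProj_eq_self {i : ℕ} {l : X.L} (hl : l ∈ X.isotypic T η i) :
    X.isotypicProj T η i l = l := by
  rw [isotypicProj_apply]
  conv_rhs => rw [← sum_invc_smul T X l]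
  refine Finset.sum_congr rfl fun g _ => ?_
  rw [hl g, ← mul_smul]
  congr 1
  have e1 : TameTotRam.chc X.A η g⁻¹ * TameTotRam.chc X.A η g = 1 := by
    rw [← TameTotRam.chc_mul, inv_mul_cancel, TameTotRam.chc_one]
  have e2 : T.hc X.A g⁻¹ * T.hc X.A g = 1 := by
    rw [← TameTotRam.hc_mul, inv_mul_cancel, TameTotRam.hc_one]
  rw [mul_assoc, mul_mul_mul_comm, e1, ← mul_pow, e2, one_pow, one_mul, mul_one]

theorem sum_isotypicProj (l : X.L) :
    ∑ i ∈ Finset.range (Module.finrank K K'), X.isotypicProj T η i l = l := by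
  simp only [isotypicProj_apply]
  rw [Finset.sum_comm, Finset.sum_eq_single 1]
  · conv_rhs => rw [← sum_invc_smul T X l]
    simp only [inv_one, TameTotRam.chc_one, TameTotRam.hc_one, one_pow, mul_one, map_one,
      Module.End.one_apply, Finset.sum_const, Finset.card_range, Finset.card_univ,
      ← Nat.card_eq_fintype_card, T.natCard_gal]
  · intro g _ hg
    rw [← Finset.sum_smul, ← Finset.mul_sum, ← Finset.mul_sum,
      T.sum_range_hc_pow X.A _ (inv_ne_one.2 hg), mul_zero, mul_zero, zero_smul]
  · intro h
    exact absurd (Finset.mem_univ _) h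

variable {X} in
theorem isotypicProj_of_ne {i j : ℕ} (hi : i < Module.finrank K K') (hj : j < Module.finrank K K')
    (hij : i ≠ j) {l : X.L} (hl : l ∈ X.isotypic T η j) : X.isotypicProj T η i l = 0 := by
  have hk : ¬Module.finrank K K' ∣ j + (Module.finrank K K' - i) := by
    rintro ⟨c, hc⟩
    have h1 : c = 1 := by
      rcases Nat.lt_trichotomy c 1 with h | h | h
      · obtain rfl : c = 0 := by omega
        omega
      · exact h
      · have := Nat.mul_le_mul_left (Module.finrank K K') h
        omega
    rw [h1] at hc
    omega
  rw [isotypicProj_apply]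
  have : ∀ g : Gal(K'/K),
      (TameTotRam.invc p K K' X.A * (TameTotRam.chc X.A η g⁻¹ * T.hc X.A g⁻¹ ^ i)) • X.ρ g l =
      (TameTotRam.invc p K K' X.A * T.hc X.A g ^ (j + (Module.finrank K K' - i))) • l := fun g => by
    rw [hl g, ← mul_smul]
    congr 1
    have e1 : TameTotRam.chc X.A η g⁻¹ * TameTotRam.chc X.A η g = 1 := by
      rw [← TameTotRam.chc_mul, inv_mul_cancel, TameTotRam.chc_one]
    have e2 : T.hc X.A g⁻¹ ^ i * T.hc X.A g ^ i = 1 := by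
      rw [← mul_pow, ← TameTotRam.hc_mul, inv_mul_cancel, TameTotRam.hc_one, one_pow]
    have e3 : T.hc X.A g ^ (Module.finrank K K' - i) * T.hc X.A g ^ i = 1 := by
      rw [← pow_add, Nat.sub_add_cancel hi.le, T.hc_pow_finrank]
    have e4 : T.hc X.A g⁻¹ ^ i = T.hc X.A g ^ (Module.finrank K K' - i) := by
      calc _ = T.hc X.A g⁻¹ ^ i * (T.hc X.A g ^ (Module.finrank K K' - i) * T.hc X.A g ^ i) := by
            rw [e3, mul_one]
        _ = (T.hc X.A g⁻¹ ^ i * T.hc X.A g ^ i) * T.hc X.A g ^ (Module.finrank K K' - i) := by ring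
        _ = _ := by rw [e2, one_mul]
    rw [mul_assoc, mul_mul_mul_comm, e1, e4, one_mul, pow_add, mul_comm (T.hc X.A g ^ j)]
  rw [Finset.sum_congr rfl fun g _ => this g, ← Finset.sum_smul, ← Finset.mul_sum,
    T.sum_hc_pow_eq_zero X.A hk, mul_zero, zero_smul]

/-- Multiplication by π' raises the degree by one because g(π') = h(g) π'. Together with h^n = 1
this gives the cyclic grading of 𝔏. -/
theorem isotypicProj_succ_unif_smul (i : ℕ) (l : X.L) :
    X.isotypicProj T η (i + 1) (T.unif X.A • l) = T.unif X.A • X.isotypicProj T η i l := by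
  rw [isotypicProj_apply, isotypicProj_apply, Finset.smul_sum]
  refine Finset.sum_congr rfl fun g _ => ?_
  rw [ρ_unif_smul, smul_comm _ (T.unif X.A), ← mul_smul]
  congr 2
  have e2 : T.hc X.A g⁻¹ * T.hc X.A g = 1 := by
    rw [← TameTotRam.hc_mul, inv_mul_cancel, TameTotRam.hc_one]
  rw [pow_succ, mul_assoc, mul_assoc, mul_assoc, e2, mul_one]

theorem isotypicProj_finrank : X.isotypicProj T η (Module.finrank K K') = X.isotypicProj T η 0 := by
  ext l
  simp only [isotypicProj_apply, T.hc_pow_finrank, pow_zero]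

theorem isotypicProj_zero_unif_smul (l : X.L) :
    X.isotypicProj T η 0 (T.unif X.A • l) =
      T.unif X.A • X.isotypicProj T η (Module.finrank K K' - 1) l := by
  rw [← isotypicProj_finrank, ← isotypicProj_succ_unif_smul, Nat.sub_add_cancel T.finrank_pos]

end LocDatum

end Isotypic

/-! ### The eigenspaces of a lattice of type `η ⊕ η'` -/

section TypeDecomposition

set_option linter.unusedSectionVars false

variable {p : ℕ} [Fact p.Prime]
  {K K' E : Type u} [Field K] [Field K'] [Field E]
  [Algebra ℚ_[p] K] [Algebra ℤ_[p] K] [IsScalarTower ℤ_[p] ℚ_[p] K]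
  [Algebra ℚ_[p] K'] [Algebra ℤ_[p] K'] [IsScalarTower ℤ_[p] ℚ_[p] K']
  [Algebra ℚ_[p] E] [Algebra ℤ_[p] E] [IsScalarTower ℤ_[p] ℚ_[p] E]
  [Algebra K K'] [IsScalarTower ℚ_[p] K K'] [IsScalarTower ℤ_[p] K K']
  [FiniteDimensional K K'] [FiniteDimensional ℚ_[p] K] [FiniteDimensional ℚ_[p] K']
  [FiniteDimensional ℚ_[p] E]


attribute [local instance] coeffAlgebra

theorem IsProjOfRank.subsingleton {R M : Type u} [CommRing R] [AddCommGroup M] [Module R M]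
    (h : IsProjOfRank R M 0) : Subsingleton M := by
  obtain ⟨_, _, h3⟩ := h
  exact (Module.rankAtStalk_eq_zero_iff_subsingleton (R := R)).1 (funext h3)

theorem IsProjOfRankOverQuotient.subsingleton {R M : Type u} [CommRing R] [AddCommGroup M]
    [Module R M] {I : Ideal R} (h : IsProjOfRankOverQuotient R M I 0) : Subsingleton M := by
  obtain ⟨_, _, h⟩ := h
  exact h.subsingleton

theorem IsProjOfRankOverQuotient.of_equiv {R M N : Type u} [CommRing R] [AddCommGroup M]
    [Module R M] [AddCommGroup N] [Module R N] {I : Ideal R} {r : ℕ} (e : M ≃ₗ[R] N)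
    (h : IsProjOfRankOverQuotient R M I r) : IsProjOfRankOverQuotient R N I r := by
  obtain ⟨m, ht, h1, h2, h3⟩ := h
  let mN : Module (R ⧸ I) N := e.symm.toAddEquiv.module (R ⧸ I)
  let e' : M ≃ₗ[R ⧸ I] N :=
    { e with map_smul' := fun a x => e.symm.injective (by
        show _ = e.symm (e (a • e.symm (e x)))
        simp) }
  refine ⟨mN, ⟨fun a b n => ?_⟩, Module.Finite.equiv e', Module.Projective.of_equiv e', fun x => ?_⟩
  · obtain ⟨x, rfl⟩ := e.surjective n
    have h4 : (a • b) • e' x = e' (a • b • x) := by rw [← map_smul, smul_assoc]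
    have h5 : b • e' x = e' (b • x) := by rw [map_smul]
    show (a • b) • e' x = a • b • e' x
    rw [h4, h5]
    exact e.map_smul a _
  · rw [← Module.rankAtStalk_eq_of_equiv e']
    exact h3 x

/-- A module which is projective of rank one over `R ⧸ I` is generated by one element up to a
scalar prime to a given prime containing `I`. -/
theorem IsProjOfRankOverQuotient.exists_generator {R M : Type u} [CommRing R] [AddCommGroup M]
    [Module R M] {I : Ideal R} (h : IsProjOfRankOverQuotient R M I 1) (𝔪 : Ideal R) [h𝔪 : 𝔪.IsPrime]
    (hI : I ≤ 𝔪) : ∃ c ∉ 𝔪, ∃ m₀ : M, ∀ m, ∃ r : R, r • m₀ = c • m := by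
  obtain ⟨_, _, h⟩ := h
  have hprime : (𝔪.map (Ideal.Quotient.mk I)).IsPrime :=
    Ideal.map_isPrime_of_surjective Ideal.Quotient.mk_surjective (by rwa [Ideal.mk_ker])
  obtain ⟨c, hc, φ, hφ⟩ := h.exists_isIsoUpTo (𝔪.map (Ideal.Quotient.mk I))
  obtain ⟨c, rfl⟩ := Ideal.Quotient.mk_surjective c
  refine ⟨c, fun h => hc (Ideal.mem_map_of_mem _ h), φ (Pi.single 0 1), fun m => ?_⟩
  obtain ⟨v, hv⟩ := hφ.surj m
  obtain ⟨r, hr⟩ := Ideal.Quotient.mk_surjective (v 0)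
  refine ⟨r, ?_⟩
  have e1 : ∀ (a : R) (x : M), Ideal.Quotient.mk I a • x = a • x := fun a x =>
    algebraMap_smul (R ⧸ I) a x
  rw [← e1, ← e1, ← hv, ← map_smul, hr]
  congr 1
  ext i
  rw [Subsingleton.elim i 0]
  simp

theorem IsProjOfRankOverQuotient.exists_smul_eq_add {R M N : Type u} [CommRing R] [AddCommGroup M]
    [Module R M] [AddCommGroup N] [Module R N] {f : N →ₗ[R] M} {I : Ideal R}
    (h : IsProjOfRankOverQuotient R (M ⧸ LinearMap.range f) I 1) (𝔪 : Ideal R) [h𝔪 : 𝔪.IsPrime]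
    (hI : I ≤ 𝔪) : ∃ c ∉ 𝔪, ∃ m₀ : M, ∀ m, ∃ (r : R) (n : N), c • m = r • m₀ + f n := by
  obtain ⟨c, hc, z, hz⟩ := h.exists_generator 𝔪 hI
  obtain ⟨m₀, rfl⟩ := Submodule.Quotient.mk_surjective _ z
  refine ⟨c, hc, m₀, fun m => ?_⟩
  obtain ⟨r, hr⟩ := hz (Submodule.Quotient.mk m)
  rw [← Submodule.Quotient.mk_smul, ← Submodule.Quotient.mk_smul, eq_comm,
    Submodule.Quotient.eq] at hr
  obtain ⟨n, hn⟩ := hr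
  exact ⟨r, n, by rw [hn, add_sub_cancel]⟩

namespace LocDatum

variable (T : TameTotRam p K K') (η η' ξ : Gal(K'/K) →* (OInt p E)ˣ) (X : LocDatum.{u} p K K' E)

theorem mem_piL {l : X.L} : l ∈ X.piL T ↔ ∃ m, l = T.unif X.A • m := Iff.rfl

theorem unif_smul_mem_piL (l : X.L) : T.unif X.A • l ∈ X.piL T := ⟨l, rfl⟩

/-- The difference is a combination of the elements g l - ξ(g) l. So a vector that is a
ξ-eigenvector modulo π' can be corrected to a true one, and passing to eigenspaces commutes with
reduction modulo π'. -/
theorem sub_projector_mem_piL (l : X.L)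
    (hl : ∀ g, X.ρ g l - algebraMap (OInt p E) X.A.carrier (ξ g) • l ∈ X.piL T) :
    projector ξ X l - l ∈ X.piL T := by
  let b : X.A.carrier := algebraMap (OInt p E) X.A.carrier
    (Ring.inverse (Nat.card Gal(K'/K) : OInt p E))
  have hb : ∑ _g : Gal(K'/K), b • l = l := by
    rw [Finset.sum_const, Finset.card_univ, ← Nat.card_eq_fintype_card,
      ← Nat.cast_smul_eq_nsmul X.A.carrier, ← mul_smul,
      ← map_natCast (algebraMap (OInt p E) X.A.carrier), ← map_mul, natCard_gal_mul_inverse T,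
      map_one, one_smul]
  have h1 : projector ξ X l - l = ∑ g : Gal(K'/K), algebraMap (OInt p E) X.A.carrier
      (Ring.inverse (Nat.card Gal(K'/K) : OInt p E) * (ξ g⁻¹ : (OInt p E)ˣ)) •
        (X.ρ g l - algebraMap (OInt p E) X.A.carrier (ξ g) • l) := by
    conv_lhs => enter [2]; rw [← hb]
    rw [projector_apply, ← Finset.sum_sub_distrib]
    refine Finset.sum_congr rfl fun g _ => ?_
    rw [smul_sub, smul_smul, ← map_mul, mul_assoc, ← Units.val_mul, ← map_mul, inv_mul_cancel,
      map_one, Units.val_one, mul_one]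
  rw [h1]
  refine Submodule.sum_mem _ fun g _ => ?_
  exact (X.piL T).smul_of_tower_mem _ (hl g)

theorem residualEigen_eq : X.residualEigen T ξ = (X.eigen ξ).map (X.piL T).mkQ := by
  ext z
  constructor
  · rintro ⟨l, hl, rfl⟩
    refine ⟨projector ξ X l, projector_mem ξ X l, ?_⟩
    rw [Submodule.mkQ_apply, Submodule.mkQ_apply, Submodule.Quotient.eq]
    exact X.sub_projector_mem_piL T ξ l hl
  · rintro ⟨l, hl, rfl⟩
    refine ⟨l, fun g => ?_, rfl⟩
    rw [hl g, sub_self]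
    exact Submodule.zero_mem _

variable {X}

theorem isLocType.symm (h : X.isLocType T η η') : X.isLocType T η' η :=
  ⟨h.1, fun ξ => by rw [add_comm]; exact h.2 ξ⟩

variable {T η η'}

theorem isLocType.eigen_le (h : X.isLocType T η η') (h1 : ξ ≠ η) (h2 : ξ ≠ η') {l : X.L}
    (hl : l ∈ X.eigen ξ) : l ∈ X.piL T := by
  have h3 := h.2 ξ
  rw [if_neg h1, if_neg h2] at h3
  have h4 := h3.subsingleton
  have h5 : (X.piL T).mkQ l ∈ X.residualEigen T ξ := by
    rw [residualEigen_eq]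
    exact ⟨l, hl, rfl⟩
  have h6 := congrArg Subtype.val (Subsingleton.elim (⟨_, h5⟩ : X.residualEigen T ξ) 0)
  exact (Submodule.Quotient.mk_eq_zero _).1 h6

variable (T η) in
/-- The part of `𝔏` on which the Galois group acts through `η h ^ i` is built from eigenspaces. -/
theorem exists_idem_smul_mem_eigen (i : ℕ) (σ : Emb p K' E) : ∃ ξ : Gal(K'/K) →* (OInt p E)ˣ,
    (∀ g, (ξ g : OInt p E) = η g * σ (T.h g) ^ i) ∧
      ∀ l ∈ X.isotypic T η i, coeffOfInt X.A (T.idem σ) • l ∈ X.eigen ξ := by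
  let ξ : Gal(K'/K) →* (OInt p E)ˣ := η * (MonoidHom.toHomUnits
    (((σ : Witt p K' →* OInt p E)).comp T.hHom)) ^ i
  have hξ : ∀ g, (ξ g : OInt p E) = η g * σ (T.h g) ^ i := fun g => rfl
  refine ⟨ξ, hξ, fun l hl => ?_⟩
  -- On e_σ the 𝒪_K-valued character h becomes the 𝒪-valued character σ ∘ h, and only characters of
  -- the latter kind enter the type condition.
  have hh : ∀ g (m : X.L), coeffIncl K K' X.A (T.hc X.A g) • coeffOfInt X.A (T.idem σ) • m =
      algebraMap (OInt p E) X.A.carrier (σ (T.h g)) • coeffOfInt X.A (T.idem σ) • m := fun g m => by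
    have e1 := congrArg (coeffOfInt X.A) (T.mul_idem σ (T.h g))
    have e2 : coeffOfInt X.A ((1 : OInt p E) ⊗ₜ[ℤ_[p]] (T.h g : OInt p K')) =
        coeffIncl K K' X.A (T.hc X.A g) := by
      simp [coeffOfInt, TameTotRam.hc, coeffIncl, T.intIncl_hU]
    have e3 : coeffOfInt X.A ((σ (T.h g)) ⊗ₜ[ℤ_[p]] (1 : OInt p K')) =
        algebraMap X.A.carrier (Coeff p X.A K') (algebraMap (OInt p E) X.A.carrier (σ (T.h g))) :=
      rfl
    rw [map_mul, map_mul, e2, e3] at e1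
    rw [← mul_smul, e1, mul_smul, algebraMap_smul]
  have hpow : ∀ g (k : ℕ), T.hc X.A g ^ k • coeffOfInt X.A (T.idem σ) • l =
      algebraMap (OInt p E) X.A.carrier (σ (T.h g)) ^ k • coeffOfInt X.A (T.idem σ) • l := by
    intro g k
    induction k with
    | zero => simp
    | succ k ih =>
      rw [pow_succ, mul_smul, coeff_smul_def X (T.hc X.A g), hh, smul_comm, ih, ← mul_smul,
        ← pow_succ']
  intro g
  rw [X.semilinear, coeffGal_coeffOfInt, T.map_galAct_idem, hl g, mul_smul, chc_smul, hξ, map_mul,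
    map_pow, mul_smul, smul_comm (coeffOfInt X.A (T.idem σ))]
  congr 1
  rw [smul_comm (coeffOfInt X.A (T.idem σ))]
  exact hpow g i

/-- Over e_σ the element l is an eigenvector for ξ = η · σ∘h^i. If ξ = η', the factor 1 - w_i kills
it; ξ = η is impossible for 0 < i < n; any other ξ has multiplicity zero in the type, so the element
lies in π'𝔏. -/
theorem isLocType.sub_wc_smul_mem_piL (h : X.isLocType T η η') (hE : Nonempty (K' →ₐ[ℚ_[p]] E))
    {i : ℕ} (h0 : 0 < i) (hi : i < Module.finrank K K') {l : X.L} (hl : l ∈ X.isotypic T η i) :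
    (1 - T.wc X.A η η' i) • l ∈ X.piL T := by
  classical
  have := T.finite_emb (E := E)
  let _ := Fintype.ofFinite (Emb p K' E)
  have hsum : (1 - T.wc X.A η η' i) • l =
      ∑ σ : Emb p K' E, (1 - T.wc X.A η η' i) • coeffOfInt X.A (T.idem σ) • l := by
    rw [← Finset.smul_sum, ← Finset.sum_smul, ← map_sum, T.sum_idem hE, map_one, one_smul]
  rw [hsum]
  refine Submodule.sum_mem _ fun σ _ => ?_
  obtain ⟨ξ, hξ, hmem⟩ := exists_idem_smul_mem_eigen (X := X) T η i σ
  by_cases h2 : ξ = η'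
  · have e1 : T.wc X.A η η' i • coeffOfInt X.A (T.idem σ) • l = coeffOfInt X.A (T.idem σ) • l := by
      rw [coeff_smul_def, ← mul_smul, TameTotRam.wc, TameTotRam.coeffIncl_coeffOfInt,
        ← map_mul, T.inclD_wIdem_mul_idem (fun g => by rw [← h2, hξ])]
    rw [sub_smul, one_smul, e1, sub_self]
    exact Submodule.zero_mem _
  by_cases h1 : ξ = η
  · exact absurd (T.exponent_unique hi T.finrank_pos hξ fun g => by rw [h1, pow_zero, mul_one]) h0.ne'
  · exact Submodule.smul_mem _ _ (h.eigen_le ξ h1 h2 (hmem l hl))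

end LocDatum

end TypeDecomposition

/-! ### The eigenspaces of a lattice of type `η ⊕ η'` form a lattice chain -/

section ToChain

set_option linter.unusedSectionVars false

variable {p : ℕ} [Fact p.Prime]
  {K K' E : Type u} [Field K] [Field K'] [Field E]
  [Algebra ℚ_[p] K] [Algebra ℤ_[p] K] [IsScalarTower ℤ_[p] ℚ_[p] K]
  [Algebra ℚ_[p] K'] [Algebra ℤ_[p] K'] [IsScalarTower ℤ_[p] ℚ_[p] K']
  [Algebra ℚ_[p] E] [Algebra ℤ_[p] E] [IsScalarTower ℤ_[p] ℚ_[p] E]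
  [Algebra K K'] [IsScalarTower ℚ_[p] K K'] [IsScalarTower ℤ_[p] K K']
  [FiniteDimensional K K'] [FiniteDimensional ℚ_[p] K] [FiniteDimensional ℚ_[p] K']
  [FiniteDimensional ℚ_[p] E]


attribute [local instance] coeffAlgebra

/-- A pair of modules with maps whose composites lie in a maximal ideal, and with cokernels
generated by one element up to a scalar prime to it, is generated by two compatible pairs of
elements up to such a scalar. -/
theorem exists_chain_generators {R M N : Type u} [CommRing R] [AddCommGroup M] [Module R M]
    [AddCommGroup N] [Module R N] [Module.Finite R M] (𝔪 : Ideal R) [h𝔪 : 𝔪.IsMaximal] {π : R}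
    (hπ : π ∈ 𝔪) (f : M →ₗ[R] N) (f' : N →ₗ[R] M) (hf : ∀ m, f' (f m) = π • m)
    {c d : R} (hc : c ∉ 𝔪) (hd : d ∉ 𝔪) {m₀ : M} {n₀ : N}
    (hm : ∀ m, ∃ (r : R) (n : N), c • m = r • m₀ + f' n)
    (hn : ∀ n, ∃ (r : R) (m : M), d • n = r • n₀ + f m) :
    ∃ a ∉ 𝔪, ∀ m, ∃ r s : R, a • m = r • m₀ + s • f' n₀ := by
  let P : Submodule R M := Submodule.span R {m₀, f' n₀}
  have hcd : d * c ∉ 𝔪 := fun h => (h𝔪.isPrime.mem_or_mem h).elim hd hc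
  obtain ⟨t, ht⟩ := h𝔪.exists_inv hcd
  -- Applying both generation hypotheses in turn leaves an error in f'(f(M)) = π M. As d c is
  -- invertible modulo 𝔪, Nakayama applies to M/P.
  have hle : (⊤ : Submodule R (M ⧸ P)) ≤ 𝔪 • ⊤ := by
    rintro z -
    obtain ⟨m, rfl⟩ := P.mkQ_surjective z
    obtain ⟨r, n, h1⟩ := hm m
    obtain ⟨s, m', h2⟩ := hn n
    have h3 : P.mkQ ((d * c) • m) = π • P.mkQ m' := by
      rw [← map_smul, ← sub_eq_zero, ← map_sub, Submodule.mkQ_apply, Submodule.Quotient.mk_eq_zero,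
        mul_smul, h1, smul_add, ← map_smul f', h2, map_add, map_smul, hf, smul_smul, ← add_assoc,
        add_sub_cancel_right]
      exact P.add_mem (P.smul_mem _ (Submodule.subset_span (by simp)))
        (P.smul_mem _ (Submodule.subset_span (by simp)))
    obtain ⟨b, hb, hbt⟩ := ht
    rw [← one_smul R (P.mkQ m), ← hbt, add_smul, mul_smul, ← map_smul P.mkQ (d * c), h3]
    exact Submodule.add_mem _ (Submodule.smul_mem _ _ (Submodule.smul_mem_smul hπ
      Submodule.mem_top)) (Submodule.smul_mem_smul hb Submodule.mem_top)
  obtain ⟨a, ha, ha'⟩ := Submodule.exists_sub_one_mem_and_smul_eq_zero_of_fg_of_le_smul 𝔪 ⊤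
    (Module.Finite.fg_top (R := R) (M := M ⧸ P)) hle
  refine ⟨a, fun h => h𝔪.ne_top ?_, fun m => ?_⟩
  · rw [Ideal.eq_top_iff_one]
    simpa using Ideal.sub_mem _ h ha
  · have h1 := ha' (P.mkQ m) Submodule.mem_top
    rw [← map_smul, Submodule.mkQ_apply, Submodule.Quotient.mk_eq_zero] at h1
    obtain ⟨r, s, h2⟩ := Submodule.mem_span_pair.1 h1
    exact ⟨r, s, h2.symm⟩

namespace LocDatum

variable {T : TameTotRam p K K'} {η η' : Gal(K'/K) →* (OInt p E)ˣ} {X : LocDatum.{u} p K K' E}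

theorem exists_isotypic_of_mem_piL {i : ℕ} {l : X.L} (hl : l ∈ X.isotypic T η (i + 1))
    (h : l ∈ X.piL T) : ∃ m ∈ X.isotypic T η i, l = T.unif X.A • m := by
  obtain ⟨m, hm⟩ := (X.mem_piL T).1 h
  exact ⟨X.isotypicProj T η i m, X.isotypicProj_mem T η i m, by
    rw [← isotypicProj_succ_unif_smul, ← hm, isotypicProj_eq_self T η hl]⟩

/-- Induction on i. Off the support of w_i the type condition allows division by π', which lowers
the degree by one; on the support the element already lies in 𝔏_{η'}. -/
theorem isLocType.exists_eq_of_mem_isotypic (h : X.isLocType T η η')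
    (hE : Nonempty (K' →ₐ[ℚ_[p]] E)) {i : ℕ} (hi : i < Module.finrank K K') {l : X.L}
    (hl : l ∈ X.isotypic T η i) : ∃ m ∈ X.eigen η, ∃ m' ∈ X.eigen η',
      l = T.unif X.A ^ i • m + T.yc X.A η η' i • m' := by
  induction i generalizing l with
  | zero =>
    rw [isotypic_zero] at hl
    exact ⟨l, hl, 0, Submodule.zero_mem _, by simp⟩
  | succ i ih =>
    obtain ⟨l', hl', he⟩ := exists_isotypic_of_mem_piL
      (Submodule.smul_mem _ (1 - T.wc X.A η η' (i + 1)) hl)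
      (h.sub_wc_smul_mem_piL hE (Nat.succ_pos i) hi hl)
    obtain ⟨m, hm, m', hm', rfl⟩ := ih (by omega) hl'
    have hw := wc_smul_mem_eigen T η η' hl
    -- The old η'-component is kept off w_(i+1) and replaced by l itself on w_(i+1). There y_(i+1)
    -- acts as 1, and off it y_(i+1) acts as π' y_i.
    refine ⟨m, hm, (1 - T.wc X.A η η' (i + 1)) • m' + T.wc X.A η η' (i + 1) • l,
      Submodule.add_mem _ (Submodule.smul_mem _ _ hm') hw, ?_⟩
    have e1 : l = (1 - T.wc X.A η η' (i + 1)) • l + T.wc X.A η η' (i + 1) • l := by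
      rw [← add_smul, sub_add_cancel, one_smul]
    have e2 := T.yc_mul_wc_of_lt X.A η η' (Nat.lt_succ_self i) hi
    have e3 : coeffIncl K K' X.A (T.wc X.A η η' (i + 1)) *
        coeffIncl K K' X.A (T.wc X.A η η' (i + 1)) = coeffIncl K K' X.A (T.wc X.A η η' (i + 1)) := by
      rw [← map_mul, T.wc_mul_self]
    rw [← map_mul] at e3
    have e4 : T.yc X.A η η' (i + 1) * coeffIncl K K' X.A (1 - T.wc X.A η η' (i + 1)) =
        T.unif X.A * T.yc X.A η η' i := by
      rw [T.yc_succ, map_sub, map_one, mul_sub, mul_one, add_mul, mul_assoc, e2, mul_zero, zero_add,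
        ← map_mul, e3, add_sub_cancel_right]
    have e5 : T.yc X.A η η' (i + 1) * coeffIncl K K' X.A (T.wc X.A η η' (i + 1)) =
        coeffIncl K K' X.A (T.wc X.A η η' (i + 1)) := by
      rw [T.yc_succ, add_mul, mul_assoc, e2, mul_zero, zero_add, ← map_mul, e3]
    conv_lhs => rw [e1, he]
    simp only [coeff_smul_def, smul_add, ← mul_smul, e4, e5, ← pow_succ']
    rw [add_assoc]

/-- An element of 𝔏_η ∩ π'𝔏 is π' times an element of degree n-1. Decomposing the latter and using
π' · π'^(n-1) = π = π₂π₁ and π' y_(n-1) = π₂ exhibits a multiple of π₂. The decomposition is a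
hypothesis so that both lattices of type τ and glued lattices can use the argument. -/
theorem exists_mulPi_eq_of_exists (hη : η ≠ η') (hE : Nonempty (K' →ₐ[ℚ_[p]] E))
    (H : ∀ i < Module.finrank K K', ∀ l ∈ X.isotypic T η i, ∃ m ∈ X.eigen η, ∃ m' ∈ X.eigen η',
      l = T.unif X.A ^ i • m + T.yc X.A η η' i • m') {l : X.L} (hl : l ∈ X.eigen η)
    (h' : l ∈ X.piL T) : ∃ m' ∈ X.eigen η', l = coeffOfInt X.A (T.piElt η' η) • m' := by
  obtain ⟨k, hk⟩ := (X.mem_piL T).1 h'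
  have h1 : l = T.unif X.A • X.isotypicProj T η (Module.finrank K K' - 1) k := by
    rw [← isotypicProj_zero_unif_smul, ← hk, isotypicProj_eq_self]
    rwa [isotypic_zero]
  have h0 := T.finrank_pos
  obtain ⟨m, hm, m', hm', he⟩ := H _ (by omega) _
    (X.isotypicProj_mem T η (Module.finrank K K' - 1) k)
  refine ⟨coeffOfInt X.A (T.piElt η η') • m + m', Submodule.add_mem _ ?_ hm', ?_⟩
  · exact (mulPi T η η' X ⟨m, hm⟩).2
  · rw [h1, he, smul_add, ← mul_smul, ← pow_succ', Nat.sub_add_cancel h0, ← mul_smul, smul_add,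
      ← mul_smul, T.piElt_mul_piElt X.A η η' hE hη, T.unif_mul_yc_last X.A η η' hE hη, T.unif_pow]

theorem range_mulPi_of_exists (hη : η ≠ η') (hE : Nonempty (K' →ₐ[ℚ_[p]] E))
    (H : ∀ l ∈ X.eigen η, l ∈ X.piL T →
      ∃ m' ∈ X.eigen η', l = coeffOfInt X.A (T.piElt η' η) • m') :
    LinearMap.range (mulPi T η' η X) = (X.piL T).comap (X.eigen η).subtype := by
  ext l
  constructor
  · rintro ⟨m, rfl⟩
    show coeffOfInt X.A (T.piElt η' η) • (m : X.L) ∈ X.piL T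
    rw [← T.unif_mul_yc_last X.A η η' hE hη, mul_smul]
    exact X.unif_smul_mem_piL T _
  · intro hl
    obtain ⟨m, hm, he⟩ := H l l.2 hl
    exact ⟨⟨m, hm⟩, Subtype.ext he.symm⟩

/-- The quotient of `𝔏_η` by its intersection with `π' 𝔏`. -/
def residualEigenEquiv
    (h : LinearMap.range (mulPi T η' η X) = (X.piL T).comap (X.eigen η).subtype) :
    (X.eigen η ⧸ LinearMap.range (mulPi T η' η X)) ≃ₗ[Coeff p X.A K] X.residualEigen T η :=
  have hker : LinearMap.ker ((X.piL T).mkQ ∘ₗ (X.eigen η).subtype) =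
      LinearMap.range (mulPi T η' η X) := by
    rw [h, LinearMap.ker_comp, Submodule.ker_mkQ]
  have hrange : LinearMap.range ((X.piL T).mkQ ∘ₗ (X.eigen η).subtype) = X.residualEigen T η := by
    rw [X.residualEigen_eq, LinearMap.range_comp, Submodule.range_subtype]
  ((Submodule.quotEquivOfEq _ _ hker.symm).trans
    ((X.piL T).mkQ ∘ₗ (X.eigen η).subtype).quotKerEquivRange).trans (LinearEquiv.ofEq _ _ hrange)

/-- The image of π₂ is 𝔏_η ∩ π'𝔏, so its cokernel is the η-eigenspace of 𝔏/π'𝔏, where the type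
condition gives the rank. -/
theorem isLocType.coker_mulPi (h : X.isLocType T η η') (hη : η ≠ η')
    (hE : Nonempty (K' →ₐ[ℚ_[p]] E)) :
    IsProjOfRankOverQuotient (Coeff p X.A K) (X.eigen η ⧸ LinearMap.range (mulPi T η' η X))
      (Ideal.span {T.unifBase X.A}) 1 := by
  have h1 := h.2 η
  rw [if_pos rfl, if_neg hη] at h1
  exact h1.of_equiv (residualEigenEquiv (range_mulPi_of_exists hη hE fun l hl h' =>
    exists_mulPi_eq_of_exists hη hE (fun _ hi _ hl => h.exists_eq_of_mem_isotypic hE hi hl) hl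
      h')).symm

theorem isLocType.exists_generator (h : X.isLocType T η η') (hη : η ≠ η')
    (hE : Nonempty (K' →ₐ[ℚ_[p]] E)) (𝔪 : Ideal (Coeff p X.A K)) [h𝔪 : 𝔪.IsMaximal] :
    ∃ c ∉ 𝔪, ∃ m₀ : X.eigen η, ∀ m, ∃ (r : Coeff p X.A K) (n : X.eigen η'),
      c • m = r • m₀ + mulPi T η' η X n :=
  (h.coker_mulPi hη hE).exists_smul_eq_add 𝔪
    ((Ideal.span_singleton_le_iff_mem _).2 (T.unifBase_mem X.A 𝔪 h𝔪))

end LocDatum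

/-- The coordinates of s π₁ in the basis of powers of π' are the s w_i, and the w_i add up to 1. -/
theorem TameTotRam.eq_zero_of_mul_piElt (T : TameTotRam p K K') (A : TestAlg.{u} p E)
    {η η' : Gal(K'/K) →* (OInt p E)ˣ} (hη : η ≠ η') (hE : Nonempty (K' →ₐ[ℚ_[p]] E))
    {s : Coeff p A K} (hs : coeffIncl K K' A s * coeffOfInt A (T.piElt η η') = 0) : s = 0 := by
  rw [T.coeffOfInt_piElt A η η' hE hη, Finset.mul_sum, Finset.sum_range] at hs
  have h1 := Fintype.linearIndependent_iff.1 (T.linearIndependent_unif_pow A)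
    (fun i => s * T.wc A η η' i) (by
      rw [← hs]
      refine Finset.sum_congr rfl fun i _ => ?_
      rw [Algebra.smul_def, algebraMap_coeff, map_mul]
      ring)
  have h2 := congrArg (s * ·) (T.sum_wc A η η')
  simp only [mul_one, Finset.sum_range, Finset.mul_sum] at h2
  rw [← h2]
  exact Finset.sum_eq_zero fun i _ => h1 i

namespace LocDatum

variable {T : TameTotRam p K K'} {η η' : Gal(K'/K) →* (OInt p E)ˣ} {X : LocDatum.{u} p K K' E}

theorem mulPi_mulPi (hη : η ≠ η') (hE : Nonempty (K' →ₐ[ℚ_[p]] E)) (l : X.eigen η) :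
    mulPi T η' η X (mulPi T η η' X l) = T.unifBase X.A • l := Subtype.ext <| by
  rw [mulPi_coe, mulPi_coe, ← mul_smul, T.piElt_mul_piElt X.A η η' hE hη]; rfl

variable (T) in
theorem isLocType.finite_eigen (h : X.isLocType T η η') (ξ : Gal(K'/K) →* (OInt p E)ˣ) :
    Module.Finite (Coeff p X.A K) (X.eigen ξ) := by
  have := T.coeff_finite X.A
  have := h.1.1.1
  have h1 : Module.Finite (Coeff p X.A K) X.L := Module.Finite.trans (Coeff p X.A K') X.L
  refine Module.Finite.of_surjective ((X.isotypicProj T ξ 0).codRestrict (X.eigen ξ)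
    fun l => by rw [← isotypic_zero T]; exact X.isotypicProj_mem T ξ 0 l) fun l => ⟨l, ?_⟩
  exact Subtype.ext (isotypicProj_eq_self T ξ (by rw [isotypic_zero]; exact l.2))

/-- Up to a scalar prime to a given maximal ideal, `𝔏` has an `𝒪_{K'} ⊗ A`-basis consisting of
elements of `𝔏_η` and `𝔏_{η'}`, giving rise to a basis of `𝔏_η`. -/
theorem isLocType.isProjOfRank_eigen (h : X.isLocType T η η') (hη : η ≠ η')
    (hE : Nonempty (K' →ₐ[ℚ_[p]] E)) : IsProjOfRank (Coeff p X.A K) (X.eigen η) 2 := by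
  refine isProjOfRank_of_isIsoUpTo fun 𝔪 h𝔪 => ?_
  have := T.coeff_finite X.A
  have := h.finite_eigen T η
  have := h.finite_eigen T η'
  obtain ⟨c, hc, m₀, hm⟩ := h.exists_generator hη hE 𝔪
  obtain ⟨d, hd, n₀, hn⟩ := h.symm.exists_generator hη.symm hE 𝔪
  obtain ⟨a, ha, hma⟩ := exists_chain_generators 𝔪 (T.unifBase_mem X.A 𝔪 h𝔪) _ _
    (mulPi_mulPi hη hE) hc hd hm hn
  obtain ⟨b, hb, hnb⟩ := exists_chain_generators 𝔪 (T.unifBase_mem X.A 𝔪 h𝔪) _ _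
    (mulPi_mulPi hη.symm hE) hd hc hn hm
  obtain ⟨g, hg, φ₀, hφ₀⟩ := h.1.1.exists_isIsoUpTo_algebraMap (T.coeffIncl_injective X.A)
    (T.unif_mem X.A) (T.exists_eq_algebraMap_add X.A) 𝔪
  let φ : (Fin 2 → Coeff p X.A K') →ₗ[Coeff p X.A K'] X.L :=
    Fintype.linearCombination (Coeff p X.A K') ![(m₀ : X.L), (n₀ : X.L)]
  have hφ : ∀ v, φ v = v 0 • (m₀ : X.L) + v 1 • (n₀ : X.L) := fun v => by
    simp [φ, Fintype.linearCombination_apply]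
  have hφm : (m₀ : X.L) ∈ LinearMap.range φ := ⟨![1, 0], by simp [hφ]⟩
  have hφn : (n₀ : X.L) ∈ LinearMap.range φ := ⟨![0, 1], by simp [hφ]⟩
  have h1 : ∀ m ∈ X.eigen η, (algebraMap (Coeff p X.A K) (Coeff p X.A K') (b * a)) • m ∈
      LinearMap.range φ := fun m hm => by
    obtain ⟨r, s, hrs⟩ := hma ⟨m, hm⟩
    have := congrArg Subtype.val hrs
    rw [map_mul, mul_smul]
    refine Submodule.smul_mem _ _ ?_
    rw [algebraMap_smul]
    rw [show a • m = _ from this]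
    exact Submodule.add_mem _ (Submodule.smul_mem _ _ hφm)
      (Submodule.smul_mem _ _ (Submodule.smul_mem _ _ hφn))
  have h2 : ∀ n ∈ X.eigen η', (algebraMap (Coeff p X.A K) (Coeff p X.A K') (b * a)) • n ∈
      LinearMap.range φ := fun n hn => by
    obtain ⟨r, s, hrs⟩ := hnb ⟨n, hn⟩
    have := congrArg Subtype.val hrs
    rw [mul_comm, map_mul, mul_smul]
    refine Submodule.smul_mem _ _ ?_
    rw [algebraMap_smul]
    rw [show b • n = _ from this]
    exact Submodule.add_mem _ (Submodule.smul_mem _ _ hφn)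
      (Submodule.smul_mem _ _ (Submodule.smul_mem _ _ hφm))
  -- Every graded part is built from 𝔏_η and 𝔏_{η'}, which m₀ and n₀ generate up to a scalar.
  have hsurj : ∀ l, ∃ v, φ v = (algebraMap (Coeff p X.A K) (Coeff p X.A K') (b * a)) • l := by
    intro l
    rw [← LinearMap.mem_range, ← X.sum_isotypicProj T η l, Finset.smul_sum]
    refine Submodule.sum_mem _ fun i hi => ?_
    obtain ⟨m, hm, m', hm', he⟩ := h.exists_eq_of_mem_isotypic hE (Finset.mem_range.1 hi)
      (X.isotypicProj_mem T η i l)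
    rw [he, smul_add, smul_comm _ (T.unif X.A ^ i), smul_comm _ (T.yc X.A η η' i)]
    exact Submodule.add_mem _ (Submodule.smul_mem _ _ (h1 m hm)) (Submodule.smul_mem _ _ (h2 m' hm'))
  -- Two elements that generate a module of rank two up to a scalar satisfy no relation up to a
  -- scalar.
  have hiso := hφ₀.of_surj hsurj
  simp only [← map_mul, ← map_pow] at hiso
  set C := b * a * (g * g * (b * a)) ^ Fintype.card (Fin 2)
  have hba : b * a ∉ 𝔪 := fun h => (h𝔪.isPrime.mem_or_mem h).elim hb ha
  have hC : C ∉ 𝔪 := fun h => (h𝔪.isPrime.mem_or_mem h).elim hba fun h =>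
    (h𝔪.isPrime.mem_or_mem (h𝔪.isPrime.mem_of_pow_mem _ h)).elim (fun h =>
      (h𝔪.isPrime.mem_or_mem h).elim hg hg) hba
  let ψ : (Fin 2 → Coeff p X.A K) →ₗ[Coeff p X.A K] X.eigen η :=
    Fintype.linearCombination (Coeff p X.A K) ![m₀, mulPi T η' η X n₀]
  have hψ : ∀ v, ψ v = v 0 • m₀ + v 1 • mulPi T η' η X n₀ := fun v => by
    simp [ψ, Fintype.linearCombination_apply]
  refine ⟨C * a, fun h => (h𝔪.isPrime.mem_or_mem h).elim hC ha, ψ, fun m => ?_, fun v hv => ?_⟩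
  · obtain ⟨r, s, hrs⟩ := hma m
    exact ⟨C • ![r, s], by rw [map_smul, hψ, mul_smul C a, hrs]; rfl⟩
  -- A relation between m₀ and π₂ n₀ over 𝒪_K ⊗ A is one between m₀ and n₀ over 𝒪_{K'} ⊗ A, with
  -- coefficients v₀ and v₁ π₂. The factor π₂ is then cancelled.
  · have h3 : φ ![coeffIncl K K' X.A (v 0),
        coeffIncl K K' X.A (v 1) * coeffOfInt X.A (T.piElt η' η)] = 0 := by
      rw [hφ, ← (show (ψ v : X.L) = 0 by rw [hv]; rfl), hψ]
      simp only [Matrix.cons_val_zero, Matrix.cons_val_one, mul_smul]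
      rfl
    have h4 := hiso.inj _ h3
    have h5 := congrFun h4 0
    have h6 := congrFun h4 1
    simp only [Pi.smul_apply, Matrix.cons_val_zero, Matrix.cons_val_one, smul_eq_mul,
      Pi.zero_apply] at h5 h6
    have h7 : C * v 0 = 0 := T.coeffIncl_injective X.A (by
      rw [map_mul, map_zero]
      exact h5)
    have h8 : C * v 1 = 0 := T.eq_zero_of_mul_piElt X.A hη.symm hE (by
      rw [map_mul, mul_assoc]
      exact h6)
    rw [mul_comm, mul_smul]
    suffices hCv : C • v = 0 by rw [hCv, smul_zero]
    ext i
    fin_cases i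
    · exact h7
    · exact h8

variable (T) in
include T in
theorem isLoc.projective_eigen_quotient (h : X.isLoc) (ξ : Gal(K'/K) →* (OInt p E)ˣ) :
    Module.Projective X.A.carrier (X.eigen ξ ⧸ X.eigenPlus ξ) := by
  have := h.2
  let i : (X.eigen ξ ⧸ (X.eigenPlus ξ).restrictScalars X.A.carrier) →ₗ[X.A.carrier]
      X.L ⧸ X.Lp.restrictScalars X.A.carrier :=
    Submodule.mapQ _ _ (ofEigen ξ X) fun _ hl => hl
  let s : (X.L ⧸ X.Lp.restrictScalars X.A.carrier) →ₗ[X.A.carrier]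
      (X.eigen ξ ⧸ (X.eigenPlus ξ).restrictScalars X.A.carrier) :=
    Submodule.mapQ _ _ (toEigen ξ X) fun l hl => projector_mem_plus ξ X l hl
  have hsi : s ∘ₗ i = LinearMap.id := by
    refine LinearMap.ext fun z => ?_
    obtain ⟨l, rfl⟩ := Submodule.Quotient.mk_surjective _ z
    show Submodule.Quotient.mk (toEigen ξ X (ofEigen ξ X l)) = Submodule.Quotient.mk l
    congr 1
    exact Subtype.ext (projector_eq_self ξ T X l l.2)
  have h1 : Module.Projective X.A.carrier (X.L ⧸ X.Lp.restrictScalars X.A.carrier) :=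
    Module.Projective.of_equiv (Submodule.Quotient.restrictScalarsEquiv X.A.carrier X.Lp).symm
  have h2 := Module.Projective.of_split i s hsi
  exact Module.Projective.of_equiv
    (Submodule.Quotient.restrictScalarsEquiv X.A.carrier (X.eigenPlus ξ))

/-- The pair of eigenspaces of a lattice of type `η ⊕ η'` is a lattice chain. -/
theorem isLocType.isIw (h : X.isLocType T η η') (hη : η ≠ η') (hE : Nonempty (K' →ₐ[ℚ_[p]] E)) :
    ((toIw T η η').obj X).isIw T.π where
  rank₁ := h.isProjOfRank_eigen hη hE
  rank₂ := h.symm.isProjOfRank_eigen hη.symm hE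
  comp₁₂ := mulPi_mulPi hη.symm hE
  comp₂₁ := mulPi_mulPi hη hE
  coker₁ := h.symm.coker_mulPi hη.symm hE
  coker₂ := h.coker_mulPi hη hE
  plus₁ := h.1.projective_eigen_quotient T η
  plus₂ := h.1.projective_eigen_quotient T η'
  map_plus₁ _ hl := X.Lp.smul_mem _ hl
  map_plus₂ _ hl := X.Lp.smul_mem _ hl

end LocDatum

end ToChain

/-! ### Lattices built from a lattice chain -/

/-- A decreasing sequence of idempotents `1 = u 0, u 1, …, u (n - 1) = 0`. -/
structure Stair (S : Type u) [CommRing S] (n : ℕ) where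
  /-- the idempotents -/
  u : ℕ → S
  pos : 0 < n
  zero : u 0 = 1
  last : u (n - 1) = 0
  mul : ∀ i j, i ≤ j → j < n → u j * u i = u j

namespace Stair

variable {S : Type u} [CommRing S] {n : ℕ} (D : Stair S n) {M N : Type u} [AddCommGroup M]
  [AddCommGroup N] [Module S M] [Module S N]

variable (M N) in
/-- The submodule of `(M × N) ^ n` with `i`-th component `u_i M × (1 - u_i) N`. -/
def glue : Submodule S (Fin n → M × N) where
  carrier := {l | ∀ i : Fin n, D.u i • (l i).1 = (l i).1 ∧ D.u i • (l i).2 = 0}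
  add_mem' {l m} hl hm i := by
    simp only [Pi.add_apply, Prod.fst_add, Prod.snd_add, smul_add, (hl i).1, (hl i).2, (hm i).1,
      (hm i).2, add_zero, and_self]
  zero_mem' i := by simp
  smul_mem' s l hl i := by
    simp only [Pi.smul_apply, Prod.smul_fst, Prod.smul_snd, smul_comm _ s, (hl i).1, (hl i).2,
      smul_zero, and_self]

theorem idem {i : ℕ} (hi : i < n) : D.u i * D.u i = D.u i := D.mul i i le_rfl hi

variable (f : M →ₗ[S] N) (f' : N →ₗ[S] M)

/-- The endomorphism which replaces `π'`. -/
def shift : D.glue M N →ₗ[S] D.glue M N where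
  -- Position 0 receives only f' of the N-component at position n-1, the M-component there being
  -- zero as u_(n-1) = 0. At i > 0 the M-component persists on u_i, and where the step from u_(i-1)
  -- to u_i drops, it passes to N through f.
  toFun l := ⟨fun i => if (i : ℕ) = 0 then (f' (l.1 ⟨n - 1, Nat.sub_lt D.pos Nat.one_pos⟩).2, 0)
      else (D.u i • (l.1 ⟨i - 1, by omega⟩).1,
        (1 - D.u i) • f (l.1 ⟨i - 1, by omega⟩).1 + (l.1 ⟨i - 1, by omega⟩).2), fun i => by
    by_cases hi : (i : ℕ) = 0
    · simp only [hi, if_true, D.zero, one_smul, smul_zero, and_self]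
    · have h2 := (l.2 ⟨i - 1, by omega⟩).2
      have h3 : D.u i * (1 - D.u i) = 0 := by rw [mul_sub, mul_one, D.idem i.2, sub_self]
      simp only [hi, if_false, ← mul_smul, D.idem i.2, smul_add, h3, zero_smul, zero_add, true_and]
      rw [← D.mul (i - 1) i (by omega) i.2, mul_smul, h2, smul_zero]⟩
  map_add' l m := Subtype.ext <| funext fun i => by
    by_cases hi : (i : ℕ) = 0
    · simp [hi]
    · simp only [hi, if_false, Submodule.coe_add, Pi.add_apply, Prod.fst_add, Prod.snd_add, map_add,
        smul_add, Prod.mk_add_mk]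
      rw [add_add_add_comm]
  map_smul' s l := Subtype.ext <| funext fun i => by
    by_cases hi : (i : ℕ) = 0
    · simp [hi]
    · simp only [hi, if_false, Submodule.coe_smul, Pi.smul_apply, Prod.smul_fst, Prod.smul_snd,
        map_smul, RingHom.id_apply, Prod.smul_mk, smul_add, smul_comm _ s]

theorem shift_zero (l : D.glue M N) (h : 0 < n) : (D.shift f f' l).1 ⟨0, h⟩ =
    (f' (l.1 ⟨n - 1, Nat.sub_lt D.pos Nat.one_pos⟩).2, 0) := rfl

theorem shift_succ (l : D.glue M N) {i : ℕ} (hi : i + 1 < n) :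
    (D.shift f f' l).1 ⟨i + 1, hi⟩ = (D.u (i + 1) • (l.1 ⟨i, by omega⟩).1,
      (1 - D.u (i + 1)) • f (l.1 ⟨i, by omega⟩).1 + (l.1 ⟨i, by omega⟩).2) := rfl

theorem one_sub_mul (i : ℕ) (hi : i < n) : (1 - D.u i) * D.u i = 0 := by
  rw [sub_mul, one_mul, D.idem hi, sub_self]

/-- The element of `M` at position `i`. -/
def inlAt (i : Fin n) : M →ₗ[S] D.glue M N where
  toFun m := ⟨Pi.single i (D.u i • m, (1 - D.u i) • f m), fun j => by
    rcases eq_or_ne j i with rfl | h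
    · simp only [Pi.single_eq_same, ← mul_smul, D.idem j.2, mul_comm (D.u j) (1 - D.u j),
        D.one_sub_mul j j.2, zero_smul, and_self]
    · simp [Pi.single_eq_of_ne h]⟩
  map_add' m m' := Subtype.ext <| by
    simp only [Submodule.coe_add, map_add, smul_add, ← Pi.single_add, Prod.mk_add_mk]
  map_smul' s m := Subtype.ext <| by
    simp only [Submodule.coe_smul, map_smul, RingHom.id_apply, ← Pi.single_smul, Prod.smul_mk,
      smul_comm _ s]

variable (M) in
/-- The element of `N` at position `i`. -/
def inrAt (i : Fin n) : N →ₗ[S] D.glue M N where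
  toFun m := ⟨Pi.single i (0, (1 - D.u i) • m), fun j => by
    rcases eq_or_ne j i with rfl | h
    · simp only [Pi.single_eq_same, ← mul_smul, mul_comm (D.u j) (1 - D.u j),
        D.one_sub_mul j j.2, zero_smul, smul_zero, and_self]
    · simp [Pi.single_eq_of_ne h]⟩
  map_add' m m' := Subtype.ext <| by
    simp only [Submodule.coe_add, smul_add, ← Pi.single_add, Prod.mk_add_mk, add_zero]
  map_smul' s m := Subtype.ext <| by
    simp only [Submodule.coe_smul, RingHom.id_apply, ← Pi.single_smul, Prod.smul_mk,
      smul_comm _ s, smul_zero]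

theorem inlAt_coe (i : Fin n) (m : M) :
    (D.inlAt f i m).1 = Pi.single i (D.u i • m, (1 - D.u i) • f m) := rfl

theorem inrAt_coe (i : Fin n) (m : N) :
    (D.inrAt M i m).1 = Pi.single i (0, (1 - D.u i) • m) := rfl

/-- Every element is the sum of its components. -/
theorem sum_inlAt_add_inrAt (l : D.glue M N) :
    ∑ i, (D.inlAt f i (l.1 i).1 + D.inrAt M i (l.1 i).2) = l := by
  have h : ∀ i, (D.inlAt f i (l.1 i).1 + D.inrAt M i (l.1 i).2).1 = Pi.single i (l.1 i) := by
    intro i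
    rw [Submodule.coe_add, inlAt_coe, inrAt_coe, ← Pi.single_add, Prod.mk_add_mk, add_zero,
      ← (l.2 i).1, map_smul, ← mul_smul, ← mul_smul, D.idem i.2, D.one_sub_mul i i.2, zero_smul,
      zero_add, sub_smul, one_smul, (l.2 i).2, sub_zero, (l.2 i).1]
  apply Subtype.ext
  rw [Submodule.coe_sum]
  refine Eq.trans ?_ (Finset.univ_sum_single l.1)
  exact Finset.sum_congr rfl fun i _ => h i

theorem shift_single_succ (l : D.glue M N) {i : ℕ} (hi : i + 1 < n) (a : M × N)
    (hl : l.1 = Pi.single ⟨i, by omega⟩ a) : (D.shift f f' l).1 =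
      (Pi.single ⟨i + 1, hi⟩ (D.u (i + 1) • a.1, (1 - D.u (i + 1)) • f a.1 + a.2) : Fin n → M × N) := by
  ext1 ⟨j, hj⟩
  rcases j with _ | j
  · rw [shift_zero, hl, Pi.single_eq_of_ne, Pi.single_eq_of_ne, Prod.snd_zero, map_zero]
    · rfl
    · simp
    · simp; omega
  · rw [shift_succ, hl]
    rcases eq_or_ne j i with rfl | h
    · rw [Pi.single_eq_same, Pi.single_eq_same]
    · rw [Pi.single_eq_of_ne, Pi.single_eq_of_ne]
      · simp
      · simpa using h
      · simpa using h

theorem shift_single_last (l : D.glue M N) (a : M × N)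
    (hl : l.1 = Pi.single ⟨n - 1, Nat.sub_lt D.pos Nat.one_pos⟩ a) : (D.shift f f' l).1 =
      (Pi.single ⟨0, D.pos⟩ (f' a.2, 0) : Fin n → M × N) := by
  ext1 ⟨j, hj⟩
  rcases j with _ | j
  · rw [shift_zero, hl, Pi.single_eq_same, Pi.single_eq_same]
  · rw [shift_succ, hl, Pi.single_eq_of_ne, Pi.single_eq_of_ne]
    · simp
    · simp
    · simp; omega

/-- In the glued module, `inlAt i m` plays the role of π'^i m, and `inrAt i m` that of y_i m. The
statements on the shift of both kinds of elements mirror the rules for these products. -/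
theorem shift_inlAt {i : ℕ} (hi : i + 1 < n) (m : M) :
    D.shift f f' (D.inlAt f ⟨i, by omega⟩ m) = D.inlAt f ⟨i + 1, hi⟩ m := Subtype.ext <| by
  rw [D.shift_single_succ f f' _ hi _ (D.inlAt_coe f _ m), inlAt_coe]
  simp only
  rw [← mul_smul, D.mul i (i + 1) (Nat.le_succ i) hi, map_smul, ← mul_smul, ← add_smul]
  congr 3
  rw [sub_mul, one_mul, D.mul i (i + 1) (Nat.le_succ i) hi]
  ring

theorem shift_inlAt_last (m : M) :
    D.shift f f' (D.inlAt f ⟨n - 1, Nat.sub_lt D.pos Nat.one_pos⟩ m) =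
      D.inlAt f ⟨0, D.pos⟩ (f' (f m)) := Subtype.ext <| by
  rw [D.shift_single_last f f' _ _ (D.inlAt_coe f _ m), inlAt_coe]
  simp only [D.zero, D.last, sub_zero, one_smul, sub_self, zero_smul]

theorem shift_inrAt {i : ℕ} (hi : i + 1 < n) (m : N) :
    D.shift f f' (D.inrAt M ⟨i, by omega⟩ m) = D.inrAt M ⟨i + 1, hi⟩ ((1 - D.u i) • m) :=
  Subtype.ext <| by
    rw [D.shift_single_succ f f' _ hi _ (D.inrAt_coe _ m), inrAt_coe]
    simp only
    rw [map_zero, smul_zero, smul_zero, zero_add, ← mul_smul]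
    congr 3
    have := D.mul i (i + 1) (Nat.le_succ i) hi
    linear_combination -this

theorem shift_inrAt_last (m : N) :
    D.shift f f' (D.inrAt M ⟨n - 1, Nat.sub_lt D.pos Nat.one_pos⟩ m) =
      D.inlAt f ⟨0, D.pos⟩ (f' m) := Subtype.ext <| by
  rw [D.shift_single_last f f' _ _ (D.inrAt_coe _ m), inlAt_coe]
  simp only [D.zero, D.last, sub_zero, one_smul, sub_self, zero_smul]

theorem shift_pow_inlAt {i : ℕ} (hi : i < n) (m : M) :
    (D.shift f f' ^ i) (D.inlAt f ⟨0, D.pos⟩ m) = D.inlAt f ⟨i, hi⟩ m := by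
  induction i with
  | zero => rfl
  | succ i ih => rw [pow_succ', Module.End.mul_apply, ih (by omega), shift_inlAt]

theorem shift_pow_inrAt (i : Fin n) (k : ℕ) (hk : i + k < n) (m : N) :
    (D.shift f f' ^ k) (D.inrAt M i ((1 - D.u i) • m)) =
      D.inrAt M ⟨i + k, hk⟩ ((1 - D.u i) • m) := by
  induction k with
  | zero => rfl
  | succ k ih =>
    rw [pow_succ', Module.End.mul_apply, ih (by omega), D.shift_inrAt f f' (by omega), ← mul_smul]
    congr 2
    have := D.mul i (i + k) (by omega) (by omega)
    linear_combination this

theorem inrAt_one_sub_smul (i : Fin n) (m : N) : D.inrAt M i ((1 - D.u i) • m) = D.inrAt M i m :=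
  Subtype.ext <| by
    rw [inrAt_coe, inrAt_coe, ← mul_smul]
    congr 3
    linear_combination D.one_sub_mul i i.2 * (-1)

/-- The shift is an `n`-th root of `π`. -/
theorem shift_pow {π : S} (h : ∀ m, f' (f m) = π • m) (h' : ∀ m, f (f' m) = π • m) :
    D.shift f f' ^ n = algebraMap S (Module.End S (D.glue M N)) π := by
  -- From position 0, n steps lead once around and apply f and then f'.
  have h1 : ∀ m, (D.shift f f' ^ n) (D.inlAt f ⟨0, D.pos⟩ m) = π • D.inlAt f ⟨0, D.pos⟩ m := by
    intro m
    obtain ⟨k, rfl⟩ := Nat.exists_eq_succ_of_ne_zero D.pos.ne'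
    rw [pow_succ', Module.End.mul_apply, D.shift_pow_inlAt f f' (Nat.lt_succ_self k)]
    exact (D.shift_inlAt_last f f' m).trans (by rw [h, map_smul])
  have h2 : ∀ i m, (D.shift f f' ^ n) (D.inlAt f i m) = π • D.inlAt f i m := by
    intro i m
    rw [← D.shift_pow_inlAt f f' i.2, ← Module.End.mul_apply, ← pow_add, add_comm, pow_add,
      Module.End.mul_apply, h1, map_smul]
  have h3 : ∀ i m, (D.shift f f' ^ n) (D.inrAt M i m) = π • D.inrAt M i m := by
    intro i m
    -- An element of N at position i moves to the last position, wraps to position 0 through f', and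
    -- climbs back to position i, where 1 - u_i turns it into f(f' m).
    have e : n = (i : ℕ) + 1 + (n - 1 - i) := by omega
    have e1 : (D.shift f f' ^ (n - 1 - i)) (D.inrAt M i ((1 - D.u i) • m)) =
        D.inrAt M ⟨n - 1, Nat.sub_lt D.pos Nat.one_pos⟩ ((1 - D.u i) • m) := by
      rw [D.shift_pow_inrAt f f' i (n - 1 - i) (by omega)]
      congr 2
      exact Fin.ext (by simp only; omega)
    rw [← inrAt_one_sub_smul]
    conv_lhs => enter [1, 2]; rw [e]
    rw [pow_add, Module.End.mul_apply, e1, pow_succ, Module.End.mul_apply, shift_inrAt_last,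
      D.shift_pow_inlAt f f' i.2]
    apply Subtype.ext
    rw [Submodule.coe_smul, inlAt_coe, inrAt_coe, ← Pi.single_smul, h', map_smul, ← mul_smul,
      mul_comm, D.one_sub_mul i i.2, zero_smul, Prod.smul_mk, smul_zero, Fin.eta,
      smul_comm (1 - D.u i) π]
  refine LinearMap.ext fun l => ?_
  rw [Module.algebraMap_end_apply, ← D.sum_inlAt_add_inrAt f l, map_sum, Finset.smul_sum]
  exact Finset.sum_congr rfl fun i _ => by rw [map_add, smul_add, h2, h3]

end Stair

section Glue

set_option linter.unusedSectionVars false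

variable {p : ℕ} [Fact p.Prime]
  {K K' E : Type u} [Field K] [Field K'] [Field E]
  [Algebra ℚ_[p] K] [Algebra ℤ_[p] K] [IsScalarTower ℤ_[p] ℚ_[p] K]
  [Algebra ℚ_[p] K'] [Algebra ℤ_[p] K'] [IsScalarTower ℤ_[p] ℚ_[p] K']
  [Algebra ℚ_[p] E] [Algebra ℤ_[p] E] [IsScalarTower ℤ_[p] ℚ_[p] E]
  [Algebra K K'] [IsScalarTower ℚ_[p] K K'] [IsScalarTower ℤ_[p] K K']
  [FiniteDimensional K K'] [FiniteDimensional ℚ_[p] K] [FiniteDimensional ℚ_[p] K']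
  [FiniteDimensional ℚ_[p] E]


attribute [local instance] coeffAlgebra

/-- The idempotents attached to `η ≠ η'`. -/
def TameTotRam.stair (T : TameTotRam p K K') (A : TestAlg.{u} p E)
    {η η' : Gal(K'/K) →* (OInt p E)ˣ} (hη : η ≠ η') :
    Stair (Coeff p A K) (Module.finrank K K') where
  u := T.uc A η η'
  pos := T.finrank_pos
  zero := T.uc_zero A η η' hη
  last := T.uc_last A η η'
  mul _ _ := T.uc_mul_of_le A η η'

namespace IwDatum

variable {T : TameTotRam p K K'} {η η' : Gal(K'/K) →* (OInt p E)ˣ} (hη : η ≠ η')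
  {Y : IwDatum.{u} p K E} (hY : Y.isIw T.π)

include hY in
-- The ring 𝒪_{K'} ⊗ A arises from 𝒪_K ⊗ A by adjoining an n-th root of π, and the shift is such a
-- root among the endomorphisms of the glued module.
theorem exists_glueHom : ∃ φ : Coeff p Y.A K' →ₐ[Coeff p Y.A K]
    Module.End (Coeff p Y.A K) ((T.stair Y.A hη).glue Y.L₁ Y.L₂),
    φ (T.unif Y.A) = (T.stair Y.A hη).shift Y.f₁ Y.f₂ :=
  exists_algHom_of_pow_eq (B := Module.End (Coeff p Y.A K)
    ((T.stair Y.A hη).glue Y.L₁ Y.L₂)) T.finrank_pos.ne' (T.unif Y.A) (T.unifBase Y.A) (T.unif_pow Y.A)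
    T.exists_eq_sum (T.linearIndependent_unif_pow Y.A) _
    ((T.stair Y.A hη).shift_pow Y.f₁ Y.f₂ hY.comp₂₁ hY.comp₁₂)

/-- The action of `𝒪_{K'} ⊗ A` on the glued module. -/
def glueHom : Coeff p Y.A K' →ₐ[Coeff p Y.A K]
    Module.End (Coeff p Y.A K) ((T.stair Y.A hη).glue Y.L₁ Y.L₂) :=
  (exists_glueHom hη hY).choose

theorem glueHom_unif :
    glueHom hη hY (T.unif Y.A) = (T.stair Y.A hη).shift Y.f₁ Y.f₂ :=
  (exists_glueHom hη hY).choose_spec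

theorem glueHom_coeffIncl (s : Coeff p Y.A K) (l : (T.stair Y.A hη).glue Y.L₁ Y.L₂) :
    glueHom hη hY (coeffIncl K K' Y.A s) l = s • l := by
  rw [← algebraMap_coeff, AlgHom.commutes, Module.algebraMap_end_apply]

/-- The action of the Galois group on the glued module. -/
def glueρ (T : TameTotRam p K K') {η η' : Gal(K'/K) →* (OInt p E)ˣ} (hη : η ≠ η')
    (Y : IwDatum.{u} p K E) (g : Gal(K'/K)) :
    (T.stair Y.A hη).glue Y.L₁ Y.L₂ →ₗ[Coeff p Y.A K] (T.stair Y.A hη).glue Y.L₁ Y.L₂ where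
  toFun l := ⟨fun i => (TameTotRam.chc Y.A η g * T.hc Y.A g ^ (i : ℕ)) • l.1 i, fun i => by
    simp only [Prod.smul_fst, Prod.smul_snd]
    rw [smul_comm, (l.2 i).1, smul_comm, (l.2 i).2, smul_zero]
    exact ⟨rfl, rfl⟩⟩
  map_add' l m := Subtype.ext <| funext fun i => smul_add _ (l.1 i) (m.1 i)
  map_smul' s l := Subtype.ext <| funext fun i => smul_comm _ s (l.1 i)

theorem glueρ_coe (g : Gal(K'/K)) (l : (T.stair Y.A hη).glue Y.L₁ Y.L₂)
    (i : Fin (Module.finrank K K')) :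
    (glueρ T hη Y g l).1 i = (TameTotRam.chc Y.A η g * T.hc Y.A g ^ (i : ℕ)) • l.1 i := rfl

theorem glueρ_glueHom (g : Gal(K'/K)) (x : Coeff p Y.A K')
    (l : (T.stair Y.A hη).glue Y.L₁ Y.L₂) : glueρ T hη Y g (glueHom hη hY x l) =
      glueHom hη hY (coeffGal Y.A g x) (glueρ T hη Y g l) := by
  refine T.coeff_induction (P := fun x => ∀ l, glueρ T hη Y g (glueHom hη hY x l) =
      glueHom hη hY (coeffGal Y.A g x) (glueρ T hη Y g l)) (fun s l => ?_) (fun l => ?_)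
    (fun y z hy hz l => ?_) (fun y z hy hz l => ?_) x l
  · rw [coeffGal_coeffIncl, glueHom_coeffIncl, glueHom_coeffIncl, map_smul]
  · rw [T.coeffGal_unif, map_mul, Module.End.mul_apply, glueHom_coeffIncl, glueHom_unif]
    apply Subtype.ext
    ext1 ⟨i, hi⟩
    rw [glueρ_coe, Submodule.coe_smul, Pi.smul_apply]
    rcases i with _ | i
    -- Position 0 receives from position n-1, so compatibility there rests on h(g)^n = 1.
    · rw [Stair.shift_zero, Stair.shift_zero, glueρ_coe, Prod.smul_snd, map_smul, Prod.smul_mk,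
        Prod.smul_mk, smul_zero, smul_zero, ← mul_smul, mul_left_comm, ← pow_succ',
        Nat.sub_add_cancel T.finrank_pos, T.hc_pow_finrank, pow_zero]
    · rw [Stair.shift_succ, Stair.shift_succ, glueρ_coe, Prod.smul_fst, Prod.smul_snd, map_smul,
        Prod.smul_mk, Prod.smul_mk]
      refine Prod.ext ?_ ?_
      · simp only [← mul_smul]
        congr 1
        ring
      · simp only [smul_add, ← mul_smul]
        congr 2
        all_goals ring
  · rw [map_add, map_add, map_add, LinearMap.add_apply, LinearMap.add_apply, map_add, hy, hz]
  · rw [map_mul, map_mul, map_mul, Module.End.mul_apply, Module.End.mul_apply, hy, hz]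

/-- The submodule glued from the submodules of the chain. -/
def gluePlus (T : TameTotRam p K K') {η η' : Gal(K'/K) →* (OInt p E)ˣ} (hη : η ≠ η')
    (Y : IwDatum.{u} p K E) :
    Submodule (Coeff p Y.A K) ((T.stair Y.A hη).glue Y.L₁ Y.L₂) where
  carrier := {l | ∀ i, (l.1 i).1 ∈ Y.Lp₁ ∧ (l.1 i).2 ∈ Y.Lp₂}
  add_mem' hl hm i := ⟨add_mem (hl i).1 (hm i).1, add_mem (hl i).2 (hm i).2⟩
  zero_mem' _ := ⟨zero_mem _, zero_mem _⟩
  smul_mem' s _ hl i := ⟨Submodule.smul_mem _ s (hl i).1, Submodule.smul_mem _ s (hl i).2⟩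

theorem glueHom_mem (x : Coeff p Y.A K') {l : (T.stair Y.A hη).glue Y.L₁ Y.L₂}
    (hl : l ∈ gluePlus T hη Y) : glueHom hη hY x l ∈ gluePlus T hη Y := by
  refine T.coeff_induction (P := fun x => ∀ l ∈ gluePlus T hη Y, glueHom hη hY x l ∈
    gluePlus T hη Y) (fun s l hl => ?_) (fun l hl => ?_) (fun y z hy hz l hl => ?_)
    (fun y z hy hz l hl => ?_) x l hl
  · rw [glueHom_coeffIncl]
    exact Submodule.smul_mem _ _ hl
  · rw [glueHom_unif]
    rintro ⟨i, hi⟩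
    rcases i with _ | i
    · rw [Stair.shift_zero]
      exact ⟨hY.map_plus₂ _ (hl _).2, zero_mem _⟩
    · rw [Stair.shift_succ]
      exact ⟨Submodule.smul_mem _ _ (hl _).1,
        add_mem (Submodule.smul_mem _ _ (hY.map_plus₁ _ (hl _).1)) (hl _).2⟩
  · rw [map_add, LinearMap.add_apply]
    exact add_mem (hy l hl) (hz l hl)
  · rw [map_mul, Module.End.mul_apply]
    exact hy _ (hz l hl)

/-- The lattice with an action of the Galois group attached to a lattice chain. -/
def toLoc : LocDatum.{u} p K K' E :=
  letI : Module (Coeff p Y.A K') ((T.stair Y.A hη).glue Y.L₁ Y.L₂) :=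
    Module.compHom _ (glueHom hη hY).toRingHom
  { A := Y.A
    L := (T.stair Y.A hη).glue Y.L₁ Y.L₂
    isScalarTower := ⟨fun a x l => by
      show glueHom hη hY (a • x) l = a • glueHom hη hY x l
      have : a • x = algebraMap Y.A.carrier (Coeff p Y.A K) a • x := by
        rw [Algebra.smul_def, Algebra.smul_def, algebraMap_coeff, AlgHom.commutes]
      rw [this, map_smul, LinearMap.smul_apply, algebraMap_smul]⟩
    ρ :=
      { toFun := fun g => (glueρ T hη Y g).restrictScalars Y.A.carrier
        map_one' := by
          refine LinearMap.ext fun l => Subtype.ext <| funext fun i => ?_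
          show (TameTotRam.chc Y.A η 1 * T.hc Y.A 1 ^ (i : ℕ)) • l.1 i = l.1 i
          rw [TameTotRam.chc_one, T.hc_one, one_pow, mul_one, one_smul]
        map_mul' := fun g g' => by
          refine LinearMap.ext fun l => Subtype.ext <| funext fun i => ?_
          show (TameTotRam.chc Y.A η (g * g') * T.hc Y.A (g * g') ^ (i : ℕ)) • l.1 i =
            (TameTotRam.chc Y.A η g * T.hc Y.A g ^ (i : ℕ)) •
              (TameTotRam.chc Y.A η g' * T.hc Y.A g' ^ (i : ℕ)) • l.1 i
          rw [TameTotRam.chc_mul, T.hc_mul, ← mul_smul]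
          congr 1
          ring }
    semilinear := glueρ_glueHom hη hY
    Lp :=
      { gluePlus T hη Y with
        smul_mem' := fun x _ hl => glueHom_mem hη hY x hl }
    stable := fun g l hl i => ⟨Submodule.smul_mem _ _ (hl i).1, Submodule.smul_mem _ _ (hl i).2⟩ }

end IwDatum

end Glue

/-! ### Recognising lattices of type `η ⊕ η'` -/

section Recognition

set_option linter.unusedSectionVars false

variable {p : ℕ} [Fact p.Prime]
  {K K' E : Type u} [Field K] [Field K'] [Field E]
  [Algebra ℚ_[p] K] [Algebra ℤ_[p] K] [IsScalarTower ℤ_[p] ℚ_[p] K]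
  [Algebra ℚ_[p] K'] [Algebra ℤ_[p] K'] [IsScalarTower ℤ_[p] ℚ_[p] K']
  [Algebra ℚ_[p] E] [Algebra ℤ_[p] E] [IsScalarTower ℤ_[p] ℚ_[p] E]
  [Algebra K K'] [IsScalarTower ℚ_[p] K K'] [IsScalarTower ℤ_[p] K K']
  [FiniteDimensional K K'] [FiniteDimensional ℚ_[p] K] [FiniteDimensional ℚ_[p] K']
  [FiniteDimensional ℚ_[p] E]


attribute [local instance] coeffAlgebra

theorem one_sub_smul_of_smul_eq_zero {R M : Type*} [Ring R] [AddCommGroup M] [Module R M] {u : R}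
    {m : M} (h : u • m = 0) : (1 - u) • m = m := by rw [sub_smul, one_smul, h, sub_zero]

theorem one_sub_smul_of_smul_eq_self {R M : Type*} [Ring R] [AddCommGroup M] [Module R M] {u : R}
    {m : M} (h : u • m = m) : (1 - u) • m = 0 := by rw [sub_smul, one_smul, h, sub_self]

namespace LocDatum

/-- The lattice `𝔏` is built from its eigenspaces `𝔏_η` and `𝔏_{η'}`. -/
structure IsGlued (T : TameTotRam p K K') (η η' : Gal(K'/K) →* (OInt p E)ˣ)
    (X : LocDatum.{u} p K K' E) : Prop where
  span : ∀ l, ∃ (a : Fin (Module.finrank K K') → X.eigen η)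
    (b : Fin (Module.finrank K K') → X.eigen η'),
    (∀ i : Fin (Module.finrank K K'), T.uc X.A η η' i • a i = a i) ∧
    (∀ i : Fin (Module.finrank K K'), T.uc X.A η η' i • b i = 0) ∧
    l = ∑ i : Fin (Module.finrank K K'), (T.unif X.A ^ (i : ℕ) • (a i : X.L) +
      T.yc X.A η η' i • (b i : X.L))
  uniq : ∀ (a : Fin (Module.finrank K K') → X.eigen η)
    (b : Fin (Module.finrank K K') → X.eigen η'),
    (∀ i : Fin (Module.finrank K K'), T.uc X.A η η' i • a i = a i) →
    (∀ i : Fin (Module.finrank K K'), T.uc X.A η η' i • b i = 0) →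
    ∑ i : Fin (Module.finrank K K'), (T.unif X.A ^ (i : ℕ) • (a i : X.L) +
      T.yc X.A η η' i • (b i : X.L)) = 0 → ∀ i, a i = 0 ∧ b i = 0

variable {T : TameTotRam p K K'} {η η' : Gal(K'/K) →* (OInt p E)ˣ} {X : LocDatum.{u} p K K' E}

/-- Multiplication by a power of `π'` or by `yc`, on coordinates with respect to `ψ₁` and `ψ₂`. -/
def gluedMap (T : TameTotRam p K K') {η η' : Gal(K'/K) →* (OInt p E)ˣ}
    {X : LocDatum.{u} p K K' E} (ψ₁ : (Fin 2 → Coeff p X.A K) →ₗ[Coeff p X.A K] X.eigen η)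
    (ψ₂ : (Fin 2 → Coeff p X.A K) →ₗ[Coeff p X.A K] X.eigen η') :
    (Fin (Module.finrank K K') × Fin 2 → Coeff p X.A K) →ₗ[Coeff p X.A K] X.L where
  toFun v := ∑ i : Fin (Module.finrank K K'),
    (T.unif X.A ^ (i : ℕ) • ((T.uc X.A η η' i • ψ₁ fun j => v (i, j) : X.eigen η) : X.L) +
      T.yc X.A η η' i • (((1 - T.uc X.A η η' i) • ψ₂ fun j => v (i, j) : X.eigen η') : X.L))
  map_add' v w := by
    rw [← Finset.sum_add_distrib]
    refine Finset.sum_congr rfl fun i _ => ?_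
    rw [add_add_add_comm, ← smul_add, ← smul_add, ← Submodule.coe_add, ← Submodule.coe_add,
      ← smul_add, ← smul_add, ← map_add, ← map_add]
    rfl
  map_smul' s v := by
    rw [RingHom.id_apply, Finset.smul_sum]
    refine Finset.sum_congr rfl fun i _ => ?_
    rw [smul_add, smul_comm s (T.unif X.A ^ (i : ℕ)), smul_comm s (T.yc X.A η η' i),
      ← Submodule.coe_smul, ← Submodule.coe_smul, smul_comm s (T.uc X.A η η' i),
      smul_comm s (1 - T.uc X.A η η' i), ← map_smul ψ₁ s, ← map_smul ψ₂ s]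
    rfl

/-- At each position i two coordinates suffice: they are read through ψ₁ on the support of u_i and
through ψ₂ off it. Hence 𝔏 has rank 2n over 𝒪_K ⊗ A up to c. -/
theorem IsGlued.isIsoUpTo_gluedMap (hg : X.IsGlued T η η') {c : Coeff p X.A K}
    {ψ₁ : (Fin 2 → Coeff p X.A K) →ₗ[Coeff p X.A K] X.eigen η}
    {ψ₂ : (Fin 2 → Coeff p X.A K) →ₗ[Coeff p X.A K] X.eigen η'}
    (h₁ : IsIsoUpTo c ψ₁) (h₂ : IsIsoUpTo c ψ₂) : IsIsoUpTo c (gluedMap T ψ₁ ψ₂) where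
  surj l := by
    obtain ⟨a, b, ha, hb, rfl⟩ := hg.span l
    choose s hs using fun i => h₁.surj (a i)
    choose t ht using fun i => h₂.surj (b i)
    refine ⟨fun k => T.uc X.A η η' k.1 * s k.1 k.2 + (1 - T.uc X.A η η' k.1) * t k.1 k.2, ?_⟩
    show ∑ i : Fin (Module.finrank K K'), _ = _
    rw [Finset.smul_sum]
    refine Finset.sum_congr rfl fun i _ => ?_
    have hi := T.uc_mul_self X.A η η' i.2
    have e1 : T.uc X.A η η' i • ψ₁ (fun j => T.uc X.A η η' i * s i j +
        (1 - T.uc X.A η η' i) * t i j) = c • a i := by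
      rw [← map_smul, show (T.uc X.A η η' i • fun j => T.uc X.A η η' i * s i j +
        (1 - T.uc X.A η η' i) * t i j) = T.uc X.A η η' i • s i from funext fun j => by
          simp only [Pi.smul_apply, smul_eq_mul]
          linear_combination (s i j - t i j) * hi, map_smul, hs, smul_comm, ha]
    have hb' : (1 - T.uc X.A η η' i) • b i = b i :=
      one_sub_smul_of_smul_eq_zero (R := Coeff p X.A K) (M := X.eigen η') (hb i)
    have e2 : (1 - T.uc X.A η η' i) • ψ₂ (fun j => T.uc X.A η η' i * s i j +
        (1 - T.uc X.A η η' i) * t i j) = c • b i := by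
      rw [← map_smul, show ((1 - T.uc X.A η η' i) • fun j => T.uc X.A η η' i * s i j +
        (1 - T.uc X.A η η' i) * t i j) = (1 - T.uc X.A η η' i) • t i from funext fun j => by
          simp only [Pi.smul_apply, smul_eq_mul]
          linear_combination (t i j - s i j) * hi, map_smul, ht, smul_comm, hb']
    rw [e1, e2, Submodule.coe_smul, Submodule.coe_smul, smul_add, smul_comm c (T.unif X.A ^ (i : ℕ)),
      smul_comm c (T.yc X.A η η' i)]
  inj v hv := by
    have h := hg.uniq _ _ (fun i => ?_) (fun i => ?_) hv
    · ext ⟨i, j⟩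
      have hi := h i
      rw [← map_smul, ← map_smul] at hi
      have e1 := congrFun (h₁.inj _ hi.1) j
      have e2 := congrFun (h₂.inj _ hi.2) j
      simp only [Pi.smul_apply, smul_eq_mul, Pi.zero_apply] at e1 e2 ⊢
      linear_combination e1 + e2
    · rw [← mul_smul, T.uc_mul_self X.A η η' i.2]
    · rw [← mul_smul, mul_sub, mul_one, T.uc_mul_self X.A η η' i.2, sub_self, zero_smul]

/-- The elements m₀ and n₀ generate 𝔏 over 𝒪_{K'} ⊗ A up to a scalar. Read over 𝒪_K ⊗ A, this is a
map from a free module of rank 2n onto 𝔏 up to a scalar; as 𝔏 itself has rank 2n, it is also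
injective up to a scalar. -/
theorem IsGlued.isProjOfRank (hg : X.IsGlued T η η') (hη : η ≠ η')
    (hE : Nonempty (K' →ₐ[ℚ_[p]] E)) (h₁ : IsProjOfRank (Coeff p X.A K) (X.eigen η) 2)
    (h₂ : IsProjOfRank (Coeff p X.A K) (X.eigen η') 2)
    (hc₁ : IsProjOfRankOverQuotient (Coeff p X.A K) (X.eigen η' ⧸ LinearMap.range (mulPi T η η' X))
      (Ideal.span {T.unifBase X.A}) 1)
    (hc₂ : IsProjOfRankOverQuotient (Coeff p X.A K) (X.eigen η ⧸ LinearMap.range (mulPi T η' η X))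
      (Ideal.span {T.unifBase X.A}) 1) : IsProjOfRank (Coeff p X.A K') X.L 2 := by
  have := T.coeff_finite X.A
  refine isProjOfRank_of_isIsoUpTo_algebraMap (S := Coeff p X.A K) fun 𝔪 h𝔪 => ?_
  have hπ := T.unifBase_mem X.A 𝔪 h𝔪
  have hI := (Ideal.span_singleton_le_iff_mem 𝔪).2 hπ
  have := h₁.1
  have := h₂.1
  obtain ⟨c, hc, m₀, hm⟩ := hc₂.exists_smul_eq_add 𝔪 hI
  obtain ⟨d, hd, n₀, hn⟩ := hc₁.exists_smul_eq_add 𝔪 hI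
  obtain ⟨a, ha, hma⟩ := exists_chain_generators 𝔪 hπ _ _ (mulPi_mulPi hη hE) hc hd hm hn
  obtain ⟨b, hb, hnb⟩ := exists_chain_generators 𝔪 hπ _ _ (mulPi_mulPi hη.symm hE) hd hc hn hm
  let ψ₁ : (Fin 2 → Coeff p X.A K) →ₗ[Coeff p X.A K] X.eigen η :=
    Fintype.linearCombination (Coeff p X.A K) ![m₀, mulPi T η' η X n₀]
  have hψ₁ : ∀ v, ψ₁ v = v 0 • m₀ + v 1 • mulPi T η' η X n₀ := fun v => by
    simp [ψ₁, Fintype.linearCombination_apply]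
  let ψ₂ : (Fin 2 → Coeff p X.A K) →ₗ[Coeff p X.A K] X.eigen η' :=
    Fintype.linearCombination (Coeff p X.A K) ![n₀, mulPi T η η' X m₀]
  have hψ₂ : ∀ v, ψ₂ v = v 0 • n₀ + v 1 • mulPi T η η' X m₀ := fun v => by
    simp [ψ₂, Fintype.linearCombination_apply]
  obtain ⟨g₁, hg₁, φ₁, hφ₁⟩ := h₁.exists_isIsoUpTo 𝔪
  obtain ⟨g₂, hg₂, φ₂, hφ₂⟩ := h₂.exists_isIsoUpTo 𝔪
  obtain ⟨d₁, hd₁, hi₁⟩ := hφ₁.exists_of_surj (φ := ψ₁) (c := a) (fun m => by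
    obtain ⟨r, s, hrs⟩ := hma m
    exact ⟨![r, s], by rw [hψ₁, hrs]; rfl⟩) h𝔪.isPrime hg₁ ha
  obtain ⟨d₂, hd₂, hi₂⟩ := hφ₂.exists_of_surj (φ := ψ₂) (c := b) (fun m => by
    obtain ⟨r, s, hrs⟩ := hnb m
    exact ⟨![r, s], by rw [hψ₂, hrs]; rfl⟩) h𝔪.isPrime hg₂ hb
  have hd₁₂ : d₁ * d₂ ∉ 𝔪 := fun h => (h𝔪.isPrime.mem_or_mem h).elim hd₁ hd₂
  -- Both eigenspace bases are brought to the common scalar d₁ d₂.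
  have hΨ := hg.isIsoUpTo_gluedMap (mul_comm d₂ d₁ ▸ hi₁.smul d₂) (hi₂.smul d₁)
  let φ : (Fin 2 → Coeff p X.A K') →ₗ[Coeff p X.A K'] X.L :=
    Fintype.linearCombination (Coeff p X.A K') ![(m₀ : X.L), (n₀ : X.L)]
  have hφ : ∀ v, φ v = v 0 • (m₀ : X.L) + v 1 • (n₀ : X.L) := fun v => by
    simp [φ, Fintype.linearCombination_apply]
  have hφm : (m₀ : X.L) ∈ LinearMap.range φ := ⟨![1, 0], by simp [hφ]⟩
  have hφn : (n₀ : X.L) ∈ LinearMap.range φ := ⟨![0, 1], by simp [hφ]⟩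
  have h1 : ∀ m : X.eigen η, (b * a) • (m : X.L) ∈ LinearMap.range φ := fun m => by
    obtain ⟨r, s, hrs⟩ := hma m
    rw [mul_smul, ← algebraMap_smul (Coeff p X.A K'), ← Submodule.coe_smul, hrs]
    exact Submodule.smul_mem _ _ (Submodule.add_mem _ (Submodule.smul_mem _ _ hφm)
      (Submodule.smul_mem _ _ (Submodule.smul_mem _ _ hφn)))
  have h2 : ∀ n : X.eigen η', (b * a) • (n : X.L) ∈ LinearMap.range φ := fun n => by
    obtain ⟨r, s, hrs⟩ := hnb n
    rw [mul_comm, mul_smul, ← algebraMap_smul (Coeff p X.A K'), ← Submodule.coe_smul, hrs]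
    exact Submodule.smul_mem _ _ (Submodule.add_mem _ (Submodule.smul_mem _ _ hφn)
      (Submodule.smul_mem _ _ (Submodule.smul_mem _ _ hφm)))
  have hba : b * a ∉ 𝔪 := fun h => (h𝔪.isPrime.mem_or_mem h).elim hb ha
  have hsurj : ∀ l, ∃ v, φ v = (b * a) • l := by
    intro l
    obtain ⟨s, t, -, -, rfl⟩ := hg.span l
    rw [← LinearMap.mem_range, Finset.smul_sum]
    refine Submodule.sum_mem _ fun i _ => ?_
    rw [smul_add, smul_comm _ (T.unif X.A ^ (i : ℕ)), smul_comm _ (T.yc X.A η η' i)]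
    exact Submodule.add_mem _ (Submodule.smul_mem _ _ (h1 _)) (Submodule.smul_mem _ _ (h2 _))
  let e : (Fin (Module.finrank K K') × Fin 2 → Coeff p X.A K) →ₗ[Coeff p X.A K]
      (Fin 2 → Coeff p X.A K') :=
    LinearMap.pi fun j => ∑ i : Fin (Module.finrank K K'),
      (LinearMap.proj (R := Coeff p X.A K) (i, j)).smulRight (T.unif X.A ^ (i : ℕ))
  have he : ∀ v j, e v j = ∑ i : Fin (Module.finrank K K'), v (i, j) • T.unif X.A ^ (i : ℕ) :=
    fun v j => by simp [e]
  have hesurj : Function.Surjective e := fun w => by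
    choose s hs using fun j => T.exists_eq_sum (A := X.A) (w j)
    exact ⟨fun k => s k.2 k.1, funext fun j => by rw [he, hs j]⟩
  obtain ⟨C, hC, hiso⟩ := hΨ.exists_of_surj (φ := (φ.restrictScalars (Coeff p X.A K)) ∘ₗ e)
    (c := b * a) (fun l => by
      obtain ⟨v, hv⟩ := hsurj l
      obtain ⟨w, rfl⟩ := hesurj v
      exact ⟨w, hv⟩) h𝔪.isPrime hd₁₂ hba
  refine ⟨C * (b * a), fun h => (h𝔪.isPrime.mem_or_mem h).elim hC hba, φ, fun l => ?_,
    fun v hv => ?_⟩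
  · obtain ⟨v, hv⟩ := hsurj l
    exact ⟨algebraMap _ _ C • v, by
      rw [map_smul, hv, algebraMap_smul, algebraMap_smul, ← mul_smul]⟩
  · obtain ⟨w, rfl⟩ := hesurj v
    rw [algebraMap_smul, mul_comm, mul_smul, ← map_smul, hiso.inj w hv, map_zero, smul_zero]

end LocDatum

end Recognition

/-! ### Glued lattices have type η ⊕ η' -/

section Recognition

set_option linter.unusedSectionVars false

variable {p : ℕ} [Fact p.Prime]
  {K K' E : Type u} [Field K] [Field K'] [Field E]
  [Algebra ℚ_[p] K] [Algebra ℤ_[p] K] [IsScalarTower ℤ_[p] ℚ_[p] K]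
  [Algebra ℚ_[p] K'] [Algebra ℤ_[p] K'] [IsScalarTower ℤ_[p] ℚ_[p] K']
  [Algebra ℚ_[p] E] [Algebra ℤ_[p] E] [IsScalarTower ℤ_[p] ℚ_[p] E]
  [Algebra K K'] [IsScalarTower ℚ_[p] K K'] [IsScalarTower ℤ_[p] K K']
  [FiniteDimensional K K'] [FiniteDimensional ℚ_[p] K] [FiniteDimensional ℚ_[p] K']
  [FiniteDimensional ℚ_[p] E]


attribute [local instance] coeffAlgebra

theorem isProjOfRankOverQuotient_zero {R M : Type u} [CommRing R] [AddCommGroup M] [Module R M]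
    [Subsingleton M] (I : Ideal R) : IsProjOfRankOverQuotient R M I 0 := by
  refine IsProjOfRankOverQuotient.of_equiv (M := PUnit.{u + 1})
    { toFun := fun _ => 0, map_add' := fun _ _ => (add_zero 0).symm,
      map_smul' := fun _ _ => (smul_zero _).symm, invFun := fun _ => ⟨⟩,
      left_inv := fun _ => rfl, right_inv := fun _ => Subsingleton.elim _ _ }
    ⟨inferInstance, ⟨fun _ _ _ => rfl⟩, inferInstance, inferInstance, fun x => ?_⟩
  rw [(Module.rankAtStalk_eq_zero_iff_subsingleton (R := R ⧸ I) (M := PUnit.{u + 1})).2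
    inferInstance]
  rfl

namespace LocDatum

variable {T : TameTotRam p K K'} {η η' : Gal(K'/K) →* (OInt p E)ˣ} {X : LocDatum.{u} p K K' E}

theorem pow_smul_mem_isotypic (i : ℕ) {l : X.L} (hl : l ∈ X.eigen η) :
    T.unif X.A ^ i • l ∈ X.isotypic T η i := by
  induction i with
  | zero => rwa [pow_zero, one_smul, isotypic_zero]
  | succ i ih =>
    rw [pow_succ', mul_smul]
    exact unif_smul_mem_isotypic T η ih

theorem yc_smul_mem_isotypic (hη : η ≠ η') (i : ℕ) {l : X.L} (hl : l ∈ X.eigen η') :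
    T.yc X.A η η' i • l ∈ X.isotypic T η i := by
  induction i with
  | zero =>
    rw [T.yc_zero X.A η η' hη, zero_smul]
    exact Submodule.zero_mem _
  | succ i ih =>
    rw [T.yc_succ, add_smul, mul_smul]
    exact Submodule.add_mem _ (unif_smul_mem_isotypic T η ih) (wc_smul_mem_isotypic T η η' hl)

theorem IsGlued.exists_eq_of_mem_isotypic (hg : X.IsGlued T η η') (hη : η ≠ η') {i : ℕ}
    (hi : i < Module.finrank K K') {l : X.L} (hl : l ∈ X.isotypic T η i) :
    ∃ m ∈ X.eigen η, ∃ m' ∈ X.eigen η', l = T.unif X.A ^ i • m + T.yc X.A η η' i • m' := by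
  obtain ⟨a, b, -, -, he⟩ := hg.span l
  refine ⟨a ⟨i, hi⟩, (a _).2, b ⟨i, hi⟩, (b _).2, ?_⟩
  have hmem : ∀ j : Fin (Module.finrank K K'), T.unif X.A ^ (j : ℕ) • (a j : X.L) +
      T.yc X.A η η' j • (b j : X.L) ∈ X.isotypic T η j := fun j =>
    Submodule.add_mem _ (pow_smul_mem_isotypic j (a j).2) (yc_smul_mem_isotypic hη j (b j).2)
  conv_lhs => rw [← isotypicProj_eq_self T η hl, he, map_sum]
  rw [Finset.sum_eq_single (⟨i, hi⟩ : Fin (Module.finrank K K'))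
    (fun j _ hj => isotypicProj_of_ne T η hi j.2 (fun h => hj (Fin.ext h.symm)) (hmem j))
    (fun h => absurd (Finset.mem_univ _) h), isotypicProj_eq_self T η (hmem ⟨i, hi⟩)]

theorem sum_wc_smul (ξ : Gal(K'/K) →* (OInt p E)ˣ) (l : X.L) :
    ∑ i ∈ Finset.range (Module.finrank K K'), T.wc X.A η ξ i • l = l := by
  rw [← Finset.sum_smul, T.sum_wc, one_smul]

theorem IsGlued.range_mulPi_right (hg : X.IsGlued T η η') (hη : η ≠ η')
    (hE : Nonempty (K' →ₐ[ℚ_[p]] E)) :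
    LinearMap.range (mulPi T η' η X) = (X.piL T).comap (X.eigen η).subtype := by
  refine range_mulPi_of_exists hη hE fun l hl h' => ?_
  exact exists_mulPi_eq_of_exists hη hE (fun _ hi _ hl => hg.exists_eq_of_mem_isotypic hη hi hl) hl h'

/-- `IsGlued` is not symmetric in the two characters, so this side needs its own argument. On
w_(j+1), the element π' k of 𝔏_{η'} is π' times the degree-j part π'^j m + y_j m' of k, and y_j
w_(j+1) = 0. This leaves π'^(j+1) m, which is π₁ m on w_(j+1). -/
theorem IsGlued.range_mulPi_left (hg : X.IsGlued T η η') (hη : η ≠ η')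
    (hE : Nonempty (K' →ₐ[ℚ_[p]] E)) :
    LinearMap.range (mulPi T η η' X) = (X.piL T).comap (X.eigen η').subtype := by
  refine range_mulPi_of_exists hη.symm hE fun l hl h' => ?_
  obtain ⟨k, rfl⟩ := (X.mem_piL T).1 h'
  obtain ⟨n, hn⟩ := Nat.exists_eq_succ_of_ne_zero T.finrank_pos.ne'
  have hk : ∀ j, ∃ m ∈ X.eigen η, j + 1 < Module.finrank K K' →
      T.wc X.A η η' (j + 1) • T.unif X.A • k =
        T.wc X.A η η' (j + 1) • T.unif X.A ^ (j + 1) • m := fun j => by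
    by_cases hj : j + 1 < Module.finrank K K'
    · obtain ⟨m, hm, m', -, he⟩ := hg.exists_eq_of_mem_isotypic hη (Nat.lt_of_succ_lt hj)
        (X.isotypicProj_mem T η j k)
      refine ⟨m, hm, fun _ => ?_⟩
      have h1 : T.wc X.A η η' (j + 1) • T.unif X.A • k =
          T.wc X.A η η' (j + 1) • T.unif X.A • X.isotypicProj T η j k := by
        rw [← isotypicProj_succ_unif_smul, ← map_smul]
        have h2 : ∀ j', T.wc X.A η η' j' • T.unif X.A • k ∈ X.isotypic T η j' := fun j' =>
          wc_smul_mem_isotypic T η η' hl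
        exact (isotypicProj_eq_self T η (h2 _)).symm
      rw [h1, he, smul_add, smul_add, ← mul_smul, ← pow_succ', add_eq_left, coeff_smul_def,
        ← mul_smul, ← mul_smul, mul_right_comm, mul_assoc, ← mul_assoc, mul_comm _ (T.yc _ _ _ _),
        T.yc_mul_wc_of_lt X.A η η' (Nat.lt_succ_self j) hj, zero_mul, zero_smul]
    · exact ⟨0, Submodule.zero_mem _, fun h => absurd h hj⟩
  choose m hm hmk using hk
  refine ⟨∑ j ∈ Finset.range n, T.wc X.A η η' (j + 1) • m j,
    Submodule.sum_mem _ fun j _ => Submodule.smul_mem _ _ (hm j), ?_⟩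
  have h0 := T.wc_zero_of_ne X.A η η' hη
  have h1 := sum_wc_smul (T := T) (η := η) η' (T.unif X.A • k)
  rw [hn, Finset.sum_range_succ', h0, zero_smul, add_zero] at h1
  rw [← h1, Finset.smul_sum]
  refine Finset.sum_congr rfl fun j hj => ?_
  have hj' : j + 1 < Module.finrank K K' := by have := Finset.mem_range.1 hj; omega
  rw [hmk j hj', T.coeffOfInt_piElt X.A η η' hE hη, Finset.sum_smul, Finset.sum_eq_single (j + 1)]
  · rw [mul_smul, ← coeff_smul_def, ← mul_smul (T.wc X.A η η' (j + 1)), T.wc_mul_self, smul_comm]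
  · intro i hi hij
    rw [coeff_smul_def, ← mul_smul, mul_assoc, ← map_mul,
      T.wc_mul_of_ne X.A η η' (Finset.mem_range.1 hi) hj' hij, map_zero, mul_zero, zero_smul]
  · exact fun h => absurd (Finset.mem_range.2 hj') h

/-- In the decomposition of w_i l, everything is divisible by π' except the w_i-multiple of m'
belonging to η'. That term dies because the idempotents w_i for ξ and for η' are orthogonal. -/
theorem IsGlued.eigen_le (hg : X.IsGlued T η η') (hη : η ≠ η') {ξ : Gal(K'/K) →* (OInt p E)ˣ}
    (h1 : ξ ≠ η) (h2 : ξ ≠ η') {l : X.L} (hl : l ∈ X.eigen ξ) : l ∈ X.piL T := by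
  rw [← sum_wc_smul (T := T) (η := η) ξ l]
  refine Submodule.sum_mem _ fun i hi => ?_
  rcases i with _ | i
  · rw [T.wc_zero_of_ne X.A η ξ h1.symm, zero_smul]
    exact Submodule.zero_mem _
  obtain ⟨m, hm, m', hm', he⟩ := hg.exists_eq_of_mem_isotypic hη (Finset.mem_range.1 hi)
    (wc_smul_mem_isotypic T η ξ hl (i := i + 1))
  rw [← T.wc_mul_self X.A η ξ, mul_smul, he, T.yc_succ, add_smul, smul_add, smul_add, pow_succ',
    mul_smul, mul_smul, ← coeff_smul_def, ← mul_smul (T.wc X.A η ξ (i + 1)),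
    T.wc_mul_wc_of_ne X.A η ξ η' h2, zero_smul, add_zero]
  exact Submodule.add_mem _ (Submodule.smul_mem _ _ (X.unif_smul_mem_piL T _))
    (Submodule.smul_mem _ _ (X.unif_smul_mem_piL T _))

/-- A lattice built from a lattice chain is of type `η ⊕ η'`. -/
theorem IsGlued.isLocType (hg : X.IsGlued T η η') (hη : η ≠ η')
    (hE : Nonempty (K' →ₐ[ℚ_[p]] E)) (h₁ : IsProjOfRank (Coeff p X.A K) (X.eigen η) 2)
    (h₂ : IsProjOfRank (Coeff p X.A K) (X.eigen η') 2)
    (hc₁ : IsProjOfRankOverQuotient (Coeff p X.A K) (X.eigen η' ⧸ LinearMap.range (mulPi T η η' X))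
      (Ideal.span {T.unifBase X.A}) 1)
    (hc₂ : IsProjOfRankOverQuotient (Coeff p X.A K) (X.eigen η ⧸ LinearMap.range (mulPi T η' η X))
      (Ideal.span {T.unifBase X.A}) 1) (hp : Module.Projective X.A.carrier (X.L ⧸ X.Lp)) :
    X.isLocType T η η' := by
  refine ⟨⟨hg.isProjOfRank hη hE h₁ h₂ hc₁ hc₂, hp⟩, fun ξ => ?_⟩
  by_cases e1 : ξ = η
  · subst e1
    rw [if_pos rfl, if_neg hη]
    exact hc₂.of_equiv (residualEigenEquiv (hg.range_mulPi_right hη hE))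
  by_cases e2 : ξ = η'
  · subst e2
    rw [if_pos rfl, if_neg e1]
    exact hc₁.of_equiv (residualEigenEquiv (hg.range_mulPi_left hη hE))
  rw [if_neg e1, if_neg e2]
  have : Subsingleton (X.residualEigen T ξ) := by
    rw [residualEigen_eq, Submodule.subsingleton_iff_eq_bot, eq_bot_iff, Submodule.map_le_iff_le_comap]
    exact fun l hl => (Submodule.Quotient.mk_eq_zero _).2 (hg.eigen_le hη e1 e2 hl)
  exact isProjOfRankOverQuotient_zero _

end LocDatum

end Recognition

/-! ### Lattices glued from a lattice chain -/

section Gluing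

set_option linter.unusedSectionVars false

variable {p : ℕ} [Fact p.Prime]
  {K K' E : Type u} [Field K] [Field K'] [Field E]
  [Algebra ℚ_[p] K] [Algebra ℤ_[p] K] [IsScalarTower ℤ_[p] ℚ_[p] K]
  [Algebra ℚ_[p] K'] [Algebra ℤ_[p] K'] [IsScalarTower ℤ_[p] ℚ_[p] K']
  [Algebra ℚ_[p] E] [Algebra ℤ_[p] E] [IsScalarTower ℤ_[p] ℚ_[p] E]
  [Algebra K K'] [IsScalarTower ℚ_[p] K K'] [IsScalarTower ℤ_[p] K K']
  [FiniteDimensional K K'] [FiniteDimensional ℚ_[p] K] [FiniteDimensional ℚ_[p] K']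
  [FiniteDimensional ℚ_[p] E]


attribute [local instance] coeffAlgebra

variable (T : TameTotRam p K K') {η η' : Gal(K'/K) →* (OInt p E)ˣ} (hη : η ≠ η')
  (X : LocDatum.{u} p K K' E) {L₁ L₂ : Type u} [AddCommGroup L₁] [AddCommGroup L₂]
  [Module (Coeff p X.A K) L₁] [Module (Coeff p X.A K) L₂]

/-- An identification of `𝔏` with the module glued from `f₁` and `f₂`. -/
structure Gluing (f₁ : L₁ →ₗ[Coeff p X.A K] L₂) (f₂ : L₂ →ₗ[Coeff p X.A K] L₁) where
  /-- the identification -/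
  equiv : X.L ≃ₗ[Coeff p X.A K] (T.stair X.A hη).glue L₁ L₂
  equiv_unif : ∀ l, equiv (T.unif X.A • l) = (T.stair X.A hη).shift f₁ f₂ (equiv l)
  equiv_ρ : ∀ g l i, (equiv (X.ρ g l)).1 i =
    (TameTotRam.chc X.A η g * T.hc X.A g ^ (i : ℕ)) • (equiv l).1 i

namespace Gluing

variable {T hη X} {f₁ : L₁ →ₗ[Coeff p X.A K] L₂} {f₂ : L₂ →ₗ[Coeff p X.A K] L₁}
  (G : Gluing T hη X f₁ f₂)

/-- The `i`-th component. -/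
def comp (i : Fin (Module.finrank K K')) : X.L →ₗ[Coeff p X.A K] L₁ × L₂ :=
  LinearMap.proj i ∘ₗ Submodule.subtype _ ∘ₗ G.equiv.toLinearMap

theorem comp_apply (i : Fin (Module.finrank K K')) (l : X.L) : G.comp i l = (G.equiv l).1 i := rfl

theorem ext_comp {l m : X.L} (h : ∀ i, G.comp i l = G.comp i m) : l = m :=
  G.equiv.injective (Subtype.ext (funext h))

theorem comp_spec (i : Fin (Module.finrank K K')) (l : X.L) :
    T.uc X.A η η' i • (G.comp i l).1 = (G.comp i l).1 ∧ T.uc X.A η η' i • (G.comp i l).2 = 0 :=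
  (G.equiv l).2 i

theorem comp_symm (i : Fin (Module.finrank K K')) (l : (T.stair X.A hη).glue L₁ L₂) :
    G.comp i (G.equiv.symm l) = l.1 i := by
  rw [comp_apply, G.equiv.apply_symm_apply]

/-- Position i is exactly the part of degree i. An eigenvector for ξ splits into graded parts in two
ways, by positions and by the idempotents w_i, and the projectors show that the two agree. -/
theorem comp_eq_of_mem_eigen {ξ : Gal(K'/K) →* (OInt p E)ˣ} {l : X.L} (hl : l ∈ X.eigen ξ)
    (i : Fin (Module.finrank K K')) : T.wc X.A η ξ i • G.comp i l = G.comp i l := by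
  classical
  let s : Fin (Module.finrank K K') → X.L := fun j => G.equiv.symm
    ⟨Pi.single j (G.comp j l), fun k => by
      rcases eq_or_ne k j with rfl | h
      · rw [Pi.single_eq_same]
        exact G.comp_spec k l
      · rw [Pi.single_eq_of_ne h]
        exact ⟨smul_zero _, smul_zero _⟩⟩
  have hs : ∀ k j, G.comp k (s j) = (Pi.single j (G.comp j l) : Fin (Module.finrank K K') → L₁ × L₂) k :=
    fun k j => G.comp_symm k _
  have hsum : ∑ j, s j = l := G.ext_comp fun k => by
    rw [map_sum, Finset.sum_congr rfl fun j _ => hs k j, Finset.sum_pi_single]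
    simp
  have hmem : ∀ j : Fin (Module.finrank K K'), s j ∈ X.isotypic T η j := fun j g => G.ext_comp fun k => by
    rw [comp_apply, G.equiv_ρ, ← comp_apply, map_smul, hs]
    rcases eq_or_ne k j with rfl | h
    · rfl
    · rw [Pi.single_eq_of_ne h, smul_zero, smul_zero]
  have h1 : X.isotypicProj T η i l = s i := by
    conv_lhs => rw [← hsum, map_sum]
    rw [Finset.sum_eq_single i (fun j _ hj => LocDatum.isotypicProj_of_ne T η i.2 j.2
      (fun h => hj (Fin.ext h.symm)) (hmem j)) (fun h => absurd (Finset.mem_univ _) h),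
      LocDatum.isotypicProj_eq_self T η (hmem i)]
  have hw : ∀ j, T.wc X.A η ξ j • l ∈ X.isotypic T η j := fun j =>
    LocDatum.wc_smul_mem_isotypic T η ξ hl
  have h2 : X.isotypicProj T η i l = T.wc X.A η ξ i • l := by
    conv_lhs => rw [← LocDatum.sum_wc_smul (T := T) (η := η) ξ l, map_sum]
    rw [Finset.sum_eq_single (i : ℕ) (fun j hj hji => LocDatum.isotypicProj_of_ne T η i.2
      (Finset.mem_range.1 hj) hji.symm (hw j)) (fun h => absurd (Finset.mem_range.2 i.2) h),
      LocDatum.isotypicProj_eq_self T η (hw i)]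
  rw [← map_smul, ← h2, h1, hs, Pi.single_eq_same]

theorem mem_eigen_iff (ξ : Gal(K'/K) →* (OInt p E)ˣ) (l : X.L) :
    l ∈ X.eigen ξ ↔ ∀ i : Fin (Module.finrank K K'),
      T.wc X.A η ξ i • G.comp i l = G.comp i l := by
  refine ⟨fun hl i => G.comp_eq_of_mem_eigen hl i, fun h => (X.mem_eigen ξ).2 fun g => ?_⟩
  refine G.ext_comp fun i => ?_
  rw [comp_apply, G.equiv_ρ, ← comp_apply, map_smul, ← h i, ← mul_smul, ← mul_smul, T.chc_mul_wc]

/-- The element of `𝔏_η` attached to an element of `𝔏₁`. -/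
def inl : L₁ ≃ₗ[Coeff p X.A K] X.eigen η where
  toFun l := ⟨G.equiv.symm ((T.stair X.A hη).inlAt f₁ ⟨0, T.finrank_pos⟩ l),
    (G.mem_eigen_iff η _).2 fun i => by
      rw [comp_symm, Stair.inlAt_coe]
      rcases eq_or_ne i ⟨0, T.finrank_pos⟩ with rfl | h
      · rw [T.wc_self_zero, one_smul]
      · rw [Pi.single_eq_of_ne h, smul_zero]⟩
  map_add' l m := Subtype.ext (by simp only [map_add, Submodule.coe_add])
  map_smul' s l := Subtype.ext (by simp only [map_smul, Submodule.coe_smul, RingHom.id_apply])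
  invFun l := (G.comp ⟨0, T.finrank_pos⟩ l).1
  left_inv l := by
    show (G.comp _ (G.equiv.symm _)).1 = l
    rw [comp_symm, Stair.inlAt_coe, Pi.single_eq_same]
    exact (congrArg (· • l) (T.stair X.A hη).zero).trans (one_smul _ _)
  right_inv l := Subtype.ext <| G.ext_comp fun i => by
    show G.comp _ (G.equiv.symm _) = _
    rw [comp_symm, Stair.inlAt_coe]
    rcases eq_or_ne i ⟨0, T.finrank_pos⟩ with rfl | h
    · have h1 := (G.comp_spec ⟨0, T.finrank_pos⟩ l).2
      have h2 : (T.stair X.A hη).u 0 = 1 := (T.stair X.A hη).zero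
      rw [show T.uc X.A η η' 0 = 1 from h2, one_smul] at h1
      rw [Pi.single_eq_same]
      simp only [h2, one_smul, sub_self, zero_smul]
      exact Prod.ext rfl h1.symm
    · rw [Pi.single_eq_of_ne h, ← G.comp_eq_of_mem_eigen l.2 i,
        T.wc_self_of_pos X.A η (Nat.pos_of_ne_zero fun h0 => h (Fin.ext h0)) i.2, zero_smul]

/-- The element of `𝔏_{η'}` attached to an element of `𝔏₂`. -/
def inr : L₂ ≃ₗ[Coeff p X.A K] X.eigen η' where
  -- Since a varies with σ, an element of 𝔏_{η'} is spread over all positions: where a = i, it sits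
  -- at position i. Summing the components recovers it.
  toFun m := ⟨G.equiv.symm ⟨fun i => (0, T.wc X.A η η' i • m), fun i => ⟨smul_zero _, by
      show T.uc X.A η η' i • T.wc X.A η η' i • m = 0
      rw [← mul_smul, T.uc_mul_wc_of_le X.A η η' le_rfl i.2, zero_smul]⟩⟩,
    (G.mem_eigen_iff η' _).2 fun i => by
      rw [comp_symm, Prod.smul_mk, smul_zero, ← mul_smul, T.wc_mul_self]⟩
  map_add' l m := Subtype.ext <| G.ext_comp fun i => by
    rw [Submodule.coe_add, map_add]
    simp only [comp_symm, smul_add, Prod.mk_add_mk, add_zero]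
  map_smul' s l := Subtype.ext <| G.ext_comp fun i => by
    rw [Submodule.coe_smul, map_smul]
    simp only [comp_symm, RingHom.id_apply, Prod.smul_mk, smul_zero, smul_comm _ s]
  invFun l := ∑ i, (G.comp i l).2
  left_inv m := by
    show ∑ i, (G.comp i (G.equiv.symm _)).2 = m
    simp only [comp_symm]
    rw [← Finset.sum_smul, ← Finset.sum_range (fun i => T.wc X.A η η' i), T.sum_wc, one_smul]
  right_inv l := Subtype.ext <| G.ext_comp fun i => by
    have h1 : ∀ j : Fin (Module.finrank K K'), (G.comp j l).2 = T.wc X.A η η' j • (G.comp j l).2 := fun j =>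
      congrArg Prod.snd (G.comp_eq_of_mem_eigen l.2 j).symm
    refine (G.comp_symm i _).trans ?_
    show (0, T.wc X.A η η' i • ∑ j, (G.comp j l).2) = G.comp i l
    rw [Finset.smul_sum, Finset.sum_eq_single i]
    · refine Prod.ext ?_ (h1 i).symm
      have h2 := congrArg Prod.fst (G.comp_eq_of_mem_eigen l.2 i)
      rw [← (G.comp_spec i l).1, ← h2, Prod.smul_fst, ← mul_smul,
        T.uc_mul_wc_of_le X.A η η' le_rfl i.2, zero_smul]
    · intro j _ hj
      rw [h1, ← mul_smul, T.wc_mul_of_ne X.A η η' i.2 j.2 (fun h => hj (Fin.ext h.symm)), zero_smul]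
    · exact fun h => absurd (Finset.mem_univ _) h

theorem equiv_inl (l : L₁) :
    G.equiv (G.inl l) = (T.stair X.A hη).inlAt f₁ ⟨0, T.finrank_pos⟩ l :=
  G.equiv.apply_symm_apply _

theorem comp_inr (i : Fin (Module.finrank K K')) (m : L₂) :
    G.comp i (G.inr m) = (0, T.wc X.A η η' i • m) := G.comp_symm i _

theorem equiv_pow (i : ℕ) (l : X.L) : G.equiv (T.unif X.A ^ i • l) =
    ((T.stair X.A hη).shift f₁ f₂ ^ i) (G.equiv l) := by
  induction i with
  | zero => rw [pow_zero, pow_zero, one_smul]; rfl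
  | succ i ih => rw [pow_succ', mul_smul, G.equiv_unif, ih, pow_succ', Module.End.mul_apply]

theorem equiv_pow_inl (i : Fin (Module.finrank K K')) (l : L₁) :
    G.equiv (T.unif X.A ^ (i : ℕ) • (G.inl l : X.L)) = (T.stair X.A hη).inlAt f₁ i l := by
  rw [equiv_pow, equiv_inl]
  exact (T.stair X.A hη).shift_pow_inlAt f₁ f₂ i.2 l

/-- Induction by the recursion for y_i. The term shifted from position i is cut by 1 - u_i, and the
w_(i+1)-component of the eigenvector fills in the rest, as u_i = u_(i+1) + w_(i+1). -/
theorem equiv_yc_inr (i : Fin (Module.finrank K K')) (m : L₂) :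
    G.equiv (T.yc X.A η η' i • (G.inr m : X.L)) = (T.stair X.A hη).inrAt L₁ i m := by
  obtain ⟨i, hi⟩ := i
  induction i generalizing m with
  | zero =>
    rw [T.yc_zero X.A η η' hη, zero_smul, map_zero]
    refine Subtype.ext ?_
    rw [Stair.inrAt_coe, (T.stair X.A hη).zero, sub_self, zero_smul, ← Prod.zero_eq_mk,
      Pi.single_zero]
    rfl
  | succ i ih =>
    rw [T.yc_succ, add_smul, map_add, mul_smul, G.equiv_unif,
      show G.equiv (T.yc X.A η η' i • (G.inr m : X.L)) = _ from ih m (by omega),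
      (T.stair X.A hη).shift_inrAt f₁ f₂ hi, ← LocDatum.coeff_smul_def, map_smul G.equiv]
    refine Subtype.ext ?_
    rw [Submodule.coe_add, Stair.inrAt_coe, Stair.inrAt_coe, Submodule.coe_smul]
    have hu : T.uc X.A η η' (i + 1) * T.uc X.A η η' i = T.uc X.A η η' (i + 1) :=
      T.uc_mul_of_le X.A η η' (Nat.le_succ i) hi
    funext j
    rw [Pi.add_apply, Pi.smul_apply, ← comp_apply, comp_inr, Prod.smul_mk, smul_zero,
      ← mul_smul (T.wc X.A η η' (i + 1))]
    rcases eq_or_ne j ⟨i + 1, hi⟩ with rfl | h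
    · rw [Pi.single_eq_same, Pi.single_eq_same, T.wc_mul_self, Prod.mk_add_mk, add_zero,
        ← mul_smul, ← add_smul]
      congr 2
      have := T.uc_succ X.A η η' i
      show (1 - T.uc X.A η η' (i + 1)) * (1 - T.uc X.A η η' i) + T.wc X.A η η' (i + 1) =
        1 - T.uc X.A η η' (i + 1)
      linear_combination hu + this
    · rw [Pi.single_eq_of_ne h, Pi.single_eq_of_ne h, T.wc_mul_of_ne X.A η η' hi j.2
        (fun h' => h (Fin.ext h'.symm)), zero_smul, zero_add]
      rfl

theorem sum_inl_add_inr (l : X.L) : ∑ i : Fin (Module.finrank K K'),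
    (T.unif X.A ^ (i : ℕ) • (G.inl (G.comp i l).1 : X.L) +
      T.yc X.A η η' i • (G.inr (G.comp i l).2 : X.L)) = l := by
  apply G.equiv.injective
  rw [map_sum, ← (T.stair X.A hη).sum_inlAt_add_inrAt f₁ (G.equiv l)]
  refine Finset.sum_congr rfl fun i _ => ?_
  rw [map_add, equiv_pow_inl, equiv_yc_inr]
  rfl

/-- The summand π'^j w_j moves l to position j, and since u_j w_j = 0 only f₁ l is left there. The
summands together are the spread-out form of f₁ l. -/
theorem mulPi_inl (hE : Nonempty (K' →ₐ[ℚ_[p]] E)) (l : L₁) :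
    LocDatum.mulPi T η η' X (G.inl l) = G.inr (f₁ l) := by
  refine Subtype.ext (G.ext_comp fun i => ?_)
  rw [LocDatum.mulPi_coe, T.coeffOfInt_piElt X.A η η' hE hη, Finset.sum_smul, map_sum, comp_inr,
    Finset.sum_range]
  have h1 : ∀ j : Fin (Module.finrank K K'), G.comp i ((T.unif X.A ^ (j : ℕ) *
      coeffIncl K K' X.A (T.wc X.A η η' j)) • (G.inl l : X.L)) =
      (Pi.single j (0, T.wc X.A η η' j • f₁ l) : Fin (Module.finrank K K') → L₁ × L₂) i :=
    fun j => by
    have hu : T.uc X.A η η' j * T.wc X.A η η' j = 0 := T.uc_mul_wc_of_le X.A η η' le_rfl j.2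
    rw [mul_comm, mul_smul, ← LocDatum.coeff_smul_def, map_smul, comp_apply, equiv_pow_inl,
      Stair.inlAt_coe]
    rcases eq_or_ne i j with rfl | h
    · rw [Pi.single_eq_same, Pi.single_eq_same, Prod.smul_mk, ← mul_smul, ← mul_smul]
      refine Prod.ext ?_ (congrArg (· • f₁ l) ?_)
      · show (T.wc X.A η η' i * T.uc X.A η η' i) • l = 0
        rw [mul_comm, hu, zero_smul]
      · show T.wc X.A η η' i * (1 - T.uc X.A η η' i) = T.wc X.A η η' i
        linear_combination -hu
    · rw [Pi.single_eq_of_ne h, Pi.single_eq_of_ne h, smul_zero]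
  rw [Finset.sum_congr rfl fun j _ => h1 j, Finset.sum_pi_single]
  simp

theorem mulPi_inr (hE : Nonempty (K' →ₐ[ℚ_[p]] E)) (m : L₂) :
    LocDatum.mulPi T η' η X (G.inr m) = G.inl (f₂ m) := by
  refine Subtype.ext (G.equiv.injective ?_)
  have h := G.equiv_yc_inr ⟨Module.finrank K K' - 1, Nat.sub_lt T.finrank_pos Nat.one_pos⟩ m
  rw [LocDatum.mulPi_coe, ← T.unif_mul_yc_last X.A η η' hE hη, mul_smul, G.equiv_unif, equiv_inl, h]
  exact (T.stair X.A hη).shift_inrAt_last f₁ f₂ m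

theorem isGlued (G : Gluing T hη X f₁ f₂) : X.IsGlued T η η' where
  span l := by
    refine ⟨fun i => G.inl (G.comp i l).1, fun i => G.inr (G.comp i l).2, fun i => ?_, fun i => ?_,
      (G.sum_inl_add_inr l).symm⟩
    · rw [← map_smul, (G.comp_spec i l).1]
    · rw [← map_smul, (G.comp_spec i l).2, map_zero]
  uniq a b ha hb h i := by
    obtain ⟨α, rfl⟩ : ∃ α, a = fun i => G.inl (α i) :=
      ⟨fun i => G.inl.symm (a i), funext fun i => (G.inl.apply_symm_apply _).symm⟩
    obtain ⟨β, rfl⟩ : ∃ β, b = fun i => G.inr (β i) :=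
      ⟨fun i => G.inr.symm (b i), funext fun i => (G.inr.apply_symm_apply _).symm⟩
    have hα : ∀ i : Fin (Module.finrank K K'), T.uc X.A η η' i • α i = α i := fun i =>
      G.inl.injective (by rw [map_smul, ha])
    have hβ : ∀ i : Fin (Module.finrank K K'), T.uc X.A η η' i • β i = 0 := fun i =>
      G.inr.injective (by rw [map_smul, hb, map_zero])
    have h1 : ∀ j : Fin (Module.finrank K K'), G.comp i (T.unif X.A ^ (j : ℕ) • (G.inl (α j) : X.L) +
        T.yc X.A η η' j • (G.inr (β j) : X.L)) =
        (Pi.single j (α j, β j) : Fin (Module.finrank K K') → L₁ × L₂) i := fun j => by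
      rw [map_add, comp_apply, comp_apply, equiv_pow_inl, equiv_yc_inr, Stair.inlAt_coe,
        Stair.inrAt_coe, ← Pi.add_apply, ← Pi.single_add, Prod.mk_add_mk, add_zero, ← map_smul]
      rw [show (T.stair X.A hη).u j • α j = α j from hα j,
        show (1 - (T.stair X.A hη).u j) • α j = 0 from one_sub_smul_of_smul_eq_self (hα j),
        show (1 - (T.stair X.A hη).u j) • β j = β j from one_sub_smul_of_smul_eq_zero (hβ j),
        map_zero, zero_add]
    have h2 := congrArg (G.comp i) h
    rw [map_sum, Finset.sum_congr rfl fun j _ => h1 j, Finset.sum_pi_single, map_zero] at h2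
    simp only [Finset.mem_univ, if_true, Prod.mk_eq_zero] at h2
    exact ⟨by simp only [h2.1, map_zero], by simp only [h2.2, map_zero]⟩

end Gluing

end Gluing

/-! ### The determinant condition -/

section Determinant

set_option linter.unusedSectionVars false

variable {p : ℕ} [Fact p.Prime]
  {K K' E : Type u} [Field K] [Field K'] [Field E]
  [Algebra ℚ_[p] K] [Algebra ℤ_[p] K] [IsScalarTower ℤ_[p] ℚ_[p] K]
  [Algebra ℚ_[p] K'] [Algebra ℤ_[p] K'] [IsScalarTower ℤ_[p] ℚ_[p] K']
  [Algebra ℚ_[p] E] [Algebra ℤ_[p] E] [IsScalarTower ℤ_[p] ℚ_[p] E]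
  [Algebra K K'] [IsScalarTower ℚ_[p] K K'] [IsScalarTower ℤ_[p] K K']
  [FiniteDimensional K K'] [FiniteDimensional ℚ_[p] K] [FiniteDimensional ℚ_[p] K']
  [FiniteDimensional ℚ_[p] E]


/-- A finite projective module becomes free after inverting one element outside a given maximal
ideal. Freeness then passes to every algebra in which that element is invertible. -/
theorem exists_cover_free (A Q : Type u) [CommRing A] [AddCommGroup Q] [Module A Q]
    [Module.Finite A Q] [Module.Projective A Q] : ∃ S : Set A, Ideal.span S = ⊤ ∧ ∀ s ∈ S,
      ∀ (B : Type u) [CommRing B] [Algebra A B], IsUnit (algebraMap A B s) →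
        Module.Free B (B ⊗[A] Q) := by
  refine ⟨{s | ∀ (B : Type u) [CommRing B] [Algebra A B], IsUnit (algebraMap A B s) →
    Module.Free B (B ⊗[A] Q)}, ?_, fun s hs => hs⟩
  by_contra h
  obtain ⟨𝔪, h𝔪, hle⟩ := Ideal.exists_le_maximal _ h
  have hfp : Module.FinitePresentation A Q := Module.finitePresentation_of_projective A Q
  have hfree : Module.Free (Localization.AtPrime 𝔪) (LocalizedModule 𝔪.primeCompl Q) :=
    Module.free_of_flat_of_isLocalRing
  obtain ⟨r, hr, hr', -⟩ := Module.FinitePresentation.exists_free_localizedModule_powers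
    𝔪.primeCompl (LocalizedModule.mkLinearMap 𝔪.primeCompl Q) (Localization.AtPrime 𝔪)
  refine hr (hle (Ideal.subset_span fun B _ _ hB => ?_))
  let _ : Algebra (Localization.Away r) B := (IsLocalization.Away.lift r hB).toAlgebra
  have : IsScalarTower A (Localization.Away r) B := IsScalarTower.of_algebraMap_eq fun a =>
    (IsLocalization.Away.lift_eq r hB a).symm
  have : Module.Free (Localization.Away r) (Localization.Away r ⊗[A] Q) :=
    Module.Free.of_equiv (IsLocalizedModule.isBaseChange (Submonoid.powers r)
      (Localization.Away r) (LocalizedModule.mkLinearMap (Submonoid.powers r) Q)).equiv.symm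
  exact Module.Free.of_equiv (AlgebraTensorModule.cancelBaseChange A (Localization.Away r) B B Q)

open scoped Pointwise in
/-- Two conditions holding Zariski locally hold Zariski locally at the same time. -/
theorem exists_cover_and {A : Type u} [CommRing A] {P Q : A → Prop}
    (hP : ∃ S : Set A, Ideal.span S = ⊤ ∧ ∀ s ∈ S, P s)
    (hQ : ∃ S : Set A, Ideal.span S = ⊤ ∧ ∀ s ∈ S, Q s) (hP' : ∀ s t, P s → P (s * t))
    (hQ' : ∀ s t, Q s → Q (s * t)) : ∃ S : Set A, Ideal.span S = ⊤ ∧ ∀ s ∈ S, P s ∧ Q s := by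
  obtain ⟨S, hS, h⟩ := hP
  obtain ⟨S', hS', h'⟩ := hQ
  refine ⟨S * S', by rw [← Ideal.span_mul_span', hS, hS', Ideal.top_mul], ?_⟩
  rintro _ ⟨s, hs, t, ht, rfl⟩
  exact ⟨hP' s t (h s hs), (mul_comm t s ▸ hQ' t s (h' t ht) : Q (s * t))⟩

/-- The part of a module on which an idempotent acts as the identity. -/
def idemPart {S : Type*} (M : Type*) [CommRing S] [AddCommGroup M] [Module S M] (U : S) :
    Submodule S M := LinearMap.eqLocus (LinearMap.lsmul S M U) LinearMap.id

theorem mem_idemPart {S M : Type*} [CommRing S] [AddCommGroup M] [Module S M] {U : S} {m : M} :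
    m ∈ idemPart M U ↔ U • m = m := Iff.rfl

/-- The decomposition of a module defined by an idempotent. -/
def idemPartEquiv {S : Type*} (M : Type*) [CommRing S] [AddCommGroup M] [Module S M] {U : S}
    (hU : U * U = U) : M ≃ₗ[S] idemPart M U × idemPart M (1 - U) where
  toFun m := (⟨U • m, by rw [mem_idemPart, ← mul_smul, hU]⟩, ⟨(1 - U) • m, by
    rw [mem_idemPart, ← mul_smul]
    congr 1
    linear_combination hU⟩)
  map_add' m m' := Prod.ext (Subtype.ext (smul_add _ _ _)) (Subtype.ext (smul_add _ _ _))
  map_smul' s m := Prod.ext (Subtype.ext (smul_comm _ _ _)) (Subtype.ext (smul_comm _ _ _))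
  invFun m := m.1 + m.2
  left_inv m := by
    show U • m + (1 - U) • m = m
    rw [← add_smul, add_sub_cancel, one_smul]
  right_inv := fun ⟨⟨m, hm⟩, ⟨m', hm'⟩⟩ => by
    rw [mem_idemPart] at hm hm'
    have h1 : (1 - U) • m = 0 := by rw [← hm, ← mul_smul, sub_mul, one_mul, hU, sub_self, zero_smul]
    have h2 : U • m' = 0 := by rw [← hm', ← mul_smul, mul_sub, mul_one, hU, sub_self, zero_smul]
    refine Prod.ext (Subtype.ext ?_) (Subtype.ext ?_)
    · show U • (m + m') = m
      rw [smul_add, hm, h2, add_zero]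
    · show (1 - U) • (m + m') = m'
      rw [smul_add, hm', h1, zero_add]

section Action

variable (K) (A : TestAlg.{u} p E) (B : Type u) [CommRing B] [Algebra A.carrier B]
  (M N : Type u) [AddCommGroup M] [Module (Coeff p A K) M] [Module A.carrier M]
  [IsScalarTower A.carrier (Coeff p A K) M] [AddCommGroup N] [Module (Coeff p A K) N]
  [Module A.carrier N] [IsScalarTower A.carrier (Coeff p A K) N]

/-- The action of `B ⊗ 𝒪_K` on `B ⊗_A M`. -/
def coeffAct : B ⊗[A.carrier] Coeff p A K →ₐ[B] Module.End B (B ⊗[A.carrier] M) :=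
  (LinearMap.tensorProductEnd A.carrier B M).comp
    (Algebra.TensorProduct.map (AlgHom.id B B) (Algebra.lsmul A.carrier A.carrier M))

theorem coeffAct_tmul (b b' : B) (s : Coeff p A K) (m : M) :
    coeffAct K A B M (b ⊗ₜ s) (b' ⊗ₜ m) = (b * b') ⊗ₜ (s • m) := by
  show (b • (Algebra.lsmul A.carrier A.carrier M s).baseChange B) (b' ⊗ₜ m) = _
  rw [LinearMap.smul_apply, LinearMap.baseChange_tmul, TensorProduct.smul_tmul', smul_eq_mul]
  rfl

variable {M N} in
theorem baseChange_coeffAct (f : M →ₗ[Coeff p A K] N) (z : B ⊗[A.carrier] Coeff p A K)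
    (t : B ⊗[A.carrier] M) : (f.restrictScalars A.carrier).baseChange B (coeffAct K A B M z t) =
      coeffAct K A B N z ((f.restrictScalars A.carrier).baseChange B t) := by
  induction z using TensorProduct.induction_on with
  | zero => simp
  | add x y hx hy => simp only [map_add, LinearMap.add_apply, hx, hy]
  | tmul b s =>
    induction t using TensorProduct.induction_on with
    | zero => simp
    | add x y hx hy => simp only [map_add, hx, hy]
    | tmul b' m => simp [coeffAct_tmul]

variable {M N} in
theorem det_coeffAct_of_equiv (e : M ≃ₗ[Coeff p A K] N) (z : B ⊗[A.carrier] Coeff p A K) :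
    LinearMap.det (coeffAct K A B M z) = LinearMap.det (coeffAct K A B N z) := by
  let e' := (e.restrictScalars A.carrier).baseChange A.carrier B M N
  rw [← LinearMap.det_conj (coeffAct K A B M z) e']
  congr 1
  refine LinearMap.ext fun t => ?_
  have := baseChange_coeffAct K A B e.toLinearMap z (e'.symm t)
  refine this.trans (congrArg _ ?_)
  exact e'.apply_symm_apply t

theorem det_coeffAct_prod [Module.Free B (B ⊗[A.carrier] M)] [Module.Free B (B ⊗[A.carrier] N)]
    [Module.Finite A.carrier M] [Module.Finite A.carrier N] (z : B ⊗[A.carrier] Coeff p A K) :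
    LinearMap.det (coeffAct K A B (M × N) z) =
      LinearMap.det (coeffAct K A B M z) * LinearMap.det (coeffAct K A B N z) := by
  let e := TensorProduct.prodRight A.carrier B B M N
  rw [← LinearMap.det_prodMap, ← LinearMap.det_conj (coeffAct K A B (M × N) z) e]
  congr 1
  refine LinearMap.ext fun t => ?_
  rw [LinearMap.comp_apply, LinearMap.comp_apply]
  obtain ⟨t, rfl⟩ := e.surjective t
  rw [LinearEquiv.coe_coe, LinearEquiv.coe_coe, e.symm_apply_apply]
  induction z using TensorProduct.induction_on with
  | zero => simp
  | add x y hx hy =>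
    simp only [map_add, LinearMap.add_apply, hx, hy, LinearMap.prodMap_apply]
    rfl
  | tmul b s =>
    induction t using TensorProduct.induction_on with
    | zero => simp only [map_zero]
    | add x y hx hy => simp only [map_add, hx, hy]
    | tmul b' m =>
      obtain ⟨m, n⟩ := m
      simp [e, coeffAct_tmul]

theorem coeffAct_one_tmul_of_smul_eq {U V : Coeff p A K} (h : ∀ m : M, U • m = V • m) :
    coeffAct K A B M (1 ⊗ₜ U) = coeffAct K A B M (1 ⊗ₜ V) := by
  refine LinearMap.ext fun t => ?_
  induction t using TensorProduct.induction_on with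
  | zero => simp
  | add x y hx hy => simp only [map_add, hx, hy]
  | tmul b' m => rw [coeffAct_tmul, coeffAct_tmul, h]

/-- The homomorphism `B ⊗ 𝒪_K → B` induced by an embedding of `K`. -/
def coeffEmb (ψ : K →ₐ[ℚ_[p]] E) : B ⊗[A.carrier] Coeff p A K →ₐ[B] B :=
  Algebra.TensorProduct.lift (AlgHom.id B B) ((Algebra.ofId A.carrier B).comp
    (Algebra.TensorProduct.lift (AlgHom.id A.carrier A.carrier)
      ((IsScalarTower.toAlgHom ℤ_[p] (OInt p E) A.carrier).comp
        (OInt.map (ψ.restrictScalars ℤ_[p]))) fun _ _ => Commute.all _ _)) fun _ _ => Commute.all _ _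

theorem coeffEmb_tmul (ψ : K →ₐ[ℚ_[p]] E) (b : B) (a : OInt p K) :
    coeffEmb K A B ψ (b ⊗ₜ (1 ⊗ₜ a)) = b * algebraMap A.carrier B
      (algebraMap (OInt p E) A.carrier (OInt.map (ψ.restrictScalars ℤ_[p]) a)) := by
  simp [coeffEmb, Algebra.ofId_apply]

theorem exists_eq_sum_tmul (z : B ⊗[A.carrier] Coeff p A K) : ∃ (n : ℕ) (a : Fin n → OInt p K)
    (b : Fin n → B), z = ∑ i, b i ⊗ₜ[A.carrier] ((1 : A.carrier) ⊗ₜ[ℤ_[p]] a i) := by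
  induction z using TensorProduct.induction_on with
  | zero => exact ⟨0, Fin.elim0, Fin.elim0, by simp⟩
  | add x y hx hy =>
    obtain ⟨n, a, b, rfl⟩ := hx
    obtain ⟨n', a', b', rfl⟩ := hy
    exact ⟨n + n', Fin.append a a', Fin.append b b', by simp [Fin.sum_univ_add]⟩
  | tmul b s =>
    induction s using TensorProduct.induction_on with
    | zero => exact ⟨0, Fin.elim0, Fin.elim0, by simp⟩
    | add x y hx hy =>
      obtain ⟨n, a, b, hx⟩ := hx
      obtain ⟨n', a', b', hy⟩ := hy
      rw [TensorProduct.tmul_add, hx, hy]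
      exact ⟨n + n', Fin.append a a', Fin.append b b', by simp [Fin.sum_univ_add]⟩
    | tmul c a =>
      refine ⟨1, fun _ => a, fun _ => algebraMap A.carrier B c * b, ?_⟩
      rw [Fin.sum_univ_one, ← Algebra.smul_def, TensorProduct.smul_tmul, TensorProduct.smul_tmul',
        smul_eq_mul, mul_one]

theorem coeffAct_sum {n : ℕ} (a : Fin n → OInt p K) (b : Fin n → B) :
    coeffAct K A B M (∑ i, b i ⊗ₜ[A.carrier] ((1 : A.carrier) ⊗ₜ[ℤ_[p]] a i)) =
      ∑ i, b i • ((LinearMap.lsmul (Coeff p A K) M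
        (1 ⊗ₜ[ℤ_[p]] a i)).restrictScalars A.carrier).baseChange B := by
  rw [map_sum]
  refine Finset.sum_congr rfl fun i _ => LinearMap.ext fun t => ?_
  induction t using TensorProduct.induction_on with
  | zero => simp
  | add x y hx hy => simp only [map_add, hx, hy]
  | tmul b' m =>
    rw [coeffAct_tmul]
    simp [TensorProduct.smul_tmul']

end Action

end Determinant

/-! ### Determinant conditions composed along an idempotent, and the rank they impose -/

section Determinant

set_option linter.unusedSectionVars false

variable {p : ℕ} [Fact p.Prime]
  {K K' E : Type u} [Field K] [Field K'] [Field E]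
  [Algebra ℚ_[p] K] [Algebra ℤ_[p] K] [IsScalarTower ℤ_[p] ℚ_[p] K]
  [Algebra ℚ_[p] K'] [Algebra ℤ_[p] K'] [IsScalarTower ℤ_[p] ℚ_[p] K']
  [Algebra ℚ_[p] E] [Algebra ℤ_[p] E] [IsScalarTower ℤ_[p] ℚ_[p] E]
  [Algebra K K'] [IsScalarTower ℚ_[p] K K'] [IsScalarTower ℤ_[p] K K']
  [FiniteDimensional K K'] [FiniteDimensional ℚ_[p] K] [FiniteDimensional ℚ_[p] K']
  [FiniteDimensional ℚ_[p] E]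


variable {A : TestAlg.{u} p E} {M N : Type u} [AddCommGroup M] [Module (Coeff p A K) M]
  [Module A.carrier M] [IsScalarTower A.carrier (Coeff p A K) M] [AddCommGroup N]
  [Module (Coeff p A K) N] [Module A.carrier N] [IsScalarTower A.carrier (Coeff p A K) N]

variable (K A M) in
/-- The determinant condition over a localisation at `s` and its extensions. -/
def DetConditionAt (s : A.carrier) : Prop :=
  ∀ (B : Type u) [CommRing B] [Algebra A.carrier B], IsUnit (algebraMap A.carrier B s) →
    Module.Free B (B ⊗[A.carrier] M) ∧ ∀ z : B ⊗[A.carrier] Coeff p A K,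
      LinearMap.det (coeffAct K A B M z) = ∏ ψ : K →ₐ[ℚ_[p]] E, coeffEmb K A B ψ z

theorem isUnit_algebraMap_of_mul {R B : Type*} [CommRing R] [CommRing B] [Algebra R B] {s t : R}
    (h : IsUnit (algebraMap R B (s * t))) : IsUnit (algebraMap R B s) := by
  rw [map_mul] at h
  exact isUnit_of_mul_isUnit_left h

theorem DetConditionAt.mul {s : A.carrier} (h : DetConditionAt K A M s) (t : A.carrier) :
    DetConditionAt K A M (s * t) := fun B _ _ hB => h B (isUnit_algebraMap_of_mul hB)

/-- Every element of B ⊗ (A ⊗ 𝒪_K) is a sum of terms b ⊗ (1 ⊗ a), so the polynomial identity is an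
identity for all such elements. In this form it may be evaluated at combinations involving
idempotents. -/
theorem detCondition_iff : DetCondition K A M ↔
    ∃ S : Set A.carrier, Ideal.span S = ⊤ ∧ ∀ s ∈ S, DetConditionAt K A M s := by
  refine exists_congr fun S => and_congr_right fun _ => forall₂_congr fun s _ => ?_
  refine ⟨fun h B _ _ hB => ⟨(h B hB).1, fun z => ?_⟩, fun h B _ _ hB =>
    ⟨(h B hB).1, fun n a b => ?_⟩⟩
  · obtain ⟨n, a, b, rfl⟩ := exists_eq_sum_tmul K A B z
    rw [coeffAct_sum, (h B hB).2]
    refine Finset.prod_congr rfl fun ψ _ => ?_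
    rw [map_sum]
    exact Finset.sum_congr rfl fun i _ => (coeffEmb_tmul K A B ψ _ _).symm
  · rw [← coeffAct_sum, (h B hB).2]
    refine Finset.prod_congr rfl fun ψ _ => ?_
    rw [map_sum]
    exact Finset.sum_congr rfl fun i _ => coeffEmb_tmul K A B ψ _ _

theorem DetCondition.of_equiv (e : M ≃ₗ[Coeff p A K] N) (h : DetCondition K A M) :
    DetCondition K A N := by
  rw [detCondition_iff] at h ⊢
  obtain ⟨S, hS, h⟩ := h
  refine ⟨S, hS, fun s hs B _ _ hB => ?_⟩
  obtain ⟨h1, h2⟩ := h s hs B hB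
  refine ⟨Module.Free.of_equiv ((e.restrictScalars A.carrier).baseChange A.carrier B M N),
    fun z => ?_⟩
  rw [← det_coeffAct_of_equiv K A B e, h2]

theorem finite_idemPart (U : Coeff p A K) (hU : U * U = U) [Module.Finite A.carrier M] :
    Module.Finite A.carrier (idemPart M U) :=
  Module.Finite.of_surjective ((LinearMap.fst _ _ _ ∘ₗ
    (idemPartEquiv M hU).toLinearMap).restrictScalars A.carrier)
    (Prod.fst_surjective.comp (idemPartEquiv M hU).surjective)

theorem projective_idemPart (U : Coeff p A K) (hU : U * U = U) [Module.Projective A.carrier M] :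
    Module.Projective A.carrier (idemPart M U) :=
  Module.Projective.of_split
    (((idemPartEquiv M hU).symm.toLinearMap ∘ₗ LinearMap.inl _ _ _).restrictScalars A.carrier)
    ((LinearMap.fst _ _ _ ∘ₗ (idemPartEquiv M hU).toLinearMap).restrictScalars A.carrier)
    (LinearMap.ext fun m => by simp)

/-- The element z U + (1 - U) acts as z on U M and as 1 on (1 - U) M, which isolates the determinant
on U M. -/
theorem det_coeffAct_idemPart (B : Type u) [CommRing B] [Algebra A.carrier B] {U : Coeff p A K}
    (hU : U * U = U) [Module.Finite A.carrier M]
    [Module.Free B (B ⊗[A.carrier] idemPart M U)]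
    [Module.Free B (B ⊗[A.carrier] idemPart M (1 - U))] (z : B ⊗[A.carrier] Coeff p A K) :
    LinearMap.det (coeffAct K A B M (z * (1 ⊗ₜ U) + 1 ⊗ₜ (1 - U))) =
      LinearMap.det (coeffAct K A B (idemPart M U) z) := by
  have hU' : (1 - U) * (1 - U) = 1 - U := by linear_combination hU
  have := finite_idemPart (M := M) U hU
  have := finite_idemPart (M := M) (1 - U) hU'
  rw [det_coeffAct_of_equiv K A B (idemPartEquiv M hU), det_coeffAct_prod,
    map_add (coeffAct K A B (idemPart M U)), map_mul (coeffAct K A B (idemPart M U)),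
    map_add (coeffAct K A B (idemPart M (1 - U))), map_mul (coeffAct K A B (idemPart M (1 - U)))]
  have h1 : coeffAct K A B (idemPart M U) (1 ⊗ₜ U) = 1 := by
    rw [coeffAct_one_tmul_of_smul_eq K A B _ (V := 1) fun m => Subtype.ext (by
      rw [one_smul]; exact m.2)]
    exact map_one _
  have h2 : coeffAct K A B (idemPart M U) (1 ⊗ₜ (1 - U)) = 0 := by
    rw [coeffAct_one_tmul_of_smul_eq K A B _ (V := 0) fun m => Subtype.ext (by
      rw [zero_smul]
      exact one_sub_smul_of_smul_eq_self m.2), TensorProduct.tmul_zero, map_zero]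
  have h3 : coeffAct K A B (idemPart M (1 - U)) (1 ⊗ₜ U) = 0 := by
    rw [coeffAct_one_tmul_of_smul_eq K A B _ (V := 0) fun m => Subtype.ext (by
      have := one_sub_smul_of_smul_eq_self m.2
      rw [sub_sub_cancel] at this
      exact this.trans (zero_smul _ _).symm), TensorProduct.tmul_zero, map_zero]
  have h4 : coeffAct K A B (idemPart M (1 - U)) (1 ⊗ₜ (1 - U)) = 1 := by
    rw [coeffAct_one_tmul_of_smul_eq K A B _ (V := 1) fun m => Subtype.ext (by
      rw [one_smul]; exact m.2)]
    exact map_one _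
  rw [h1, h2, h3, h4, mul_one, add_zero, mul_zero, zero_add, map_one, mul_one]

/-- The determinant on the composed module is the product of those of z U + (1 - U) on M and z (1 -
U) + U on N. The two elements multiply to z, and every embedding is multiplicative. -/
theorem DetConditionAt.idemPart_prod {U : Coeff p A K} (hU : U * U = U)
    [Module.Finite A.carrier M] [Module.Finite A.carrier N] {s : A.carrier}
    (hM : DetConditionAt K A M s) (hN : DetConditionAt K A N s)
    (h : ∀ (B : Type u) [CommRing B] [Algebra A.carrier B], IsUnit (algebraMap A.carrier B s) →
      Module.Free B (B ⊗[A.carrier] idemPart M U) ∧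
      Module.Free B (B ⊗[A.carrier] idemPart M (1 - U)) ∧
      Module.Free B (B ⊗[A.carrier] idemPart N U) ∧
      Module.Free B (B ⊗[A.carrier] idemPart N (1 - U))) :
    DetConditionAt K A (idemPart M U × idemPart N (1 - U)) s := fun B _ _ hB => by
  have hU' : (1 - U) * (1 - U) = 1 - U := by linear_combination hU
  have := finite_idemPart (M := M) U hU
  have := finite_idemPart (M := N) (1 - U) hU'
  obtain ⟨h1, h2, h3, h4⟩ := h B hB
  have h3' : Module.Free B (B ⊗[A.carrier] idemPart N (1 - (1 - U))) := by
    rwa [sub_sub_cancel]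
  refine ⟨Module.Free.of_equiv (TensorProduct.prodRight A.carrier B B _ _).symm, fun z => ?_⟩
  rw [det_coeffAct_prod, ← det_coeffAct_idemPart B hU, ← det_coeffAct_idemPart B hU', (hM B hB).2,
    (hN B hB).2, ← Finset.prod_mul_distrib]
  refine Finset.prod_congr rfl fun ψ _ => ?_
  rw [← map_mul]
  congr 1
  have e1 : (1 ⊗ₜ U : B ⊗[A.carrier] Coeff p A K) * 1 ⊗ₜ U = 1 ⊗ₜ U := by
    rw [Algebra.TensorProduct.tmul_mul_tmul, hU, mul_one]
  have e2 : (1 ⊗ₜ (1 - U) : B ⊗[A.carrier] Coeff p A K) = 1 - 1 ⊗ₜ U := by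
    rw [TensorProduct.tmul_sub]
    rfl
  rw [sub_sub_cancel, e2]
  linear_combination (-(z - 1) ^ 2) * e1

/-- The determinant condition passes to a module composed of two modules by means of an
idempotent. -/
theorem DetCondition.idemPart_prod {U : Coeff p A K} (hU : U * U = U)
    [Module.Finite A.carrier M] [Module.Finite A.carrier N] [Module.Projective A.carrier M]
    [Module.Projective A.carrier N] (hM : DetCondition K A M) (hN : DetCondition K A N) :
    DetCondition K A (idemPart M U × idemPart N (1 - U)) := by
  have hU' : (1 - U) * (1 - U) = 1 - U := by linear_combination hU
  have := finite_idemPart (M := M) U hU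
  have := finite_idemPart (M := M) (1 - U) hU'
  have := finite_idemPart (M := N) U hU
  have := finite_idemPart (M := N) (1 - U) hU'
  have := projective_idemPart (M := M) U hU
  have := projective_idemPart (M := M) (1 - U) hU'
  have := projective_idemPart (M := N) U hU
  have := projective_idemPart (M := N) (1 - U) hU'
  rw [detCondition_iff] at hM hN ⊢
  have hmul : ∀ (Q : Type u) [AddCommGroup Q] [Module A.carrier Q] (s t : A.carrier),
      (∀ (B : Type u) [CommRing B] [Algebra A.carrier B], IsUnit (algebraMap A.carrier B s) →
        Module.Free B (B ⊗[A.carrier] Q)) →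
      ∀ (B : Type u) [CommRing B] [Algebra A.carrier B], IsUnit (algebraMap A.carrier B (s * t)) →
        Module.Free B (B ⊗[A.carrier] Q) :=
    fun Q _ _ s t h B _ _ hB => h B (isUnit_algebraMap_of_mul hB)
  obtain ⟨S, hS, h⟩ := exists_cover_and (exists_cover_and hM hN (fun _ t h => h.mul t)
    fun _ t h => h.mul t) (exists_cover_and (exists_cover_and
      (exists_cover_free A.carrier (idemPart M U)) (exists_cover_free A.carrier (idemPart M (1 - U)))
      (hmul _) (hmul _)) (exists_cover_and (exists_cover_free A.carrier (idemPart N U))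
      (exists_cover_free A.carrier (idemPart N (1 - U))) (hmul _) (hmul _))
      (fun s t h => ⟨hmul _ s t h.1, hmul _ s t h.2⟩)
      fun s t h => ⟨hmul _ s t h.1, hmul _ s t h.2⟩)
    (fun s t h => ⟨h.1.mul t, h.2.mul t⟩) fun s t h =>
      ⟨⟨hmul _ s t h.1.1, hmul _ s t h.1.2⟩, ⟨hmul _ s t h.2.1, hmul _ s t h.2.2⟩⟩
  refine ⟨S, hS, fun s hs => ?_⟩
  obtain ⟨⟨h1, h2⟩, ⟨h3, h4⟩, h5, h6⟩ := h s hs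
  exact h1.idemPart_prod hU h2 fun B _ _ hB => ⟨h3 B hB, h4 B hB, h5 B hB, h6 B hB⟩

/-- Evaluating the condition at an indeterminate over the residue field of x gives X^rank = X^d,
with d the number of embeddings. -/
theorem DetCondition.rankAtStalk [Module.Finite A.carrier M] [Module.Projective A.carrier M]
    (h : DetCondition K A M) (x : PrimeSpectrum A.carrier) :
    Module.rankAtStalk (R := A.carrier) M x = Fintype.card (K →ₐ[ℚ_[p]] E) := by
  obtain ⟨S, hS, h⟩ := detCondition_iff.1 h
  obtain ⟨s, hs, hsx⟩ : ∃ s ∈ S, s ∉ x.asIdeal := by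
    by_contra! hle
    exact x.2.ne_top (top_le_iff.1 (hS ▸ Ideal.span_le.2 hle))
  let κ := x.asIdeal.ResidueField
  have hB : IsUnit (algebraMap A.carrier (Polynomial κ) s) := by
    rw [IsScalarTower.algebraMap_apply A.carrier κ (Polynomial κ)]
    refine IsUnit.map _ (IsUnit.mk0 _ fun h0 => hsx ?_)
    rwa [Ideal.algebraMap_residueField_eq_zero] at h0
  obtain ⟨h1, h2⟩ := h s hs (Polynomial κ) hB
  have h3 := h2 (Polynomial.X ⊗ₜ 1)
  have h4 : coeffAct K A (Polynomial κ) M (Polynomial.X ⊗ₜ 1) =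
      (Polynomial.X : Polynomial κ) • LinearMap.id := by
    have : (Polynomial.X ⊗ₜ 1 : Polynomial κ ⊗[A.carrier] Coeff p A K) =
        (Polynomial.X : Polynomial κ) • (1 ⊗ₜ 1) := by
      rw [TensorProduct.smul_tmul' (Polynomial.X : Polynomial κ) 1 1, smul_eq_mul,
        mul_one]
    rw [this, map_smul, ← Algebra.TensorProduct.one_def, map_one]
    rfl
  have h5 : ∀ ψ : K →ₐ[ℚ_[p]] E, coeffEmb K A (Polynomial κ) ψ (Polynomial.X ⊗ₜ 1) =
      Polynomial.X := fun ψ => by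
    rw [Algebra.TensorProduct.one_def, coeffEmb_tmul, map_one, map_one, map_one, mul_one]
  rw [h4, LinearMap.det_smul, LinearMap.det_id, mul_one, Finset.prod_congr rfl fun ψ _ => h5 ψ,
    Finset.prod_const, Finset.card_univ] at h3
  have h6 := congrArg Polynomial.natDegree h3
  rw [Polynomial.natDegree_X_pow, Polynomial.natDegree_X_pow] at h6
  -- The zero ideal of κ[X] lies over x, so the rank at x is the rank after base change to κ[X].
  have h7 : x = PrimeSpectrum.comap (algebraMap A.carrier (Polynomial κ)) ⊥ := by
    ext a
    rw [PrimeSpectrum.comap_asIdeal, Ideal.mem_comap, PrimeSpectrum.asIdeal_bot, Ideal.mem_bot,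
      IsScalarTower.algebraMap_apply A.carrier κ (Polynomial κ), Polynomial.algebraMap_eq,
      Polynomial.C_eq_zero, Ideal.algebraMap_residueField_eq_zero]
  rw [← h6]
  exact (congrArg _ h7).trans ((Module.rankAtStalk_baseChange _).symm.trans
    (congrFun Module.rankAtStalk_eq_finrank_of_free _))

end Determinant

/-! ### Projectivity, type and determinant condition for a glued lattice -/

section Gluing

set_option linter.unusedSectionVars false

variable {p : ℕ} [Fact p.Prime]
  {K K' E : Type u} [Field K] [Field K'] [Field E]
  [Algebra ℚ_[p] K] [Algebra ℤ_[p] K] [IsScalarTower ℤ_[p] ℚ_[p] K]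
  [Algebra ℚ_[p] K'] [Algebra ℤ_[p] K'] [IsScalarTower ℤ_[p] ℚ_[p] K']
  [Algebra ℚ_[p] E] [Algebra ℤ_[p] E] [IsScalarTower ℤ_[p] ℚ_[p] E]
  [Algebra K K'] [IsScalarTower ℚ_[p] K K'] [IsScalarTower ℤ_[p] K K']
  [FiniteDimensional K K'] [FiniteDimensional ℚ_[p] K] [FiniteDimensional ℚ_[p] K']
  [FiniteDimensional ℚ_[p] E]


attribute [local instance] coeffAlgebra

section Quotient

variable {A S M : Type*} [CommRing A] [CommRing S] [Algebra A S] [AddCommGroup M] [Module A M]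
  [Module S M] [IsScalarTower A S M] (N : Submodule S M) [Module.Projective A (M ⧸ N)]

theorem exists_retraction_of_projective_quotient : ∃ r : M →ₗ[A] N, ∀ n : N, r n = n := by
  obtain ⟨s, hs⟩ := Module.projective_lifting_property (N.mkQ.restrictScalars A) LinearMap.id
    N.mkQ_surjective
  refine ⟨LinearMap.codRestrict (N.restrictScalars A)
    (LinearMap.id - s ∘ₗ N.mkQ.restrictScalars A) fun m => ?_, fun n => Subtype.ext ?_⟩
  · have : N.mkQ (s (N.mkQ m)) = N.mkQ m := LinearMap.congr_fun hs _
    rw [Submodule.restrictScalars_mem, ← Submodule.Quotient.mk_eq_zero]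
    show N.mkQ (m - s (N.mkQ m)) = 0
    rw [map_sub, this, sub_self]
  · show (n : M) - s (N.mkQ n) = n
    rw [Submodule.mkQ_apply, (Submodule.Quotient.mk_eq_zero N).2 n.2, map_zero, sub_zero]

variable [Module.Finite A M] [Module.Projective A M]

/-- A submodule with projective quotient of a finite projective module is finite projective. -/
theorem finite_and_projective_of_quotient : Module.Finite A N ∧ Module.Projective A N := by
  obtain ⟨r, hr⟩ := exists_retraction_of_projective_quotient (A := A) N
  exact ⟨Module.Finite.of_surjective r fun n => ⟨n, hr n⟩,
    Module.Projective.of_split (N.subtype.restrictScalars A) r (LinearMap.ext hr)⟩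

theorem rankAtStalk_eq_add_quotient (x : PrimeSpectrum A) : Module.rankAtStalk (R := A) M x =
    Module.rankAtStalk (R := A) N x + Module.rankAtStalk (R := A) (M ⧸ N) x := by
  obtain ⟨r, hr⟩ := exists_retraction_of_projective_quotient (A := A) N
  obtain ⟨_, _⟩ := finite_and_projective_of_quotient (A := A) N
  have : Module.Finite A (M ⧸ N) := Module.Finite.of_surjective (N.mkQ.restrictScalars A)
    N.mkQ_surjective
  have hb : Function.Bijective (r.prod (N.mkQ.restrictScalars A)) := by
    refine ⟨(injective_iff_map_eq_zero _).2 fun m hm => ?_, fun ⟨n, q⟩ => ?_⟩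
    · have h1 : m ∈ N := (Submodule.Quotient.mk_eq_zero N).1 (congrArg Prod.snd hm)
      have h2 : r m = 0 := congrArg Prod.fst hm
      have h3 := congrArg Subtype.val (hr ⟨m, h1⟩)
      rw [h2] at h3
      exact h3.symm
    · obtain ⟨m, rfl⟩ := N.mkQ_surjective q
      refine ⟨m - r m + n, Prod.ext ?_ ?_⟩
      · show r (m - r m + n) = n
        rw [map_add, map_sub, hr, hr, sub_self, zero_add]
      · show N.mkQ (m - r m + n) = N.mkQ m
        rw [← sub_eq_zero, ← map_sub]
        refine (Submodule.Quotient.mk_eq_zero N).2 ?_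
        rw [sub_add, sub_sub_cancel_left, neg_sub]
        exact N.sub_mem n.2 (r m).2
  rw [Module.rankAtStalk_eq_of_equiv (LinearEquiv.ofBijective _ hb), Module.rankAtStalk_prod]
  rfl

variable {N} in
/-- Submodules of the same rank with projective quotients are equal if one contains the other. -/
theorem eq_of_le_of_rankAtStalk_eq {N' : Submodule S M} [Module.Projective A (M ⧸ N')]
    (h : N ≤ N') (hr : ∀ x, Module.rankAtStalk (R := A) N x = Module.rankAtStalk (R := A) N' x) :
    N = N' := by
  refine le_antisymm h fun m hm => ?_
  have : Module.Finite A (M ⧸ N) := Module.Finite.of_surjective (N.mkQ.restrictScalars A)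
    N.mkQ_surjective
  have : Module.Finite A (M ⧸ N') := Module.Finite.of_surjective (N'.mkQ.restrictScalars A)
    N'.mkQ_surjective
  have hb := Module.bijective_of_surjective_of_rankAtStalk_eq
    (φ := (N.mapQ N' LinearMap.id h).restrictScalars A) (fun q => by
      obtain ⟨m, rfl⟩ := N'.mkQ_surjective q
      exact ⟨N.mkQ m, rfl⟩) fun 𝔪 _ => by
        have h1 := rankAtStalk_eq_add_quotient (A := A) N ⟨𝔪, inferInstance⟩
        have h2 := rankAtStalk_eq_add_quotient (A := A) N' ⟨𝔪, inferInstance⟩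
        have h3 := hr ⟨𝔪, inferInstance⟩
        omega
  refine (Submodule.Quotient.mk_eq_zero N).1 (hb.1 ?_)
  rw [map_zero]
  exact (Submodule.Quotient.mk_eq_zero N').2 hm

end Quotient

theorem projective_of_projective_of_free (R S M : Type*) [CommRing R] [CommRing S] [Algebra R S]
    [AddCommGroup M] [Module R M] [Module S M] [IsScalarTower R S M] [Module.Finite S M]
    [Module.Projective S M] [Module.Free R S] : Module.Projective R M := by
  obtain ⟨n, f, hf⟩ := Module.Finite.exists_fin' S M
  obtain ⟨s, hs⟩ := Module.projective_lifting_property f LinearMap.id hf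
  exact Module.Projective.of_split (s.restrictScalars R) (f.restrictScalars R)
    (LinearMap.ext fun m => LinearMap.congr_fun hs m)

theorem IsProjOfRank.of_equiv {R M N : Type u} [CommRing R] [AddCommGroup M] [Module R M]
    [AddCommGroup N] [Module R N] {r : ℕ} (h : IsProjOfRank R M r) (e : M ≃ₗ[R] N) :
    IsProjOfRank R N r := by
  obtain ⟨h1, h2, h3⟩ := h
  exact ⟨Module.Finite.equiv e, Module.Projective.of_equiv e, fun x => by
    rw [← Module.rankAtStalk_eq_of_equiv e, h3]⟩

theorem IsProjOfRank.finite_and_projective {A : TestAlg.{u} p E} {M : Type u} [AddCommGroup M]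
    [Module (Coeff p A K) M] [Module A.carrier M] [IsScalarTower A.carrier (Coeff p A K) M] {r : ℕ}
    (h : IsProjOfRank (Coeff p A K) M r) :
    Module.Finite A.carrier M ∧ Module.Projective A.carrier M := by
  obtain ⟨h1, h2, -⟩ := h
  exact ⟨Module.Finite.trans (Coeff p A K) M, projective_of_projective_of_free _ (Coeff p A K) M⟩

namespace TameTotRam

/-- The idempotent which is `u_i` on the part on which `ξ = η h ^ i`. -/
def ucc (T : TameTotRam p K K') (A : TestAlg.{u} p E)
    (η η' ξ : Gal(K'/K) →* (OInt p E)ˣ) : Coeff p A K :=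
  ∑ i : Fin (Module.finrank K K'), T.uc A η η' i * T.wc A η ξ i

theorem ucc_mul_wc (T : TameTotRam p K K') (A : TestAlg.{u} p E)
    (η η' ξ : Gal(K'/K) →* (OInt p E)ˣ) (i : Fin (Module.finrank K K')) :
    T.ucc A η η' ξ * T.wc A η ξ i = T.uc A η η' i * T.wc A η ξ i := by
  rw [ucc, Finset.sum_mul, Finset.sum_eq_single i]
  · rw [mul_assoc, T.wc_mul_self]
  · intro j _ hj
    rw [mul_assoc, T.wc_mul_of_ne A η ξ j.2 i.2 fun h => hj (Fin.ext h), mul_zero]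
  · exact fun h => absurd (Finset.mem_univ _) h

theorem ucc_mul_self (T : TameTotRam p K K')
    (A : TestAlg.{u} p E) (η η' ξ : Gal(K'/K) →* (OInt p E)ˣ) :
    T.ucc A η η' ξ * T.ucc A η η' ξ = T.ucc A η η' ξ := by
  conv_lhs => enter [2]; rw [ucc]
  rw [Finset.mul_sum]
  conv_rhs => rw [ucc]
  refine Finset.sum_congr rfl fun i _ => ?_
  rw [mul_left_comm, T.ucc_mul_wc, ← mul_assoc, T.uc_mul_self A η η' i.2]

end TameTotRam

namespace Gluing

variable {T : TameTotRam p K K'} {η η' : Gal(K'/K) →* (OInt p E)ˣ} {hη : η ≠ η'}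
  {X : LocDatum.{u} p K K' E} {L₁ L₂ : Type u} [AddCommGroup L₁] [AddCommGroup L₂]
  [Module (Coeff p X.A K) L₁] [Module (Coeff p X.A K) L₂]
  {f₁ : L₁ →ₗ[Coeff p X.A K] L₂} {f₂ : L₂ →ₗ[Coeff p X.A K] L₁} (G : Gluing T hη X f₁ f₂)
  [Module X.A.carrier L₁] [IsScalarTower X.A.carrier (Coeff p X.A K) L₁]
  [Module X.A.carrier L₂] [IsScalarTower X.A.carrier (Coeff p X.A K) L₂]
  {Lp₁ : Submodule (Coeff p X.A K) L₁} {Lp₂ : Submodule (Coeff p X.A K) L₂}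
  (hLp : ∀ l, l ∈ X.Lp ↔ ∀ i, (G.comp i l).1 ∈ Lp₁ ∧ (G.comp i l).2 ∈ Lp₂)

include hLp

/-- The components embed 𝔏/𝔏⁺ into n copies of L₁/L₁⁺ × L₂/L₂⁺, and `inlAt`, `inrAt` give a
retraction. It is well defined because f₁ preserves the submodules, f₁ being part of `inlAt`. -/
theorem projective_quotient (h₁ : Module.Projective X.A.carrier (L₁ ⧸ Lp₁))
    (h₂ : Module.Projective X.A.carrier (L₂ ⧸ Lp₂)) (hf : ∀ l ∈ Lp₁, f₁ l ∈ Lp₂) :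
    Module.Projective X.A.carrier (X.L ⧸ X.Lp) := by
  let f : X.L →ₗ[X.A.carrier] Fin (Module.finrank K K') → (L₁ ⧸ Lp₁) × (L₂ ⧸ Lp₂) :=
    LinearMap.pi fun i => (Lp₁.mkQ.prodMap Lp₂.mkQ ∘ₗ G.comp i).restrictScalars X.A.carrier
  let i : (X.L ⧸ X.Lp) →ₗ[X.A.carrier] Fin (Module.finrank K K') → (L₁ ⧸ Lp₁) × (L₂ ⧸ Lp₂) :=
    Submodule.liftQ (X.Lp.restrictScalars X.A.carrier) f (fun l hl => funext fun i => Prod.ext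
      ((Submodule.Quotient.mk_eq_zero _).2 ((hLp l).1 hl i).1)
      ((Submodule.Quotient.mk_eq_zero _).2 ((hLp l).1 hl i).2)) ∘ₗ
      (Submodule.Quotient.restrictScalarsEquiv X.A.carrier X.Lp).symm.toLinearMap
  let a : ∀ j : Fin (Module.finrank K K'), (L₁ ⧸ Lp₁) →ₗ[Coeff p X.A K] (X.L ⧸ X.Lp) := fun j =>
    Lp₁.liftQ (X.Lp.mkQ.restrictScalars (Coeff p X.A K) ∘ₗ G.equiv.symm.toLinearMap ∘ₗ
      (T.stair X.A hη).inlAt f₁ j) fun l hl => by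
        refine (Submodule.Quotient.mk_eq_zero _).2 ((hLp _).2 fun k => ?_)
        show (G.comp k (G.equiv.symm _)).1 ∈ Lp₁ ∧ (G.comp k (G.equiv.symm _)).2 ∈ Lp₂
        rw [comp_symm, Stair.inlAt_coe]
        rcases eq_or_ne k j with rfl | h
        · rw [Pi.single_eq_same]
          exact ⟨Submodule.smul_mem _ _ hl, Submodule.smul_mem _ _ (hf l hl)⟩
        · rw [Pi.single_eq_of_ne h]
          exact ⟨zero_mem _, zero_mem _⟩
  let b : ∀ j : Fin (Module.finrank K K'), (L₂ ⧸ Lp₂) →ₗ[Coeff p X.A K] (X.L ⧸ X.Lp) := fun j =>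
    Lp₂.liftQ (X.Lp.mkQ.restrictScalars (Coeff p X.A K) ∘ₗ G.equiv.symm.toLinearMap ∘ₗ
      (T.stair X.A hη).inrAt L₁ j) fun l hl => by
        refine (Submodule.Quotient.mk_eq_zero _).2 ((hLp _).2 fun k => ?_)
        show (G.comp k (G.equiv.symm _)).1 ∈ Lp₁ ∧ (G.comp k (G.equiv.symm _)).2 ∈ Lp₂
        rw [comp_symm, Stair.inrAt_coe]
        rcases eq_or_ne k j with rfl | h
        · rw [Pi.single_eq_same]
          exact ⟨zero_mem _, Submodule.smul_mem _ _ hl⟩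
        · rw [Pi.single_eq_of_ne h]
          exact ⟨zero_mem _, zero_mem _⟩
  let s : (Fin (Module.finrank K K') → (L₁ ⧸ Lp₁) × (L₂ ⧸ Lp₂)) →ₗ[X.A.carrier] (X.L ⧸ X.Lp) :=
    ∑ j, ((a j).coprod (b j)).restrictScalars X.A.carrier ∘ₗ LinearMap.proj j
  have : Module.Projective X.A.carrier (Fin (Module.finrank K K') → (L₁ ⧸ Lp₁) × (L₂ ⧸ Lp₂)) :=
    Module.Projective.of_equiv (DirectSum.linearEquivFunOnFintype X.A.carrier
      (Fin (Module.finrank K K')) fun _ => (L₁ ⧸ Lp₁) × (L₂ ⧸ Lp₂))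
  refine Module.Projective.of_split i s (LinearMap.ext fun z => ?_)
  obtain ⟨l, rfl⟩ := Submodule.Quotient.mk_surjective _ z
  rw [LinearMap.comp_apply, LinearMap.sum_apply, LinearMap.id_apply]
  have h : ∑ j, (G.equiv.symm ((T.stair X.A hη).inlAt f₁ j (G.comp j l).1) +
      G.equiv.symm ((T.stair X.A hη).inrAt L₁ j (G.comp j l).2)) = l := by
    apply G.equiv.injective
    rw [map_sum]
    refine Eq.trans (Finset.sum_congr rfl fun j _ => ?_)
      ((T.stair X.A hη).sum_inlAt_add_inrAt f₁ (G.equiv l))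
    rw [map_add, LinearEquiv.apply_symm_apply, LinearEquiv.apply_symm_apply]
    rfl
  conv_rhs => rw [← h]
  exact (map_sum X.Lp.mkQ _ _).symm

theorem isLocType (hE : Nonempty (K' →ₐ[ℚ_[p]] E))
    (h₁ : IsProjOfRank (Coeff p X.A K) L₁ 2) (h₂ : IsProjOfRank (Coeff p X.A K) L₂ 2)
    (hc₁ : IsProjOfRankOverQuotient (Coeff p X.A K) (L₂ ⧸ LinearMap.range f₁)
      (Ideal.span {T.unifBase X.A}) 1)
    (hc₂ : IsProjOfRankOverQuotient (Coeff p X.A K) (L₁ ⧸ LinearMap.range f₂)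
      (Ideal.span {T.unifBase X.A}) 1)
    (hp₁ : Module.Projective X.A.carrier (L₁ ⧸ Lp₁))
    (hp₂ : Module.Projective X.A.carrier (L₂ ⧸ Lp₂)) (hf : ∀ l ∈ Lp₁, f₁ l ∈ Lp₂) :
    X.isLocType T η η' := by
  refine G.isGlued.isLocType hη hE (h₁.of_equiv G.inl) (h₂.of_equiv G.inr)
    (hc₁.of_equiv (Submodule.Quotient.equiv _ _ G.inr ?_))
    (hc₂.of_equiv (Submodule.Quotient.equiv _ _ G.inl ?_)) (G.projective_quotient hLp hp₁ hp₂ hf)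
  · rw [← LinearMap.range_comp, ← LinearMap.range_comp_of_range_eq_top (LocDatum.mulPi T η η' X)
      (LinearMap.range_eq_top.2 G.inl.surjective)]
    congr 1
    exact LinearMap.ext fun l => (G.mulPi_inl hE l).symm
  · rw [← LinearMap.range_comp, ← LinearMap.range_comp_of_range_eq_top (LocDatum.mulPi T η' η X)
      (LinearMap.range_eq_top.2 G.inr.surjective)]
    congr 1
    exact LinearMap.ext fun l => (G.mulPi_inr hE l).symm

omit hLp in
-- The components of a ξ-eigenvector are supported on the pairwise orthogonal w_i, so adding them up
-- loses no information. On the support of w_i, `ucc` is u_i.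
theorem ucc_smul_sum_comp {ξ : Gal(K'/K) →* (OInt p E)ˣ} {l : X.L} (hl : l ∈ X.eigen ξ) :
    T.ucc X.A η η' ξ • (∑ i, G.comp i l).1 = (∑ i, G.comp i l).1 ∧
      T.ucc X.A η η' ξ • (∑ i, G.comp i l).2 = 0 := by
  rw [Prod.fst_sum, Prod.snd_sum, Finset.smul_sum, Finset.smul_sum]
  have h : ∀ i, T.ucc X.A η η' ξ • G.comp i l = T.uc X.A η η' i • G.comp i l := fun i => by
    rw [← G.comp_eq_of_mem_eigen hl i, ← mul_smul, T.ucc_mul_wc, mul_smul]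
  refine ⟨Finset.sum_congr rfl fun i _ => ?_, Finset.sum_eq_zero fun i _ => ?_⟩
  · rw [← Prod.smul_fst, h, Prod.smul_fst, (G.comp_spec i l).1]
  · rw [← Prod.smul_snd, h, Prod.smul_snd, (G.comp_spec i l).2]

omit hLp in
theorem wc_smul_sum_comp {ξ : Gal(K'/K) →* (OInt p E)ˣ} {l : X.L} (hl : l ∈ X.eigen ξ)
    (i : Fin (Module.finrank K K')) : T.wc X.A η ξ i • ∑ j, G.comp j l = G.comp i l := by
  rw [Finset.smul_sum, Finset.sum_eq_single i]
  · exact G.comp_eq_of_mem_eigen hl i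
  · intro j _ hj
    rw [← G.comp_eq_of_mem_eigen hl j, ← mul_smul,
      T.wc_mul_of_ne X.A η ξ i.2 j.2 fun h => hj (Fin.ext h.symm), zero_smul]
  · exact fun h => absurd (Finset.mem_univ _) h

/-- The eigenspaces of the glued submodule. -/
def eigenPlusEquiv (ξ : Gal(K'/K) →* (OInt p E)ˣ) : X.eigenPlus ξ ≃ₗ[Coeff p X.A K]
    idemPart Lp₁ (T.ucc X.A η η' ξ) × idemPart Lp₂ (1 - T.ucc X.A η η' ξ) where
  toFun l := (⟨⟨(∑ i, G.comp i (l : X.eigen ξ)).1, by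
      rw [Prod.fst_sum]
      exact sum_mem fun i _ => ((hLp _).1 l.2 i).1⟩,
      Subtype.ext (G.ucc_smul_sum_comp l.1.2).1⟩,
    ⟨⟨(∑ i, G.comp i (l : X.eigen ξ)).2, by
      rw [Prod.snd_sum]
      exact sum_mem fun i _ => ((hLp _).1 l.2 i).2⟩,
      Subtype.ext (one_sub_smul_of_smul_eq_zero (G.ucc_smul_sum_comp l.1.2).2)⟩)
  map_add' l m := by
    have h : ∑ i, G.comp i ((l + m : X.eigenPlus ξ) : X.eigen ξ) =
        ∑ i, G.comp i (l : X.eigen ξ) + ∑ i, G.comp i (m : X.eigen ξ) := by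
      rw [← Finset.sum_add_distrib]
      exact Finset.sum_congr rfl fun i _ => map_add (G.comp i) _ _
    exact Prod.ext (Subtype.ext (Subtype.ext (congrArg Prod.fst h)))
      (Subtype.ext (Subtype.ext (congrArg Prod.snd h)))
  map_smul' s l := by
    have h : ∑ i, G.comp i ((s • l : X.eigenPlus ξ) : X.eigen ξ) =
        s • ∑ i, G.comp i (l : X.eigen ξ) := by
      rw [Finset.smul_sum]
      exact Finset.sum_congr rfl fun i _ => map_smul (G.comp i) s _
    exact Prod.ext (Subtype.ext (Subtype.ext (congrArg Prod.fst h)))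
      (Subtype.ext (Subtype.ext (congrArg Prod.snd h)))
  invFun m := ⟨⟨G.equiv.symm ⟨fun i => T.wc X.A η ξ i • ((m.1 : Lp₁).1, (m.2 : Lp₂).1), fun i => by
      have h1 : T.ucc X.A η η' ξ • ((m.1 : Lp₁) : L₁) = m.1 :=
        congrArg Subtype.val (mem_idemPart.1 m.1.2)
      have h2 : (1 - T.ucc X.A η η' ξ) • ((m.2 : Lp₂) : L₂) = m.2 :=
        congrArg Subtype.val (mem_idemPart.1 m.2.2)
      rw [sub_smul, one_smul, sub_eq_self] at h2
      constructor
      · show T.uc X.A η η' i • T.wc X.A η ξ i • ((m.1 : Lp₁) : L₁) = T.wc X.A η ξ i • _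
        rw [← mul_smul, ← T.ucc_mul_wc, mul_comm, mul_smul, h1]
      · show T.uc X.A η η' i • T.wc X.A η ξ i • ((m.2 : Lp₂) : L₂) = 0
        rw [← mul_smul, ← T.ucc_mul_wc, mul_comm, mul_smul, h2, smul_zero]⟩,
      (G.mem_eigen_iff _ _).2 fun i => by
        rw [comp_symm, ← mul_smul, T.wc_mul_self]⟩, (hLp _).2 fun i => by
      rw [comp_symm]
      exact ⟨Submodule.smul_mem _ _ (m.1 : Lp₁).2, Submodule.smul_mem _ _ (m.2 : Lp₂).2⟩⟩
  left_inv l := Subtype.ext <| Subtype.ext <| G.ext_comp fun i =>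
    (G.comp_symm i _).trans (G.wc_smul_sum_comp l.1.2 i)
  right_inv m := by
    have h : ∀ t : L₁ × L₂, ∑ i : Fin (Module.finrank K K'), T.wc X.A η ξ i • t = t := fun t => by
      rw [← Finset.sum_smul, ← Finset.sum_range (fun i => T.wc X.A η ξ i), T.sum_wc, one_smul]
    refine Prod.ext (Subtype.ext (Subtype.ext ?_)) (Subtype.ext (Subtype.ext ?_))
    · exact (congrArg Prod.fst (Finset.sum_congr rfl fun i _ => G.comp_symm i _)).trans
        (congrArg Prod.fst (h ((m.1 : Lp₁).1, (m.2 : Lp₂).1)))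
    · exact (congrArg Prod.snd (Finset.sum_congr rfl fun i _ => G.comp_symm i _)).trans
        (congrArg Prod.snd (h ((m.1 : Lp₁).1, (m.2 : Lp₂).1)))

/-- The ξ-part of the glued submodule is L₁⁺ on one idempotent and L₂⁺ on the complementary one, so
the two determinant conditions combine. -/
theorem detCondition (ξ : Gal(K'/K) →* (OInt p E)ˣ)
    (h₁ : IsProjOfRank (Coeff p X.A K) L₁ 2) (h₂ : IsProjOfRank (Coeff p X.A K) L₂ 2)
    (hp₁ : Module.Projective X.A.carrier (L₁ ⧸ Lp₁))
    (hp₂ : Module.Projective X.A.carrier (L₂ ⧸ Lp₂))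
    (hd₁ : DetCondition K X.A Lp₁) (hd₂ : DetCondition K X.A Lp₂) :
    DetCondition K X.A (X.eigenPlus ξ) := by
  obtain ⟨_, _⟩ := h₁.finite_and_projective
  obtain ⟨_, _⟩ := h₂.finite_and_projective
  obtain ⟨_, _⟩ := finite_and_projective_of_quotient (A := X.A.carrier) Lp₁
  obtain ⟨_, _⟩ := finite_and_projective_of_quotient (A := X.A.carrier) Lp₂
  exact (DetCondition.idemPart_prod (T.ucc_mul_self X.A η η' ξ) hd₁ hd₂).of_equiv
    (G.eigenPlusEquiv hLp ξ).symm

end Gluing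

end Gluing

/-! ### Morphisms of glued lattices -/

section GluingHom

set_option linter.unusedSectionVars false

variable {p : ℕ} [Fact p.Prime]
  {K K' E : Type u} [Field K] [Field K'] [Field E]
  [Algebra ℚ_[p] K] [Algebra ℤ_[p] K] [IsScalarTower ℤ_[p] ℚ_[p] K]
  [Algebra ℚ_[p] K'] [Algebra ℤ_[p] K'] [IsScalarTower ℤ_[p] ℚ_[p] K']
  [Algebra ℚ_[p] E] [Algebra ℤ_[p] E] [IsScalarTower ℤ_[p] ℚ_[p] E]
  [Algebra K K'] [IsScalarTower ℚ_[p] K K'] [IsScalarTower ℤ_[p] K K']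
  [FiniteDimensional K K'] [FiniteDimensional ℚ_[p] K] [FiniteDimensional ℚ_[p] K']
  [FiniteDimensional ℚ_[p] E]

attribute [local instance] coeffAlgebra

theorem IsBaseChangeAlong.prodMap {A B M N M' N' : Type u} [CommRing A] [CommRing B]
    [AddCommGroup M] [AddCommGroup N] [AddCommGroup M'] [AddCommGroup N'] [Module A M] [Module B N]
    [Module A M'] [Module B N'] {φ : A →+* B} {f : M →+ N} {g : M' →+ N'}
    (hf : IsBaseChangeAlong φ f) (hg : IsBaseChangeAlong φ g) :
    IsBaseChangeAlong φ (f.prodMap g) := by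
  let _ := φ.toAlgebra
  obtain ⟨e, he⟩ := hf
  obtain ⟨e', he'⟩ := hg
  exact ⟨(TensorProduct.prodRight A B B M M').trans (e.prodCongr e'), fun b m =>
    Prod.ext (he b m.1) (he' b m.2)⟩

theorem IsBaseChangeAlong.compLeft {A B M N : Type u} [CommRing A] [CommRing B]
    [AddCommGroup M] [AddCommGroup N] [Module A M] [Module B N] {φ : A →+* B} {f : M →+ N}
    (hf : IsBaseChangeAlong φ f) (n : ℕ) :
    IsBaseChangeAlong φ (f.compLeft (Fin n)) := by
  let _ := φ.toAlgebra
  obtain ⟨e, he⟩ := hf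
  refine ⟨(TensorProduct.piRight A B B fun _ : Fin n => M).trans
    (LinearEquiv.piCongrRight fun _ => e), fun b m => funext fun i => ?_⟩
  rw [LinearEquiv.trans_apply, LinearEquiv.piCongrRight_apply, TensorProduct.piRight_apply,
    TensorProduct.piRightHom_tmul, he]
  rfl

namespace TameTotRam

variable (T : TameTotRam p K K') {A B : TestAlg.{u} p E} (b : A ⟶ B)

theorem coeffMap_wc (ξ₀ ξ : Gal(K'/K) →* (OInt p E)ˣ) (i : ℕ) :
    coeffMap b K (T.wc B ξ₀ ξ i) = T.wc A ξ₀ ξ i :=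
  coeffMap_coeffOfInt (K' := K) b _

theorem coeffMap_uc (ξ₀ ξ : Gal(K'/K) →* (OInt p E)ˣ) (i : ℕ) :
    coeffMap b K (T.uc B ξ₀ ξ i) = T.uc A ξ₀ ξ i := by
  rw [uc, map_sub, map_one, map_sum]
  simp only [coeffMap_wc]
  rfl

theorem coeffMap_unif : coeffMap b K' (T.unif B) = T.unif A := by
  simp [coeffMap, unif]

theorem coeffMap_hc (g : Gal(K'/K)) : coeffMap b K (T.hc B g) = T.hc A g := by
  simp [coeffMap, hc]

theorem coeffMap_chc (ξ : Gal(K'/K) →* (OInt p E)ˣ) (g : Gal(K'/K)) :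
    coeffMap b K (chc B ξ g) = chc A ξ g := by
  simp [coeffMap, chc]

end TameTotRam

/-- A morphism of lattice chains over a given morphism of test objects. -/
structure ChainHom {A B : TestAlg.{u} p E} (b : A ⟶ B) {L₁ L₂ M₁ M₂ : Type u} [AddCommGroup L₁]
    [AddCommGroup L₂] [Module (Coeff p A K) L₁] [Module (Coeff p A K) L₂]
    [Module A.carrier L₁] [IsScalarTower A.carrier (Coeff p A K) L₁]
    [Module A.carrier L₂] [IsScalarTower A.carrier (Coeff p A K) L₂] [AddCommGroup M₁]
    [AddCommGroup M₂] [Module (Coeff p B K) M₁] [Module (Coeff p B K) M₂]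
    [Module B.carrier M₁] [IsScalarTower B.carrier (Coeff p B K) M₁]
    [Module B.carrier M₂] [IsScalarTower B.carrier (Coeff p B K) M₂]
    (f₁ : L₁ →ₗ[Coeff p A K] L₂) (f₂ : L₂ →ₗ[Coeff p A K] L₁)
    (Lp₁ : Submodule (Coeff p A K) L₁) (Lp₂ : Submodule (Coeff p A K) L₂)
    (g₁ : M₁ →ₗ[Coeff p B K] M₂) (g₂ : M₂ →ₗ[Coeff p B K] M₁)
    (Mp₁ : Submodule (Coeff p B K) M₁) (Mp₂ : Submodule (Coeff p B K) M₂) where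
  /-- the map `M₁ → L₁` -/
  toFun₁ : M₁ →+ L₁
  /-- the map `M₂ → L₂` -/
  toFun₂ : M₂ →+ L₂
  map_smul₁ : ∀ (x : Coeff p B K) (l : M₁), toFun₁ (x • l) = coeffMap b K x • toFun₁ l
  map_smul₂ : ∀ (x : Coeff p B K) (l : M₂), toFun₂ (x • l) = coeffMap b K x • toFun₂ l
  map_f₁ : ∀ l, toFun₂ (g₁ l) = f₁ (toFun₁ l)
  map_f₂ : ∀ l, toFun₁ (g₂ l) = f₂ (toFun₂ l)
  map_mem₁ : ∀ l ∈ Mp₁, toFun₁ l ∈ Lp₁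
  map_mem₂ : ∀ l ∈ Mp₂, toFun₂ l ∈ Lp₂
  isBaseChange₁ : IsBaseChangeAlong (TestAlg.toAlgHom p E b).toRingHom toFun₁
  isBaseChange₂ : IsBaseChangeAlong (TestAlg.toAlgHom p E b).toRingHom toFun₂
  isBaseChange_plus₁ : IsBaseChangeAlong (TestAlg.toAlgHom p E b).toRingHom
    (restrictAdd toFun₁ map_mem₁)
  isBaseChange_plus₂ : IsBaseChangeAlong (TestAlg.toAlgHom p E b).toRingHom
    (restrictAdd toFun₂ map_mem₂)

namespace Gluing

variable {T : TameTotRam p K K'} {η η' : Gal(K'/K) →* (OInt p E)ˣ} {hη : η ≠ η'}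

section Retract

variable {X : LocDatum.{u} p K K' E} {L₁ L₂ : Type u} [AddCommGroup L₁] [AddCommGroup L₂]
  [Module (Coeff p X.A K) L₁] [Module (Coeff p X.A K) L₂]
  {f₁ : L₁ →ₗ[Coeff p X.A K] L₂} {f₂ : L₂ →ₗ[Coeff p X.A K] L₁} (G : Gluing T hη X f₁ f₂)
  [Module X.A.carrier L₁] [IsScalarTower X.A.carrier (Coeff p X.A K) L₁]
  [Module X.A.carrier L₂] [IsScalarTower X.A.carrier (Coeff p X.A K) L₂]
  {Lp₁ : Submodule (Coeff p X.A K) L₁} {Lp₂ : Submodule (Coeff p X.A K) L₂}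
  (hLp : ∀ l, l ∈ X.Lp ↔ ∀ i, (G.comp i l).1 ∈ Lp₁ ∧ (G.comp i l).2 ∈ Lp₂)

/-- All components together. -/
def incl : X.L →ₗ[X.A.carrier] (Fin (Module.finrank K K') → L₁ × L₂) :=
  LinearMap.pi fun i => (G.comp i).restrictScalars X.A.carrier

/-- The projection to the glued module. -/
def proj : (Fin (Module.finrank K K') → L₁ × L₂) →ₗ[X.A.carrier] X.L where
  toFun v := G.equiv.symm ⟨fun i => (T.uc X.A η η' i • (v i).1, (1 - T.uc X.A η η' i) • (v i).2),
    fun i => ⟨by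
      show T.uc X.A η η' i • T.uc X.A η η' i • (v i).1 = T.uc X.A η η' i • (v i).1
      rw [← mul_smul, T.uc_mul_self X.A η η' i.2], by
      show T.uc X.A η η' i • (1 - T.uc X.A η η' i) • (v i).2 = 0
      rw [← mul_smul, mul_sub, mul_one, T.uc_mul_self X.A η η' i.2, sub_self, zero_smul]⟩⟩
  map_add' v w := G.ext_comp fun i => by
    rw [map_add]
    simp only [comp_symm, Pi.add_apply, Prod.fst_add, Prod.snd_add, smul_add, Prod.mk_add_mk]
  map_smul' a v := G.ext_comp fun i => by
    rw [← LinearMap.coe_restrictScalars X.A.carrier, map_smul]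
    simp only [LinearMap.coe_restrictScalars, comp_symm, Pi.smul_apply, Prod.smul_fst,
      Prod.smul_snd, Prod.smul_mk, RingHom.id_apply, smul_comm a]

theorem comp_proj (v : Fin (Module.finrank K K') → L₁ × L₂) (i : Fin (Module.finrank K K')) :
    G.comp i (G.proj v) = (T.uc X.A η η' i • (v i).1, (1 - T.uc X.A η η' i) • (v i).2) :=
  G.comp_symm i _

theorem proj_incl (l : X.L) : G.proj (G.incl l) = l := G.ext_comp fun i => by
  rw [comp_proj]
  exact Prod.ext (G.comp_spec i l).1 (one_sub_smul_of_smul_eq_zero (G.comp_spec i l).2)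

/-- All components of an element of the glued submodule. -/
def inclPlus : X.Lp →ₗ[X.A.carrier] (Fin (Module.finrank K K') → Lp₁ × Lp₂) where
  toFun l i := (⟨(G.comp i l).1, ((hLp l).1 l.2 i).1⟩, ⟨(G.comp i l).2, ((hLp l).1 l.2 i).2⟩)
  map_add' _ _ := funext fun i => Prod.ext (Subtype.ext (congrArg Prod.fst (map_add (G.comp i) _ _)))
    (Subtype.ext (congrArg Prod.snd (map_add (G.comp i) _ _)))
  map_smul' a _ := funext fun i => Prod.ext
    (Subtype.ext (congrArg Prod.fst (map_smul ((G.comp i).restrictScalars X.A.carrier) a _)))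
    (Subtype.ext (congrArg Prod.snd (map_smul ((G.comp i).restrictScalars X.A.carrier) a _)))

/-- The projection to the glued submodule. -/
def projPlus : (Fin (Module.finrank K K') → Lp₁ × Lp₂) →ₗ[X.A.carrier] X.Lp where
  toFun v := ⟨G.proj fun i => ((v i).1, (v i).2), (hLp _).2 fun i => by
    rw [comp_proj]
    exact ⟨Submodule.smul_mem _ _ (v i).1.2, Submodule.smul_mem _ _ (v i).2.2⟩⟩
  map_add' v w := Subtype.ext (map_add G.proj (fun i => (((v i).1 : L₁), ((v i).2 : L₂)))
    fun i => (((w i).1 : L₁), ((w i).2 : L₂)))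
  map_smul' a v := Subtype.ext (map_smul G.proj a fun i => (((v i).1 : L₁), ((v i).2 : L₂)))

theorem projPlus_inclPlus (l : X.Lp) : G.projPlus hLp (G.inclPlus hLp l) = l :=
  Subtype.ext (G.proj_incl l)

end Retract

section Hom

variable {X : LocDatum.{u} p K K' E} {L₁ L₂ : Type u} [AddCommGroup L₁] [AddCommGroup L₂]
  [Module (Coeff p X.A K) L₁] [Module (Coeff p X.A K) L₂]
  {f₁ : L₁ →ₗ[Coeff p X.A K] L₂} {f₂ : L₂ →ₗ[Coeff p X.A K] L₁} (G : Gluing T hη X f₁ f₂)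
  [Module X.A.carrier L₁] [IsScalarTower X.A.carrier (Coeff p X.A K) L₁]
  [Module X.A.carrier L₂] [IsScalarTower X.A.carrier (Coeff p X.A K) L₂]
  {Lp₁ : Submodule (Coeff p X.A K) L₁} {Lp₂ : Submodule (Coeff p X.A K) L₂}
  (hLp : ∀ l, l ∈ X.Lp ↔ ∀ i, (G.comp i l).1 ∈ Lp₁ ∧ (G.comp i l).2 ∈ Lp₂)
  {Y : LocDatum.{u} p K K' E} {M₁ M₂ : Type u} [AddCommGroup M₁] [AddCommGroup M₂]
  [Module (Coeff p Y.A K) M₁] [Module (Coeff p Y.A K) M₂]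
  {g₁ : M₁ →ₗ[Coeff p Y.A K] M₂} {g₂ : M₂ →ₗ[Coeff p Y.A K] M₁} (H : Gluing T hη Y g₁ g₂)
  [Module Y.A.carrier M₁] [IsScalarTower Y.A.carrier (Coeff p Y.A K) M₁]
  [Module Y.A.carrier M₂] [IsScalarTower Y.A.carrier (Coeff p Y.A K) M₂]
  {Mp₁ : Submodule (Coeff p Y.A K) M₁} {Mp₂ : Submodule (Coeff p Y.A K) M₂}
  (hMp : ∀ l, l ∈ Y.Lp ↔ ∀ i, (H.comp i l).1 ∈ Mp₁ ∧ (H.comp i l).2 ∈ Mp₂)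
  {b : X.A ⟶ Y.A} (f : ChainHom b f₁ f₂ Lp₁ Lp₂ g₁ g₂ Mp₁ Mp₂)

/-- The additive map of glued modules induced by a morphism of lattice chains. -/
def mapAdd : Y.L →+ X.L where
  toFun l := G.equiv.symm ⟨fun i => (f.toFun₁ (H.comp i l).1, f.toFun₂ (H.comp i l).2), fun i =>
    ⟨by
      show T.uc X.A η η' i • f.toFun₁ (H.comp i l).1 = f.toFun₁ (H.comp i l).1
      rw [← T.coeffMap_uc b, ← f.map_smul₁, (H.comp_spec i l).1], by
      show T.uc X.A η η' i • f.toFun₂ (H.comp i l).2 = 0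
      rw [← T.coeffMap_uc b, ← f.map_smul₂, (H.comp_spec i l).2, map_zero]⟩⟩
  map_zero' := G.ext_comp fun i => by
    simp only [comp_symm, map_zero, Prod.fst_zero, Prod.snd_zero, Prod.mk_zero_zero]
  map_add' l m := G.ext_comp fun i => by
    rw [map_add]
    simp only [comp_symm, map_add, Prod.fst_add, Prod.snd_add, Prod.mk_add_mk]

theorem comp_mapAdd (i : Fin (Module.finrank K K')) (l : Y.L) :
    G.comp i (G.mapAdd H f l) = (f.toFun₁ (H.comp i l).1, f.toFun₂ (H.comp i l).2) :=
  G.comp_symm i _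

theorem comp_unif_zero (l : X.L) (h : 0 < Module.finrank K K') :
    G.comp ⟨0, h⟩ (T.unif X.A • l) =
      (f₂ (G.comp ⟨Module.finrank K K' - 1, Nat.sub_lt h Nat.one_pos⟩ l).2, 0) := by
  rw [comp_apply, equiv_unif, Stair.shift_zero]
  rfl

theorem comp_unif_succ (l : X.L) {i : ℕ} (h : i + 1 < Module.finrank K K') :
    G.comp ⟨i + 1, h⟩ (T.unif X.A • l) = (T.uc X.A η η' (i + 1) • (G.comp ⟨i, by omega⟩ l).1,
      (1 - T.uc X.A η η' (i + 1)) • f₁ (G.comp ⟨i, by omega⟩ l).1 + (G.comp ⟨i, by omega⟩ l).2) := by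
  rw [comp_apply, equiv_unif, Stair.shift_succ]
  rfl

theorem mapAdd_smul (x : Coeff p Y.A K') (l : Y.L) :
    G.mapAdd H f (x • l) = coeffMap b K' x • G.mapAdd H f l := by
  refine T.coeff_induction (P := fun x => ∀ l, G.mapAdd H f (x • l) =
    (coeffMap b K' x : Coeff p X.A K') • G.mapAdd H f l) (fun s l => ?_) (fun l => ?_)
    (fun y z hy hz l => ?_) (fun y z hy hz l => ?_) x l
  · rw [coeffMap_coeffIncl]
    show G.mapAdd H f (s • l) = (coeffMap b K s : Coeff p X.A K) • G.mapAdd H f l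
    refine G.ext_comp fun i => ?_
    rw [map_smul (G.comp i), comp_mapAdd, comp_mapAdd, map_smul, Prod.smul_fst, Prod.smul_snd]
    exact Prod.ext (f.map_smul₁ s _) (f.map_smul₂ s _)
  · rw [T.coeffMap_unif]
    refine G.ext_comp fun i => ?_
    obtain ⟨i, hi⟩ := i
    rcases i with _ | i
    · rw [comp_mapAdd]
      rw [G.comp_unif_zero, H.comp_unif_zero]
      rw [comp_mapAdd, map_zero]
      exact Prod.ext (f.map_f₂ _) rfl
    · rw [comp_mapAdd]
      rw [G.comp_unif_succ _ hi, H.comp_unif_succ _ hi]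
      rw [comp_mapAdd, map_add]
      refine Prod.ext ((f.map_smul₁ _ _).trans ?_) (congrArg (· + _) ((f.map_smul₂ _ _).trans ?_))
      · exact congrArg (· • _) (T.coeffMap_uc b η η' _)
      · rw [map_sub, map_one]
        rw [T.coeffMap_uc b η η' _]
        exact congrArg ((1 - T.uc X.A η η' (i + 1)) • ·) (f.map_f₁ _)
  · rw [add_smul, map_add, map_add, add_smul, hy, hz]
  · rw [mul_smul, hy, hz, map_mul, mul_smul]

/-- The morphism of glued modules induced by a morphism of lattice chains. -/
def homMk : X ⟶ Y where
  base := b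
  toFun := G.mapAdd H f
  map_smul := G.mapAdd_smul H f
  map_ρ g l := G.ext_comp fun i => by
    rw [comp_apply (l := X.ρ g _), G.equiv_ρ, ← comp_apply, comp_mapAdd, comp_mapAdd, comp_apply,
      H.equiv_ρ, ← comp_apply]
    rw [← T.coeffMap_hc b, ← TameTotRam.coeffMap_chc b, ← map_pow, ← map_mul]
    exact Prod.ext (f.map_smul₁ _ _) (f.map_smul₂ _ _)
  map_mem l hl := (hLp _).2 fun i => by
    rw [comp_mapAdd]
    exact ⟨f.map_mem₁ _ ((hMp l).1 hl i).1, f.map_mem₂ _ ((hMp l).1 hl i).2⟩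
  -- The glued module is a direct summand of n copies of L₁ × L₂, compatibly with base change since
  -- the idempotents u_i are.
  isBaseChange := ((f.isBaseChange₁.prodMap f.isBaseChange₂).compLeft
    (Module.finrank K K')).retract H.incl H.proj H.proj_incl G.incl G.proj G.proj_incl _
    (fun l => funext fun i => (G.comp_mapAdd H f i l).symm)
    (fun v => G.ext_comp fun i => by
      rw [comp_proj, comp_mapAdd, comp_proj, ← T.coeffMap_uc b]
      refine Prod.ext (f.map_smul₁ _ _).symm (Eq.trans ?_ (f.map_smul₂ _ _).symm)
      rw [map_sub, map_one]
      rfl)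
  isBaseChange_plus := ((f.isBaseChange_plus₁.prodMap f.isBaseChange_plus₂).compLeft
    (Module.finrank K K')).retract (H.inclPlus hMp) (H.projPlus hMp) (H.projPlus_inclPlus hMp)
    (G.inclPlus hLp) (G.projPlus hLp) (G.projPlus_inclPlus hLp) _
    (fun l => funext fun i => Prod.ext
      (Subtype.ext (congrArg Prod.fst (G.comp_mapAdd H f i l).symm))
      (Subtype.ext (congrArg Prod.snd (G.comp_mapAdd H f i l).symm)))
    (fun v => Subtype.ext <| G.ext_comp fun i => by
      refine (G.comp_proj _ i).trans (Eq.trans ?_ (G.comp_mapAdd H f i _).symm)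
      erw [H.comp_proj]
      rw [← T.coeffMap_uc b]
      refine Prod.ext (f.map_smul₁ _ _).symm (Eq.trans ?_ (f.map_smul₂ _ _).symm)
      rw [map_sub, map_one]
      rfl)

end Hom

end Gluing

end GluingHom

/-! ### The lattice built from a chain satisfies the conditions of the stack -/

section ChainGluing

set_option linter.unusedSectionVars false

variable {p : ℕ} [Fact p.Prime]
  {K K' E : Type u} [Field K] [Field K'] [Field E]
  [Algebra ℚ_[p] K] [Algebra ℤ_[p] K] [IsScalarTower ℤ_[p] ℚ_[p] K]
  [Algebra ℚ_[p] K'] [Algebra ℤ_[p] K'] [IsScalarTower ℤ_[p] ℚ_[p] K']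
  [Algebra ℚ_[p] E] [Algebra ℤ_[p] E] [IsScalarTower ℤ_[p] ℚ_[p] E]
  [Algebra K K'] [IsScalarTower ℚ_[p] K K'] [IsScalarTower ℤ_[p] K K']
  [FiniteDimensional K K'] [FiniteDimensional ℚ_[p] K] [FiniteDimensional ℚ_[p] K']
  [FiniteDimensional ℚ_[p] E]

attribute [local instance] coeffAlgebra

namespace IwDatum

variable {T : TameTotRam p K K'} {η η' : Gal(K'/K) →* (OInt p E)ˣ} (hη : η ≠ η')
  {Y : IwDatum.{u} p K E} (hY : Y.isIw T.π)

instance : Module (Coeff p (toLoc hη hY).A K) Y.L₁ := Y.moduleCoeff₁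
instance : Module (Coeff p (toLoc hη hY).A K) Y.L₂ := Y.moduleCoeff₂
instance : Module (toLoc hη hY).A.carrier Y.L₁ := Y.module₁
instance : Module (toLoc hη hY).A.carrier Y.L₂ := Y.module₂
instance : IsScalarTower (toLoc hη hY).A.carrier (Coeff p (toLoc hη hY).A K) Y.L₁ :=
  Y.isScalarTower₁
instance : IsScalarTower (toLoc hη hY).A.carrier (Coeff p (toLoc hη hY).A K) Y.L₂ :=
  Y.isScalarTower₂

/-- The lattice attached to a lattice chain is glued from it. -/
def gluing : Gluing T hη (toLoc hη hY) (L₁ := Y.L₁) (L₂ := Y.L₂) Y.f₁ Y.f₂ where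
  equiv :=
    { toFun := fun l => l
      map_add' := fun _ _ => rfl
      map_smul' := fun s l => glueHom_coeffIncl hη hY s l
      invFun := fun l => l
      left_inv := fun _ => rfl
      right_inv := fun _ => rfl }
  equiv_unif l := LinearMap.congr_fun (glueHom_unif hη hY) l
  equiv_ρ _ _ _ := rfl

theorem mem_toLoc_Lp (l : (toLoc hη hY).L) : l ∈ (toLoc hη hY).Lp ↔
    ∀ i, ((gluing hη hY).comp i l).1 ∈ Y.Lp₁ ∧ ((gluing hη hY).comp i l).2 ∈ Y.Lp₂ := Iff.rfl

theorem isLocType_toLoc (hE : Nonempty (K' →ₐ[ℚ_[p]] E)) : (toLoc hη hY).isLocType T η η' :=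
  (gluing hη hY).isLocType (mem_toLoc_Lp hη hY) hE hY.rank₁ hY.rank₂ hY.coker₁ hY.coker₂ hY.plus₁
    hY.plus₂ hY.map_plus₁

theorem isLocTypeBT_toLoc (hE : Nonempty (K' →ₐ[ℚ_[p]] E)) (hd₁ : DetCondition K Y.A Y.Lp₁)
    (hd₂ : DetCondition K Y.A Y.Lp₂) : (toLoc hη hY).isLocTypeBT T η η' :=
  ⟨isLocType_toLoc hη hY hE, fun ξ => (gluing hη hY).detCondition (mem_toLoc_Lp hη hY) ξ hY.rank₁
    hY.rank₂ hY.plus₁ hY.plus₂ hd₁ hd₂⟩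

end IwDatum

end ChainGluing

/-! ### A lattice of type η ⊕ η' is glued from its eigenspaces -/

section Counit

set_option linter.unusedSectionVars false

variable {p : ℕ} [Fact p.Prime]
  {K K' E : Type u} [Field K] [Field K'] [Field E]
  [Algebra ℚ_[p] K] [Algebra ℤ_[p] K] [IsScalarTower ℤ_[p] ℚ_[p] K]
  [Algebra ℚ_[p] K'] [Algebra ℤ_[p] K'] [IsScalarTower ℤ_[p] ℚ_[p] K']
  [Algebra ℚ_[p] E] [Algebra ℤ_[p] E] [IsScalarTower ℤ_[p] ℚ_[p] E]
  [Algebra K K'] [IsScalarTower ℚ_[p] K K'] [IsScalarTower ℤ_[p] K K']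
  [FiniteDimensional K K'] [FiniteDimensional ℚ_[p] K] [FiniteDimensional ℚ_[p] K']
  [FiniteDimensional ℚ_[p] E]

attribute [local instance] coeffAlgebra

namespace LocDatum

variable {T : TameTotRam p K K'} {η η' : Gal(K'/K) →* (OInt p E)ˣ} (hη : η ≠ η')
  {X : LocDatum.{u} p K K' E}

theorem yc_smul_one_sub_smul (i : Fin (Module.finrank K K')) (m : X.L) :
    T.yc X.A η η' i • (1 - T.uc X.A η η' i) • m = T.yc X.A η η' i • m := by
  have h : T.yc X.A η η' i * coeffIncl K K' X.A (T.uc X.A η η' i) = 0 := by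
    rw [TameTotRam.yc, Finset.sum_mul]
    refine Finset.sum_eq_zero fun j hj => ?_
    rw [mul_assoc, ← map_mul, mul_comm (T.wc _ _ _ _),
      T.uc_mul_wc_of_le X.A η η' (Nat.lt_succ_iff.1 (Finset.mem_range.1 hj)) i.2, map_zero, mul_zero]
  rw [sub_smul, one_smul, smul_sub, coeff_smul_def, ← mul_smul, h, zero_smul, sub_zero]

variable (X) in
/-- The map `(l_i, m_i) ↦ ∑ π' ^ i l_i + y_i m_i` from the module glued from `𝔏_η` and `𝔏_{η'}`
to `𝔏`. -/
def unglue : (T.stair X.A hη).glue (X.eigen η) (X.eigen η') →ₗ[Coeff p X.A K] X.L where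
  toFun l := ∑ i : Fin (Module.finrank K K'),
    (T.unif X.A ^ (i : ℕ) • ((l.1 i).1 : X.L) + T.yc X.A η η' i • ((l.1 i).2 : X.L))
  map_add' l m := by
    rw [← Finset.sum_add_distrib]
    refine Finset.sum_congr rfl fun i _ => ?_
    rw [add_add_add_comm, ← smul_add, ← smul_add]
    rfl
  map_smul' s l := by
    rw [RingHom.id_apply, Finset.smul_sum]
    refine Finset.sum_congr rfl fun i _ => ?_
    rw [smul_add, smul_comm s, smul_comm s]
    rfl

theorem unglue_apply (l : (T.stair X.A hη).glue (X.eigen η) (X.eigen η')) :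
    X.unglue hη l = ∑ i : Fin (Module.finrank K K'),
      (T.unif X.A ^ (i : ℕ) • ((l.1 i).1 : X.L) + T.yc X.A η η' i • ((l.1 i).2 : X.L)) := rfl

theorem unglue_of_single (l : (T.stair X.A hη).glue (X.eigen η) (X.eigen η'))
    (i : Fin (Module.finrank K K')) (m : X.eigen η × X.eigen η') (h : l.1 = Pi.single i m) :
    X.unglue hη l = T.unif X.A ^ (i : ℕ) • (m.1 : X.L) + T.yc X.A η η' i • (m.2 : X.L) := by
  rw [unglue_apply, h, Finset.sum_eq_single i]
  · rw [Pi.single_eq_same]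
  · intro j _ hj
    rw [Pi.single_eq_of_ne hj, Prod.fst_zero, Prod.snd_zero, Submodule.coe_zero, Submodule.coe_zero,
      smul_zero, smul_zero, add_zero]
  · exact fun h => absurd (Finset.mem_univ _) h

theorem unglue_inlAt (hE : Nonempty (K' →ₐ[ℚ_[p]] E)) (i : Fin (Module.finrank K K'))
    (l : X.eigen η) : X.unglue hη ((T.stair X.A hη).inlAt (mulPi T η η' X) i l) =
      T.unif X.A ^ (i : ℕ) • (l : X.L) := by
  rw [unglue_of_single hη _ i _ (Stair.inlAt_coe ..)]
  -- On the complement of u_i the element is stored as π₁ l in 𝔏_{η'}, and y_i π₁ = π'^i there.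
  have h : T.yc X.A η η' i • (((1 - T.uc X.A η η' i) • mulPi T η η' X l : X.eigen η') : X.L) =
      T.unif X.A ^ (i : ℕ) • (1 - T.uc X.A η η' i) • (l : X.L) := by
    rw [Submodule.coe_smul, yc_smul_one_sub_smul, mulPi_coe, ← mul_smul,
      T.yc_mul_piElt X.A η η' hE hη i.2, mul_smul]
    rfl
  refine (congrArg (_ + ·) h).trans ?_
  rw [← smul_add, ← Submodule.coe_smul, ← Submodule.coe_add]
  show _ • ((T.uc X.A η η' i • l + (1 - T.uc X.A η η' i) • l : X.eigen η) : X.L) = _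
  rw [← add_smul, add_sub_cancel, one_smul]

theorem unglue_inrAt (i : Fin (Module.finrank K K')) (m : X.eigen η') :
    X.unglue hη ((T.stair X.A hη).inrAt (X.eigen η) i m) = T.yc X.A η η' i • (m : X.L) := by
  rw [unglue_of_single hη _ i _ (Stair.inrAt_coe ..), Submodule.coe_zero, smul_zero, zero_add]
  exact yc_smul_one_sub_smul i (m : X.L)

/-- It suffices to test on elements at one position. Inside the staircase this is the recursion for
y_i; at the last position it is π₂π₁ = π = π'^n and π' y_(n-1) = π₂. -/
theorem unglue_shift (hE : Nonempty (K' →ₐ[ℚ_[p]] E))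
    (l : (T.stair X.A hη).glue (X.eigen η) (X.eigen η')) :
    X.unglue hη ((T.stair X.A hη).shift (mulPi T η η' X) (mulPi T η' η X) l) =
      T.unif X.A • X.unglue hη l := by
  have h₁ : ∀ i a, X.unglue hη ((T.stair X.A hη).shift (mulPi T η η' X) (mulPi T η' η X)
      ((T.stair X.A hη).inlAt (mulPi T η η' X) i a)) = T.unif X.A • X.unglue hη
      ((T.stair X.A hη).inlAt (mulPi T η η' X) i a) := fun ⟨i, hi⟩ a => by
    by_cases h : i + 1 < Module.finrank K K'
    · rw [Stair.shift_inlAt _ _ _ h, unglue_inlAt hη hE, unglue_inlAt hη hE, ← mul_smul, pow_succ']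
    · obtain rfl : i = Module.finrank K K' - 1 := by omega
      rw [Stair.shift_inlAt_last, unglue_inlAt hη hE, unglue_inlAt hη hE, ← mul_smul, ← pow_succ',
        mulPi_mulPi hη hE, pow_zero, one_smul, Nat.sub_add_cancel T.finrank_pos, T.unif_pow]
      rfl
  have h₂ : ∀ i b, X.unglue hη ((T.stair X.A hη).shift (mulPi T η η' X) (mulPi T η' η X)
      ((T.stair X.A hη).inrAt (X.eigen η) i b)) = T.unif X.A • X.unglue hη
      ((T.stair X.A hη).inrAt (X.eigen η) i b) := fun ⟨i, hi⟩ b => by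
    by_cases h : i + 1 < Module.finrank K K'
    · rw [Stair.shift_inrAt _ _ _ h, unglue_inrAt, unglue_inrAt, T.yc_succ, add_smul, mul_smul]
      have h3 : T.wc X.A η η' (i + 1) * (1 - T.uc X.A η η' i) = 0 := by
        rw [mul_sub, mul_one, mul_comm, T.uc_mul_wc_of_lt X.A η η' (Nat.lt_succ_self i) h, sub_self]
      show _ • _ • (1 - T.uc X.A η η' i) • (b : X.L) +
        T.wc X.A η η' (i + 1) • (1 - T.uc X.A η η' i) • (b : X.L) = _
      rw [← mul_smul (T.wc X.A η η' (i + 1)), h3, zero_smul, add_zero]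
      exact congrArg (_ • ·) (yc_smul_one_sub_smul ⟨i, hi⟩ (b : X.L))
    · obtain rfl : i = Module.finrank K K' - 1 := by omega
      rw [Stair.shift_inrAt_last, unglue_inlAt hη hE, unglue_inrAt, ← mul_smul,
        T.unif_mul_yc_last X.A η η' hE hη, pow_zero, one_smul]
      rfl
  rw [← (T.stair X.A hη).sum_inlAt_add_inrAt (mulPi T η η' X) l]
  simp only [map_sum, map_add, h₁, h₂, Finset.smul_sum, smul_add]

theorem unglue_algHom (hE : Nonempty (K' →ₐ[ℚ_[p]] E)) (φ : Coeff p X.A K' →ₐ[Coeff p X.A K]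
      Module.End (Coeff p X.A K) ((T.stair X.A hη).glue (X.eigen η) (X.eigen η')))
    (hφ : φ (T.unif X.A) = (T.stair X.A hη).shift (mulPi T η η' X) (mulPi T η' η X))
    (x : Coeff p X.A K') (l : (T.stair X.A hη).glue (X.eigen η) (X.eigen η')) :
    X.unglue hη (φ x l) = x • X.unglue hη l := by
  refine T.coeff_induction (P := fun x => ∀ l, X.unglue hη (φ x l) = x • X.unglue hη l)
    (fun s l => ?_) (fun l => ?_) (fun y z hy hz l => ?_) (fun y z hy hz l => ?_) x l
  · rw [← algebraMap_coeff, AlgHom.commutes, Module.algebraMap_end_apply]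
    exact map_smul (X.unglue hη) s l
  · rw [hφ]
    exact unglue_shift hη hE l
  · rw [map_add, LinearMap.add_apply, map_add, hy, hz, add_smul]
  · rw [map_mul, Module.End.mul_apply, hy, hz, mul_smul]

theorem unglue_glueρ (g : Gal(K'/K)) (l : (T.stair X.A hη).glue (X.eigen η) (X.eigen η')) :
    X.unglue hη (IwDatum.glueρ T hη ((toIw T η η').obj X) g l) = X.ρ g (X.unglue hη l) := by
  rw [unglue_apply hη l, map_sum]
  refine (unglue_apply hη _).trans ?_
  refine Finset.sum_congr rfl fun i _ => ?_
  rw [map_add, pow_smul_mem_isotypic i (l.1 i).1.2 g, yc_smul_mem_isotypic hη i (l.1 i).2.2 g,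
    smul_comm _ (T.unif X.A ^ (i : ℕ)), smul_comm _ (T.yc X.A η η' i)]
  rfl

section

variable (h : X.isLocType T η η') (hE : Nonempty (K' →ₐ[ℚ_[p]] E))

instance (hX : ((toIw T η η').obj X).isIw T.π) :
    Module (Coeff p X.A K') (IwDatum.toLoc hη hX).L := (IwDatum.toLoc hη hX).moduleCoeff

/-- The map from the lattice glued from the eigenspaces of `𝔏` to `𝔏`. -/
def counit : (IwDatum.toLoc hη (h.isIw hη hE)).L →ₗ[Coeff p X.A K'] X.L where
  toFun := X.unglue hη
  map_add' := map_add (X.unglue hη)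
  map_smul' := unglue_algHom hη hE (IwDatum.glueHom hη (h.isIw hη hE))
    (IwDatum.glueHom_unif hη (h.isIw hη hE))

include h hE in
theorem isLocType.unglue_surjective : Function.Surjective (X.unglue (T := T) hη) := by
  rw [← LinearMap.range_eq_top, eq_top_iff]
  rintro l -
  rw [← X.sum_isotypicProj T η l]
  refine Submodule.sum_mem _ fun i hi => ?_
  obtain ⟨m, hm, m', hm', he⟩ := h.exists_eq_of_mem_isotypic hE (Finset.mem_range.1 hi)
    (X.isotypicProj_mem T η i l)
  rw [he]
  exact Submodule.add_mem _ ⟨_, unglue_inlAt hη hE ⟨i, Finset.mem_range.1 hi⟩ ⟨m, hm⟩⟩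
    ⟨_, unglue_inrAt hη ⟨i, Finset.mem_range.1 hi⟩ ⟨m', hm'⟩⟩

include h hE in
-- A surjection between finite projective modules of the same rank is an isomorphism. The glued side
-- has rank two because the eigenspaces form a lattice chain.
theorem isLocType.unglue_bijective : Function.Bijective (X.unglue (T := T) hη) := by
  obtain ⟨h1, h2, h3⟩ := (IwDatum.isLocType_toLoc hη (h.isIw hη hE) hE).1.1
  obtain ⟨h1', h2', h3'⟩ := h.1.1
  have _ : Module.Finite (Coeff p X.A K') (IwDatum.toLoc hη (h.isIw hη hE)).L := h1
  have _ : Module.Projective (Coeff p X.A K') (IwDatum.toLoc hη (h.isIw hη hE)).L := h2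
  exact Module.bijective_of_surjective_of_rankAtStalk_eq (R := Coeff p X.A K') (φ := counit hη h hE)
    (h.unglue_surjective hη hE) fun 𝔪 _ => (h3 _).trans (h3' _).symm

/-- A lattice of type `η ⊕ η'` is glued from its eigenspaces. -/
def isLocType.gluing : Gluing T hη X (mulPi T η η' X) (mulPi T η' η X) where
  equiv := (LinearEquiv.ofBijective (X.unglue hη) (h.unglue_bijective hη hE)).symm
  equiv_unif l := by
    rw [LinearEquiv.symm_apply_eq, LinearEquiv.ofBijective_apply, unglue_shift hη hE]
    congr 1
    exact ((LinearEquiv.ofBijective (X.unglue hη) (h.unglue_bijective hη hE)).apply_symm_apply l).symm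
  equiv_ρ g l i := by
    set e := LinearEquiv.ofBijective (X.unglue hη) (h.unglue_bijective hη hE)
    obtain ⟨l, rfl⟩ := e.surjective l
    have h1 : X.ρ g (e l) = e (IwDatum.glueρ T hη ((toIw T η η').obj X) g l) :=
      (unglue_glueρ hη g l).symm
    have h2 : e.symm (X.ρ g (e l)) = IwDatum.glueρ T hη ((toIw T η η').obj X) g l :=
      (congrArg e.symm h1).trans (e.symm_apply_apply _)
    rw [h2, e.symm_apply_apply]
    rfl

end

end LocDatum

end Counit

/-! ### The submodule 𝔏⁺ is generated by its η- and η'-parts -/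

section Reglue

set_option linter.unusedSectionVars false

variable {p : ℕ} [Fact p.Prime]
  {K K' E : Type u} [Field K] [Field K'] [Field E]
  [Algebra ℚ_[p] K] [Algebra ℤ_[p] K] [IsScalarTower ℤ_[p] ℚ_[p] K]
  [Algebra ℚ_[p] K'] [Algebra ℤ_[p] K'] [IsScalarTower ℤ_[p] ℚ_[p] K']
  [Algebra ℚ_[p] E] [Algebra ℤ_[p] E] [IsScalarTower ℤ_[p] ℚ_[p] E]
  [Algebra K K'] [IsScalarTower ℚ_[p] K K'] [IsScalarTower ℤ_[p] K K']
  [FiniteDimensional K K'] [FiniteDimensional ℚ_[p] K] [FiniteDimensional ℚ_[p] K']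
  [FiniteDimensional ℚ_[p] E]


attribute [local instance] coeffAlgebra

namespace LocDatum

variable {T : TameTotRam p K K'} {η η' : Gal(K'/K) →* (OInt p E)ˣ} (hη : η ≠ η')
  {X : LocDatum.{u} p K K' E} (h : X.isLocType T η η') (hE : Nonempty (K' →ₐ[ℚ_[p]] E))

variable (X) in
theorem finite_and_projective_eigen (T : TameTotRam p K K') (h : X.isLoc)
    (ξ : Gal(K'/K) →* (OInt p E)ˣ) :
    Module.Finite X.A.carrier (X.eigen ξ) ∧ Module.Projective X.A.carrier (X.eigen ξ) := by
  obtain ⟨_, _⟩ := h.1.finite_and_projective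
  have hs : toEigen ξ X ∘ₗ ofEigen ξ X = LinearMap.id :=
    LinearMap.ext fun l => Subtype.ext (projector_eq_self ξ T X l l.2)
  exact ⟨Module.Finite.of_surjective (toEigen ξ X) fun l => ⟨l, LinearMap.congr_fun hs l⟩,
    Module.Projective.of_split _ _ hs⟩

/-- Summands of elements of the submodule `𝔏⁺` in eigenspaces lie in `𝔏⁺`. -/
theorem mem_of_forall_eigen (hE : Nonempty (K' →ₐ[ℚ_[p]] E)) (T : TameTotRam p K K')
    {N : Submodule (Coeff p X.A K') X.L}
    (hN : ∀ (ξ : Gal(K'/K) →* (OInt p E)ˣ), ∀ l ∈ X.eigen ξ, l ∈ X.Lp → l ∈ N) {l : X.L}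
    (hl : l ∈ X.Lp) : l ∈ N := by
  have := T.finite_emb (E := E)
  have := Fintype.ofFinite (Emb p K' E)
  -- The grading relative to the trivial character, refined by the e_σ, splits l into eigenvectors
  -- for 𝒪-valued characters.
  rw [← X.sum_isotypicProj T 1 l]
  refine N.sum_mem fun i _ => ?_
  rw [← one_smul (Coeff p X.A K') (X.isotypicProj T 1 i l), ← map_one (coeffOfInt X.A),
    ← T.sum_idem hE, map_sum, Finset.sum_smul]
  refine N.sum_mem fun σ _ => ?_
  obtain ⟨ξ, -, hξ⟩ := exists_idem_smul_mem_eigen (X := X) T 1 i σ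
  refine hN ξ _ (hξ _ (X.isotypicProj_mem T 1 i l)) (X.Lp.smul_mem _ ?_)
  rw [isotypicProj_apply]
  exact X.Lp.sum_mem fun g _ => X.Lp.smul_mem _ (X.stable g l hl)

/-- The datum with the same lattice, and the submodule generated by `𝔏⁺_η` and `𝔏⁺_{η'}`. -/
abbrev reglue : LocDatum.{u} p K K' E where
  A := X.A
  L := X.L
  ρ := X.ρ
  semilinear := X.semilinear
  Lp := (IwDatum.toLoc hη (h.isIw hη hE)).Lp.map (counit hη h hE)
  stable := by
    rintro g _ ⟨l, hl, rfl⟩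
    exact ⟨_, (IwDatum.toLoc hη (h.isIw hη hE)).stable g l hl, unglue_glueρ hη g l⟩

/-- The lattice `𝔏` is still glued from its eigenspaces. -/
def reglueGluing : Gluing T hη (reglue hη h hE) (L₁ := X.eigen η) (L₂ := X.eigen η')
    (mulPi T η η' X) (mulPi T η' η X) where
  equiv := (h.gluing hη hE).equiv
  equiv_unif := (h.gluing hη hE).equiv_unif
  equiv_ρ := (h.gluing hη hE).equiv_ρ

theorem mem_reglue_Lp (l : (reglue hη h hE).L) : l ∈ (reglue hη h hE).Lp ↔
    ∀ i, ((reglueGluing hη h hE).comp i l).1 ∈ X.eigenPlus η ∧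
      ((reglueGluing hη h hE).comp i l).2 ∈ X.eigenPlus η' := by
  constructor
  · rintro ⟨m, hm, rfl⟩
    have e : (h.gluing hη hE).equiv (counit hη h hE m) = m :=
      (h.gluing hη hE).equiv.apply_symm_apply m
    intro i
    show (((h.gluing hη hE).equiv (counit hη h hE m)).1 i).1 ∈ _ ∧
      (((h.gluing hη hE).equiv (counit hη h hE m)).1 i).2 ∈ _
    rw [e]
    exact hm i
  · intro hl
    exact ⟨(h.gluing hη hE).equiv l, hl, (h.gluing hη hE).equiv.symm_apply_apply l⟩

theorem reglue_Lp_le : (reglue hη h hE).Lp ≤ X.Lp := by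
  rintro _ ⟨m, hm, rfl⟩
  have e : counit hη h hE m = _ := unglue_apply hη _
  rw [e]
  exact X.Lp.sum_mem fun i _ => add_mem (X.Lp.smul_mem _ (hm i).1) (X.Lp.smul_mem _ (hm i).2)

/-- By the determinant condition, `𝔏⁺` is generated by `𝔏⁺_η` and `𝔏⁺_{η'}`. -/
theorem isLocTypeBT.reglue_Lp_eq (hX : X.isLocTypeBT T η η') :
    (reglue hη hX.1 hE).Lp = X.Lp := by
  refine le_antisymm (reglue_Lp_le hη hX.1 hE) fun l hl => ?_
  refine mem_of_forall_eigen (X := X) hE T (fun ξ l hξ hl => ?_) hl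
  have hIw := hX.1.isIw hη hE
  have hloc : (reglue hη hX.1 hE).isLoc := ⟨hX.1.1.1,
    (reglueGluing hη hX.1 hE).projective_quotient (mem_reglue_Lp hη hX.1 hE) hIw.plus₁ hIw.plus₂
      hIw.map_plus₁⟩
  -- The conditions for η and η' alone imply the condition for the ξ-part of the generated
  -- submodule.
  have hdet := (reglueGluing hη hX.1 hE).detCondition (mem_reglue_Lp hη hX.1 hE) ξ hIw.rank₁
    hIw.rank₂ hIw.plus₁ hIw.plus₂ (hX.2 η) (hX.2 η')
  obtain ⟨_, _⟩ := X.finite_and_projective_eigen T hX.1.1 ξ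
  have _ : Module.Projective X.A.carrier (X.eigen ξ ⧸ X.eigenPlus ξ) :=
    hX.1.1.projective_eigen_quotient T ξ
  obtain ⟨_, _⟩ := finite_and_projective_of_quotient (A := X.A.carrier) (X.eigenPlus ξ)
  let N : Submodule (Coeff p X.A K) (X.eigen ξ) := (reglue hη hX.1 hE).eigenPlus ξ
  have _ : Module.Projective X.A.carrier (X.eigen ξ ⧸ N) :=
    hloc.projective_eigen_quotient T ξ
  obtain ⟨_, _⟩ := finite_and_projective_of_quotient (A := X.A.carrier) N
  have hdet' : DetCondition K X.A N := hdet
  -- The strong determinant condition at ξ gives 𝔏⁺_ξ the same rank as N, which it contains; both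
  -- quotients are projective.
  have key : N = X.eigenPlus ξ := eq_of_le_of_rankAtStalk_eq (A := X.A.carrier)
    (fun l hl => reglue_Lp_le hη hX.1 hE hl)
    fun x => (hdet'.rankAtStalk x).trans ((hX.2 ξ).rankAtStalk x).symm
  have : (⟨l, hξ⟩ : X.eigen ξ) ∈ N := key ▸ hl
  exact this

theorem isLocTypeBT.mem_Lp (hX : X.isLocTypeBT T η η') (l : X.L) : l ∈ X.Lp ↔
    ∀ i, ((hX.1.gluing hη hE).comp i l).1 ∈ X.eigenPlus η ∧
      ((hX.1.gluing hη hE).comp i l).2 ∈ X.eigenPlus η' := by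
  rw [← hX.reglue_Lp_eq hη hE]
  exact mem_reglue_Lp hη hX.1 hE l

end LocDatum

end Reglue

/-! ### Full faithfulness, and recovery of a chain from its lattice -/

section FullyFaithful

set_option linter.unusedSectionVars false

variable {p : ℕ} [Fact p.Prime]
  {K K' E : Type u} [Field K] [Field K'] [Field E]
  [Algebra ℚ_[p] K] [Algebra ℤ_[p] K] [IsScalarTower ℤ_[p] ℚ_[p] K]
  [Algebra ℚ_[p] K'] [Algebra ℤ_[p] K'] [IsScalarTower ℤ_[p] ℚ_[p] K']
  [Algebra ℚ_[p] E] [Algebra ℤ_[p] E] [IsScalarTower ℤ_[p] ℚ_[p] E]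
  [Algebra K K'] [IsScalarTower ℚ_[p] K K'] [IsScalarTower ℤ_[p] K K']
  [FiniteDimensional K K'] [FiniteDimensional ℚ_[p] K] [FiniteDimensional ℚ_[p] K']
  [FiniteDimensional ℚ_[p] E]


attribute [local instance] coeffAlgebra

section Equiv

variable {A S M N : Type u} [CommRing A] [CommRing S] [Algebra A S] [AddCommGroup M]
  [AddCommGroup N] [Module A M] [Module S M] [IsScalarTower A S M] [Module A N] [Module S N]
  [IsScalarTower A S N]

theorem isBaseChangeAlong_linearEquiv (e : M ≃ₗ[A] N) :
    IsBaseChangeAlong (RingHom.id A) e.toLinearMap.toAddMonoidHom :=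
  ⟨(TensorProduct.lid A M).trans e, fun b m => by
    show e (TensorProduct.lid A M (b ⊗ₜ m)) = b • e m
    rw [TensorProduct.lid_tmul, map_smul]⟩

theorem isBaseChangeAlong_equiv (e : M ≃ₗ[S] N) :
    IsBaseChangeAlong (RingHom.id A) e.toLinearMap.toAddMonoidHom :=
  isBaseChangeAlong_linearEquiv (e.restrictScalars A)

theorem isBaseChangeAlong_restrictAdd (e : M ≃ₗ[S] N) {P : Submodule S M} {Q : Submodule S N}
    (h : ∀ m, e m ∈ Q ↔ m ∈ P) :
    IsBaseChangeAlong (RingHom.id A)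
      (restrictAdd e.toLinearMap.toAddMonoidHom fun m => (h m).2) :=
  isBaseChangeAlong_equiv (S := S) (e.ofSubmodules P Q (by
    ext n
    obtain ⟨m, rfl⟩ := e.surjective n
    exact (Submodule.mem_map_equiv P).trans (by rw [e.symm_apply_apply, h])))

end Equiv

theorem map_smul_coeffMap_id {A : TestAlg.{u} p E} {M N : Type u} [AddCommGroup M] [AddCommGroup N]
    [Module (Coeff p A K) M] [Module (Coeff p A K) N] (e : M ≃ₗ[Coeff p A K] N) (x : Coeff p A K)
    (m : M) : e (x • m) = coeffMap (𝟙 A) K x • e m := by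
  rw [coeffMap_id, map_smul]

namespace Gluing

variable {T : TameTotRam p K K'} {η η' : Gal(K'/K) →* (OInt p E)ˣ} {hη : η ≠ η'}
  {X : LocDatum.{u} p K K' E} {L₁ L₂ : Type u} [AddCommGroup L₁] [AddCommGroup L₂]
  [Module (Coeff p X.A K) L₁] [Module (Coeff p X.A K) L₂]
  {f₁ : L₁ →ₗ[Coeff p X.A K] L₂} {f₂ : L₂ →ₗ[Coeff p X.A K] L₁} (G : Gluing T hη X f₁ f₂)

theorem comp_inl (i : Fin (Module.finrank K K')) (l : L₁) : G.comp i (G.inl l) =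
    (Pi.single ⟨0, T.finrank_pos⟩ (l, 0) : Fin (Module.finrank K K') → L₁ × L₂) i := by
  rw [comp_apply, equiv_inl, Stair.inlAt_coe]
  have h : (T.stair X.A hη).u ((⟨0, T.finrank_pos⟩ : Fin (Module.finrank K K')) : ℕ) = 1 :=
    (T.stair X.A hη).zero
  rw [h, one_smul, sub_self, zero_smul]

section Plus

variable {Lp₁ : Submodule (Coeff p X.A K) L₁} {Lp₂ : Submodule (Coeff p X.A K) L₂}
  (hLp : ∀ l, l ∈ X.Lp ↔ ∀ i, (G.comp i l).1 ∈ Lp₁ ∧ (G.comp i l).2 ∈ Lp₂)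

include hLp

theorem inl_mem_eigenPlus (l : L₁) : G.inl l ∈ X.eigenPlus η ↔ l ∈ Lp₁ := by
  refine (hLp _).trans ⟨fun h => ?_, fun h i => ?_⟩
  · have h1 := (h ⟨0, T.finrank_pos⟩).1
    rwa [comp_inl, Pi.single_eq_same] at h1
  · rw [comp_inl]
    rcases eq_or_ne i ⟨0, T.finrank_pos⟩ with rfl | hi
    · rw [Pi.single_eq_same]
      exact ⟨h, zero_mem _⟩
    · rw [Pi.single_eq_of_ne hi]
      exact ⟨zero_mem _, zero_mem _⟩

theorem inr_mem_eigenPlus (m : L₂) : G.inr m ∈ X.eigenPlus η' ↔ m ∈ Lp₂ := by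
  refine (hLp _).trans ⟨fun h => ?_, fun h i => ?_⟩
  · have h1 : ∑ i, (G.comp i (G.inr m)).2 = m := G.inr.symm_apply_apply m
    rw [← h1]
    exact sum_mem fun i _ => (h i).2
  · rw [comp_inr]
    exact ⟨zero_mem _, Submodule.smul_mem _ _ h⟩

end Plus

variable [Module X.A.carrier L₁] [IsScalarTower X.A.carrier (Coeff p X.A K) L₁]
  [Module X.A.carrier L₂] [IsScalarTower X.A.carrier (Coeff p X.A K) L₂]
  {Lp₁ : Submodule (Coeff p X.A K) L₁} {Lp₂ : Submodule (Coeff p X.A K) L₂}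
  {Y : LocDatum.{u} p K K' E} {M₁ M₂ : Type u} [AddCommGroup M₁] [AddCommGroup M₂]
  [Module (Coeff p Y.A K) M₁] [Module (Coeff p Y.A K) M₂]
  {g₁ : M₁ →ₗ[Coeff p Y.A K] M₂} {g₂ : M₂ →ₗ[Coeff p Y.A K] M₁} (H : Gluing T hη Y g₁ g₂)
  [Module Y.A.carrier M₁] [IsScalarTower Y.A.carrier (Coeff p Y.A K) M₁]
  [Module Y.A.carrier M₂] [IsScalarTower Y.A.carrier (Coeff p Y.A K) M₂]
  {Mp₁ : Submodule (Coeff p Y.A K) M₁} {Mp₂ : Submodule (Coeff p Y.A K) M₂}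
  {b : X.A ⟶ Y.A} (f : ChainHom b f₁ f₂ Lp₁ Lp₂ g₁ g₂ Mp₁ Mp₂)

theorem mapAdd_inl (l : M₁) : G.mapAdd H f (H.inl l) = G.inl (f.toFun₁ l) := by
  refine G.ext_comp fun i => ?_
  rw [comp_mapAdd, comp_inl, comp_inl]
  rcases eq_or_ne i ⟨0, T.finrank_pos⟩ with rfl | hi
  · rw [Pi.single_eq_same, Pi.single_eq_same, map_zero]
  · rw [Pi.single_eq_of_ne hi, Pi.single_eq_of_ne hi]
    exact Prod.ext (map_zero _) (map_zero _)

theorem mapAdd_inr (m : M₂) : G.mapAdd H f (H.inr m) = G.inr (f.toFun₂ m) := by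
  refine G.ext_comp fun i => ?_
  rw [comp_mapAdd, comp_inr, comp_inr, map_zero, f.map_smul₂, T.coeffMap_wc b]

end Gluing

theorem TameTotRam.yc_mul_wc_self (T : TameTotRam p K K') (A : TestAlg.{u} p E)
    (η η' : Gal(K'/K) →* (OInt p E)ˣ) {i : ℕ} (hi : i < Module.finrank K K') :
    T.yc A η η' i * coeffIncl K K' A (T.wc A η η' i) = coeffIncl K K' A (T.wc A η η' i) := by
  rw [yc, Finset.sum_mul, Finset.sum_eq_single i]
  · rw [Nat.sub_self, pow_zero, one_mul, ← map_mul, T.wc_mul_self]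
  · intro j hj hji
    rw [mul_assoc, ← map_mul, T.wc_mul_of_ne A η η' (by have := Finset.mem_range.1 hj; omega) hi hji,
      map_zero, mul_zero]
  · exact fun h => absurd (Finset.mem_range.2 (Nat.lt_succ_self i)) h

namespace LocDatum

variable {T : TameTotRam p K K'} {η η' : Gal(K'/K) →* (OInt p E)ˣ} (hη : η ≠ η')
  (hE : Nonempty (K' →ₐ[ℚ_[p]] E)) {X Y : LocDatum.{u} p K K' E}

/-- The identification of 𝔏_η with itself that comes from the gluing is the identity, so a morphism
constructed by gluing induces exactly the given map on eigenspaces. The next statement does the same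
for η'. -/
theorem isLocType.gluing_inl (h : X.isLocType T η η') (l : X.eigen η) :
    (h.gluing hη hE).inl l = l := by
  refine Subtype.ext ((unglue_inlAt hη hE ⟨0, T.finrank_pos⟩ l).trans ?_)
  rw [pow_zero, one_smul]

theorem isLocType.gluing_inr (h : X.isLocType T η η') (m : X.eigen η') :
    (h.gluing hη hE).inr m = m := by
  refine Subtype.ext ((unglue_apply hη _).trans ?_)
  have h1 : ∀ i : Fin (Module.finrank K K'), T.yc X.A η η' i • ((T.wc X.A η η' i • m : X.eigen η') :
      X.L) = T.wc X.A η η' i • (m : X.L) := fun i => by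
    rw [Submodule.coe_smul, coeff_smul_def, ← mul_smul, T.yc_mul_wc_self X.A η η' i.2]
  refine (Finset.sum_congr rfl fun i _ => (congrArg₂ (· + ·) (smul_zero _) (h1 i)).trans
    (zero_add _)).trans ?_
  rw [← Finset.sum_smul, ← Finset.sum_range (fun i => T.wc X.A η η' i), T.sum_wc, one_smul]

include hη hE

/-- A semilinear map is determined on 𝔏 by its values on 𝔏_η and 𝔏_{η'}, which generate 𝔏. -/
theorem isLocType.eq_of_toIw_map_eq (h : Y.isLocType T η η') {f g : X ⟶ Y}
    (hfg : (toIw T η η').map f = (toIw T η η').map g) : f = g := by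
  have hb : Hom.base f = Hom.base g := congrArg IwDatum.Hom.base hfg
  have h₁ : ∀ l : Y.eigen η, Hom.toFun f l = Hom.toFun g l := fun l =>
    congrArg Subtype.val (DFunLike.congr_fun (congrArg IwDatum.Hom.toFun₁ hfg) l)
  have h₂ : ∀ l : Y.eigen η', Hom.toFun f l = Hom.toFun g l := fun l =>
    congrArg Subtype.val (DFunLike.congr_fun (congrArg IwDatum.Hom.toFun₂ hfg) l)
  refine Hom.ext hb (AddMonoidHom.ext fun l => ?_)
  obtain ⟨m, rfl⟩ := h.unglue_surjective hη hE l
  rw [unglue_apply, map_sum, map_sum]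
  refine Finset.sum_congr rfl fun i _ => ?_
  rw [map_add, map_add, Hom.map_smul, Hom.map_smul, Hom.map_smul, Hom.map_smul, h₁, h₂, hb]

/-- A morphism of chains extends position by position. The determinant condition enters because 𝔏⁺
must also be glued from its two eigenspaces. -/
theorem isLocTypeBT.exists_toIw_map_eq (hX : X.isLocTypeBT T η η') (hY : Y.isLocTypeBT T η η')
    (g : (toIw T η η').obj X ⟶ (toIw T η η').obj Y) : ∃ f : X ⟶ Y, (toIw T η η').map f = g := by
  let b : X.A ⟶ Y.A := IwDatum.Hom.base g
  let c : ChainHom b (mulPi T η η' X) (mulPi T η' η X) (X.eigenPlus η)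
      (X.eigenPlus η') (mulPi T η η' Y) (mulPi T η' η Y) (Y.eigenPlus η) (Y.eigenPlus η') :=
    { toFun₁ := IwDatum.Hom.toFun₁ g
      toFun₂ := IwDatum.Hom.toFun₂ g
      map_smul₁ := IwDatum.Hom.map_smul₁ g
      map_smul₂ := IwDatum.Hom.map_smul₂ g
      map_f₁ := IwDatum.Hom.map_f₁ g
      map_f₂ := IwDatum.Hom.map_f₂ g
      map_mem₁ := IwDatum.Hom.map_mem₁ g
      map_mem₂ := IwDatum.Hom.map_mem₂ g
      isBaseChange₁ := IwDatum.Hom.isBaseChange₁ g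
      isBaseChange₂ := IwDatum.Hom.isBaseChange₂ g
      isBaseChange_plus₁ := IwDatum.Hom.isBaseChange_plus₁ g
      isBaseChange_plus₂ := IwDatum.Hom.isBaseChange_plus₂ g }
  refine ⟨(hX.1.gluing hη hE).homMk (hX.mem_Lp hη hE) (hY.1.gluing hη hE) (hY.mem_Lp hη hE) c,
    IwDatum.Hom.ext rfl (AddMonoidHom.ext fun l => Subtype.ext ?_)
      (AddMonoidHom.ext fun l => Subtype.ext ?_)⟩
  · have := (hX.1.gluing hη hE).mapAdd_inl (hY.1.gluing hη hE) c l
    exact (congrArg ((hX.1.gluing hη hE).mapAdd (hY.1.gluing hη hE) c)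
      (congrArg Subtype.val (hY.1.gluing_inl hη hE l)).symm).trans
      (this.trans (congrArg Subtype.val (hX.1.gluing_inl hη hE (c.toFun₁ l))))
  · have := (hX.1.gluing hη hE).mapAdd_inr (hY.1.gluing hη hE) c l
    exact (congrArg ((hX.1.gluing hη hE).mapAdd (hY.1.gluing hη hE) c)
      (congrArg Subtype.val (hY.1.gluing_inr hη hE l)).symm).trans
      (this.trans (congrArg Subtype.val (hX.1.gluing_inr hη hE (c.toFun₂ l))))

end LocDatum

namespace IwDatum

variable {T : TameTotRam p K K'} {η η' : Gal(K'/K) →* (OInt p E)ˣ} (hη : η ≠ η')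
  (hE : Nonempty (K' →ₐ[ℚ_[p]] E)) {Y : IwDatum.{u} p K E} (hY : Y.isIw T.π)

instance (ξ : Gal(K'/K) →* (OInt p E)ˣ) : Module (Coeff p Y.A K) ((toLoc hη hY).eigen ξ) :=
  inferInstanceAs (Module (Coeff p (toLoc hη hY).A K) ((toLoc hη hY).eigen ξ))

instance (ξ : Gal(K'/K) →* (OInt p E)ˣ) : Module Y.A.carrier ((toLoc hη hY).eigen ξ) :=
  inferInstanceAs (Module (toLoc hη hY).A.carrier ((toLoc hη hY).eigen ξ))

instance (ξ : Gal(K'/K) →* (OInt p E)ˣ) :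
    IsScalarTower Y.A.carrier (Coeff p Y.A K) ((toLoc hη hY).eigen ξ) :=
  inferInstanceAs (IsScalarTower (toLoc hη hY).A.carrier (Coeff p (toLoc hη hY).A K)
    ((toLoc hη hY).eigen ξ))

/-- The identification of `𝔏₁` with an eigenspace. -/
def inlEquiv : Y.L₁ ≃ₗ[Coeff p Y.A K] (toLoc hη hY).eigen η := (gluing hη hY).inl

/-- The identification of `𝔏₂` with an eigenspace. -/
def inrEquiv : Y.L₂ ≃ₗ[Coeff p Y.A K] (toLoc hη hY).eigen η' := (gluing hη hY).inr

/-- The submodule `𝔏⁺_ξ` over the base ring of the chain. -/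
def toLocPlus (ξ : Gal(K'/K) →* (OInt p E)ˣ) :
    Submodule (Coeff p Y.A K) ((toLoc hη hY).eigen ξ) := (toLoc hη hY).eigenPlus ξ

theorem inlEquiv_mem (l : Y.L₁) : inlEquiv hη hY l ∈ toLocPlus hη hY η ↔ l ∈ Y.Lp₁ :=
  (gluing hη hY).inl_mem_eigenPlus (mem_toLoc_Lp hη hY) l

theorem inrEquiv_mem (l : Y.L₂) : inrEquiv hη hY l ∈ toLocPlus hη hY η' ↔ l ∈ Y.Lp₂ :=
  (gluing hη hY).inr_mem_eigenPlus (mem_toLoc_Lp hη hY) l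

theorem inlEquiv_symm_mem (l : (toLoc hη hY).eigen η) :
    (inlEquiv hη hY).symm l ∈ Y.Lp₁ ↔ l ∈ toLocPlus hη hY η := by
  rw [← inlEquiv_mem hη hY, LinearEquiv.apply_symm_apply]

theorem inrEquiv_symm_mem (l : (toLoc hη hY).eigen η') :
    (inrEquiv hη hY).symm l ∈ Y.Lp₂ ↔ l ∈ toLocPlus hη hY η' := by
  rw [← inrEquiv_mem hη hY, LinearEquiv.apply_symm_apply]

include hE in
theorem inrEquiv_f₁ (l : Y.L₁) : inrEquiv hη hY (Y.f₁ l) =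
    LocDatum.mulPi T η η' (toLoc hη hY) (inlEquiv hη hY l) :=
  ((gluing hη hY).mulPi_inl hE l).symm

include hE in
theorem inlEquiv_f₂ (l : Y.L₂) : inlEquiv hη hY (Y.f₂ l) =
    LocDatum.mulPi T η' η (toLoc hη hY) (inrEquiv hη hY l) :=
  ((gluing hη hY).mulPi_inr hE l).symm

/-- A lattice chain is recovered from the lattice glued from it. -/
def toIwToLocIso : (LocDatum.toIw T η η').obj (toLoc hη hY) ≅ Y where
  hom :=
    { base := 𝟙 Y.A
      toFun₁ := (inlEquiv hη hY).toLinearMap.toAddMonoidHom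
      toFun₂ := (inrEquiv hη hY).toLinearMap.toAddMonoidHom
      map_smul₁ := (map_smul_coeffMap_id (inlEquiv hη hY) :)
      map_smul₂ := (map_smul_coeffMap_id (inrEquiv hη hY) :)
      map_f₁ := inrEquiv_f₁ hη hE hY
      map_f₂ := inlEquiv_f₂ hη hE hY
      map_mem₁ := fun l => (inlEquiv_mem hη hY l).2
      map_mem₂ := fun l => (inrEquiv_mem hη hY l).2
      isBaseChange₁ := (isBaseChangeAlong_equiv (A := Y.A.carrier) (inlEquiv hη hY) :)
      isBaseChange₂ := (isBaseChangeAlong_equiv (A := Y.A.carrier) (inrEquiv hη hY) :)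
      isBaseChange_plus₁ := (isBaseChangeAlong_restrictAdd (A := Y.A.carrier)
        (inlEquiv hη hY) (inlEquiv_mem hη hY) :)
      isBaseChange_plus₂ := (isBaseChangeAlong_restrictAdd (A := Y.A.carrier)
        (inrEquiv hη hY) (inrEquiv_mem hη hY) :) }
  inv :=
    { base := 𝟙 Y.A
      toFun₁ := (inlEquiv hη hY).symm.toLinearMap.toAddMonoidHom
      toFun₂ := (inrEquiv hη hY).symm.toLinearMap.toAddMonoidHom
      map_smul₁ := (map_smul_coeffMap_id (inlEquiv hη hY).symm :)
      map_smul₂ := (map_smul_coeffMap_id (inrEquiv hη hY).symm :)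
      map_f₁ := fun l => (inrEquiv hη hY).symm_apply_eq.2 <|
        Eq.trans (congrArg (LocDatum.mulPi T η η' (toLoc hη hY))
          ((inlEquiv hη hY).apply_symm_apply l).symm) (inrEquiv_f₁ hη hE hY _).symm
      map_f₂ := fun l => (inlEquiv hη hY).symm_apply_eq.2 <|
        Eq.trans (congrArg (LocDatum.mulPi T η' η (toLoc hη hY))
          ((inrEquiv hη hY).apply_symm_apply l).symm) (inlEquiv_f₂ hη hE hY _).symm
      map_mem₁ := fun l => (inlEquiv_symm_mem hη hY l).2
      map_mem₂ := fun l => (inrEquiv_symm_mem hη hY l).2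
      isBaseChange₁ := (isBaseChangeAlong_equiv (A := Y.A.carrier) (inlEquiv hη hY).symm :)
      isBaseChange₂ := (isBaseChangeAlong_equiv (A := Y.A.carrier) (inrEquiv hη hY).symm :)
      isBaseChange_plus₁ := (isBaseChangeAlong_restrictAdd (A := Y.A.carrier)
        (inlEquiv hη hY).symm
        (inlEquiv_symm_mem hη hY) :)
      isBaseChange_plus₂ := (isBaseChangeAlong_restrictAdd (A := Y.A.carrier)
        (inrEquiv hη hY).symm
        (inrEquiv_symm_mem hη hY) :) }
  hom_inv_id := Hom.ext (Category.comp_id (𝟙 Y.A))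
    (AddMonoidHom.ext (inlEquiv hη hY).apply_symm_apply)
    (AddMonoidHom.ext (inrEquiv hη hY).apply_symm_apply)
  inv_hom_id := Hom.ext (Category.comp_id (𝟙 Y.A))
    (AddMonoidHom.ext (inlEquiv hη hY).symm_apply_apply)
    (AddMonoidHom.ext (inrEquiv hη hY).symm_apply_apply)

end IwDatum

end FullyFaithful

/-! ### An equivalence of based categories -/

section BasedEquivalence

set_option linter.unusedSectionVars false

variable {p : ℕ} [Fact p.Prime]
  {K K' E : Type u} [Field K] [Field K'] [Field E]
  [Algebra ℚ_[p] K] [Algebra ℤ_[p] K] [IsScalarTower ℤ_[p] ℚ_[p] K]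
  [Algebra ℚ_[p] K'] [Algebra ℤ_[p] K'] [IsScalarTower ℤ_[p] ℚ_[p] K']
  [Algebra ℚ_[p] E] [Algebra ℤ_[p] E] [IsScalarTower ℤ_[p] ℚ_[p] E]
  [Algebra K K'] [IsScalarTower ℚ_[p] K K'] [IsScalarTower ℤ_[p] K K']
  [FiniteDimensional K K'] [FiniteDimensional ℚ_[p] K] [FiniteDimensional ℚ_[p] K']
  [FiniteDimensional ℚ_[p] E]


attribute [local instance] coeffAlgebra

namespace BasedEquivalence

universe v w

variable {𝒮 : Type*} [Category 𝒮] {𝒳 𝒴 : BasedCategory.{v, w} 𝒮} {F : BasedFunctor 𝒳 𝒴}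
  (hF : F.toFunctor.FullyFaithful) {G : 𝒴.obj → 𝒳.obj} (ε : ∀ d, F.obj (G d) ≅ d)
  (hε : ∀ d, 𝒴.p.IsHomLift (𝟙 (𝒴.p.obj d)) (ε d).hom)

include hε in
-- Conjugating by isomorphisms that lie over identities does not change the underlying morphism of
-- test objects. This makes the inverse functor commute with the projections strictly.
theorem isHomLift_preimage {d d' : 𝒴.obj} (f : d ⟶ d') :
    𝒳.p.IsHomLift (𝒴.p.map f) (hF.preimage ((ε d).hom ≫ f ≫ (ε d').inv)) := by
  have _ := hε d
  have _ := hε d'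
  have _ : 𝒴.p.IsHomLift (𝟙 (𝒴.p.obj d')) (ε d').inv := IsHomLift.lift_id_inv 𝒴.p _ (ε d')
  rw [← F.isHomLift_iff, hF.map_preimage]
  have h : 𝒴.p.IsHomLift (𝟙 (𝒴.p.obj d) ≫ 𝒴.p.map f ≫ 𝟙 (𝒴.p.obj d'))
    ((ε d).hom ≫ f ≫ (ε d').inv) := inferInstance
  rwa [Category.id_comp, Category.comp_id] at h

/-- The inverse of a fully faithful based functor that is surjective up to isomorphisms over
identities. -/
def inverse : BasedFunctor 𝒴 𝒳 where
  obj := G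
  map {d d'} f := hF.preimage ((ε d).hom ≫ f ≫ (ε d').inv)
  map_id d := hF.map_injective (by simp)
  map_comp f g := hF.map_injective (by simp)
  w := CategoryTheory.Functor.ext
    (fun d => by
      have _ := hε d
      exact (F.w_obj (G d)).symm.trans (IsHomLift.domain_eq 𝒴.p (𝟙 (𝒴.p.obj d)) (ε d).hom))
    fun d d' f => by
      have _ := isHomLift_preimage hF ε hε f
      exact IsHomLift.fac' 𝒳.p (𝒴.p.map f) (hF.preimage ((ε d).hom ≫ f ≫ (ε d').inv))

/-- The counit of the equivalence. -/
def counitIso : (inverse hF ε hε).comp F ≅ BasedFunctor.id 𝒴 :=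
  BasedNatIso.mkNatIso (NatIso.ofComponents ε fun {d d'} f => by
    show F.map (hF.preimage ((ε d).hom ≫ f ≫ (ε d').inv)) ≫ (ε d').hom = (ε d).hom ≫ f
    simp) hε

/-- The unit of the equivalence. -/
def unitIso : BasedFunctor.id 𝒳 ≅ F.comp (inverse hF ε hε) :=
  BasedNatIso.mkNatIso (NatIso.ofComponents (fun c => hF.preimageIso (ε (F.obj c)).symm)
    fun {c c'} f => hF.map_injective (by
      show F.map (f ≫ hF.preimage (ε (F.obj c')).inv) = F.map (hF.preimage (ε (F.obj c)).inv ≫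
        hF.preimage ((ε (F.obj c)).hom ≫ F.map f ≫ (ε (F.obj c')).inv))
      simp)) fun c => by
    show 𝒳.p.IsHomLift (𝟙 (𝒳.p.obj c)) (hF.preimage (ε (F.obj c)).inv)
    have _ := hε (F.obj c)
    rw [← F.isHomLift_iff, hF.map_preimage, ← F.w_obj c]
    exact IsHomLift.lift_id_inv 𝒴.p _ (ε (F.obj c))

/-- A fully faithful based functor that is surjective up to isomorphisms over identities is an
equivalence. -/
def equivalence : Bicategory.Equivalence 𝒳 𝒴 :=
  Bicategory.Equivalence.mkOfAdjointifyCounit (f := F) (g := inverse hF ε hε) (unitIso hF ε hε)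
    (counitIso hF ε hε)

end BasedEquivalence

section

variable {T : TameTotRam p K K'} {η η' : Gal(K'/K) →* (OInt p E)ˣ} (hη : η ≠ η')
  (hE : Nonempty (K' →ₐ[ℚ_[p]] E))

/-- The morphism `M_loc^{τ,BT} → M_{loc,Iw}^{BT}`. -/
def locToIwBT : BasedFunctor (locStackBT.{u} T η η') (iwStackBT.{u} (E := E) T.π) where
  toFunctor := ObjectProperty.lift (IwDatum.isIwBT T.π)
    ((LocDatum.isLocTypeBT T η η').ι ⋙ LocDatum.toIw T η η') fun X =>
      ⟨X.property.1.isIw hη hE, X.property.2 η, X.property.2 η'⟩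
  w := rfl

/-- The morphism `M_loc^{τ,BT} → M_{loc,Iw}^{BT}` is fully faithful. -/
theorem nonempty_fullyFaithful_locToIwBT :
    Nonempty (locToIwBT.{u} (T := T) hη hE).toFunctor.FullyFaithful := by
  have hfull : (locToIwBT.{u} (T := T) hη hE).toFunctor.Full := ⟨fun {X Y} g => by
    obtain ⟨f, hf⟩ := X.property.exists_toIw_map_eq hη hE Y.property g.hom
    exact ⟨ObjectProperty.homMk f, ObjectProperty.hom_ext _ hf⟩⟩
  have hfaith : (locToIwBT.{u} (T := T) hη hE).toFunctor.Faithful := ⟨fun {X Y} f g hfg =>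
    ObjectProperty.hom_ext _ (Y.property.1.eq_of_toIw_map_eq hη hE
      (congrArg (fun k => (IwDatum.isIwBT (E := E) T.π).ι.map k) hfg))⟩
  exact ⟨Functor.FullyFaithful.ofFullyFaithful _⟩

/-- The lattice attached to a lattice chain, as an object of the stack. -/
def toLocBT (Y : (iwStackBT.{u} (E := E) T.π).obj) : (locStackBT.{u} T η η').obj :=
  ⟨IwDatum.toLoc hη Y.property.1,
    IwDatum.isLocTypeBT_toLoc hη Y.property.1 hE Y.property.2.1 Y.property.2.2⟩

/-- A lattice chain is recovered from the lattice attached to it. -/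
def locToIwBTIso (Y : (iwStackBT.{u} (E := E) T.π).obj) :
    (locToIwBT.{u} (T := T) hη hE).obj (toLocBT hη hE Y) ≅ Y :=
  ObjectProperty.isoMk _ (IwDatum.toIwToLocIso hη hE Y.property.1)

theorem isHomLift_locToIwBTIso (Y : (iwStackBT.{u} (E := E) T.π).obj) :
    (iwStackBT.{u} (E := E) T.π).p.IsHomLift (𝟙 ((iwStackBT.{u} (E := E) T.π).p.obj Y))
      (locToIwBTIso (T := T) hη hE Y).hom :=
  IsHomLift.map (iwStackBT.{u} (E := E) T.π).p (locToIwBTIso (T := T) hη hE Y).hom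

end

end BasedEquivalence

end TameLocalModel

end

/-- Let `K'/K` be a totally ramified tame Galois extension of `p`-adic fields with uniformiser `π'`,
`π = π' ^ [K' : K] ∈ K`, and let `E` contain the images of all embeddings of `K'` into an algebraic
closure. For `τ = η ⊕ η'` with `η ≠ η'`, the rule
`(𝔏, 𝔏⁺) ↦ (𝔏_η, 𝔏⁺_η, 𝔏_{η'}, 𝔏⁺_{η'}, π₁, π₂)` defines a morphism `M_loc^τ → M_{loc,Iw}`, and this
morphism induces an equivalence `M_loc^{τ,BT} ≃ M_{loc,Iw}^{BT}` of stacks over the category of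
test objects: there is an equivalence `e` of categories over that category for which the square
formed by `e`, the morphism `M_loc^τ → M_{loc,Iw}` and the two inclusions commutes. -/
theorem proposition4p4p2 (p : ℕ) [Fact p.Prime] (K K' E : Type u) [Field K] [Field K'] [Field E]
    [Algebra ℚ_[p] K] [Algebra ℤ_[p] K] [IsScalarTower ℤ_[p] ℚ_[p] K]
    [Algebra ℚ_[p] K'] [Algebra ℤ_[p] K'] [IsScalarTower ℤ_[p] ℚ_[p] K']
    [Algebra ℚ_[p] E] [Algebra ℤ_[p] E] [IsScalarTower ℤ_[p] ℚ_[p] E]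
    [Algebra K K'] [IsScalarTower ℚ_[p] K K'] [IsScalarTower ℤ_[p] K K']
    [FiniteDimensional ℚ_[p] K] [FiniteDimensional K K'] [FiniteDimensional ℚ_[p] E]
    (hE : ∀ (ψ : K' →ₐ[ℚ_[p]] AlgebraicClosure E) (x : K'),
      ψ x ∈ (algebraMap E (AlgebraicClosure E)).range)
    (T : TameLocalModel.TameTotRam p K K')
    (η η' : Gal(K'/K) →* (TameLocalModel.OInt p E)ˣ) (hη : η ≠ η') :
    ∃ (h : ∀ X : TameLocalModel.LocDatum.{u} p K K' E, X.isLocType T η η' →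
        ((TameLocalModel.LocDatum.toIw T η η').obj X).isIw T.π)
      (e : Bicategory.Equivalence (TameLocalModel.locStackBT.{u} T η η')
        (TameLocalModel.iwStackBT.{u} (E := E) T.π)),
      BasedFunctor.comp e.hom (TameLocalModel.iwIncl T.π) =
        BasedFunctor.comp (TameLocalModel.locIncl T η η') (TameLocalModel.locToIw T η η' h) := by
  have hfin : FiniteDimensional ℚ_[p] K' := Module.Finite.trans K K'
  have hE' := T.exists_algHom hE
  obtain ⟨hF⟩ := TameLocalModel.nonempty_fullyFaithful_locToIwBT (T := T) hη hE'
  -- The underlying functor of the equivalence is the restriction of the given morphism, so the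
  -- square commutes by definition.
  exact ⟨fun X hX => hX.isIw hη hE', TameLocalModel.BasedEquivalence.equivalence hF
    (TameLocalModel.locToIwBTIso hη hE') (TameLocalModel.isHomLift_locToIwBTIso hη hE'), rfl⟩
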